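/- For an even integer $k\ge 2$ let $H_k$ be the Hecke basis of $S_k(\mathrm{SL}_2(\mathbb Z))$, i.e. the finite set of cusp forms $f(z)=\sum_{n\ge1}\lambda_f(n)n^{(k-1)/2}e^{2\pi i nz}$ of weight $k$ and level $1$ that are eigenfunctions of all Hecke operators and satisfy $\lambda_f(1)=1$. Let $L(s,\mathrm{sym}^2 f)$ be the analytic continuation of $\zeta(2s)\sum_{n\ge1}\lambda_f(n^2)n^{-s}$ from $\mathrm{Re}(s)>1$, and for $W:(0,\infty)\to\mathbb R$ smooth with compact support, an integer $h\ge 1$ and $X>0$ put $$A_f^{W}(h,X)=\sum_{n\ge1}\lambda_f(n)\lambda_f(n+h)\,W\!\left(\frac{n+h/2}{X}\right).$$ Write $\tau_1(n)=\sum_{d\mid n}d$, $\|W\|_\infty=\sup_{y>0}|W(y)|$ and $\|W\|_{2,1}=\sum_{i=0}^{2}\int_0^\infty|W^{(i)}(y)|\,dy$. **Theorem.** For all $\varepsilon,\delta,C>0$ there is a constant $K=K(\varepsilon,\delta,C)>0$ such that the following holds. Let $W_1,W_2:(0,\infty)\to\mathbb R$ be smooth with compact support, $\operatorname{supp}W_i\subseteq[a_{W_i},A_{W_i}]$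 with $a_{W_i}>0$ and $A_{W_i}\ge1$; let $h_1,h_2\ge1$ be integers, $k\ge2$ an even integer and $X>0$ with $$A_{W_1}A_{W_2}X\le C\,k^{1/2-\varepsilon},\qquad h_i<2a_{W_i}X\quad(i=1,2).$$ Then $$\left|\frac{2\pi^2}{k-1}\sum_{f\in H_k}\frac{A_f^{W_1}(h_1,X)\,\overline{A_f^{W_2}(h_2,X)}}{L(1,\mathrm{sym}^2f)}-\tau_1(\gcd(h_1,h_2))\int_0^\infty W_1(h_1y)W_2(h_2y)\,dy\cdot X\right|$$ $$\le K\,\max(h_1,h_2)^{\delta}\Big(\|W_1(h_1\cdot)W_2(h_2\cdot)\|_{2,1}+\|W_1\|_\infty\|W_2\|_\infty\Big).$$ In particular, for fixed $W_i$ and $h_i$, the error is $O(1)$. -/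

import Mathlib

open UpperHalfPlane ModularFormClass
open scoped MatrixGroups ContDiff ComplexConjugate

noncomputable section

namespace ShiftedConvolution

/-- The `n`-th Hecke operator in weight `k` and level one,
`(T_n f)(z) = n^{k-1} ∑_{ad = n} d^{-k} ∑_{0 ≤ b < d} f((a z + b)/d)`, on functions on the
upper half-plane. For `d ∣ n`, `n ≥ 1`, the point `(a z + b)/d` lies in the upper half-plane,
where `ofComplex` is the inverse of the inclusion of `ℍ` in `ℂ`. -/
def heckeOperator (k n : ℕ) (f : ℍ → ℂ) (z : ℍ) : ℂ :=
  (n : ℂ) ^ ((k : ℤ) - 1) * ∑ d ∈ n.divisors, (d : ℂ) ^ (-(k : ℤ)) *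
    ∑ b ∈ Finset.range d, f (ofComplex ((((n / d : ℕ) : ℂ) * (z : ℂ) + (b : ℂ)) / (d : ℂ)))

/-- The Hecke basis `H_k` of `S_k(SL₂(ℤ))`: all cusp forms of weight `k` and level one that are
eigenfunctions of every Hecke operator `T_n`, `n ≥ 1`, and whose first Fourier coefficient
is `1`. -/
def heckeBasis (k : ℕ) : Set (CuspForm 𝒮ℒ (k : ℤ)) :=
  {f | (qExpansion 1 f).coeff 1 = 1 ∧
    ∀ n : ℕ, 0 < n → ∃ c : ℂ, ∀ z : ℍ, heckeOperator k n f z = c * f z}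

variable {k : ℕ}

/-- The normalized Fourier coefficient `λ_f(n)`, defined by
`f(z) = ∑_{n ≥ 1} λ_f(n) n^{(k-1)/2} e(nz)`. -/
def normCoeff (f : CuspForm 𝒮ℒ (k : ℤ)) (n : ℕ) : ℂ :=
  (qExpansion 1 f).coeff n / (((n : ℝ) ^ (((k : ℝ) - 1) / 2) : ℝ) : ℂ)

/-- The smooth shifted convolution sum
`A_f^W(X, h) = ∑_{n ≥ 1} λ_f(n) λ_f(n + h) W((n + h/2)/X)`. -/
def shiftedSum (f : CuspForm 𝒮ℒ (k : ℤ)) (W : ℝ → ℝ) (h : ℕ) (X : ℝ) : ℂ :=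
  ∑' n : ℕ+, normCoeff f n * normCoeff f (n + h) * ((W (((n : ℝ) + (h : ℝ) / 2) / X) : ℝ) : ℂ)

/-- The expression `ζ(2s) ∑_{n ≥ 1} λ_f(n²) n^{-s}`, meaningful for `Re s > 1`. -/
def symSquareSeries (f : CuspForm 𝒮ℒ (k : ℤ)) (s : ℂ) : ℂ :=
  riemannZeta (2 * s) * LSeries (fun n => normCoeff f (n ^ 2)) s

/-- `w` is the value at `s` of an analytic continuation of `symSquareSeries f` from the half-plane
`Re z > 1` to an open set containing that half-plane and `s` and star-shaped about `2`. -/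
def IsSymSquareValue (f : CuspForm 𝒮ℒ (k : ℤ)) (s w : ℂ) : Prop :=
  ∃ (U : Set ℂ) (g : ℂ → ℂ), IsOpen U ∧ StarConvex ℝ 2 U ∧ {z : ℂ | 1 < z.re} ⊆ U ∧ s ∈ U ∧
    DifferentiableOn ℂ g U ∧ (∀ z : ℂ, 1 < z.re → g z = symSquareSeries f z) ∧ g s = w

/-- The value of the analytic continuation does not depend on the domain chosen. -/
theorem IsSymSquareValue.unique {f : CuspForm 𝒮ℒ (k : ℤ)} {s w w' : ℂ}
    (h : IsSymSquareValue f s w) (h' : IsSymSquareValue f s w') : w = w' := by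
  obtain ⟨U, g, hU, hUs, hUh, hsU, hg, hgs, rfl⟩ := h
  obtain ⟨V, g', hV, hVs, hVh, hsV, hg', hgs', rfl⟩ := h'
  have h2 : (2 : ℂ) ∈ {z : ℂ | 1 < z.re} := by simp
  have hc : IsPreconnected (U ∩ V) :=
    ((hUs.inter hVs).isPathConnected ⟨hUh h2, hVh h2⟩).isConnected.isPreconnected
  refine ((hg.mono Set.inter_subset_left).analyticOnNhd (hU.inter hV)).eqOn_of_preconnected_of_eventuallyEq
    ((hg'.mono Set.inter_subset_right).analyticOnNhd (hU.inter hV)) hc ⟨hUh h2, hVh h2⟩ ?_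
    ⟨hsU, hsV⟩
  filter_upwards [(isOpen_lt continuous_const Complex.continuous_re).mem_nhds h2] with z hz
  rw [hgs z hz, hgs' z hz]

open Classical in
/-- The symmetric square `L`-function `L(s, sym² f)`: the analytic continuation of
`ζ(2s) ∑_{n ≥ 1} λ_f(n²) n^{-s}`. -/
def symSquareL (f : CuspForm 𝒮ℒ (k : ℤ)) (s : ℂ) : ℂ :=
  if h : ∃ w, IsSymSquareValue f s w then h.choose else 0

/-- The variance
`(2π²/(k-1)) ∑_{f ∈ H_k} A_f^{W₁}(X, h₁) conj(A_f^{W₂}(X, h₂)) / L(1, sym² f)`. -/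
def variance (k : ℕ) (W₁ W₂ : ℝ → ℝ) (h₁ h₂ : ℕ) (X : ℝ) : ℂ :=
  (2 * (Real.pi : ℂ) ^ 2 / ((k : ℂ) - 1)) *
    ∑ᶠ f ∈ heckeBasis k, shiftedSum f W₁ h₁ X * conj (shiftedSum f W₂ h₂ X) / symSquareL f 1

/-- `B_{h₁,h₂}(W₁, W₂) = τ₁((h₁, h₂)) ∫_0^∞ W₁(h₁ y) W₂(h₂ y) dy` for real weights, where
`τ₁(n) = ∑_{d ∣ n} d`. -/
def mainTerm (W₁ W₂ : ℝ → ℝ) (h₁ h₂ : ℕ) : ℝ :=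
  ((∑ d ∈ (Nat.gcd h₁ h₂).divisors, d : ℕ) : ℝ) *
    ∫ y in Set.Ioi (0 : ℝ), W₁ (h₁ * y) * W₂ (h₂ * y)

/-- The Sobolev norm `‖W‖_{l,1} = ∑_{0 ≤ i ≤ l} ∫_0^∞ |W^{(i)}(y)| dy`. -/
def sobolevNormOne (l : ℕ) (W : ℝ → ℝ) : ℝ :=
  ∑ i ∈ Finset.range (l + 1), ∫ y in Set.Ioi (0 : ℝ), |iteratedDeriv i W y|

/-- The sup norm of a function on `(0, ∞)`. -/
def supNorm (W : ℝ → ℝ) : ℝ := ⨆ y : Set.Ioi (0 : ℝ), |W y|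

end ShiftedConvolution

end

/-!
# The variance of shifted convolution sums over the Hecke basis

By the Hecke relations, `A_f^W(h, X)` is a linear combination of the single eigenvalues
`λ_f(m (m + l))`, where `l` runs over the divisors of `h` (`shiftedSum_eq`). The average over `f`
of a product of two such sums therefore reduces to the Petersson formula, provided the weights
`2 π² / ((k - 1) L(1, sym² f))` are the harmonic weights `(k - 2)! / ((4 π)^(k - 1) ⟨f, f⟩)`.

*The harmonic weights.* Unfolding the integral of `y^k |f|²` against the Epstein zeta function
`∑ |c z + d|^{-2s}` gives the gamma factor times `ζ(s) ζ(2s) ∑ λ_f(n²) n^{-s}`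
(`integral_petersson_mul_epstein`). Subtracting from the lattice sum its average over translations
continues the Epstein zeta function to `Re s > 1/2` (`epstein_eq`), so that the residue at `s = 1`
evaluates `L(1, sym² f)` in terms of `⟨f, f⟩` (`isSymSquareValue_one`, `heckeWeight_eq`).

*The Petersson formula.* The kernel `∑ (c z w + d w + a z + b)^{-k}` over the integral matrices of
determinant `n` is a cusp form in each variable. For `n = 1` it reproduces cusp forms, and in
general it is the image of the case `n = 1` under the Hecke operator `T_n`. Hence the Hecke
operators preserve `S_k` and are symmetric for the Petersson product, `H_k` is a finite orthogonal
basis with real eigenvalues, and the kernel for `n = 1` expands in this basis (`kernel_eq_sum`).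
The terms with `c = 0` carry the diagonal. The coefficients at `m` and `n` of the other terms are
bounded by integrating over horocycles of height `k / (2π m)` and `k / (2π n)`
(`petersson_formula`), which saves a factor `(2π √(m n) / k)^k` up to `e^(2k)` and powers of `m`
and `n`. No Kloosterman sums or Bessel functions are needed, because here
`√(m n) ≤ (A X)² ≪ k^(1 - 2ε)`, and the error is smaller than any power of `k`
(`exists_superexponential_bound`).

*The diagonal.* What remains is the sum over `m₁ (m₁ + l₁) = m₂ (m₂ + l₂)` with `l₁ ∣ h₁` and
`l₂ ∣ h₂`. If `l₁ = l₂ = l`, then `m₁ = m₂`, and the sum over `m₁` is a Riemann sum with step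
`1 / (l X)` (`abs_riemann_sum_sub_le`); summing `l` over the common divisors gives the factor
`τ₁(gcd(h₁, h₂))`. If `l₁ ≠ l₂`, completing the square makes every solution a factorization of
`l₁² - l₂²` (`card_solutions_le`), and the divisor bound gives `max(h₁, h₂)^δ`
(`abs_diagonal_sub_le`).

For `k < 16`, where the error term of the Petersson formula is not available, the hypotheses leave
only boundedly many forms and integers, and both sides are estimated trivially
(`exists_bound_fixed_weight`).
-/


noncomputable section

namespace ShiftedConvolution

open Filter Topology Modular MeasureTheory Complex
open scoped Manifold ModularForm Real Nat

/-! ### The fundamental domain and the unfolding identity -/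

instance smulInvariantMeasure_SL : SMulInvariantMeasure SL(2, ℤ) ℍ volume where
  measure_preimage_smul γ _s hs :=
    measure_preimage_smul_of_nullMeasurableSet
      (c := Matrix.SpecialLinearGroup.mapGL ℝ γ) (μ := (volume : Measure ℍ)) hs.nullMeasurableSet

instance : MeasurableConstSMul SL(2, ℤ) ℍ where
  measurable_const_smul γ :=
    (continuous_const_smul (Matrix.SpecialLinearGroup.mapGL ℝ γ)).measurable

instance : Countable SL(2, ℤ) :=
  have : Countable (Matrix (Fin 2) (Fin 2) ℤ) := inferInstanceAs (Countable (Fin 2 → Fin 2 → ℤ))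
  inferInstanceAs (Countable {A : Matrix (Fin 2) (Fin 2) ℤ // A.det = 1})

lemma volume_eq_zero_of_coe_image {s : Set ℍ} (h : volume (UpperHalfPlane.coe '' s) = 0) :
    volume s = 0 := by
  rw [volume_eq_lintegral]
  exact setLIntegral_measure_zero _ _ h

lemma volume_re_eq (a : ℝ) : volume {z : ℂ | z.re = a} = 0 := by
  have h := Complex.volume_preserving_equiv_real_prod.measure_preimage
    (s := ({a} : Set ℝ) ×ˢ (Set.univ : Set ℝ))
    ((measurableSet_singleton a).prod MeasurableSet.univ).nullMeasurableSet
  have h2 : Complex.measurableEquivRealProd ⁻¹' (({a} : Set ℝ) ×ˢ (Set.univ : Set ℝ))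
      = {z : ℂ | z.re = a} := by
    ext z; simp [Complex.measurableEquivRealProd]
  rw [← h2, h, Measure.volume_eq_prod, Measure.prod_prod]
  simp

/-- The boundary of the standard fundamental domain is a null set. -/
lemma volume_fd_diff_fdo : volume (𝒟 \ 𝒟ᵒ : Set ℍ) = 0 := by
  apply volume_eq_zero_of_coe_image
  have hsub : UpperHalfPlane.coe '' (𝒟 \ 𝒟ᵒ : Set ℍ) ⊆
      ({z : ℂ | z.re = 1 / 2} ∪ {z : ℂ | z.re = -(1 / 2)}) ∪ Metric.sphere (0 : ℂ) 1 := by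
    rintro _ ⟨z, ⟨hz, hz'⟩, rfl⟩
    simp only [ModularGroup.fd, ModularGroup.fdo, Set.mem_ofPred_eq, not_and_or, not_lt] at hz hz'
    rcases hz' with h | h
    · right
      have : Complex.normSq (z : ℂ) = 1 := le_antisymm h hz.1
      rw [Complex.normSq_eq_norm_sq] at this
      simp only [mem_sphere_iff_norm, sub_zero]
      nlinarith [norm_nonneg (z : ℂ)]
    · left
      have : |z.re| = 1 / 2 := le_antisymm hz.2 h
      rcases (abs_eq (by norm_num)).mp this with h | h
      · left; simpa using h
      · right; simpa using h
  refine measure_mono_null hsub ?_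
  simp only [measure_union_null_iff]
  exact ⟨⟨volume_re_eq _, volume_re_eq _⟩, Measure.addHaar_sphere _ _ _⟩

lemma measurableSet_fd : MeasurableSet (𝒟 : Set ℍ) := ModularGroup.isClosed_fd.measurableSet

/-- Almost every orbit of `SL(2, ℤ)` meets the fundamental domain for exactly two group elements
(a pair `±γ`). -/
lemma ae_tsum_indicator_fd :
    ∀ᵐ z : ℍ, ∑' γ : SL(2, ℤ), (𝒟 : Set ℍ).indicator (1 : ℍ → ENNReal) (γ • z) = 2 := by
  have hnull : ∀ᵐ z : ℍ, ∀ γ : SL(2, ℤ), γ • z ∉ (𝒟 \ 𝒟ᵒ : Set ℍ) := by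
    rw [ae_all_iff]
    intro γ
    have := measure_preimage_smul (μ := (volume : Measure ℍ)) γ (𝒟 \ 𝒟ᵒ : Set ℍ)
    rw [volume_fd_diff_fdo] at this
    exact measure_eq_zero_iff_ae_notMem.mp this
  filter_upwards [hnull] with z hz
  obtain ⟨g, hg⟩ := ModularGroup.exists_smul_mem_fd z
  have hgo : g • z ∈ (𝒟ᵒ : Set ℍ) := by
    by_contra h
    exact hz g ⟨hg, h⟩
  have key : ∀ γ : SL(2, ℤ), γ • z ∈ (𝒟 : Set ℍ) ↔ γ = g ∨ γ = -g := by
    intro γ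
    constructor
    · intro h
      have h1 : (γ * g⁻¹) • (g • z) ∈ (𝒟 : Set ℍ) := by
        rw [smul_smul, inv_mul_cancel_right]; exact h
      rcases ModularGroup.eq_one_or_neg_one_of_mem_fdo_mem_fd hgo h1 with h | h
      · left; exact mul_inv_eq_one.mp h
      · right; rw [mul_inv_eq_iff_eq_mul] at h; simpa using h
    · rintro (rfl | rfl)
      · exact hg
      · rwa [ModularGroup.SL_neg_smul]
  have hne : g ≠ -g := by
    intro h
    have h2 := congrArg (fun A : SL(2, ℤ) => (A : Matrix (Fin 2) (Fin 2) ℤ)) h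
    simp only [Matrix.SpecialLinearGroup.coe_neg] at h2
    have h3 : (g : Matrix (Fin 2) (Fin 2) ℤ) = 0 := by
      ext i j
      have := congrFun (congrFun h2 i) j
      simp only [Matrix.neg_apply] at this
      simp only [Matrix.zero_apply]
      omega
    have := g.det_coe
    rw [h3] at this
    simp at this
  classical
  rw [tsum_eq_sum (s := {g, -g})]
  · rw [Finset.sum_pair hne, Set.indicator_of_mem hg, Set.indicator_of_mem]
    · simp [one_add_one_eq_two]
    · exact (key _).mpr (Or.inr rfl)
  · intro γ hγ
    apply Set.indicator_of_notMem
    intro h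
    rcases (key γ).mp h with h | h <;> simp [h] at hγ

/-- Unfolding for nonnegative functions. -/
lemma tsum_lintegral_fd_smul (F : ℍ → ENNReal) (hF : AEMeasurable F volume) :
    ∑' γ : SL(2, ℤ), ∫⁻ z in (𝒟 : Set ℍ), F (γ • z) = 2 * ∫⁻ z, F z := by
  have h1 : ∀ γ : SL(2, ℤ), ∫⁻ z in (𝒟 : Set ℍ), F (γ • z)
      = ∫⁻ z, (𝒟 : Set ℍ).indicator (1 : ℍ → ENNReal) (γ⁻¹ • z) * F z := by
    intro γ
    rw [← lintegral_indicator measurableSet_fd]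
    have := (measurePreserving_smul γ (volume : Measure ℍ)).lintegral_comp_emb
      (MeasurableEquiv.smul γ).measurableEmbedding
      (fun z => (𝒟 : Set ℍ).indicator (1 : ℍ → ENNReal) (γ⁻¹ • z) * F z)
    rw [← this]
    refine lintegral_congr fun z => ?_
    rw [inv_smul_smul]
    by_cases hz : z ∈ (𝒟 : Set ℍ) <;> simp [hz]
  simp_rw [h1]
  have he := (Equiv.inv SL(2, ℤ)).tsum_eq (fun γ => ∫⁻ z, (𝒟 : Set ℍ).indicator
      (1 : ℍ → ENNReal) (γ • z) * F z)
  simp only [Equiv.inv_apply] at he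
  rw [he, ← lintegral_tsum, ← lintegral_const_mul'' _ hF]
  · refine lintegral_congr_ae ?_
    filter_upwards [ae_tsum_indicator_fd] with z hz
    rw [ENNReal.tsum_mul_right, hz]
  · intro γ
    refine AEMeasurable.mul ?_ hF
    exact ((measurable_one.indicator measurableSet_fd).comp
      (measurable_const_smul γ)).aemeasurable

/-- Each translate of an integrable function is integrable. -/
lemma integrable_smul {F : ℍ → ℂ} (hF : Integrable F) (γ : SL(2, ℤ)) :
    Integrable fun z => F (γ • z) :=
  ((measurePreserving_smul γ (volume : Measure ℍ)).integrable_comp_emb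
    (MeasurableEquiv.smul γ).measurableEmbedding).mpr hF

/-- Absolute convergence in the unfolding identity. -/
lemma summable_integral_norm_fd_smul {F : ℍ → ℂ} (hF : Integrable F) :
    Summable fun γ : SL(2, ℤ) => ∫ z in (𝒟 : Set ℍ), ‖F (γ • z)‖ := by
  have h := tsum_lintegral_fd_smul (fun z => ‖F z‖ₑ) hF.aestronglyMeasurable.enorm
  have hfin : 2 * ∫⁻ z, ‖F z‖ₑ ≠ ⊤ := ENNReal.mul_ne_top (by simp) hF.2.ne
  rw [← h] at hfin
  have := ENNReal.summable_toReal hfin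
  refine this.congr fun γ => ?_
  rw [integral_norm_eq_lintegral_enorm (integrable_smul hF γ).aestronglyMeasurable.restrict]

/-- The **unfolding identity** for the fundamental domain of `SL(2, ℤ)`: the factor `2` accounts
for the trivial action of `-1`. -/
lemma integral_fd_tsum_smul {F : ℍ → ℂ} (hF : Integrable F) :
    ∫ z in (𝒟 : Set ℍ), ∑' γ : SL(2, ℤ), F (γ • z) = 2 * ∫ z, F z := by
  have hs := summable_integral_norm_fd_smul hF
  rw [← integral_tsum_of_summable_integral_norm (fun γ => (integrable_smul hF γ).restrict) hs]
  -- The computation of `tsum_lintegral_fd_smul`, now justified by absolute convergence.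
  set u : SL(2, ℤ) → ℍ → ℂ := fun γ z => (𝒟 : Set ℍ).indicator (1 : ℍ → ℂ) (γ • z) * F z with hu
  have h1 : ∀ γ : SL(2, ℤ), ∫ z in (𝒟 : Set ℍ), F (γ • z) = ∫ z, u γ⁻¹ z := by
    intro γ
    rw [← integral_indicator measurableSet_fd]
    rw [← (measurePreserving_smul γ (volume : Measure ℍ)).integral_comp
      (MeasurableEquiv.smul γ).measurableEmbedding (u γ⁻¹)]
    refine integral_congr_ae (Eventually.of_forall fun z => ?_)
    simp only [hu, inv_smul_smul]
    by_cases hz : z ∈ (𝒟 : Set ℍ) <;> simp [hz]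
  have h1n : ∀ γ : SL(2, ℤ), ∫ z in (𝒟 : Set ℍ), ‖F (γ • z)‖ = ∫ z, ‖u γ⁻¹ z‖ := by
    intro γ
    rw [← integral_indicator measurableSet_fd]
    rw [← (measurePreserving_smul γ (volume : Measure ℍ)).integral_comp
      (MeasurableEquiv.smul γ).measurableEmbedding (fun z => ‖u γ⁻¹ z‖)]
    refine integral_congr_ae (Eventually.of_forall fun z => ?_)
    simp only [hu, inv_smul_smul]
    by_cases hz : z ∈ (𝒟 : Set ℍ) <;> simp [hz]
  simp_rw [h1n] at hs
  simp_rw [h1]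
  have he := (Equiv.inv SL(2, ℤ)).tsum_eq (fun γ => ∫ z, u γ z)
  simp only [Equiv.inv_apply] at he
  rw [he]
  have hs' : Summable fun γ => ∫ z, ‖u γ z‖ :=
    (Equiv.inv SL(2, ℤ)).summable_iff.mp hs
  have hint : ∀ γ, Integrable (u γ) := by
    intro γ
    refine hF.bdd_mul (c := 1) ?_ (Eventually.of_forall fun z => ?_)
    · exact ((measurable_one.indicator measurableSet_fd).comp
        (measurable_const_smul γ)).aestronglyMeasurable
    · generalize γ • z = w
      by_cases hz : w ∈ (𝒟 : Set ℍ) <;> simp [hz]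
  rw [integral_tsum_of_summable_integral_norm hint hs', ← integral_const_mul]
  refine integral_congr_ae ?_
  filter_upwards [ae_tsum_indicator_fd] with z hz
  simp only [hu]
  rw [tsum_mul_right]
  congr 1
  have h2 : ∀ γ : SL(2, ℤ), (𝒟 : Set ℍ).indicator (1 : ℍ → ℂ) (γ • z)
      = (((𝒟 : Set ℍ).indicator (1 : ℍ → ENNReal) (γ • z)).toReal : ℂ) := by
    intro γ
    generalize γ • z = w
    by_cases hz : w ∈ (𝒟 : Set ℍ) <;> simp [hz]
  simp_rw [h2]
  rw [← Complex.ofReal_tsum, ← ENNReal.tsum_toReal_eq, hz]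
  · simp
  · intro γ
    generalize γ • z = w
    by_cases hz : w ∈ (𝒟 : Set ℍ) <;> simp [hz]

/-! ### The hyperbolic measure in coordinates -/

lemma range_coe_eq : Set.range UpperHalfPlane.coe = {z : ℂ | 0 < z.im} := by
  ext z
  exact ⟨by rintro ⟨w, rfl⟩; exact w.im_pos, fun h => ⟨⟨z, h⟩, rfl⟩⟩

lemma measurePreserving_coe : MeasurePreserving UpperHalfPlane.coe
    ((volume : Measure ℂ).comap UpperHalfPlane.coe) (volume.restrict {z : ℂ | 0 < z.im}) :=
  ⟨measurable_coe, by rw [measurableEmbedding_coe.map_comap, range_coe_eq]⟩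

lemma measurable_density :
    Measurable fun z : ℍ => (1 / NNReal.mk z.im z.im_pos.le : NNReal) ^ 2 := by
  have : Measurable fun z : ℍ => NNReal.mk z.im z.im_pos.le :=
    (UpperHalfPlane.continuous_im.measurable).subtype_mk
  exact (measurable_const.div this).pow_const 2

lemma integrable_iff_coe {F : ℍ → ℂ} : Integrable F ↔
    IntegrableOn (fun z : ℂ => ((z.im ^ 2)⁻¹ : ℝ) • F (ofComplex z)) {z : ℂ | 0 < z.im} := by
  rw [volume_def, integrable_withDensity_iff_integrable_smul measurable_density, IntegrableOn,
    ← measurePreserving_coe.integrable_comp_emb measurableEmbedding_coe]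
  refine integrable_congr (Eventually.of_forall fun z => ?_)
  simp [NNReal.smul_def]

lemma integral_eq_coe (F : ℍ → ℂ) : ∫ z, F z =
    ∫ z in {z : ℂ | 0 < z.im}, ((z.im ^ 2)⁻¹ : ℝ) • F (ofComplex z) := by
  rw [volume_def, integral_withDensity_eq_integral_smul measurable_density,
    ← measurePreserving_coe.integral_comp measurableEmbedding_coe]
  refine integral_congr_ae (Eventually.of_forall fun z => ?_)
  simp [NNReal.smul_def]

lemma integral_eq_iterated {F : ℍ → ℂ} (hF : Integrable F) : ∫ z, F z =
    ∫ y in Set.Ioi (0 : ℝ), ((y ^ 2)⁻¹ : ℝ) • ∫ x : ℝ, F (ofComplex (x + y * Complex.I)) := by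
  have hint := integrable_iff_coe.mp hF
  have hS : MeasurableSet {z : ℂ | 0 < z.im} := measurableSet_lt measurable_const Complex.measurable_im
  rw [integral_eq_coe, ← integral_indicator hS]
  rw [← integrable_indicator_iff hS] at hint
  have h1 := Complex.volume_preserving_equiv_real_prod.symm.integrable_comp_emb
    Complex.measurableEquivRealProd.symm.measurableEmbedding
    (g := {z : ℂ | 0 < z.im}.indicator fun z : ℂ => ((z.im ^ 2)⁻¹ : ℝ) • F (ofComplex z))
  have h2 := Complex.volume_preserving_equiv_real_prod.symm.integral_comp
    Complex.measurableEquivRealProd.symm.measurableEmbedding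
    ({z : ℂ | 0 < z.im}.indicator fun z : ℂ => ((z.im ^ 2)⁻¹ : ℝ) • F (ofComplex z))
  rw [← h2, Measure.volume_eq_prod, integral_prod_symm _ (by
    rw [← Measure.volume_eq_prod]; exact h1.mpr hint), ← integral_indicator measurableSet_Ioi]
  refine integral_congr_ae (Eventually.of_forall fun y => ?_)
  simp only
  by_cases hy : 0 < y
  · rw [Set.indicator_of_mem (by exact hy), ← integral_smul]
    refine integral_congr_ae (Eventually.of_forall fun x => ?_)
    have he : Complex.measurableEquivRealProd.symm (x, y) = (x + y * Complex.I : ℂ) := by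
      apply Complex.ext <;> simp [Complex.measurableEquivRealProd]
    simp only [he]
    rw [Set.indicator_of_mem (by simpa using hy)]
    simp
  · rw [Set.indicator_of_notMem (by exact hy)]
    rw [integral_eq_zero_of_ae]
    refine Eventually.of_forall fun x => ?_
    have he : Complex.measurableEquivRealProd.symm (x, y) = (x + y * Complex.I : ℂ) := by
      apply Complex.ext <;> simp [Complex.measurableEquivRealProd]
    simp only [he]
    rw [Set.indicator_of_notMem (by simpa using hy)]
    rfl

/-! ### Kernel functions -/

/-- The bilinear form `c z w + d w + a z + b` attached to a matrix `(a b; c d)`. -/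
def kernelForm (M : Matrix (Fin 2) (Fin 2) ℤ) (z w : ℂ) : ℂ :=
  ((M 1 0 : ℂ) * z + M 1 1) * w + (M 0 0 * z + M 0 1)

/-- The kernel `∑ (c z w + d w + a z + b)^{-k}`, the sum running over all integral matrices
`(a b; c d)` of determinant `n`. -/
def kernel (k : ℕ) (n : ℤ) (z w : ℂ) : ℂ :=
  ∑' M : FixedDetMatrix (Fin 2) ℤ n, (kernelForm M.1 z w ^ k)⁻¹

/-- The summable weight `∏ (1 + |M i j|)^{-2}` dominating the kernel. -/
def matrixWeight (M : Matrix (Fin 2) (Fin 2) ℤ) : ℝ :=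
  (((1 + |(M 0 0 : ℝ)|) ^ 2)⁻¹ * ((1 + |(M 0 1 : ℝ)|) ^ 2)⁻¹) *
    (((1 + |(M 1 0 : ℝ)|) ^ 2)⁻¹ * ((1 + |(M 1 1 : ℝ)|) ^ 2)⁻¹)

lemma matrixWeight_nonneg (M : Matrix (Fin 2) (Fin 2) ℤ) : 0 ≤ matrixWeight M := by
  unfold matrixWeight; positivity

lemma summable_inv_one_add_abs_sq : Summable fun n : ℤ => ((1 + |(n : ℝ)|) ^ 2)⁻¹ := by
  have h : Summable fun n : ℕ => ((1 + (n : ℝ)) ^ 2)⁻¹ := by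
    have := (summable_nat_add_iff 1).mpr (Real.summable_nat_pow_inv.mpr (one_lt_two))
    refine this.congr fun n => ?_
    push_cast; rw [add_comm]
  refine Summable.of_nat_of_neg ?_ ?_ <;> simpa using h

lemma summable_inv_one_add_abs_sq_prod : Summable fun q : (ℤ × ℤ) × (ℤ × ℤ) =>
    (((1 + |(q.1.1 : ℝ)|) ^ 2)⁻¹ * ((1 + |(q.1.2 : ℝ)|) ^ 2)⁻¹) *
      (((1 + |(q.2.1 : ℝ)|) ^ 2)⁻¹ * ((1 + |(q.2.2 : ℝ)|) ^ 2)⁻¹) := by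
  have h2 : Summable fun p : ℤ × ℤ => ((1 + |(p.1 : ℝ)|) ^ 2)⁻¹ * ((1 + |(p.2 : ℝ)|) ^ 2)⁻¹ :=
    Summable.mul_of_nonneg (f := fun n : ℤ => ((1 + |(n : ℝ)|) ^ 2)⁻¹)
      (g := fun n : ℤ => ((1 + |(n : ℝ)|) ^ 2)⁻¹) summable_inv_one_add_abs_sq
      summable_inv_one_add_abs_sq (fun n => inv_nonneg.mpr (sq_nonneg _))
      (fun n => inv_nonneg.mpr (sq_nonneg _))
  exact Summable.mul_of_nonneg
    (f := fun p : ℤ × ℤ => ((1 + |(p.1 : ℝ)|) ^ 2)⁻¹ * ((1 + |(p.2 : ℝ)|) ^ 2)⁻¹)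
    (g := fun p : ℤ × ℤ => ((1 + |(p.1 : ℝ)|) ^ 2)⁻¹ * ((1 + |(p.2 : ℝ)|) ^ 2)⁻¹) h2 h2
    (fun p => mul_nonneg (inv_nonneg.mpr (sq_nonneg _)) (inv_nonneg.mpr (sq_nonneg _)))
    (fun p => mul_nonneg (inv_nonneg.mpr (sq_nonneg _)) (inv_nonneg.mpr (sq_nonneg _)))

/-- The entries of an integral matrix of fixed determinant. -/
def entries {n : ℤ} (M : FixedDetMatrix (Fin 2) ℤ n) : (ℤ × ℤ) × (ℤ × ℤ) :=
  ((M.1 0 0, M.1 0 1), (M.1 1 0, M.1 1 1))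

lemma entries_injective (n : ℤ) :
    Function.Injective (entries : FixedDetMatrix (Fin 2) ℤ n → (ℤ × ℤ) × (ℤ × ℤ)) := by
  intro A B h
  have h1 : A.1 0 0 = B.1 0 0 := congrArg (fun q => q.1.1) h
  have h2 : A.1 0 1 = B.1 0 1 := congrArg (fun q => q.1.2) h
  have h3 : A.1 1 0 = B.1 1 0 := congrArg (fun q => q.2.1) h
  have h4 : A.1 1 1 = B.1 1 1 := congrArg (fun q => q.2.2) h
  apply FixedDetMatrices.ext'
  rw [Matrix.eta_fin_two A.1, Matrix.eta_fin_two B.1, h1, h2, h3, h4]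

lemma summable_matrixWeight (n : ℤ) :
    Summable fun M : FixedDetMatrix (Fin 2) ℤ n => matrixWeight M.1 := by
  have h := summable_inv_one_add_abs_sq_prod.comp_injective (entries_injective n)
  simp only [Function.comp_def, entries] at h
  unfold matrixWeight
  exact h

/-- The fundamental identity behind all bounds for the kernel: with `p = c z + d`, `q = a z + b`
and `w = u + i v` one has `|p w + q|² = |q + u p|² + v² |p|² + 2 v (det M) Im z`. -/
lemma normSq_kernelForm (M : Matrix (Fin 2) (Fin 2) ℤ) (z w : ℂ) :
    Complex.normSq (kernelForm M z w) =
      (((M 0 0 + w.re * M 1 0) * z.re + (M 0 1 + w.re * M 1 1)) ^ 2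
        + ((M 0 0 + w.re * M 1 0) * z.im) ^ 2)
      + w.im ^ 2 * ((M 1 0 * z.re + M 1 1) ^ 2 + (M 1 0 * z.im) ^ 2)
      + 2 * w.im * z.im * (M.det : ℝ) := by
  rw [Matrix.det_fin_two]
  simp only [kernelForm, Complex.normSq_apply, Complex.add_re, Complex.mul_re, Complex.add_im,
    Complex.mul_im, Complex.intCast_re, Complex.intCast_im]
  push_cast
  ring

/-- On truncated strips all entries of a matrix of positive determinant are bounded by the kernel
form: each of the squares in `normSq_kernelForm` is at most the total, and the determinant term
keeps the form away from `0`. -/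
lemma one_add_abs_le_norm_kernelForm {M : Matrix (Fin 2) (Fin 2) ℤ} (hM : 0 < M.det)
    {z w : ℂ} {κ R : ℝ} (hκ : 0 < κ) (hκ1 : κ ≤ 1) (hR : 1 ≤ R) (hz : κ ≤ z.im) (hw : κ ≤ w.im)
    (hz' : |z.re| ≤ R) (hw' : |w.re| ≤ R) (i j : Fin 2) :
    1 + |(M i j : ℝ)| ≤ 5 * R ^ 2 / κ ^ 2 * ‖kernelForm M z w‖ := by
  have hid := normSq_kernelForm M z w
  rw [Complex.normSq_eq_norm_sq] at hid
  set e := ‖kernelForm M z w‖ with he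
  have he0 : 0 ≤ e := norm_nonneg _
  set a : ℝ := ((M 0 0 : ℤ) : ℝ)
  set b : ℝ := ((M 0 1 : ℤ) : ℝ)
  set c : ℝ := ((M 1 0 : ℤ) : ℝ)
  set d : ℝ := ((M 1 1 : ℤ) : ℝ)
  set x := z.re
  set y := z.im
  set u := w.re
  set v := w.im
  have hdet : (1 : ℝ) ≤ M.det := by exact_mod_cast hM
  have hy0 : 0 < y := hκ.trans_le hz
  have hv0 : 0 < v := hκ.trans_le hw
  have hvy : κ ^ 2 ≤ v * y := by rw [sq]; exact mul_le_mul hw hz hκ.le hv0.le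
  have hpos : 2 * κ ^ 2 ≤ 2 * v * y * (M.det : ℝ) := by
    have : v * y * 1 ≤ v * y * (M.det : ℝ) := by gcongr
    linarith
  have hκ2 : 0 < κ ^ 2 := by positivity
  have hs1 : 0 ≤ ((a + u * c) * x + (b + u * d)) ^ 2 := sq_nonneg _
  have hs2 : 0 ≤ ((a + u * c) * y) ^ 2 := sq_nonneg _
  have hs3 : 0 ≤ v ^ 2 * (c * x + d) ^ 2 := by positivity
  have hs4 : 0 ≤ v ^ 2 * (c * y) ^ 2 := by positivity
  rw [mul_add] at hid
  -- Everything is measured in units of `T = e / κ ^ 2`.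
  set T := e / κ ^ 2 with hT
  have hT0 : 0 ≤ T := by positivity
  have heT : e = T * κ ^ 2 := by rw [hT]; field_simp
  have hκsq : κ ^ 2 ≤ 1 := pow_le_one₀ hκ.le hκ1
  have heT1 : e ≤ T := by rw [heT]; exact mul_le_of_le_one_right hT0 hκsq
  have heT2 : e ≤ T * κ := by
    rw [heT]; exact mul_le_mul_of_nonneg_left (by nlinarith) hT0
  have h1 : 1 ≤ T := by
    have h2 : κ ≤ e := (sq_le_sq₀ hκ.le he0).mp (by linarith)
    have h3 : 1 * κ ≤ T * κ := by linarith
    exact le_of_mul_le_mul_right h3 hκ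
  have hcd : |c * x + d| ≤ T := by
    have h : v * |c * x + d| ≤ e := by
      refine (sq_le_sq₀ (by positivity) he0).mp ?_
      rw [mul_pow, sq_abs]
      linarith
    have : κ * |c * x + d| ≤ κ * T := (mul_le_mul_of_nonneg_right hw (abs_nonneg _)).trans
      (h.trans (by rw [mul_comm]; exact heT2))
    exact le_of_mul_le_mul_left this hκ
  have hc : |c| ≤ T := by
    have h : v * (|c| * y) ≤ e := by
      refine (sq_le_sq₀ (by positivity) he0).mp ?_
      rw [mul_pow, mul_pow, sq_abs, ← mul_pow]
      linarith
    have : κ * (|c| * κ) ≤ v * (|c| * y) := by gcongr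
    have h3 : κ ^ 2 * |c| ≤ κ ^ 2 * T := by linarith [this.trans h]
    exact le_of_mul_le_mul_left h3 (by positivity)
  have hau : |a + u * c| ≤ T := by
    have h : |a + u * c| * y ≤ e := by
      refine (sq_le_sq₀ (by positivity) he0).mp ?_
      rw [mul_pow, sq_abs, ← mul_pow]
      linarith
    have : |a + u * c| * κ ≤ |a + u * c| * y := by gcongr
    exact le_of_mul_le_mul_right (this.trans (h.trans heT2)) hκ
  have hq : |(a + u * c) * x + (b + u * d)| ≤ T := by
    refine le_trans ?_ heT1
    refine (sq_le_sq₀ (abs_nonneg _) he0).mp ?_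
    rw [sq_abs]
    linarith
  have hRT : T ≤ R * T := le_mul_of_one_le_left hT0 hR
  have hRT2 : R * T ≤ R ^ 2 * T := by
    rw [sq, mul_assoc]; exact le_mul_of_one_le_left (by positivity) hR
  have hcx : |c * x| ≤ R * T := by
    rw [abs_mul, mul_comm]; exact mul_le_mul hz' hc (abs_nonneg _) (by positivity)
  have hcu : |u * c| ≤ R * T := by
    rw [abs_mul]; exact mul_le_mul hw' hc (abs_nonneg _) (by positivity)
  have hd : |d| ≤ 2 * (R * T) := by
    have : d = (c * x + d) - c * x := by ring
    rw [this]; refine (abs_sub _ _).trans ?_; linarith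
  have ha : |a| ≤ 2 * (R * T) := by
    have : a = (a + u * c) - u * c := by ring
    rw [this]; refine (abs_sub _ _).trans ?_; linarith
  have hb : |b| ≤ 4 * (R ^ 2 * T) := by
    have h1 : |(a + u * c) * x| ≤ T * R := by
      rw [abs_mul]; exact mul_le_mul hau hz' (abs_nonneg _) hT0
    have h2 : |u * d| ≤ R * (2 * (R * T)) := by
      rw [abs_mul]; exact mul_le_mul hw' hd (abs_nonneg _) (by positivity)
    have : b = ((a + u * c) * x + (b + u * d)) - (a + u * c) * x - u * d := by ring
    rw [this]
    refine (abs_sub _ _).trans ?_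
    have := abs_sub ((a + u * c) * x + (b + u * d)) ((a + u * c) * x)
    linarith
  have hgoal : 5 * R ^ 2 / κ ^ 2 * e = 5 * (R ^ 2 * T) := by rw [hT]; ring
  rw [hgoal]
  fin_cases i <;> fin_cases j
  · change 1 + |a| ≤ _; linarith
  · change 1 + |b| ≤ _; linarith
  · change 1 + |c| ≤ _; linarith
  · change 1 + |d| ≤ _; linarith

/-- Eight powers of the kernel form pay for the summable weight, the remaining `k - 8` are bounded
below by `m`. -/
lemma inv_norm_kernelForm_pow_le {M : Matrix (Fin 2) (Fin 2) ℤ} (hM : 0 < M.det)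
    {z w : ℂ} {κ R m : ℝ} (hκ : 0 < κ) (hκ1 : κ ≤ 1) (hR : 1 ≤ R) (hz : κ ≤ z.im) (hw : κ ≤ w.im)
    (hz' : |z.re| ≤ R) (hw' : |w.re| ≤ R) (hm : 0 < m) (hm' : m ≤ ‖kernelForm M z w‖)
    {k : ℕ} (hk : 8 ≤ k) :
    ‖(kernelForm M z w ^ k)⁻¹‖ ≤ (m ^ (k - 8))⁻¹ * (5 * R ^ 2 / κ ^ 2) ^ 8 * matrixWeight M := by
  have h := one_add_abs_le_norm_kernelForm hM hκ hκ1 hR hz hw hz' hw'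
  set e := ‖kernelForm M z w‖
  have he : 0 < e := hm.trans_le hm'
  set K := 5 * R ^ 2 / κ ^ 2 with hK
  have hK0 : 0 < K := by positivity
  have h8 : (e ^ 8)⁻¹ ≤ K ^ 8 * matrixWeight M := by
    have hw : matrixWeight M = ((1 + |(M 0 0 : ℝ)|) ^ 2 * (1 + |(M 0 1 : ℝ)|) ^ 2
        * ((1 + |(M 1 0 : ℝ)|) ^ 2 * (1 + |(M 1 1 : ℝ)|) ^ 2))⁻¹ := by
      simp only [matrixWeight, mul_inv]
    rw [hw, ← div_eq_mul_inv, le_div_iff₀ (by positivity), inv_mul_le_iff₀ (by positivity)]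
    calc _ ≤ (K * e) ^ 2 * (K * e) ^ 2 * ((K * e) ^ 2 * (K * e) ^ 2) := by
          gcongr <;> exact h _ _
      _ = _ := by ring
  rw [norm_inv, norm_pow]
  have hsplit : e ^ k = e ^ (k - 8) * e ^ 8 := by rw [← pow_add]; congr 1; omega
  rw [hsplit, mul_inv, mul_assoc]
  gcongr

/-- A lower bound growing linearly in `Im z`: it comes from the lower left entry of `M` if that does
not vanish, and from the upper left entry otherwise. -/
lemma mul_min_le_norm_kernelForm {M : Matrix (Fin 2) (Fin 2) ℤ} (hM : 0 < M.det)
    {z w : ℂ} (hz : 0 < z.im) (hw : 0 < w.im) : z.im * min 1 w.im ≤ ‖kernelForm M z w‖ := by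
  have hid := normSq_kernelForm M z w
  rw [Complex.normSq_eq_norm_sq] at hid
  refine (sq_le_sq₀ (by positivity) (norm_nonneg _)).mp ?_
  rw [hid]
  have hdet : (0 : ℝ) < M.det := by exact_mod_cast hM
  have hpos : 0 ≤ 2 * w.im * z.im * (M.det : ℝ) := by positivity
  have hmin0 : 0 < min 1 w.im := by positivity
  have h1 := min_le_left 1 w.im
  have h2 := min_le_right 1 w.im
  by_cases hc : M 1 0 = 0
  · have ha : M 0 0 ≠ 0 := by
      intro ha; rw [Matrix.det_fin_two, hc, ha] at hM; simp at hM
    have ha1 : (1 : ℝ) ≤ (M 0 0 : ℝ) ^ 2 := by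
      have : (1 : ℤ) ≤ (M 0 0) ^ 2 := by
        have := sq_pos_of_ne_zero ha; omega
      exact_mod_cast this
    have : (z.im * min 1 w.im) ^ 2 ≤ (M 0 0 * z.im) ^ 2 := by
      rw [mul_pow, mul_pow]
      nlinarith [mul_nonneg (sq_nonneg z.im) (sub_nonneg.mpr ha1), sq_nonneg z.im,
        mul_nonneg (sq_nonneg z.im) (show 0 ≤ 1 - (min 1 w.im) ^ 2 by nlinarith)]
    rw [hc]
    simp only [Int.cast_zero, mul_zero, add_zero, zero_mul]
    nlinarith [sq_nonneg (M 0 0 * z.re + (M 0 1 + w.re * M 1 1)),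
      mul_nonneg (sq_nonneg w.im) (sq_nonneg ((0 : ℝ) + M 1 1))]
  · have hc1 : (1 : ℝ) ≤ (M 1 0 : ℝ) ^ 2 := by
      have : (1 : ℤ) ≤ (M 1 0) ^ 2 := by
        have := sq_pos_of_ne_zero hc; omega
      exact_mod_cast this
    have : (z.im * min 1 w.im) ^ 2 ≤ w.im ^ 2 * (M 1 0 * z.im) ^ 2 := by
      have h3 : (min 1 w.im) ^ 2 ≤ w.im ^ 2 := by gcongr
      rw [mul_pow, mul_pow]
      calc z.im ^ 2 * (min 1 w.im) ^ 2 ≤ z.im ^ 2 * w.im ^ 2 := by gcongr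
        _ ≤ z.im ^ 2 * w.im ^ 2 * (M 1 0 : ℝ) ^ 2 := le_mul_of_one_le_right (by positivity) hc1
        _ = _ := by ring
    nlinarith [sq_nonneg ((M 0 0 + w.re * M 1 0) * z.re + (M 0 1 + w.re * M 1 1)),
      sq_nonneg ((M 0 0 + w.re * M 1 0) * z.im),
      mul_nonneg (sq_nonneg w.im) (sq_nonneg (M 1 0 * z.re + M 1 1))]

/-- If the lower left entry does not vanish, the linear form is at least `Im z * Im w`. -/
lemma im_mul_im_le_norm_kernelForm {M : Matrix (Fin 2) (Fin 2) ℤ} (hM : 0 < M.det)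
    (hc : M 1 0 ≠ 0) {z w : ℂ} (hz : 0 < z.im) (hw : 0 < w.im) :
    z.im * w.im ≤ ‖kernelForm M z w‖ := by
  have hid := normSq_kernelForm M z w
  rw [Complex.normSq_eq_norm_sq] at hid
  refine (sq_le_sq₀ (by positivity) (norm_nonneg _)).mp ?_
  rw [hid]
  have hdet : (0 : ℝ) < M.det := by exact_mod_cast hM
  have hpos : 0 ≤ 2 * w.im * z.im * (M.det : ℝ) := by positivity
  have hc1 : (1 : ℝ) ≤ (M 1 0 : ℝ) ^ 2 := by
    have : (1 : ℤ) ≤ (M 1 0) ^ 2 := by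
      have := sq_pos_of_ne_zero hc; omega
    exact_mod_cast this
  have : (z.im * w.im) ^ 2 ≤ w.im ^ 2 * (M 1 0 * z.im) ^ 2 := by
    calc (z.im * w.im) ^ 2 ≤ (z.im * w.im) ^ 2 * (M 1 0 : ℝ) ^ 2 :=
          le_mul_of_one_le_right (by positivity) hc1
      _ = _ := by ring
  nlinarith [sq_nonneg ((M 0 0 + w.re * M 1 0) * z.re + (M 0 1 + w.re * M 1 1)),
    sq_nonneg ((M 0 0 + w.re * M 1 0) * z.im),
    mul_nonneg (sq_nonneg w.im) (sq_nonneg (M 1 0 * z.re + M 1 1))]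

lemma det_pos_of_fixedDet {n : ℤ} (hn : 0 < n) (M : FixedDetMatrix (Fin 2) ℤ n) : 0 < M.1.det := by
  rw [M.2]; exact hn

/-- Uniform domination of the terms of the kernel on truncated strips. -/
lemma norm_kernel_term_le {n : ℤ} (hn : 0 < n) {k : ℕ} (hk : 8 ≤ k) {κ R : ℝ} (hκ : 0 < κ)
    (hκ1 : κ ≤ 1) (hR : 1 ≤ R) {z w : ℂ} (hz : κ ≤ z.im) (hw : κ ≤ w.im)
    (hz' : |z.re| ≤ R) (hw' : |w.re| ≤ R) (M : FixedDetMatrix (Fin 2) ℤ n) :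
    ‖(kernelForm M.1 z w ^ k)⁻¹‖ ≤
      ((z.im * min 1 w.im) ^ (k - 8))⁻¹ * (5 * R ^ 2 / κ ^ 2) ^ 8 * matrixWeight M.1 := by
  have hz0 : 0 < z.im := hκ.trans_le hz
  have hw0 : 0 < w.im := hκ.trans_le hw
  exact inv_norm_kernelForm_pow_le (det_pos_of_fixedDet hn M) hκ hκ1 hR hz hw hz' hw'
    (by positivity) (mul_min_le_norm_kernelForm (det_pos_of_fixedDet hn M) hz0 hw0) hk

lemma summable_norm_kernel_term {n : ℤ} (hn : 0 < n) {k : ℕ} (hk : 8 ≤ k) {z w : ℂ}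
    (hz : 0 < z.im) (hw : 0 < w.im) :
    Summable fun M : FixedDetMatrix (Fin 2) ℤ n => ‖(kernelForm M.1 z w ^ k)⁻¹‖ := by
  refine Summable.of_nonneg_of_le (fun _ => norm_nonneg _) (fun M => norm_kernel_term_le hn hk
    (κ := min 1 (min z.im w.im)) (R := max 1 (max |z.re| |w.re|)) (by positivity)
    (min_le_left _ _) (le_max_left _ _) ?_ ?_ ?_ ?_ M) ((summable_matrixWeight n).mul_left _)
  · exact (min_le_right _ _).trans (min_le_left _ _)
  · exact (min_le_right _ _).trans (min_le_right _ _)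
  · exact (le_max_left _ _).trans (le_max_right _ _)
  · exact (le_max_right _ _).trans (le_max_right _ _)

lemma summable_kernel_term {n : ℤ} (hn : 0 < n) {k : ℕ} (hk : 8 ≤ k) {z w : ℂ}
    (hz : 0 < z.im) (hw : 0 < w.im) :
    Summable fun M : FixedDetMatrix (Fin 2) ℤ n => (kernelForm M.1 z w ^ k)⁻¹ :=
  (summable_norm_kernel_term hn hk hz hw).of_norm

lemma kernelForm_ne_zero {M : Matrix (Fin 2) (Fin 2) ℤ} (hM : 0 < M.det)
    {z w : ℂ} (hz : 0 < z.im) (hw : 0 < w.im) : kernelForm M z w ≠ 0 := by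
  rw [← norm_pos_iff]
  exact lt_of_lt_of_le (by positivity) (mul_min_le_norm_kernelForm hM hz hw)

/-- The involution `(a b; c d) ↦ (d b; c a)`, under which the kernel form is symmetric. -/
def swapDiag (n : ℤ) : FixedDetMatrix (Fin 2) ℤ n ≃ FixedDetMatrix (Fin 2) ℤ n where
  toFun M := ⟨!![M.1 1 1, M.1 0 1; M.1 1 0, M.1 0 0], by
    have := M.2; rw [Matrix.det_fin_two] at this; rw [Matrix.det_fin_two_of]; linarith⟩
  invFun M := ⟨!![M.1 1 1, M.1 0 1; M.1 1 0, M.1 0 0], by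
    have := M.2; rw [Matrix.det_fin_two] at this; rw [Matrix.det_fin_two_of]; linarith⟩
  left_inv M := by
    apply FixedDetMatrices.ext; intro i j; fin_cases i <;> fin_cases j <;> rfl
  right_inv M := by
    apply FixedDetMatrices.ext; intro i j; fin_cases i <;> fin_cases j <;> rfl

lemma kernel_symm (k : ℕ) (n : ℤ) (z w : ℂ) : kernel k n z w = kernel k n w z := by
  rw [kernel, kernel, ← (swapDiag n).tsum_eq fun M => (kernelForm M.1 w z ^ k)⁻¹]
  refine tsum_congr fun M => ?_
  congr 2
  have h00 : (swapDiag n M).1 0 0 = M.1 1 1 := rfl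
  have h01 : (swapDiag n M).1 0 1 = M.1 0 1 := rfl
  have h10 : (swapDiag n M).1 1 0 = M.1 1 0 := rfl
  have h11 : (swapDiag n M).1 1 1 = M.1 0 0 := rfl
  rw [kernelForm, kernelForm, h00, h01, h10, h11]
  ring

/-- The involution `(a b; c d) ↦ (a -b; -c d)`, corresponding to complex conjugation. -/
def negOffDiag (n : ℤ) : FixedDetMatrix (Fin 2) ℤ n ≃ FixedDetMatrix (Fin 2) ℤ n where
  toFun M := ⟨!![M.1 0 0, -M.1 0 1; -M.1 1 0, M.1 1 1], by
    have := M.2; rw [Matrix.det_fin_two] at this; rw [Matrix.det_fin_two_of]; linarith⟩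
  invFun M := ⟨!![M.1 0 0, -M.1 0 1; -M.1 1 0, M.1 1 1], by
    have := M.2; rw [Matrix.det_fin_two] at this; rw [Matrix.det_fin_two_of]; linarith⟩
  left_inv M := by
    apply FixedDetMatrices.ext; intro i j; fin_cases i <;> fin_cases j <;> simp
  right_inv M := by
    apply FixedDetMatrices.ext; intro i j; fin_cases i <;> fin_cases j <;> simp

lemma conj_kernel {k : ℕ} (hk : Even k) (n : ℤ) (z w : ℂ) :
    conj (kernel k n z w) = kernel k n (-conj z) (-conj w) := by
  rw [kernel, kernel, ← (negOffDiag n).tsum_eq fun M => (kernelForm M.1 (-conj z) (-conj w) ^ k)⁻¹,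
    Complex.conj_tsum]
  refine tsum_congr fun M => ?_
  rw [map_inv₀, map_pow, ← hk.neg_pow]
  congr 2
  have h00 : (negOffDiag n M).1 0 0 = M.1 0 0 := rfl
  have h01 : (negOffDiag n M).1 0 1 = -M.1 0 1 := rfl
  have h10 : (negOffDiag n M).1 1 0 = -M.1 1 0 := rfl
  have h11 : (negOffDiag n M).1 1 1 = M.1 1 1 := rfl
  rw [kernelForm, kernelForm, h00, h01, h10, h11]
  simp only [map_add, map_mul, Int.cast_neg, map_intCast]
  ring

/-- Right multiplication by an element of `SL(2, ℤ)`. -/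
def mulRightSL (n : ℤ) (γ : SL(2, ℤ)) : FixedDetMatrix (Fin 2) ℤ n ≃ FixedDetMatrix (Fin 2) ℤ n where
  toFun M := ⟨M.1 * γ.1, by rw [Matrix.det_mul, M.2, γ.2, mul_one]⟩
  invFun M := ⟨M.1 * (γ⁻¹).1, by rw [Matrix.det_mul, M.2, (γ⁻¹).2, mul_one]⟩
  left_inv M := by
    apply FixedDetMatrices.ext'
    change M.1 * γ.1 * (γ⁻¹).1 = M.1
    rw [mul_assoc, ← Matrix.SpecialLinearGroup.coe_mul, mul_inv_cancel,
      Matrix.SpecialLinearGroup.coe_one, mul_one]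
  right_inv M := by
    apply FixedDetMatrices.ext'
    change M.1 * (γ⁻¹).1 * γ.1 = M.1
    rw [mul_assoc, ← Matrix.SpecialLinearGroup.coe_mul, inv_mul_cancel,
      Matrix.SpecialLinearGroup.coe_one, mul_one]

/-- Transformation of the kernel form under a linear fractional substitution in `z`. -/
lemma kernelForm_mul (M A : Matrix (Fin 2) (Fin 2) ℤ) (z w : ℂ)
    (h : (A 1 0 : ℂ) * z + A 1 1 ≠ 0) :
    kernelForm (M * A) z w =
      (A 1 0 * z + A 1 1) * kernelForm M ((A 0 0 * z + A 0 1) / (A 1 0 * z + A 1 1)) w := by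
  simp only [kernelForm, Matrix.mul_apply, Fin.sum_univ_two]
  push_cast
  field_simp
  ring

lemma kernel_smul (k : ℕ) (n : ℤ) (γ : SL(2, ℤ)) (z : ℍ) (w : ℂ) :
    kernel k n ((γ • z : ℍ) : ℂ) w = denom γ z ^ k * kernel k n z w := by
  have hden : denom γ z = (γ.1 1 0 : ℂ) * z + γ.1 1 1 := by simp [ModularGroup.denom_apply]
  have hne : (γ.1 1 0 : ℂ) * z + γ.1 1 1 ≠ 0 := hden ▸ denom_ne_zero _ z
  have hz : ((γ • z : ℍ) : ℂ) = (γ.1 0 0 * z + γ.1 0 1) / (γ.1 1 0 * z + γ.1 1 1) := by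
    rw [UpperHalfPlane.specialLinearGroup_apply]; simp
  rw [kernel, kernel, ← (mulRightSL n γ).tsum_eq (fun M => (kernelForm M.1 z w ^ k)⁻¹),
    ← tsum_mul_left]
  refine tsum_congr fun M => ?_
  change _ = denom γ z ^ k * (kernelForm (M.1 * γ.1) z w ^ k)⁻¹
  rw [kernelForm_mul _ _ _ _ hne, ← hz, ← hden, mul_pow, mul_inv, mul_inv_cancel_left₀]
  exact pow_ne_zero _ (denom_ne_zero _ z)

lemma norm_kernel_le {n : ℤ} (hn : 0 < n) {k : ℕ} (hk : 8 ≤ k) {κ R : ℝ} (hκ : 0 < κ)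
    (hκ1 : κ ≤ 1) (hR : 1 ≤ R) {z w : ℂ} (hz : κ ≤ z.im) (hw : κ ≤ w.im)
    (hz' : |z.re| ≤ R) (hw' : |w.re| ≤ R) :
    ‖kernel k n z w‖ ≤ ((z.im * min 1 w.im) ^ (k - 8))⁻¹ * (5 * R ^ 2 / κ ^ 2) ^ 8 *
      ∑' M : FixedDetMatrix (Fin 2) ℤ n, matrixWeight M.1 := by
  rw [← tsum_mul_left]
  exact tsum_of_norm_bounded ((summable_matrixWeight n).mul_left _).hasSum
    (fun M => norm_kernel_term_le hn hk hκ hκ1 hR hz hw hz' hw' M)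

lemma differentiableAt_kernel {n : ℤ} (hn : 0 < n) {k : ℕ} (hk : 8 ≤ k) {w : ℂ} (hw : 0 < w.im)
    {z : ℂ} (hz : 0 < z.im) : DifferentiableAt ℂ (fun z => kernel k n z w) z := by
  set U : Set ℂ := {x : ℂ | z.im / 2 < x.im} ∩ {x : ℂ | |x.re| < |z.re| + 1} with hU
  have hUo : IsOpen U := (isOpen_lt continuous_const Complex.continuous_im).inter
    (isOpen_lt (continuous_abs.comp Complex.continuous_re) continuous_const)
  have hzU : z ∈ U := ⟨show z.im / 2 < z.im by linarith, show |z.re| < |z.re| + 1 by linarith⟩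
  set κ := min 1 (min (z.im / 2) w.im)
  set R := max (|z.re| + 1) (max 1 |w.re|)
  have hκ : 0 < κ := by positivity
  refine (Complex.differentiableOn_tsum_of_summable_norm (u := fun M : FixedDetMatrix (Fin 2) ℤ n =>
    ((κ * min 1 w.im) ^ (k - 8))⁻¹ * (5 * R ^ 2 / κ ^ 2) ^ 8 * matrixWeight M.1)
    ((summable_matrixWeight n).mul_left _) (fun M x hx => ?_) hUo (fun M x hx => ?_)
    |>.differentiableAt (hUo.mem_nhds hzU))
  · have hx0 : 0 < x.im := by have := hx.1; simp only [Set.mem_ofPred_eq] at this; linarith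
    have hne := kernelForm_ne_zero (det_pos_of_fixedDet hn M) hx0 hw
    refine DifferentiableAt.differentiableWithinAt ?_
    refine DifferentiableAt.inv (DifferentiableAt.pow ?_ k) (pow_ne_zero _ hne)
    unfold kernelForm
    fun_prop
  · have hx1 : κ ≤ x.im :=
      ((min_le_right _ _).trans (min_le_left _ _)).trans (le_of_lt hx.1)
    refine (norm_kernel_term_le hn hk hκ (min_le_left _ _)
      ((le_max_left 1 _).trans (le_max_right _ _)) hx1
      ((min_le_right _ _).trans (min_le_right _ _)) ((le_of_lt hx.2).trans (le_max_left _ _))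
      ((le_max_right 1 _).trans (le_max_right _ _)) M).trans ?_
    have := matrixWeight_nonneg M.1
    gcongr

lemma mdifferentiable_kernel {n : ℤ} (hn : 0 < n) {k : ℕ} (hk : 8 ≤ k) {w : ℂ} (hw : 0 < w.im) :
    MDiff (fun z : ℍ => kernel k n z w) := by
  rw [UpperHalfPlane.mdifferentiable_iff]
  have h : DifferentiableOn ℂ (fun z => kernel k n z w) {z : ℂ | 0 < z.im} :=
    fun z hz => (differentiableAt_kernel hn hk hw hz).differentiableWithinAt
  refine h.congr fun z hz => ?_
  simp [ofComplex_apply_of_im_pos (show 0 < z.im from hz)]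

lemma kernel_T_zpow_smul (k : ℕ) (n : ℤ) (m : ℤ) (z : ℍ) (w : ℂ) :
    kernel k n ((ModularGroup.T ^ m • z : ℍ) : ℂ) w = kernel k n z w := by
  rw [kernel_smul]
  have : denom (ModularGroup.T ^ m : SL(2, ℤ)) z = 1 := by
    rw [ModularGroup.denom_apply, ModularGroup.coe_T_zpow]; simp
  rw [this]; simp

lemma isZeroAtImInfty_kernel {n : ℤ} (hn : 0 < n) {k : ℕ} (hk : 9 ≤ k) {w : ℂ} (hw : 0 < w.im) :
    IsZeroAtImInfty (fun z : ℍ => kernel k n z w) := by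
  rw [UpperHalfPlane.isZeroAtImInfty_iff]
  intro ε hε
  set κ := min 1 w.im
  set R := max 1 |w.re|
  have hκ : 0 < κ := by positivity
  set S := ∑' M : FixedDetMatrix (Fin 2) ℤ n, matrixWeight M.1
  have hS : 0 ≤ S := tsum_nonneg fun M => matrixWeight_nonneg M.1
  set C := (κ ^ (k - 8))⁻¹ * (5 * R ^ 2 / κ ^ 2) ^ 8 * S with hC
  have hC0 : 0 ≤ C := by positivity
  refine ⟨max 1 (C / ε), fun z hz => ?_⟩
  have hz1 : 1 ≤ z.im := (le_max_left _ _).trans hz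
  -- In the strip `0 ≤ Re z < 1` the dominating series is uniform, and every term decays at least
  -- as `(Im z)⁻¹`.
  set z' : ℍ := ModularGroup.T ^ (-⌊z.re⌋) • z
  have hre : z'.re = z.re - ⌊z.re⌋ := by
    rw [ModularGroup.re_T_zpow_smul]; push_cast; ring
  have him : z'.im = z.im := ModularGroup.im_T_zpow_smul _ _
  have habs : |(z' : ℂ).re| ≤ R := by
    rw [UpperHalfPlane.coe_re, hre, abs_of_nonneg (Int.fract_nonneg _)]
    exact (Int.fract_lt_one _).le.trans (le_max_left _ _)
  rw [← kernel_T_zpow_smul k n (-⌊z.re⌋) z w]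
  have h := norm_kernel_le hn (by omega : 8 ≤ k) hκ (min_le_left _ _) (le_max_left _ _)
    (z := z') (w := w) (by rw [UpperHalfPlane.coe_im, him]; exact (min_le_left _ _).trans hz1)
    (min_le_right _ _) habs (le_max_right _ _)
  refine h.trans ?_
  rw [UpperHalfPlane.coe_im, him, mul_pow, mul_inv]
  have hpow : z.im ≤ z.im ^ (k - 8) := le_self_pow₀ hz1 (by omega)
  have hz0 : 0 < z.im := z.im_pos
  have h2 : (z.im ^ (k - 8))⁻¹ ≤ z.im⁻¹ := inv_anti₀ hz0 hpow
  calc (z.im ^ (k - 8))⁻¹ * (κ ^ (k - 8))⁻¹ * (5 * R ^ 2 / κ ^ 2) ^ 8 * S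
      = (z.im ^ (k - 8))⁻¹ * C := by rw [hC]; ring
    _ ≤ z.im⁻¹ * C := by gcongr
    _ ≤ ε := by
      rw [inv_mul_le_iff₀ hz0]
      have := (le_max_right 1 (C / ε)).trans hz
      rwa [div_le_iff₀ hε] at this

lemma slash_kernel {k : ℕ} (n : ℤ) (w : ℂ) (γ : SL(2, ℤ)) :
    (fun z : ℍ => kernel k n z w) ∣[(k : ℤ)] γ = fun z : ℍ => kernel k n z w := by
  ext z
  rw [ModularForm.SL_slash_apply, kernel_smul]
  have := denom_ne_zero γ z
  simp only [zpow_neg, zpow_natCast]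
  field_simp

/-- The kernel as a cusp form in its first variable. -/
def kernelForm₁ {k : ℕ} (hk : 9 ≤ k) {n : ℤ} (hn : 0 < n) {w : ℂ} (hw : 0 < w.im) :
    CuspForm 𝒮ℒ (k : ℤ) where
  toFun z := kernel k n z w
  slash_action_eq' := fun _ ⟨γ, hγ⟩ => hγ ▸ slash_kernel n w γ
  holo' := mdifferentiable_kernel hn (by omega) hw
  zero_at_cusps' {c} hc := by
    rw [OnePoint.isZeroAt_iff_forall_SL2Z hc]
    intro γ _
    rw [slash_kernel n w γ]
    exact isZeroAtImInfty_kernel hn hk hw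

/-! ### Hecke operators -/

/-- Index set `{(d, b) : d ∣ n, 0 ≤ b < d}` of the upper triangular matrices
`(n/d b; 0 d)`. -/
def heckeReps (n : ℕ) : Finset (Σ _ : ℕ, ℕ) := n.divisors.sigma fun d => Finset.range d

lemma mem_heckeReps {n : ℕ} {p : Σ _ : ℕ, ℕ} :
    p ∈ heckeReps n ↔ (p.1 ∣ n ∧ n ≠ 0) ∧ p.2 < p.1 := by
  simp [heckeReps]

/-- The upper triangular matrix `(n/d b; 0 d)`. -/
def heckeMatrix (n : ℕ) (p : Σ _ : ℕ, ℕ) : Matrix (Fin 2) (Fin 2) ℤ :=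
  !![((n / p.1 : ℕ) : ℤ), (p.2 : ℤ); 0, (p.1 : ℤ)]

lemma det_heckeMatrix {n : ℕ} {p : Σ _ : ℕ, ℕ} (hp : p ∈ heckeReps n) :
    (heckeMatrix n p).det = n := by
  rw [heckeMatrix, Matrix.det_fin_two_of, mul_zero, sub_zero]
  exact_mod_cast Nat.div_mul_cancel (mem_heckeReps.mp hp).1.1

/-- The map `(γ, A) ↦ γ A` from pairs of an element of `SL(2, ℤ)` and an upper triangular
representative to the integral matrices of determinant `n`. -/
def heckeMul (n : ℕ) (q : heckeReps n × SL(2, ℤ)) : FixedDetMatrix (Fin 2) ℤ n :=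
  ⟨q.2.1 * heckeMatrix n q.1.1, by
    rw [Matrix.det_mul, q.2.2, det_heckeMatrix q.1.2, one_mul]⟩

lemma heckeMul_injective (n : ℕ) : Function.Injective (heckeMul n) := by
  rintro ⟨⟨⟨d₁, b₁⟩, h₁⟩, γ₁⟩ ⟨⟨⟨d₂, b₂⟩, h₂⟩, γ₂⟩ h
  have h0 : γ₁.1 * heckeMatrix n ⟨d₁, b₁⟩ = γ₂.1 * heckeMatrix n ⟨d₂, b₂⟩ := congrArg Subtype.val h
  set γ : SL(2, ℤ) := γ₂⁻¹ * γ₁ with hγ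
  have h3 : γ.1 * heckeMatrix n ⟨d₁, b₁⟩ = heckeMatrix n ⟨d₂, b₂⟩ := by
    rw [hγ, Matrix.SpecialLinearGroup.coe_mul, mul_assoc, h0, ← mul_assoc,
      ← Matrix.SpecialLinearGroup.coe_mul, inv_mul_cancel, Matrix.SpecialLinearGroup.coe_one, one_mul]
  obtain ⟨⟨hd1, hn⟩, hb1⟩ := mem_heckeReps.mp h₁
  obtain ⟨⟨hd2, -⟩, hb2⟩ := mem_heckeReps.mp h₂
  simp only at hd1 hd2 hb1 hb2
  have e00 := congrFun (congrFun h3 0) 0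
  have e01 := congrFun (congrFun h3 0) 1
  have e10 := congrFun (congrFun h3 1) 0
  have e11 := congrFun (congrFun h3 1) 1
  have hdet := γ.2
  rw [Matrix.det_fin_two] at hdet
  simp only [heckeMatrix, Matrix.mul_apply, Fin.sum_univ_two, Matrix.of_apply, Matrix.cons_val',
    Matrix.cons_val_zero, Matrix.cons_val_one, Matrix.cons_val_fin_one, mul_zero, add_zero]
    at e00 e01 e10 e11
  have ha1 : 0 < ((n / d₁ : ℕ) : ℤ) := by
    exact_mod_cast Nat.div_pos (Nat.le_of_dvd (Nat.pos_of_ne_zero hn) hd1) (by omega)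
  have ha2 : 0 < ((n / d₂ : ℕ) : ℤ) := by
    exact_mod_cast Nat.div_pos (Nat.le_of_dvd (Nat.pos_of_ne_zero hn) hd2) (by omega)
  -- `γ = γ₂⁻¹ γ₁` is upper triangular with diagonal entries `1`, by positivity of the diagonal
  -- entries of the representatives; its last entry vanishes because `0 ≤ b₁, b₂ < d`.
  have hr : γ.1 1 0 = 0 := by
    rcases mul_eq_zero.mp e10 with h | h
    · exact h
    · omega
  rw [hr] at hdet e11
  simp only [zero_mul, mul_zero, sub_zero, zero_add] at hdet e11
  have hp : γ.1 0 0 = 1 := by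
    rcases Int.eq_one_or_neg_one_of_mul_eq_one hdet with h | h
    · exact h
    · rw [h] at e00; omega
  have hs : γ.1 1 1 = 1 := by rw [hp] at hdet; omega
  rw [hs, one_mul] at e11
  have hd : d₁ = d₂ := by exact_mod_cast e11
  rw [hp, one_mul] at e01
  have hq : γ.1 0 1 = 0 := by
    by_contra hq
    have h1 : (d₁ : ℤ) ≤ |γ.1 0 1 * d₁| := by
      rw [abs_mul, abs_of_nonneg (Int.natCast_nonneg d₁)]
      have := Int.one_le_abs hq
      nlinarith [Int.natCast_nonneg d₁]
    have h2 : γ.1 0 1 * d₁ = b₂ - b₁ := by omega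
    rw [h2] at h1
    have : |(b₂ : ℤ) - b₁| < d₁ := by rw [abs_lt]; omega
    omega
  rw [hq] at e01
  have hb : b₁ = b₂ := by simp only [zero_mul, add_zero] at e01; exact_mod_cast e01
  have hγ1 : γ = 1 := by
    ext i j; fin_cases i <;> fin_cases j <;> simp [hp, hq, hr, hs]
  rw [hγ, inv_mul_eq_one] at hγ1
  subst hd hb
  rw [hγ1]

lemma heckeMul_surjective {n : ℕ} (hn : n ≠ 0) : Function.Surjective (heckeMul n) := by
  rintro ⟨M, hM⟩
  have hdet := hM
  rw [Matrix.det_fin_two] at hdet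
  set α := M 0 0
  set β := M 0 1
  set c := M 1 0
  set δ := M 1 1
  have hn' : (0 : ℤ) < n := by exact_mod_cast Nat.pos_of_ne_zero hn
  -- A Bézout matrix reduces the first column to `(g, 0)`, and division with remainder by the lower
  -- right entry `e` reduces the upper right entry.
  set g : ℕ := Int.gcd α c with hg
  have hg0 : 0 < g := by
    rw [hg, Int.gcd_pos_iff]
    by_contra h
    push Not at h
    rw [h.1, h.2] at hdet
    simp at hdet
    omega
  obtain ⟨α', hα⟩ : (g : ℤ) ∣ α := Int.gcd_dvd_left _ _
  obtain ⟨c', hc⟩ : (g : ℤ) ∣ c := Int.gcd_dvd_right _ _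
  have hg0' : (0 : ℤ) < g := by exact_mod_cast hg0
  set u := Int.gcdA α c
  set v := Int.gcdB α c
  have hbez : α' * u + c' * v = 1 := by
    have h := Int.gcd_eq_gcd_ab α c
    have h2 : (g : ℤ) * (α' * u + c' * v) = g * 1 := by
      rw [mul_one]; conv_rhs => rw [hg, h]
      change _ = α * u + c * v
      rw [hα, hc]; ring
    exact mul_left_cancel₀ hg0'.ne' h2
  set e := α' * δ - c' * β with he
  have hge : (g : ℤ) * e = n := by rw [he, ← hdet, hα, hc]; ring
  have he0 : 0 < e := by
    by_contra h
    push Not at h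
    nlinarith
  set b0 := u * β + v * δ with hb0
  set j := b0 / e with hj
  obtain ⟨d, hd⟩ : ∃ d : ℕ, (d : ℤ) = e := ⟨e.toNat, Int.toNat_of_nonneg he0.le⟩
  obtain ⟨b, hb⟩ : ∃ b : ℕ, (b : ℤ) = b0 % e :=
    ⟨(b0 % e).toNat, Int.toNat_of_nonneg (Int.emod_nonneg _ he0.ne')⟩
  have hbd : b < d := by
    have := Int.emod_lt_of_pos b0 he0
    omega
  have hgd : g * d = n := by
    have : ((g * d : ℕ) : ℤ) = n := by push_cast; rw [hd]; exact hge
    exact_mod_cast this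
  have hmem : (⟨d, b⟩ : Σ _ : ℕ, ℕ) ∈ heckeReps n :=
    mem_heckeReps.mpr ⟨⟨⟨g, by rw [mul_comm]; exact hgd.symm⟩, hn⟩, hbd⟩
  have hnd : n / d = g := by
    rw [← hgd]; exact Nat.mul_div_cancel _ (by omega)
  have hγ : (!![α', α' * j - v; c', c' * j + u] : Matrix (Fin 2) (Fin 2) ℤ).det = 1 := by
    rw [Matrix.det_fin_two_of]; linarith [hbez]
  refine ⟨⟨⟨⟨d, b⟩, hmem⟩, ⟨_, hγ⟩⟩, ?_⟩
  apply FixedDetMatrices.ext'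
  have hb0' : b0 = e * j + b := by rw [hb, hj]; exact (Int.mul_ediv_add_emod b0 e).symm
  change (!![α', α' * j - v; c', c' * j + u] : Matrix (Fin 2) (Fin 2) ℤ) * heckeMatrix n ⟨d, b⟩ = M
  rw [heckeMatrix, Matrix.mul_fin_two, Matrix.eta_fin_two M, hnd]
  simp only [hd, mul_zero, add_zero]
  have h01 : α' * (b : ℤ) + (α' * j - v) * e = β := by
    have : (b : ℤ) = b0 - e * j := by linarith
    rw [this, hb0, he]
    linear_combination β * hbez
  have h11 : c' * (b : ℤ) + (c' * j + u) * e = δ := by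
    have : (b : ℤ) = b0 - e * j := by linarith
    rw [this, hb0, he]
    linear_combination δ * hbez
  rw [h01, h11]
  change !![α' * (g : ℤ), β; c' * (g : ℤ), δ] = !![α, β; c, δ]
  rw [hα, hc, mul_comm α', mul_comm c']

/-- The decomposition of the matrices of determinant `n` into cosets of `SL(2, ℤ)`. -/
def heckeEquiv {n : ℕ} (hn : n ≠ 0) : heckeReps n × SL(2, ℤ) ≃ FixedDetMatrix (Fin 2) ℤ n :=
  Equiv.ofBijective _ ⟨heckeMul_injective n, heckeMul_surjective hn⟩

/-- The Hecke operator `T_n` maps the kernel of determinant `1` to `n^{k-1}` times the kernel of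
determinant `n`. -/
lemma heckeOperator_kernel {k : ℕ} (hk : 8 ≤ k) {n : ℕ} (hn : n ≠ 0) {w : ℂ} (hw : 0 < w.im)
    (z : ℍ) : heckeOperator k n (fun z => kernel k 1 z w) z
      = (n : ℂ) ^ ((k : ℤ) - 1) * kernel k n z w := by
  have hsum : Summable fun q : heckeReps n × SL(2, ℤ) =>
      (kernelForm (heckeMul n q).1 z w ^ k)⁻¹ :=
    (heckeEquiv hn).summable_iff.mpr (summable_kernel_term (n := n)
      (by exact_mod_cast Nat.pos_of_ne_zero hn) hk z.im_pos hw)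
  rw [heckeOperator]
  congr 1
  have hk2 : kernel k n z w = ∑' q : heckeReps n × SL(2, ℤ),
      (kernelForm (heckeMul n q).1 z w ^ k)⁻¹ :=
    ((heckeEquiv hn).tsum_eq fun M => (kernelForm M.1 z w ^ k)⁻¹).symm
  rw [hk2, hsum.tsum_prod, tsum_fintype]
  simp_rw [Finset.mul_sum]
  rw [Finset.sum_sigma']
  rw [← Finset.sum_coe_sort]
  refine Finset.sum_congr rfl fun p _ => ?_
  obtain ⟨⟨d, b⟩, hp⟩ := p
  obtain ⟨⟨hd, -⟩, hb⟩ := mem_heckeReps.mp hp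
  simp only at hd hb ⊢
  have hd0 : (d : ℂ) ≠ 0 := by exact_mod_cast (by omega : d ≠ 0)
  have him : 0 < (((((n / d : ℕ) : ℂ) * (z : ℂ) + (b : ℂ)) / (d : ℂ))).im := by
    have h1 : 0 < n / d := Nat.div_pos (Nat.le_of_dvd (Nat.pos_of_ne_zero hn) hd) (by omega)
    rw [Complex.div_natCast_im]
    refine div_pos ?_ (by exact_mod_cast (by omega : 0 < d))
    have : (0 : ℝ) < (n / d : ℕ) := by exact_mod_cast h1
    rw [Complex.add_im, Complex.natCast_im, add_zero, Complex.mul_im, Complex.natCast_im,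
      Complex.natCast_re, zero_mul, add_zero]
    exact mul_pos this z.im_pos
  rw [ofComplex_apply_of_im_pos him, kernel, ← tsum_mul_left]
  refine tsum_congr fun γ => ?_
  change (d : ℂ) ^ (-(k : ℤ)) * (kernelForm γ.1 _ w ^ k)⁻¹ =
    (kernelForm (γ.1 * heckeMatrix n ⟨d, b⟩) z w ^ k)⁻¹
  have h10 : (heckeMatrix n ⟨d, b⟩ 1 0 : ℂ) * z + heckeMatrix n ⟨d, b⟩ 1 1 = d := by
    simp [heckeMatrix]
  have h00 : (heckeMatrix n ⟨d, b⟩ 0 0 : ℂ) * z + heckeMatrix n ⟨d, b⟩ 0 1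
      = ((n / d : ℕ) : ℂ) * z + b := by
    have h1 : heckeMatrix n ⟨d, b⟩ 0 0 = ((n / d : ℕ) : ℤ) := rfl
    have h2 : heckeMatrix n ⟨d, b⟩ 0 1 = (b : ℤ) := rfl
    rw [h1, h2, Int.cast_natCast, Int.cast_natCast]
  rw [kernelForm_mul _ _ _ _ (by rw [h10]; exact hd0), h10, h00, mul_pow, mul_inv, zpow_neg,
    zpow_natCast]

/-! ### Fourier coefficients -/

lemma coe_ofComplex_mk (x : ℝ) {y : ℝ} (hy : 0 < y) :
    ((ofComplex ((x : ℂ) + y * Complex.I) : ℍ) : ℂ) = x + y * Complex.I := by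
  rw [ofComplex_apply_of_im_pos (by simpa using hy)]

lemma ofComplex_mk_im (x : ℝ) {y : ℝ} (hy : 0 < y) :
    (ofComplex ((x : ℂ) + y * Complex.I) : ℍ).im = y := by
  rw [← UpperHalfPlane.coe_im, coe_ofComplex_mk x hy]; simp

lemma norm_cexp_two_pi (n : ℕ) (z : ℂ) :
    ‖cexp (2 * π * Complex.I * n * z)‖ = Real.exp (-2 * π * n * z.im) := by
  rw [Complex.norm_exp]
  congr 1
  have : (2 * π * Complex.I * n * z : ℂ) = ((2 * π * n : ℝ) : ℂ) * (Complex.I * z) := by push_cast; ring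
  rw [this, Complex.re_ofReal_mul, Complex.I_mul_re]
  ring

section coeff

variable {k : ℤ} (f : CuspForm 𝒮ℒ k)

lemma hasSum_coeff (z : ℍ) :
    HasSum (fun n : ℕ => (qExpansion 1 f).coeff n * cexp (2 * π * Complex.I * n * z)) (f z) := by
  have : Fact (IsCusp OnePoint.infty 𝒮ℒ) :=
    ⟨Subgroup.isCusp_of_mem_strictPeriods one_pos one_mem_strictPeriods_SL⟩
  have h := UpperHalfPlane.hasSum_qExpansion (h := 1) one_pos
    (SlashInvariantFormClass.periodic_comp_ofComplex f one_mem_strictPeriods_SL)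
    (CuspFormClass.holo f) (ModularFormClass.bdd_at_infty f) z
  refine h.congr_fun fun n => ?_
  rw [smul_eq_mul, Function.Periodic.qParam, ← Complex.exp_nat_mul]
  congr 2
  push_cast
  ring

lemma summable_norm_coeff {y : ℝ} (hy : 0 < y) :
    Summable fun n : ℕ => ‖(qExpansion 1 f).coeff n‖ * Real.exp (-2 * π * n * y) := by
  have h := (hasSum_coeff f ⟨(0 : ℝ) + y * Complex.I, by simpa using hy⟩).summable.norm
  refine h.congr fun n => ?_
  rw [norm_mul, norm_cexp_two_pi]
  simp

lemma coeff_zero : (qExpansion 1 f).coeff 0 = 0 :=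
  CuspFormClass.qExpansion_coeff_zero f one_pos one_mem_strictPeriods_SL

lemma coeff_eq_integral (n : ℕ) {y : ℝ} (hy : 0 < y) :
    ∫ x in (0 : ℝ)..1, f (ofComplex (x + y * Complex.I)) * cexp (-(2 * π * Complex.I * n * (x + y * Complex.I)))
      = (qExpansion 1 f).coeff n := by
  rw [ModularFormClass.qExpansion_coeff_eq_intervalIntegral f one_pos one_mem_strictPeriods_SL n hy]
  simp only [ofReal_one, div_one, one_mul]
  refine intervalIntegral.integral_congr fun x _ => ?_
  rw [ofComplex_apply_of_im_pos (by simpa using hy), mul_comm]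
  congr 1
  rw [Function.Periodic.qParam, ← Complex.exp_nat_mul, one_div, ← Complex.exp_neg]
  congr 2
  push_cast
  ring

lemma continuous_comp_ofComplex {y : ℝ} (hy : 0 < y) :
    Continuous fun x : ℝ => f (ofComplex (x + y * Complex.I)) := by
  have h1 : Continuous fun x : ℝ => (⟨(x : ℂ) + y * Complex.I, by simpa using hy⟩ : ℍ) := by
    rw [UpperHalfPlane.isEmbedding_coe.continuous_iff]
    simp only [Function.comp_def]
    fun_prop
  have h2 : (fun x : ℝ => f (ofComplex (x + y * Complex.I))) = fun x : ℝ => f ⟨(x : ℂ) + y * Complex.I, by simpa using hy⟩ := by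
    ext x; rw [ofComplex_apply_of_im_pos (by simpa using hy)]
  rw [h2]
  exact (ModularFormClass.continuous f).comp h1

end coeff

/-! ### Integrability -/

/-- An integrability criterion on `ℍ`: the factor `(Im z)²` cancels the density of the hyperbolic
measure, and `(1 + |z|)^{-r}` is integrable over the plane for `r > 2`. -/
lemma integrable_of_norm_le {F : ℍ → ℂ} (hF : Continuous F) {C r : ℝ} (hr : 2 < r)
    (h : ∀ z : ℍ, ‖F z‖ ≤ C * (z.im ^ 2 * (1 + ‖(z : ℂ)‖) ^ (-r))) : Integrable F := by
  have h1 : Integrable fun z : ℍ => ((z.im ^ 2 * (1 + ‖(z : ℂ)‖) ^ (-r) : ℝ) : ℂ) := by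
    rw [integrable_iff_coe]
    have h2 : IntegrableOn (fun z : ℂ => (((1 + ‖z‖) ^ (-r) : ℝ) : ℂ)) {z : ℂ | 0 < z.im} :=
      (integrable_one_add_norm (by rw [Complex.finrank_real_complex]; exact_mod_cast hr)).ofReal.integrableOn
    refine h2.congr_fun (fun z hz => ?_) (measurableSet_lt measurable_const Complex.measurable_im)
    have hz : 0 < z.im := hz
    simp only
    rw [← UpperHalfPlane.coe_im, ofComplex_apply_of_im_pos hz, Complex.real_smul, ← ofReal_mul]
    congr 1
    have : z.im ^ 2 ≠ 0 := by positivity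
    field_simp
  refine (h1.const_mul (C : ℂ)).mono hF.aestronglyMeasurable (Eventually.of_forall fun z => ?_)
  refine (h z).trans ?_
  rw [← ofReal_mul, Complex.norm_real]
  exact le_abs_self _

/-- A linear lower bound for the distance of `conj z` to a point of the upper half-plane. -/
lemma one_add_norm_le_mul {z w : ℂ} (hz : 0 ≤ z.im) (hw : 0 < w.im) :
    1 + ‖z‖ ≤ (1 + (1 + ‖w‖) / w.im) * ‖conj z - w‖ := by
  have h1 : w.im ≤ ‖conj z - w‖ := by
    have := Complex.abs_im_le_norm (conj z - w)
    rw [Complex.sub_im, Complex.conj_im, abs_of_nonpos (by linarith)] at this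
    linarith
  have h2 : ‖z‖ ≤ ‖conj z - w‖ + ‖w‖ := by
    have := norm_add_le (conj z - w) w
    rwa [sub_add_cancel, Complex.norm_conj] at this
  have h3 : (1 + ‖w‖) ≤ (1 + ‖w‖) / w.im * ‖conj z - w‖ := by
    rw [div_mul_eq_mul_div, le_div_iff₀ hw]
    gcongr
  linarith

lemma im_le_norm_conj_sub {z w : ℂ} (hz : 0 ≤ z.im) (hw : 0 < w.im) : z.im ≤ ‖conj z - w‖ := by
  have := Complex.abs_im_le_norm (conj z - w)
  rw [Complex.sub_im, Complex.conj_im, abs_of_nonpos (by linarith)] at this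
  linarith

section reproducing

variable {k : ℕ} (f : CuspForm 𝒮ℒ (k : ℤ))

/-- The integrand of the reproducing integral over the upper half-plane. -/
def reproIntegrand (w : ℂ) (z : ℍ) : ℂ := f z * (z.im : ℂ) ^ k * ((conj (z : ℂ) - w) ^ k)⁻¹

lemma conj_sub_ne_zero {z w : ℂ} (hz : 0 < z.im) (hw : 0 < w.im) : conj z - w ≠ 0 := by
  intro h
  have := congrArg Complex.im h
  simp at this
  linarith

lemma integrable_reproIntegrand (hk : 6 ≤ k) (hk2 : Even k) {w : ℂ} (hw : 0 < w.im) :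
    Integrable (reproIntegrand f w) := by
  obtain ⟨j, hj⟩ := hk2
  obtain ⟨C, hC⟩ := CuspFormClass.exists_bound f
  set M := 1 + (1 + ‖w‖) / w.im with hM
  have hM0 : 0 < M := by positivity
  refine integrable_of_norm_le (C := C * M ^ (j + 2)) (r := ((j + 2 : ℕ) : ℝ)) ?_
    (by push_cast; have : (3 : ℝ) ≤ j := by exact_mod_cast (by omega : 3 ≤ j)
        linarith) fun z => ?_
  · unfold reproIntegrand
    refine (((ModularFormClass.continuous f).mul ?_)).mul ?_
    · exact (continuous_ofReal.comp UpperHalfPlane.continuous_im).pow k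
    · refine Continuous.inv₀ ?_ fun z => pow_ne_zero _ (conj_sub_ne_zero z.im_pos hw)
      exact ((continuous_conj.comp UpperHalfPlane.continuous_coe).sub continuous_const).pow k
  · have hy := z.im_pos
    have hC' : ‖f z‖ ≤ C / z.im ^ j := by
      have := hC z
      have hk' : (((k : ℤ) : ℝ) / 2 : ℝ) = (j : ℝ) := by rw [hj]; push_cast; ring
      rwa [hk', Real.rpow_natCast] at this
    have hC0 : 0 ≤ C := by
      have := (norm_nonneg _).trans hC'
      by_contra h
      push Not at h
      have : C / z.im ^ j < 0 := div_neg_of_neg_of_pos h (by positivity)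
      linarith
    set D := ‖conj (z : ℂ) - w‖ with hD
    have hD1 : z.im ≤ D := im_le_norm_conj_sub z.im_pos.le hw
    have hD0 : 0 < D := hy.trans_le hD1
    have hD2 : 1 + ‖(z : ℂ)‖ ≤ M * D := one_add_norm_le_mul z.im_pos.le hw
    rw [reproIntegrand, norm_mul, norm_mul, norm_inv, norm_pow, norm_pow, Complex.norm_real,
      Real.norm_of_nonneg hy.le, Real.rpow_neg (by positivity), Real.rpow_natCast]
    -- Here `k = 2 j` and `|f| ≪ y^{-j}`. Of the `2 j` factors `D⁻¹`, `j - 2` absorb powers of `y`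
    -- and `j + 2 > 2` give integrability.
    have e1 : z.im ^ j ≤ z.im ^ 2 * D ^ (j - 2) := by
      have : z.im ^ j = z.im ^ 2 * z.im ^ (j - 2) := by rw [← pow_add]; congr 1; omega
      rw [this]; gcongr
    have e2 : D ^ k = D ^ (j - 2) * D ^ (j + 2) := by rw [← pow_add]; congr 1; omega
    have e3 : (D ^ (j + 2))⁻¹ ≤ M ^ (j + 2) * ((1 + ‖(z : ℂ)‖) ^ (j + 2))⁻¹ := by
      rw [← div_eq_mul_inv, le_div_iff₀ (by positivity), inv_mul_le_iff₀ (by positivity), ← mul_pow]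
      rw [mul_comm D M]
      gcongr
    calc ‖f z‖ * z.im ^ k * (D ^ k)⁻¹ ≤ C / z.im ^ j * z.im ^ k * (D ^ k)⁻¹ := by gcongr
      _ = C * z.im ^ j * (D ^ k)⁻¹ := by
          have : z.im ^ k = z.im ^ j * z.im ^ j := by rw [← pow_add, ← hj]
          rw [this]; field_simp
      _ ≤ C * (z.im ^ 2 * D ^ (j - 2)) * (D ^ (j - 2) * D ^ (j + 2))⁻¹ := by rw [e2]; gcongr
      _ = C * z.im ^ 2 * (D ^ (j + 2))⁻¹ := by field_simp
      _ ≤ C * z.im ^ 2 * (M ^ (j + 2) * ((1 + ‖(z : ℂ)‖) ^ (j + 2))⁻¹) := by gcongr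
      _ = _ := by ring

lemma exists_bound_horizontal {y : ℝ} (hy : 0 < y) :
    ∃ B, 0 ≤ B ∧ ∀ x : ℝ, ‖f (ofComplex (x + y * Complex.I))‖ ≤ B := by
  obtain ⟨C, hC⟩ := CuspFormClass.exists_bound f
  refine ⟨max 0 (C / y ^ (((k : ℤ) : ℝ) / 2)), le_max_left _ _, fun x => ?_⟩
  have := hC (ofComplex (x + y * Complex.I))
  rw [ofComplex_mk_im x hy] at this
  exact this.trans (le_max_right _ _)

lemma apply_ofComplex_add_int (x : ℝ) (y : ℝ) (b : ℤ) :
    f (ofComplex (((x + b : ℝ) : ℂ) + y * Complex.I)) = f (ofComplex (x + y * Complex.I)) := by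
  have h := (SlashInvariantFormClass.periodic_comp_ofComplex f one_mem_strictPeriods_SL).int_mul b
    ((x : ℂ) + y * Complex.I)
  simp only [Function.comp_apply, ofReal_one, mul_one] at h
  rw [← h]
  congr 2
  push_cast; ring

/-- The Lipschitz formula in the form needed for even weight. -/
lemma lipschitz_formula (hk : 2 ≤ k) (hk2 : Even k) {τ : ℂ} (hτ : 0 < τ.im) :
    ∑' b : ℤ, ((τ + b) ^ k)⁻¹ = (2 * π * Complex.I) ^ k / (k - 1)! *
      ∑' n : ℕ, (n : ℂ) ^ (k - 1) * cexp (2 * π * Complex.I * n * τ) := by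
  have h := EisensteinSeries.qExpansion_identity (k := k - 1) (by omega) ⟨τ, hτ⟩
  rw [Nat.sub_add_cancel (by omega : 1 ≤ k)] at h
  simp only [one_div] at h
  have e1 : (-2 * π * Complex.I : ℂ) ^ k = (2 * π * Complex.I) ^ k := by
    rw [← hk2.neg_pow (2 * π * Complex.I : ℂ)]; congr 1; ring
  rw [e1] at h
  refine h.trans ?_
  congr 1
  refine tsum_congr fun n => ?_
  rw [← Complex.exp_nat_mul]
  congr 2
  ring

lemma summable_pow_mul_exp (j : ℕ) {v : ℝ} (hv : 0 < v) :
    Summable fun n : ℕ => (n : ℝ) ^ j * Real.exp (-2 * π * n * v) := by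
  have := Real.summable_pow_mul_exp_neg_nat_mul j (r := 2 * π * v) (by positivity)
  refine this.congr fun n => ?_
  congr 2; ring

/-- The integral over a horizontal line: the integral over `ℝ` is folded to `[0, 1]` by the
periodicity of `f`, the resulting sum over translates is expanded by the Lipschitz formula, and the
integral against each additive character is a Fourier coefficient of `f`. -/
lemma integral_horizontal (hk : 2 ≤ k) (hk2 : Even k) {w : ℂ} (hw : 0 < w.im) {y : ℝ} (hy : 0 < y) :
    ∫ x : ℝ, f (ofComplex (x + y * Complex.I)) * ((conj ((x : ℂ) + y * Complex.I) - w) ^ k)⁻¹ =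
      (2 * π * Complex.I) ^ k / (k - 1)! * ∑' n : ℕ, (n : ℂ) ^ (k - 1) *
        ((qExpansion 1 f).coeff n * cexp (2 * π * Complex.I * n * w)) * Real.exp (-(4 * π * n) * y) := by
  obtain ⟨B, hB0, hB⟩ := exists_bound_horizontal f hy
  set g : ℝ → ℂ := fun x => f (ofComplex (x + y * Complex.I)) * ((conj ((x : ℂ) + y * Complex.I) - w) ^ k)⁻¹ with hg
  have hconj : ∀ x : ℝ, conj ((x : ℂ) + y * Complex.I) = x - y * Complex.I := by
    intro x; simp [sub_eq_add_neg]
  have hne : ∀ x : ℝ, conj ((x : ℂ) + y * Complex.I) - w ≠ 0 := fun x =>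
    conj_sub_ne_zero (by simpa using hy) hw
  have hgc : Continuous g := by
    refine (continuous_comp_ofComplex f hy).mul (Continuous.inv₀ ?_ fun x => pow_ne_zero _ (hne x))
    simp only [hconj]
    fun_prop
  have hgi : Integrable g := by
    set M := 1 + (1 + ‖w‖) / w.im with hM
    have hM0 : 0 < M := by positivity
    have h1 : Integrable fun x : ℝ => B * M ^ k * (1 + ‖x‖) ^ (-(k : ℝ)) :=
      (integrable_one_add_norm (by simp; omega)).const_mul _
    refine h1.mono' hgc.aestronglyMeasurable (Eventually.of_forall fun x => ?_)
    have h2 := one_add_norm_le_mul (z := (x : ℂ) + y * Complex.I) (by simpa using hy.le) hw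
    have h3 : ‖x‖ ≤ ‖(x : ℂ) + y * Complex.I‖ := by
      have := Complex.abs_re_le_norm ((x : ℂ) + y * Complex.I)
      simpa using this
    set D := ‖conj ((x : ℂ) + y * Complex.I) - w‖
    have hD0 : 0 < D := norm_pos_iff.mpr (hne x)
    rw [hg]
    simp only
    rw [norm_mul, norm_inv, norm_pow, Real.rpow_neg (by positivity), Real.rpow_natCast, mul_assoc]
    refine mul_le_mul (hB x) ?_ (by positivity) hB0
    rw [← div_eq_mul_inv, le_div_iff₀ (by positivity), inv_mul_le_iff₀ (by positivity), ← mul_pow]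
    rw [mul_comm D M]
    gcongr
    linarith
  have hs := hgi.hasSum_intervalIntegral_comp_add_int
  have hsn := hgi.norm.hasSum_intervalIntegral_comp_add_int
  rw [← hs.tsum_eq]
  have hperiod : ∀ (x : ℝ) (b : ℤ), g (x + b) = f (ofComplex (x + y * Complex.I)) *
      (((x : ℂ) + b - y * Complex.I - w) ^ k)⁻¹ := by
    intro x b
    simp only [hg]
    rw [hconj, apply_ofComplex_add_int f x y b]
    push_cast; ring_nf
  simp_rw [intervalIntegral.integral_of_le zero_le_one] at hsn ⊢
  rw [integral_tsum_of_summable_integral_norm (F := fun (b : ℤ) (x : ℝ) => g (x + b))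
    (fun b => ((hgc.comp (continuous_add_const _)).continuousOn.integrableOn_Icc).mono_set
      Set.Ioc_subset_Icc_self) hsn.summable]
  have h1 : ∀ x : ℝ, ∑' b : ℤ, g (x + b) = ∑' n : ℕ, (2 * π * Complex.I) ^ k / (k - 1)! *
      ((n : ℂ) ^ (k - 1) * cexp (2 * π * Complex.I * n * (w + y * Complex.I)) *
        (f (ofComplex (x + y * Complex.I)) * cexp (-(2 * π * Complex.I * n * x)))) := by
    intro x
    simp_rw [hperiod, tsum_mul_left]
    have hτ : 0 < (w + y * Complex.I - x).im := by simp; positivity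
    have h2 := lipschitz_formula hk hk2 hτ
    have h3 : ∑' b : ℤ, (((x : ℂ) + b - y * Complex.I - w) ^ k)⁻¹ = ∑' b : ℤ, ((w + y * Complex.I - x + b) ^ k)⁻¹ := by
      rw [← (Equiv.neg ℤ).tsum_eq]
      refine tsum_congr fun b => ?_
      rw [← hk2.neg_pow]
      congr 2
      simp only [Equiv.neg_apply]
      push_cast; ring
    rw [h3, h2, mul_left_comm, ← tsum_mul_left]
    congr 1
    refine tsum_congr fun n => ?_
    have : cexp (2 * π * Complex.I * n * (w + y * Complex.I - x)) =
        cexp (2 * π * Complex.I * n * (w + y * Complex.I)) * cexp (-(2 * π * Complex.I * n * x)) := by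
      rw [← Complex.exp_add]; congr 1; ring
    rw [this]; ring
  simp_rw [h1]
  have hcn : ∀ n : ℕ, Continuous fun x : ℝ => (2 * π * Complex.I) ^ k / (k - 1)! *
      ((n : ℂ) ^ (k - 1) * cexp (2 * π * Complex.I * n * (w + y * Complex.I)) *
        (f (ofComplex (x + y * Complex.I)) * cexp (-(2 * π * Complex.I * n * x)))) := by
    intro n
    exact continuous_const.mul (continuous_const.mul ((continuous_comp_ofComplex f hy).mul
      (by fun_prop)))
  rw [← integral_tsum_of_summable_integral_norm]
  · rw [← tsum_mul_left]
    refine tsum_congr fun n => ?_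
    rw [integral_const_mul, integral_const_mul, ← intervalIntegral.integral_of_le zero_le_one]
    congr 1
    have h4 := coeff_eq_integral f n hy
    have h5 : ∀ x : ℝ, f (ofComplex (x + y * Complex.I)) * cexp (-(2 * π * Complex.I * n * (x + y * Complex.I)))
        = cexp (-(2 * π * Complex.I * n * (y * Complex.I))) *
          (f (ofComplex (x + y * Complex.I)) * cexp (-(2 * π * Complex.I * n * x))) := by
      intro x
      rw [mul_left_comm, ← Complex.exp_add]; congr 2; ring
    simp_rw [h5] at h4
    rw [intervalIntegral.integral_const_mul] at h4
    rw [← h4]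
    have h6 : cexp (2 * π * Complex.I * n * (w + y * Complex.I)) = cexp (2 * π * Complex.I * n * w) *
        (cexp (-(2 * π * Complex.I * n * (y * Complex.I))) * Real.exp (-(4 * π * n) * y)) := by
      rw [Complex.ofReal_exp, ← Complex.exp_add, ← Complex.exp_add]
      congr 1
      push_cast
      linear_combination (4 * π * n * y) * I_mul_I
    rw [h6]; ring
  · intro n
    exact ((hcn n).continuousOn.integrableOn_Icc).mono_set Set.Ioc_subset_Icc_self
  · have hv : 0 < w.im + y := by positivity
    refine Summable.of_nonneg_of_le (fun n => integral_nonneg fun x => norm_nonneg _) (fun n => ?_)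
      (((summable_pow_mul_exp (k - 1) hv).mul_left (‖((2 * π * Complex.I) ^ k / (k - 1)! : ℂ)‖ * B)))
    have hb : ∀ x : ℝ, ‖(2 * π * Complex.I) ^ k / (k - 1)! *
      ((n : ℂ) ^ (k - 1) * cexp (2 * π * Complex.I * n * (w + y * Complex.I)) *
        (f (ofComplex (x + y * Complex.I)) * cexp (-(2 * π * Complex.I * n * x))))‖ ≤
        ‖((2 * π * Complex.I) ^ k / (k - 1)! : ℂ)‖ * B * ((n : ℝ) ^ (k - 1) *
          Real.exp (-2 * π * n * (w.im + y))) := by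
      intro x
      have e1 : ‖cexp (-(2 * π * Complex.I * n * x))‖ = 1 := by
        have : (-(2 * π * Complex.I * n * x) : ℂ) = ((-(2 * π * n * x) : ℝ) : ℂ) * Complex.I := by push_cast; ring
        rw [this, Complex.norm_exp_ofReal_mul_I]
      rw [norm_mul, norm_mul, norm_mul, norm_mul (f _), e1, norm_cexp_two_pi, norm_pow,
        Complex.norm_natCast]
      have : (w + y * Complex.I).im = w.im + y := by simp
      rw [this]
      calc _ ≤ ‖((2 * π * Complex.I) ^ k / (k - 1)! : ℂ)‖ * ((n : ℝ) ^ (k - 1) *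
          Real.exp (-2 * π * n * (w.im + y)) * (B * 1)) := by gcongr; exact hB x
        _ = _ := by ring
    calc _ ≤ ∫ x in Set.Ioc (0 : ℝ) 1, ‖((2 * π * Complex.I) ^ k / (k - 1)! : ℂ)‖ * B * ((n : ℝ) ^ (k - 1) *
          Real.exp (-2 * π * n * (w.im + y))) := by
          refine integral_mono ?_ ?_ hb
          · exact (((hcn n).norm).continuousOn.integrableOn_Icc).mono_set Set.Ioc_subset_Icc_self
          · exact integrable_const _
      _ = _ := by simp

/-- The constant in the reproducing formula. -/
def reproConst (k : ℕ) : ℂ := (2 * π * Complex.I) ^ k / (k - 1)! * ((k - 2)! / (4 * π) ^ (k - 1))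

/-- The reproducing formula on the upper half-plane: after the horizontal integration, the vertical
integral is a Mellin transform at `k - 1`, taken term by term. -/
lemma integral_reproIntegrand (hk : 6 ≤ k) (hk2 : Even k) (w : ℍ) :
    ∫ z, reproIntegrand f w z = reproConst k * f w := by
  have hw := w.im_pos
  rw [integral_eq_iterated (integrable_reproIntegrand f hk hk2 hw)]
  set b : ℕ → ℂ := fun n => (n : ℂ) ^ (k - 1) *
        ((qExpansion 1 f).coeff n * cexp (2 * π * Complex.I * n * w)) with hb
  have hk1 : (k : ℂ) - 1 = ((k - 1 : ℕ) : ℂ) := by push_cast [Nat.cast_sub (by omega : 1 ≤ k)]; ring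
  have hinner : ∀ y ∈ Set.Ioi (0 : ℝ), ((y ^ 2)⁻¹ : ℝ) • ∫ x : ℝ, reproIntegrand f w (ofComplex (x + y * Complex.I))
      = (y : ℂ) ^ (((k : ℂ) - 1) - 1) • ((2 * π * Complex.I) ^ k / (k - 1)! *
          ∑' n : ℕ, b n * Real.exp (-(4 * π * n) * y)) := by
    intro y hy
    have hy : 0 < y := hy
    rw [← integral_horizontal f (by omega) hk2 hw hy]
    have : ∀ x : ℝ, reproIntegrand f w (ofComplex (x + y * Complex.I)) = (y : ℂ) ^ k *
        (f (ofComplex (x + y * Complex.I)) * ((conj ((x : ℂ) + y * Complex.I) - w) ^ k)⁻¹) := by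
      intro x
      rw [reproIntegrand, ofComplex_mk_im x hy, coe_ofComplex_mk x hy]; ring
    simp_rw [this]
    rw [integral_const_mul, ← smul_eq_mul ((y : ℂ) ^ k), Complex.real_smul, smul_eq_mul, ← mul_assoc]
    rw [smul_eq_mul]
    congr 1
    have hyc : (y : ℂ) ≠ 0 := by exact_mod_cast hy.ne'
    have h2 : (k : ℂ) - 1 - 1 = ((k - 2 : ℕ) : ℂ) := by
      push_cast [Nat.cast_sub (by omega : 2 ≤ k)]; ring
    rw [h2, Complex.cpow_natCast]
    have h3 : (y : ℂ) ^ k = y ^ 2 * y ^ (k - 2) := by rw [← pow_add]; congr 1; omega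
    rw [h3]; push_cast; field_simp
  rw [setIntegral_congr_fun measurableSet_Ioi hinner]
  have hsum : Summable fun n : ℕ => ‖b n‖ / (4 * π * n) ^ ((k : ℂ) - 1).re := by
    have h1 := (summable_norm_coeff f hw).mul_left (((4 * π) ^ (k - 1))⁻¹)
    refine h1.congr fun n => ?_
    rw [hk1, Complex.natCast_re, Real.rpow_natCast, hb]
    simp only
    rcases Nat.eq_zero_or_pos n with rfl | hn
    · simp [coeff_zero]
    · have : (n : ℝ) ≠ 0 := by positivity
      rw [norm_mul, norm_mul, norm_pow, Complex.norm_natCast, norm_cexp_two_pi, mul_pow]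
      rw [UpperHalfPlane.coe_im, mul_pow, mul_pow]
      field_simp
  have hsumm : ∀ t ∈ Set.Ioi (0 : ℝ), Summable fun n : ℕ => b n * Real.exp (-(4 * π * n) * t) := by
    intro t ht
    have ht : 0 < t := ht
    have h1 : Summable fun n : ℕ => ‖b n‖ := by
      obtain ⟨C, hC⟩ : ∃ C : ℝ, ∀ n : ℕ, (n : ℝ) ^ (k - 1) * Real.exp (-2 * π * n * (w.im / 2)) ≤ C := by
        obtain ⟨C, hC⟩ := (summable_pow_mul_exp (k - 1) (half_pos hw)).tendsto_atTop_zero.bddAbove_range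
        exact ⟨C, fun n => hC ⟨n, rfl⟩⟩
      refine Summable.of_nonneg_of_le (fun _ => norm_nonneg _) (fun n => ?_)
        ((summable_norm_coeff f (half_pos hw)).mul_left C)
      rw [hb]
      simp only
      rw [norm_mul, norm_mul, norm_pow, Complex.norm_natCast, norm_cexp_two_pi, UpperHalfPlane.coe_im]
      have : Real.exp (-2 * π * n * w.im) = Real.exp (-2 * π * n * (w.im / 2)) *
          Real.exp (-2 * π * n * (w.im / 2)) := by rw [← Real.exp_add]; congr 1; ring
      rw [this]
      calc _ = (n : ℝ) ^ (k - 1) * Real.exp (-2 * π * n * (w.im / 2)) *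
            (‖(qExpansion 1 f).coeff n‖ * Real.exp (-2 * π * n * (w.im / 2))) := by ring
        _ ≤ _ := by gcongr; exact hC n
    refine Summable.of_norm_bounded h1 fun n => ?_
    rw [norm_mul, Complex.norm_real, Real.norm_of_nonneg (Real.exp_nonneg _)]
    refine mul_le_of_le_one_right (norm_nonneg _) (Real.exp_le_one_iff.mpr ?_)
    have : 0 ≤ 4 * π * n * t := by positivity
    linarith
  have hmel := hasSum_mellin (a := b) (p := fun n : ℕ => 4 * π * n) (s := (k : ℂ) - 1)
    (F := fun t => ∑' n : ℕ, b n * Real.exp (-(4 * π * n) * t)) (fun n => by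
      rcases Nat.eq_zero_or_pos n with rfl | hn
      · left; simp [hb, coeff_zero]
      · right; positivity) (by rw [hk1, Complex.natCast_re]; exact_mod_cast (by omega : 0 < k - 1))
    (fun t ht => (hsumm t ht).hasSum) hsum
  have hmel2 : ∫ y in Set.Ioi (0 : ℝ), (y : ℂ) ^ (((k : ℂ) - 1) - 1) • ((2 * π * Complex.I) ^ k / (k - 1)! *
          ∑' n : ℕ, b n * Real.exp (-(4 * π * n) * y)) = (2 * π * Complex.I) ^ k / (k - 1)! *
        mellin (fun t => ∑' n : ℕ, b n * Real.exp (-(4 * π * n) * t)) ((k : ℂ) - 1) := by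
    rw [mellin, ← integral_const_mul]
    refine setIntegral_congr_fun measurableSet_Ioi fun t _ => ?_
    simp only [smul_eq_mul]
    ring
  rw [hmel2, ← hmel.tsum_eq, reproConst, mul_assoc _ _ (f w)]
  congr 1
  rw [← (hasSum_coeff f w).tsum_eq, ← tsum_mul_left]
  refine tsum_congr fun n => ?_
  have hG : Complex.Gamma ((k : ℂ) - 1) = (k - 2)! := by
    have : (k : ℂ) - 1 = ((k - 2 : ℕ) : ℂ) + 1 := by
      push_cast [Nat.cast_sub (by omega : 2 ≤ k)]; ring
    rw [this, Complex.Gamma_nat_eq_factorial]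
  rw [hG, hk1, Complex.cpow_natCast, hb]
  simp only
  rcases Nat.eq_zero_or_pos n with rfl | hn
  · simp [coeff_zero]
  · have : (n : ℂ) ≠ 0 := by exact_mod_cast hn.ne'
    have hpi : (π : ℂ) ≠ 0 := by exact_mod_cast Real.pi_ne_zero
    push_cast
    rw [mul_pow]
    field_simp

lemma slash_apply_SL (γ : SL(2, ℤ)) (z : ℍ) : f (γ • z) = denom γ z ^ k * f z := by
  have h := congrFun (SlashInvariantFormClass.slash_action_eq f
    (γ := Matrix.SpecialLinearGroup.mapGL ℝ γ) ⟨γ, rfl⟩) z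
  have h2 : ((f : ℍ → ℂ) ∣[(k : ℤ)] γ) z = f z := h
  rw [ModularForm.SL_slash_apply] at h2
  rw [← h2]
  have := denom_ne_zero γ z
  simp only [zpow_neg, zpow_natCast]
  field_simp

/-- The **reproducing property** of the kernel with respect to the Petersson product: the sum over
the matrices of determinant `1` unfolds the integral over `𝒟` to the one over `ℍ`. -/
lemma integral_petersson_kernel (hk : 8 ≤ k) (hk2 : Even k) (w : ℍ) :
    ∫ z in (𝒟 : Set ℍ), petersson k (fun z : ℍ => kernel k 1 z (-conj (w : ℂ))) f z
      = 2 * reproConst k * f w := by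
  rw [mul_assoc, ← integral_reproIntegrand f (by omega) hk2 w,
    ← integral_fd_tsum_smul (integrable_reproIntegrand f (by omega) hk2 w.im_pos)]
  refine integral_congr_ae (Eventually.of_forall fun z => ?_)
  simp only [petersson]
  rw [kernel, Complex.conj_tsum, ← tsum_mul_right, ← tsum_mul_right]
  refine tsum_congr fun γ => ?_
  change conj ((kernelForm γ.1 z (-conj (w : ℂ)) ^ k)⁻¹) * f z * (z.im : ℂ) ^ (k : ℤ) =
    reproIntegrand f w ((show SL(2, ℤ) from γ) • z)
  set γ' : SL(2, ℤ) := γ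
  have hden : denom γ' z = (γ'.1 1 0 : ℂ) * z + γ'.1 1 1 := by simp [ModularGroup.denom_apply]
  have hne : denom γ' z ≠ 0 := denom_ne_zero γ' z
  have hz : ((γ' • z : ℍ) : ℂ) * denom γ' z = γ'.1 0 0 * z + γ'.1 0 1 := by
    rw [hden] at hne
    rw [UpperHalfPlane.specialLinearGroup_apply, hden]
    simp only [algebraMap_int_eq, eq_intCast, ofReal_intCast]
    exact div_mul_cancel₀ _ hne
  have hE : kernelForm γ'.1 z (-conj (w : ℂ)) = denom γ' z * (((γ' • z : ℍ) : ℂ) - conj (w : ℂ)) := by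
    rw [kernelForm, ← hden, ← hz]; ring
  change conj ((kernelForm γ'.1 z (-conj (w : ℂ)) ^ k)⁻¹) * f z * (z.im : ℂ) ^ (k : ℤ) = _
  rw [hE, reproIntegrand, slash_apply_SL, zpow_natCast]
  have him : ((γ' • z : ℍ).im : ℂ) = z.im / (denom γ' z * conj (denom γ' z)) := by
    rw [Complex.mul_conj, ← Complex.ofReal_div, ModularGroup.im_smul_eq_div_normSq]
  rw [him]
  have hne2 : conj (denom γ' z) ≠ 0 := (map_ne_zero _).mpr hne
  simp only [map_inv₀, map_pow, map_mul, map_sub, Complex.conj_conj, mul_pow, div_pow, mul_inv]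
  field_simp

end reproducing

/-! ### The Petersson inner product -/

lemma volume_fd_lt_top : volume (𝒟 : Set ℍ) < ⊤ := by
  have hS : MeasurableSet (UpperHalfPlane.coe '' (𝒟 : Set ℍ)) :=
    measurableEmbedding_coe.measurableSet_image.mpr measurableSet_fd
  have h : Integrable ((𝒟 : Set ℍ).indicator fun _ => (1 : ℂ)) := by
    rw [integrable_iff_coe]
    have h1 : Integrable (fun p : ℝ × ℝ => (Set.Icc (-1 / 2 : ℝ) (1 / 2)).indicator
        (fun _ => (1 : ℝ)) p.1 * (Set.Ioi (1 / 2 : ℝ)).indicator (fun y => y ^ (-2 : ℝ)) p.2)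
        (volume.prod volume) := by
      refine Integrable.mul_prod ?_ ?_
      · rw [integrable_indicator_iff measurableSet_Icc]
        exact integrableOn_const (by simp) (by simp)
      · rw [integrable_indicator_iff measurableSet_Ioi]
        exact integrableOn_Ioi_rpow_of_lt (by norm_num) (by norm_num)
    have h2 := (Complex.volume_preserving_equiv_real_prod.integrable_comp_emb
      Complex.measurableEquivRealProd.measurableEmbedding).mpr h1
    have h3 : IntegrableOn ((UpperHalfPlane.coe '' (𝒟 : Set ℍ)).indicator
        fun z : ℂ => (((z.im ^ 2)⁻¹ : ℝ) : ℂ)) {z : ℂ | 0 < z.im} := by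
      refine (h2.integrableOn).mono' ?_ (Eventually.of_forall fun z => ?_)
      · refine (Measurable.indicator ?_ hS).aestronglyMeasurable
        exact Complex.measurable_ofReal.comp ((Complex.measurable_im.pow_const 2).inv)
      · by_cases hz : z ∈ UpperHalfPlane.coe '' (𝒟 : Set ℍ)
        · rw [Set.indicator_of_mem hz]
          obtain ⟨w, hw, rfl⟩ := hz
          have him : 1 / 2 < w.im := by
            have := ModularGroup.three_le_four_mul_im_sq_of_mem_fd hw
            nlinarith [w.im_pos]
          have hre := abs_le.mp hw.2
          have e1 : (w : ℂ).re ∈ Set.Icc (-1 / 2 : ℝ) (1 / 2) := by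
            rw [UpperHalfPlane.coe_re]; constructor <;> linarith [hre.1, hre.2]
          have e2 : (w : ℂ).im ∈ Set.Ioi (1 / 2 : ℝ) := by rw [UpperHalfPlane.coe_im]; exact him
          simp only [Function.comp_apply, Complex.measurableEquivRealProd_apply]
          rw [Set.indicator_of_mem e1, Set.indicator_of_mem e2, one_mul, Complex.norm_real,
            Real.norm_of_nonneg (by positivity), Real.rpow_neg (by rw [UpperHalfPlane.coe_im]; exact w.im_pos.le)]
          norm_num
        · rw [Set.indicator_of_notMem hz, norm_zero]
          refine mul_nonneg (Set.indicator_nonneg (fun _ _ => zero_le_one) _)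
            (Set.indicator_nonneg (fun y hy => ?_) _)
          have hy : (1 / 2 : ℝ) < y := hy
          have : 0 < y := by linarith
          positivity
    refine h3.congr_fun (fun z hz => ?_) (measurableSet_lt measurable_const Complex.measurable_im)
    have hz : 0 < z.im := hz
    rw [ofComplex_apply_of_im_pos hz]
    have hiff : z ∈ UpperHalfPlane.coe '' (𝒟 : Set ℍ) ↔ (⟨z, hz⟩ : ℍ) ∈ (𝒟 : Set ℍ) :=
      ⟨by rintro ⟨w, hw, rfl⟩; exact hw, fun h => ⟨_, h, rfl⟩⟩
    by_cases h : (⟨z, hz⟩ : ℍ) ∈ (𝒟 : Set ℍ)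
    · rw [Set.indicator_of_mem (hiff.mpr h), Set.indicator_of_mem h]; simp
    · rw [Set.indicator_of_notMem (fun h' => h (hiff.mp h')), Set.indicator_of_notMem h]; simp
  rw [integrable_indicator_iff measurableSet_fd, integrableOn_const_iff (by simp)] at h
  simpa using h

section

variable {k : ℕ}

lemma integrableOn_petersson (f g : CuspForm 𝒮ℒ (k : ℤ)) :
    IntegrableOn (petersson k f g) (𝒟 : Set ℍ) := by
  obtain ⟨C, hC⟩ := CuspFormClass.petersson_bounded_left (k : ℤ) 𝒮ℒ f g
  exact Measure.integrableOn_of_bounded volume_fd_lt_top.ne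
    (petersson_continuous k (ModularFormClass.continuous f)
      (ModularFormClass.continuous g)).aestronglyMeasurable (Eventually.of_forall hC)

/-- The Petersson inner product of level one, conjugate linear in the first variable. -/
def peterssonProd (f g : CuspForm 𝒮ℒ (k : ℤ)) : ℂ := ∫ z in (𝒟 : Set ℍ), petersson k f g z

lemma conj_peterssonProd (f g : CuspForm 𝒮ℒ (k : ℤ)) :
    conj (peterssonProd f g) = peterssonProd g f := by
  rw [peterssonProd, peterssonProd, ← integral_conj]
  exact integral_congr_ae (Eventually.of_forall fun z => (petersson_symm k f g z).symm)

lemma peterssonProd_add_left (f g h : CuspForm 𝒮ℒ (k : ℤ)) :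
    peterssonProd (f + g) h = peterssonProd f h + peterssonProd g h := by
  rw [peterssonProd, peterssonProd, peterssonProd,
    ← integral_add (integrableOn_petersson f h) (integrableOn_petersson g h)]
  refine integral_congr_ae (Eventually.of_forall fun z => ?_)
  simp [petersson]; ring

lemma peterssonProd_smul_left (f g : CuspForm 𝒮ℒ (k : ℤ)) (r : ℂ) :
    peterssonProd (r • f) g = conj r * peterssonProd f g := by
  rw [peterssonProd, peterssonProd, ← integral_const_mul]
  refine integral_congr_ae (Eventually.of_forall fun z => ?_)
  simp [petersson]; ring

lemma petersson_self (f : CuspForm 𝒮ℒ (k : ℤ)) (z : ℍ) :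
    petersson k f f z = ((‖f z‖ ^ 2 * z.im ^ k : ℝ) : ℂ) := by
  rw [petersson, mul_comm (conj _), Complex.mul_conj, Complex.normSq_eq_norm_sq]
  push_cast
  rw [zpow_natCast]

lemma peterssonProd_self (f : CuspForm 𝒮ℒ (k : ℤ)) :
    peterssonProd f f = ((∫ z in (𝒟 : Set ℍ), ‖f z‖ ^ 2 * z.im ^ k : ℝ) : ℂ) := by
  rw [← integral_complex_ofReal]
  exact integral_congr_ae (Eventually.of_forall fun z => petersson_self f z)

lemma re_peterssonProd_self_nonneg (f : CuspForm 𝒮ℒ (k : ℤ)) : 0 ≤ (peterssonProd f f).re := by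
  rw [peterssonProd_self, Complex.ofReal_re]
  refine integral_nonneg fun z => ?_
  have := z.im_pos
  simp only [Pi.zero_apply]
  positivity

lemma neg_conj_im_pos (w : ℍ) : 0 < (-conj (w : ℂ)).im := by
  simpa using w.im_pos

/-- The cusp form representing `f ↦ f w` up to a scalar under the Petersson product. -/
def reproKernel (hk : 9 ≤ k) (w : ℍ) : CuspForm 𝒮ℒ (k : ℤ) :=
  kernelForm₁ hk one_pos (neg_conj_im_pos w)

lemma reproKernel_apply (hk : 9 ≤ k) (w z : ℍ) :
    reproKernel hk w z = kernel k 1 z (-conj (w : ℂ)) := rfl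

lemma peterssonProd_reproKernel (hk : 9 ≤ k) (hk2 : Even k) (w : ℍ) (f : CuspForm 𝒮ℒ (k : ℤ)) :
    peterssonProd (reproKernel hk w) f = 2 * reproConst k * f w :=
  integral_petersson_kernel f (by omega) hk2 w

lemma reproConst_ne_zero (k : ℕ) : reproConst k ≠ 0 := by
  have : (π : ℂ) ≠ 0 := by exact_mod_cast Real.pi_ne_zero
  rw [reproConst]
  have h1 : ((k - 1)! : ℂ) ≠ 0 := by exact_mod_cast (Nat.factorial_pos _).ne'
  have h2 : ((k - 2)! : ℂ) ≠ 0 := by exact_mod_cast (Nat.factorial_pos _).ne'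
  simp [this, h1, h2]

lemma conj_reproConst (hk2 : Even k) : conj (reproConst k) = reproConst k := by
  obtain ⟨j, rfl⟩ := hk2
  simp only [reproConst, map_mul, map_div₀, map_pow, Complex.conj_I, Complex.conj_ofReal,
    Complex.conj_natCast, map_ofNat]
  congr 2
  rw [← two_mul, pow_mul, pow_mul]
  congr 1
  ring

/-- If `⟨f, f⟩ = 0` then `f` vanishes almost everywhere on `𝒟`, so it is orthogonal to all
reproducing kernels, and hence vanishes at every point. -/
lemma eq_zero_of_peterssonProd_self (hk : 9 ≤ k) (hk2 : Even k) {f : CuspForm 𝒮ℒ (k : ℤ)}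
    (hf : peterssonProd f f = 0) : f = 0 := by
  rw [peterssonProd_self, Complex.ofReal_eq_zero, setIntegral_eq_zero_iff_of_nonneg_ae] at hf
  · ext w
    have h1 : peterssonProd (reproKernel hk w) f = 0 := by
      refine integral_eq_zero_of_ae ?_
      filter_upwards [hf] with z hz
      have hz' : ‖f z‖ ^ 2 * z.im ^ k = 0 := hz
      have h2 : f z = 0 := by
        have := z.im_pos
        rcases mul_eq_zero.mp hz' with h | h
        · simpa using h
        · exact absurd h (by positivity)
      simp [petersson, h2]
    rw [peterssonProd_reproKernel hk hk2] at h1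
    simpa [reproConst_ne_zero] using h1
  · refine Eventually.of_forall fun z => ?_
    have := z.im_pos
    simp only [Pi.zero_apply]
    positivity
  · have := (integrableOn_petersson f f).re
    refine this.congr (Eventually.of_forall fun z => ?_)
    simp only [petersson_self f z]
    exact Complex.ofReal_re _

/-- The Petersson product as an inner product on the space of cusp forms. -/
@[reducible] def peterssonCore (hk : 9 ≤ k) (hk2 : Even k) :
    InnerProductSpace.Core ℂ (CuspForm 𝒮ℒ (k : ℤ)) where
  inner := peterssonProd
  conj_inner_symm f g := conj_peterssonProd g f
  re_inner_nonneg f := re_peterssonProd_self_nonneg f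
  add_left := peterssonProd_add_left
  smul_left := peterssonProd_smul_left
  definite _ := eq_zero_of_peterssonProd_self hk hk2

instance : FiniteDimensional ℂ (CuspForm 𝒮ℒ (k : ℤ)) :=
  FiniteDimensional.of_injective _ (CuspForm.toModularFormₗ_injective (Γ := 𝒮ℒ) (k := (k : ℤ)))

/-- A form orthogonal to all reproducing kernels vanishes at every point. -/
lemma span_reproKernel (hk : 9 ≤ k) (hk2 : Even k) :
    Submodule.span ℂ (Set.range (reproKernel hk)) = ⊤ := by
  let core := peterssonCore hk hk2
  let _ : NormedAddCommGroup (CuspForm 𝒮ℒ (k : ℤ)) := core.toNormedAddCommGroup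
  let _ : InnerProductSpace ℂ (CuspForm 𝒮ℒ (k : ℤ)) := InnerProductSpace.ofCore core.toCore
  rw [← Submodule.orthogonal_eq_bot_iff, Submodule.eq_bot_iff]
  intro f hf
  ext w
  have h1 : peterssonProd (reproKernel hk w) f = 0 :=
    (Submodule.mem_orthogonal _ _).mp hf _ (Submodule.subset_span ⟨w, rfl⟩)
  rw [peterssonProd_reproKernel hk hk2] at h1
  simpa [reproConst_ne_zero] using h1

end

/-! ### Hecke operators on cusp forms -/

section

variable {k : ℕ}

lemma heckeOperator_zero (k : ℕ) (f : ℍ → ℂ) (z : ℍ) : heckeOperator k 0 f z = 0 := by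
  simp [heckeOperator]

lemma heckeOperator_add (k n : ℕ) (f g : ℍ → ℂ) (z : ℍ) :
    heckeOperator k n (f + g) z = heckeOperator k n f z + heckeOperator k n g z := by
  simp only [heckeOperator, Pi.add_apply, Finset.sum_add_distrib, mul_add]

lemma heckeOperator_smul (k n : ℕ) (c : ℂ) (f : ℍ → ℂ) (z : ℍ) :
    heckeOperator k n (c • f) z = c * heckeOperator k n f z := by
  simp only [heckeOperator, Pi.smul_apply, smul_eq_mul, Finset.mul_sum]
  refine Finset.sum_congr rfl fun d _ => Finset.sum_congr rfl fun b _ => ?_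
  ring

lemma heckeOperator_reproKernel (hk : 9 ≤ k) {n : ℕ} (hn : n ≠ 0) (w z : ℍ) :
    heckeOperator k n (reproKernel hk w) z =
      (n : ℂ) ^ ((k : ℤ) - 1) * kernel k n z (-conj (w : ℂ)) :=
  heckeOperator_kernel (by omega) hn (neg_conj_im_pos w) z

/-- Hecke operators preserve the space of cusp forms. It is enough to see this on the reproducing
kernels, which span the space and are mapped to kernels of larger determinant. -/
lemma exists_eq_heckeOperator (hk : 9 ≤ k) (hk2 : Even k) (n : ℕ) (f : CuspForm 𝒮ℒ (k : ℤ)) :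
    ∃ g : CuspForm 𝒮ℒ (k : ℤ), ∀ z, g z = heckeOperator k n f z := by
  rcases Nat.eq_zero_or_pos n with rfl | hn
  · exact ⟨0, fun z => (heckeOperator_zero k f z).symm⟩
  have hf : f ∈ Submodule.span ℂ (Set.range (reproKernel hk)) := by
    rw [span_reproKernel hk hk2]; trivial
  induction hf using Submodule.span_induction with
  | mem f hf =>
    obtain ⟨w, rfl⟩ := hf
    refine ⟨(n : ℂ) ^ ((k : ℤ) - 1) • kernelForm₁ hk (n := (n : ℤ)) (by exact_mod_cast hn)
      (neg_conj_im_pos w), fun z => ?_⟩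
    rw [heckeOperator_reproKernel hk hn.ne']
    rfl
  | zero => exact ⟨0, fun z => by simp [heckeOperator]⟩
  | add f g _ _ hf hg =>
    obtain ⟨f', hf⟩ := hf
    obtain ⟨g', hg⟩ := hg
    refine ⟨f' + g', fun z => ?_⟩
    have : (⇑(f + g) : ℍ → ℂ) = (f : ℍ → ℂ) + (g : ℍ → ℂ) := rfl
    rw [this, heckeOperator_add, ← hf, ← hg]
    rfl
  | smul c f _ hf =>
    obtain ⟨f', hf⟩ := hf
    refine ⟨c • f', fun z => ?_⟩
    have : (⇑(c • f) : ℍ → ℂ) = c • (f : ℍ → ℂ) := rfl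
    rw [this, heckeOperator_smul, ← hf]
    rfl

/-- The Hecke operator `T_n` as an endomorphism of the space of cusp forms. -/
def heckeEnd (hk : 9 ≤ k) (hk2 : Even k) (n : ℕ) :
    CuspForm 𝒮ℒ (k : ℤ) →ₗ[ℂ] CuspForm 𝒮ℒ (k : ℤ) where
  toFun f := (exists_eq_heckeOperator hk hk2 n f).choose
  map_add' f g := by
    ext z
    have : (⇑(f + g) : ℍ → ℂ) = (f : ℍ → ℂ) + (g : ℍ → ℂ) := rfl
    rw [(exists_eq_heckeOperator hk hk2 n _).choose_spec, this, heckeOperator_add,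
      ← (exists_eq_heckeOperator hk hk2 n f).choose_spec,
      ← (exists_eq_heckeOperator hk hk2 n g).choose_spec]
    rfl
  map_smul' c f := by
    ext z
    have : (⇑(c • f) : ℍ → ℂ) = c • (f : ℍ → ℂ) := rfl
    rw [(exists_eq_heckeOperator hk hk2 n _).choose_spec, this, heckeOperator_smul,
      ← (exists_eq_heckeOperator hk hk2 n f).choose_spec]
    rfl

lemma heckeEnd_apply (hk : 9 ≤ k) (hk2 : Even k) (n : ℕ) (f : CuspForm 𝒮ℒ (k : ℤ)) (z : ℍ) :
    heckeEnd hk hk2 n f z = heckeOperator k n f z :=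
  (exists_eq_heckeOperator hk hk2 n f).choose_spec z

lemma peterssonProd_add_right (f g h : CuspForm 𝒮ℒ (k : ℤ)) :
    peterssonProd f (g + h) = peterssonProd f g + peterssonProd f h := by
  rw [← conj_peterssonProd, peterssonProd_add_left, map_add, conj_peterssonProd, conj_peterssonProd]

lemma peterssonProd_smul_right (f g : CuspForm 𝒮ℒ (k : ℤ)) (r : ℂ) :
    peterssonProd f (r • g) = r * peterssonProd f g := by
  rw [← conj_peterssonProd, peterssonProd_smul_left, map_mul, conj_peterssonProd, Complex.conj_conj]

/-- Hecke operators are self-adjoint: on reproducing kernels this is the symmetry of the kernel of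
determinant `n`. -/
lemma peterssonProd_heckeEnd (hk : 9 ≤ k) (hk2 : Even k) (n : ℕ) (f g : CuspForm 𝒮ℒ (k : ℤ)) :
    peterssonProd (heckeEnd hk hk2 n f) g = peterssonProd f (heckeEnd hk hk2 n g) := by
  rcases Nat.eq_zero_or_pos n with rfl | hn
  · have h0 : ∀ f, heckeEnd hk hk2 0 f = 0 := fun f => by
      ext z; rw [heckeEnd_apply, heckeOperator_zero]; rfl
    rw [h0, h0, ← zero_smul ℂ (0 : CuspForm 𝒮ℒ (k : ℤ)), peterssonProd_smul_left,
      peterssonProd_smul_right]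
    simp
  have hf : f ∈ Submodule.span ℂ (Set.range (reproKernel hk)) := by
    rw [span_reproKernel hk hk2]; trivial
  have hg : g ∈ Submodule.span ℂ (Set.range (reproKernel hk)) := by
    rw [span_reproKernel hk hk2]; trivial
  induction hf using Submodule.span_induction with
  | mem f hf =>
    obtain ⟨w, rfl⟩ := hf
    induction hg using Submodule.span_induction with
    | mem g hg =>
      obtain ⟨v, rfl⟩ := hg
      rw [peterssonProd_reproKernel hk hk2, ← conj_peterssonProd, peterssonProd_reproKernel hk hk2,
        heckeEnd_apply, heckeEnd_apply, heckeOperator_reproKernel hk hn.ne',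
        heckeOperator_reproKernel hk hn.ne', map_mul, map_mul, map_mul, conj_reproConst hk2,
        conj_kernel hk2, kernel_symm, map_neg, Complex.conj_conj, neg_neg, map_zpow₀,
        Complex.conj_natCast, map_ofNat]
    | zero => rw [map_zero, ← zero_smul ℂ (0 : CuspForm 𝒮ℒ (k : ℤ)), peterssonProd_smul_right,
        peterssonProd_smul_right, zero_mul, zero_mul]
    | add f g _ _ hf hg =>
      rw [peterssonProd_add_right, hf, hg, map_add, peterssonProd_add_right]
    | smul c f _ hf =>
      rw [peterssonProd_smul_right, hf, map_smul, peterssonProd_smul_right]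
  | zero => rw [map_zero, ← zero_smul ℂ (0 : CuspForm 𝒮ℒ (k : ℤ)), peterssonProd_smul_left,
      peterssonProd_smul_left, map_zero, zero_mul, zero_mul]
  | add f g _ _ hf hg =>
    rw [map_add, peterssonProd_add_left, hf, hg, peterssonProd_add_left]
  | smul c f _ hf =>
    rw [map_smul, peterssonProd_smul_left, hf, peterssonProd_smul_left]

/-! ### Hecke operators and Fourier coefficients -/

lemma coeff_unique (f : CuspForm 𝒮ℒ (k : ℤ)) {c : ℕ → ℂ}
    (h : ∀ z : ℍ, HasSum (fun n : ℕ => c n * cexp (2 * π * Complex.I * n * z)) (f z)) (n : ℕ) :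
    (qExpansion 1 f).coeff n = c n := by
  symm
  refine ModularFormClass.qExpansion_coeff_unique one_pos one_mem_strictPeriods_SL (f := f)
    (fun z => ?_) n
  refine (h z).congr_fun fun m => ?_
  rw [smul_eq_mul, Function.Periodic.qParam, ← Complex.exp_nat_mul]
  congr 2
  push_cast
  ring

lemma cuspForm_ext_coeff {f g : CuspForm 𝒮ℒ (k : ℤ)}
    (h : ∀ n, 0 < n → (qExpansion 1 f).coeff n = (qExpansion 1 g).coeff n) : f = g := by
  ext z
  refine (hasSum_coeff f z).unique ?_
  convert hasSum_coeff g z using 2 with n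
  rcases Nat.eq_zero_or_pos n with rfl | hn
  · rw [coeff_zero, coeff_zero]
  · rw [h n hn]

lemma sum_cexp_eq_ite {d : ℕ} (hd : d ≠ 0) (m : ℕ) :
    ∑ b ∈ Finset.range d, cexp (2 * π * Complex.I * m * (b / d)) = if d ∣ m then (d : ℂ) else 0 := by
  have hdc : (d : ℂ) ≠ 0 := by exact_mod_cast hd
  have h1 : ∀ b : ℕ, cexp (2 * π * Complex.I * m * (b / d)) = cexp (2 * π * Complex.I * (m / d)) ^ b := by
    intro b
    rw [← Complex.exp_nat_mul]; congr 1; ring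
  simp_rw [h1]
  have h2 : cexp (2 * π * Complex.I * (m / d)) ^ d = 1 := by
    rw [← Complex.exp_nat_mul, Complex.exp_eq_one_iff]
    exact ⟨m, by push_cast; field_simp⟩
  split_ifs with h
  · obtain ⟨j, rfl⟩ := h
    have : cexp (2 * π * Complex.I * ((d * j : ℕ) / d)) = 1 := by
      rw [Complex.exp_eq_one_iff]
      exact ⟨j, by push_cast; field_simp⟩
    simp only [this, one_pow, Finset.sum_const, Finset.card_range, nsmul_eq_mul, mul_one]
  · have h3 : cexp (2 * π * Complex.I * (m / d)) ≠ 1 := by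
      intro h3
      rw [Complex.exp_eq_one_iff] at h3
      obtain ⟨j, hj⟩ := h3
      have h4 : (m : ℂ) = d * j := by
        have h5 : (2 * π * Complex.I : ℂ) ≠ 0 := Complex.two_pi_I_ne_zero
        have h6 : (m / d : ℂ) = j := by
          apply mul_left_cancel₀ h5; rw [hj]; ring
        rw [← h6]; field_simp
      have h5 : (m : ℤ) = d * j := by exact_mod_cast h4
      exact h (by exact_mod_cast (Dvd.intro _ h5.symm : (d : ℤ) ∣ m))
    rw [geom_sum_eq h3, h2, sub_self, zero_div]

/-- The Fourier expansion of one block of the Hecke operator: the sum over `b` selects the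
coefficients at multiples of `d`. -/
lemma hasSum_heckeBlock (f : CuspForm 𝒮ℒ (k : ℤ)) {d e : ℕ} (hd : d ≠ 0) (he : e ≠ 0) (z : ℍ) :
    HasSum (fun l : ℕ => (if e ∣ l then (d : ℂ) * (qExpansion 1 f).coeff (d * (l / e)) else 0) *
        cexp (2 * π * Complex.I * l * z))
      (∑ b ∈ Finset.range d, f (ofComplex (((e : ℂ) * z + b) / d))) := by
  have hdc : (d : ℂ) ≠ 0 := by exact_mod_cast hd
  have him : ∀ b : ℕ, 0 < (((e : ℂ) * z + b) / d).im := by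
    intro b
    rw [Complex.div_natCast_im]
    refine div_pos ?_ (by exact_mod_cast Nat.pos_of_ne_zero hd)
    rw [Complex.add_im, Complex.natCast_im, add_zero, Complex.mul_im, Complex.natCast_im,
      Complex.natCast_re, zero_mul, add_zero]
    exact mul_pos (by exact_mod_cast Nat.pos_of_ne_zero he) z.im_pos
  have h1 := hasSum_sum (s := Finset.range d) fun b _ =>
    hasSum_coeff f (ofComplex (((e : ℂ) * z + b) / d))
  have h2 : ∀ m : ℕ, ∑ b ∈ Finset.range d, (qExpansion 1 f).coeff m *
      cexp (2 * π * Complex.I * m * (ofComplex (((e : ℂ) * z + b) / d) : ℍ)) =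
      if d ∣ m then d * (qExpansion 1 f).coeff m * cexp (2 * π * Complex.I * m * (e * z / d)) else 0 := by
    intro m
    have : ∀ b ∈ Finset.range d, (qExpansion 1 f).coeff m *
      cexp (2 * π * Complex.I * m * (ofComplex (((e : ℂ) * z + b) / d) : ℍ)) =
      (qExpansion 1 f).coeff m * cexp (2 * π * Complex.I * m * (e * z / d)) *
        cexp (2 * π * Complex.I * m * (b / d)) := by
      intro b _
      rw [ofComplex_apply_of_im_pos (him b), mul_assoc (PowerSeries.coeff m _),
        ← Complex.exp_add]
      congr 2
      change 2 * π * Complex.I * m * (((e : ℂ) * z + b) / d) = _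
      ring
    rw [Finset.sum_congr rfl this, ← Finset.mul_sum, sum_cexp_eq_ite hd]
    split_ifs <;> ring
  simp_rw [h2] at h1
  rw [← Function.Injective.hasSum_iff (g := fun j : ℕ => d * j)
    (fun a b h => Nat.eq_of_mul_eq_mul_left (Nat.pos_of_ne_zero hd) h) (by
    intro m hm
    rw [if_neg]
    rintro ⟨j, rfl⟩
    exact hm ⟨j, rfl⟩)] at h1
  rw [← Function.Injective.hasSum_iff (g := fun j : ℕ => e * j)
    (fun a b h => Nat.eq_of_mul_eq_mul_left (Nat.pos_of_ne_zero he) h) (by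
    intro m hm
    rw [if_neg, zero_mul]
    rintro ⟨j, rfl⟩
    exact hm ⟨j, rfl⟩)]
  refine h1.congr_fun fun j => ?_
  simp only [Function.comp_apply, dvd_mul_right, if_true]
  rw [Nat.mul_div_cancel_left _ (Nat.pos_of_ne_zero he)]
  congr 2
  push_cast
  field_simp

/-- The Fourier coefficients of `T_n f`: the sum over `d` defining `T_n` is rewritten in terms of
the complementary divisor `e = n / d`. -/
lemma coeff_heckeEnd_aux (hk : 9 ≤ k) (hk2 : Even k) {n : ℕ} (hn : n ≠ 0)
    (f : CuspForm 𝒮ℒ (k : ℤ)) (l : ℕ) :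
    (qExpansion 1 (heckeEnd hk hk2 n f)).coeff l = ∑ e ∈ n.divisors,
      if e ∣ l then (e : ℂ) ^ (k - 1) * (qExpansion 1 f).coeff (n / e * (l / e)) else 0 := by
  rw [coeff_unique (heckeEnd hk hk2 n f) (c := fun l => (n : ℂ) ^ ((k : ℤ) - 1) *
    ∑ d ∈ n.divisors, (d : ℂ) ^ (-(k : ℤ)) *
    (if (n / d) ∣ l then (d : ℂ) * (qExpansion 1 f).coeff (d * (l / (n / d))) else 0))]
  · rw [← Nat.sum_div_divisors n, Finset.mul_sum]
    refine Finset.sum_congr rfl fun e he => ?_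
    have hen := Nat.dvd_of_mem_divisors he
    rw [Nat.div_div_self hen hn]
    split_ifs
    · obtain ⟨d, rfl⟩ := hen
      have he0 : e ≠ 0 := by rintro rfl; simp at hn
      have hd0 : d ≠ 0 := by rintro rfl; simp at hn
      have hec : (e : ℂ) ≠ 0 := by exact_mod_cast he0
      have hdc : (d : ℂ) ≠ 0 := by exact_mod_cast hd0
      rw [Nat.mul_div_cancel_left _ (Nat.pos_of_ne_zero he0)]
      have hkk : (k : ℤ) - 1 = ((k - 1 : ℕ) : ℤ) := by omega
      rw [hkk, zpow_neg, zpow_natCast, zpow_natCast, Nat.cast_mul, mul_pow]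
      have : (d : ℂ) ^ k = d ^ (k - 1) * d := by rw [← pow_succ]; congr 1; omega
      rw [this]
      field_simp
    · ring
  · intro z
    rw [heckeEnd_apply, heckeOperator]
    simp_rw [mul_assoc ((n : ℂ) ^ ((k : ℤ) - 1)), Finset.sum_mul, mul_assoc _ _ (cexp _)]
    refine (hasSum_sum fun d hd => ?_).mul_left _
    have hdn := Nat.dvd_of_mem_divisors hd
    have hd0 : d ≠ 0 := by rintro rfl; exact hn (zero_dvd_iff.mp hdn)
    have he0 : n / d ≠ 0 := (Nat.div_pos (Nat.le_of_dvd (Nat.pos_of_ne_zero hn) hdn)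
      (Nat.pos_of_ne_zero hd0)).ne'
    exact (hasSum_heckeBlock f hd0 he0 z).mul_left _

end

/-! ### The Hecke relations -/

/-- The sum `∑_{e ∣ (n, l)} e^r a(n l / e²)` appearing in the Hecke relations. -/
def heckeSum (r : ℕ) (a : ℕ → ℂ) (n l : ℕ) : ℂ :=
  ∑ e ∈ n.divisors, if e ∣ l then (e : ℂ) ^ r * a (n / e * (l / e)) else 0

/-- The Hecke sum as a sum over a set of divisors of `n l` given by conditions symmetric in `n` and
`l`. -/
lemma heckeSum_eq (r : ℕ) (a : ℕ → ℂ) {n l : ℕ} (hn : n ≠ 0) (hl : l ≠ 0) :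
    heckeSum r a n l = ∑ g ∈ (n * l).divisors with g ∣ n ∧ g ∣ l,
      (g : ℂ) ^ r * a (n * l / (g * g)) := by
  rw [heckeSum, ← Finset.sum_filter]
  refine Finset.sum_congr ?_ fun g hg => ?_
  · ext g
    simp only [Finset.mem_filter, Nat.mem_divisors]
    constructor
    · rintro ⟨⟨h1, -⟩, h2⟩
      exact ⟨⟨h1.mul_right l, mul_ne_zero hn hl⟩, h1, h2⟩
    · rintro ⟨-, h1, h2⟩
      exact ⟨⟨h1, hn⟩, h2⟩
  · simp only [Finset.mem_filter] at hg
    rw [Nat.div_mul_div_comm hg.2.1 hg.2.2]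

lemma pow_mul_heckeSum (r : ℕ) (a : ℕ → ℂ) {p n l : ℕ} (hp : p ≠ 0) (hn : n ≠ 0) (hl : l ≠ 0) :
    (p : ℂ) ^ r * heckeSum r a n l =
      ∑ g ∈ (p * (p * n) * l).divisors with p ∣ g ∧ g ∣ p * n ∧ g ∣ p * l,
        (g : ℂ) ^ r * a (p * (p * n) * l / (g * g)) := by
  rw [heckeSum_eq r a hn hl, Finset.mul_sum]
  refine Finset.sum_nbij (fun e => p * e) ?_ ?_ ?_ ?_
  · intro e he
    simp only [Finset.mem_filter, Nat.mem_divisors] at he ⊢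
    refine ⟨⟨?_, by positivity⟩, dvd_mul_right _ _, mul_dvd_mul_left _ he.2.1,
      mul_dvd_mul_left _ he.2.2⟩
    exact ((mul_dvd_mul_left p he.2.1).mul_left p).mul_right l
  · intro e _ e' _ h
    exact Nat.eq_of_mul_eq_mul_left (Nat.pos_of_ne_zero hp) h
  · intro g hg
    simp only [Finset.coe_filter, Nat.mem_divisors, Set.mem_ofPred_eq] at hg
    obtain ⟨-, ⟨e, rfl⟩, h1, h2⟩ := hg
    have h1 := Nat.dvd_of_mul_dvd_mul_left (Nat.pos_of_ne_zero hp) h1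
    have h2 := Nat.dvd_of_mul_dvd_mul_left (Nat.pos_of_ne_zero hp) h2
    refine ⟨e, ?_, rfl⟩
    simp only [Finset.coe_filter, Nat.mem_divisors, Set.mem_ofPred_eq]
    exact ⟨⟨h1.mul_right l, mul_ne_zero hn hl⟩, h1, h2⟩
  · intro e _
    have : p * (p * n) * l / (p * e * (p * e)) = n * l / (e * e) := by
      rw [show p * (p * n) * l = (p * p) * (n * l) by ring,
        show p * e * (p * e) = (p * p) * (e * e) by ring,
        Nat.mul_div_mul_left _ _ (by positivity)]
    rw [this]; push_cast; ring

/-- The combinatorial identity behind `T_p T_n = T_{pn} + p^{k-1} T_{n/p}`. Written over the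
divisors `g` of `p n l`, the two sides agree term by term: if `p ∣ g` they involve the same two
conditions, and if `p ∤ g` only one summand on each side contributes. -/
lemma heckeSum_prime (r : ℕ) (a : ℕ → ℂ) {p n l : ℕ} (hp : p.Prime) (hn : n ≠ 0) (hl : l ≠ 0) :
    heckeSum r a (p * n) l + (if p ∣ n then (p : ℂ) ^ r * heckeSum r a (n / p) l else 0) =
      heckeSum r a n (p * l) + (if p ∣ l then (p : ℂ) ^ r * heckeSum r a n (l / p) else 0) := by
  set D := (p * n * l).divisors with hD
  set G : ℕ → ℂ := fun g => (g : ℂ) ^ r * a (p * n * l / (g * g)) with hG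
  have h1 : heckeSum r a (p * n) l = ∑ g ∈ D with g ∣ p * n ∧ g ∣ l, G g :=
    heckeSum_eq r a (mul_ne_zero hp.ne_zero hn) hl
  have h2 : heckeSum r a n (p * l) = ∑ g ∈ D with g ∣ n ∧ g ∣ p * l, G g := by
    rw [heckeSum_eq r a hn (mul_ne_zero hp.ne_zero hl), show n * (p * l) = p * n * l by ring]
  have h3 : (if p ∣ n then (p : ℂ) ^ r * heckeSum r a (n / p) l else 0) =
      ∑ g ∈ D with p ∣ g ∧ g ∣ n ∧ g ∣ p * l, G g := by
    split_ifs with h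
    · obtain ⟨m, rfl⟩ := h
      rw [Nat.mul_div_cancel_left _ hp.pos,
        pow_mul_heckeSum r a hp.ne_zero (by rintro rfl; simp at hn) hl]
    · rw [Finset.filter_false_of_mem, Finset.sum_empty]
      rintro g - ⟨h4, h5, -⟩
      exact h (h4.trans h5)
  have h4 : (if p ∣ l then (p : ℂ) ^ r * heckeSum r a n (l / p) else 0) =
      ∑ g ∈ D with p ∣ g ∧ g ∣ p * n ∧ g ∣ l, G g := by
    split_ifs with h
    · obtain ⟨m, rfl⟩ := h
      rw [Nat.mul_div_cancel_left _ hp.pos,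
        pow_mul_heckeSum r a hp.ne_zero hn (by rintro rfl; simp at hl), hD, hG,
        show p * (p * n) * m = p * n * (p * m) by ring]
    · rw [Finset.filter_false_of_mem, Finset.sum_empty]
      rintro g - ⟨h4, -, h5⟩
      exact h (h4.trans h5)
  rw [h1, h2, h3, h4]
  simp only [Finset.sum_filter, ← Finset.sum_add_distrib]
  refine Finset.sum_congr rfl fun g _ => ?_
  by_cases hpg : p ∣ g
  · simp only [hpg, true_and]; ring
  · have hc : Nat.Coprime g p := ((Nat.Prime.coprime_iff_not_dvd hp).mpr hpg).symm
    simp only [hpg, false_and, if_false, add_zero]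
    simp only [hc.dvd_mul_left]

section

variable {k : ℕ}

lemma coeff_heckeEnd (hk : 9 ≤ k) (hk2 : Even k) {n : ℕ} (hn : n ≠ 0) (f : CuspForm 𝒮ℒ (k : ℤ))
    (l : ℕ) : (qExpansion 1 (heckeEnd hk hk2 n f)).coeff l =
      heckeSum (k - 1) (fun m => (qExpansion 1 f).coeff m) n l :=
  coeff_heckeEnd_aux hk hk2 hn f l

lemma heckeSum_one_right (r : ℕ) (a : ℕ → ℂ) {n : ℕ} (hn : n ≠ 0) : heckeSum r a n 1 = a n := by
  simp [heckeSum, hn]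

lemma heckeSum_one_left (r : ℕ) (a : ℕ → ℂ) (l : ℕ) : heckeSum r a 1 l = a l := by
  simp [heckeSum]

lemma heckeSum_prime_left (r : ℕ) (a : ℕ → ℂ) {p : ℕ} (hp : p.Prime) (l : ℕ) :
    heckeSum r a p l = a (p * l) + if p ∣ l then (p : ℂ) ^ r * a (l / p) else 0 := by
  rw [heckeSum, hp.divisors, Finset.sum_pair hp.one_lt.ne]
  simp [hp.pos]

lemma qExpansion_coeff_add (f g : CuspForm 𝒮ℒ (k : ℤ)) (n : ℕ) :
    (qExpansion 1 (f + g : CuspForm 𝒮ℒ (k : ℤ))).coeff n = (qExpansion 1 f).coeff n + (qExpansion 1 g).coeff n :=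
  coeff_unique (f + g) (c := fun n => (qExpansion 1 f).coeff n + (qExpansion 1 g).coeff n)
    (fun z => by
      simp_rw [add_mul]
      exact (hasSum_coeff f z).add (hasSum_coeff g z)) n

lemma qExpansion_coeff_smul (c : ℂ) (f : CuspForm 𝒮ℒ (k : ℤ)) (n : ℕ) :
    (qExpansion 1 (c • f : CuspForm 𝒮ℒ (k : ℤ))).coeff n = c * (qExpansion 1 f).coeff n :=
  coeff_unique (c • f) (c := fun n => c * (qExpansion 1 f).coeff n)
    (fun z => ((hasSum_coeff f z).mul_left c).congr_fun fun n => by ring) n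

lemma qExpansion_coeff_cuspForm_zero (n : ℕ) :
    (qExpansion 1 (0 : CuspForm 𝒮ℒ (k : ℤ))).coeff n = 0 :=
  coeff_unique (0 : CuspForm 𝒮ℒ (k : ℤ)) (c := fun _ => 0)
    (fun z => by simp) n

lemma heckeEnd_one (hk : 9 ≤ k) (hk2 : Even k) (f : CuspForm 𝒮ℒ (k : ℤ)) :
    heckeEnd hk hk2 1 f = f :=
  cuspForm_ext_coeff fun l _ => by
    rw [coeff_heckeEnd hk hk2 one_ne_zero, heckeSum_one_left]

lemma heckeEnd_prime_mul (hk : 9 ≤ k) (hk2 : Even k) {p n : ℕ} (hp : p.Prime) (hn : n ≠ 0)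
    (f : CuspForm 𝒮ℒ (k : ℤ)) :
    heckeEnd hk hk2 (p * n) f + (if p ∣ n then (p : ℂ) ^ (k - 1) • heckeEnd hk hk2 (n / p) f else 0) =
      heckeEnd hk hk2 p (heckeEnd hk hk2 n f) := by
  refine cuspForm_ext_coeff fun l hl => ?_
  rw [qExpansion_coeff_add, coeff_heckeEnd hk hk2 (mul_ne_zero hp.ne_zero hn),
    coeff_heckeEnd hk hk2 hp.ne_zero, heckeSum_prime_left _ _ hp]
  simp only [coeff_heckeEnd hk hk2 hn]
  rw [← heckeSum_prime _ _ hp hn hl.ne']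
  congr 1
  split_ifs with h
  · have : n / p ≠ 0 := (Nat.div_pos (Nat.le_of_dvd (Nat.pos_of_ne_zero hn) h) hp.pos).ne'
    rw [qExpansion_coeff_smul, coeff_heckeEnd hk hk2 this]
  · exact qExpansion_coeff_cuspForm_zero l

lemma heckeEnd_prime_comm (hk : 9 ≤ k) (hk2 : Even k) {p q : ℕ} (hp : p.Prime) (hq : q.Prime)
    (hpq : p ≠ q) : Commute (heckeEnd hk hk2 p) (heckeEnd hk hk2 q) := by
  refine LinearMap.ext fun f => ?_
  change heckeEnd hk hk2 p (heckeEnd hk hk2 q f) = heckeEnd hk hk2 q (heckeEnd hk hk2 p f)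
  rw [← heckeEnd_prime_mul hk hk2 hp hq.ne_zero, ← heckeEnd_prime_mul hk hk2 hq hp.ne_zero,
    mul_comm q p, if_neg, if_neg]
  · rw [Nat.prime_dvd_prime_iff_eq hq hp]; exact hpq.symm
  · rw [Nat.prime_dvd_prime_iff_eq hp hq]; exact hpq

/-! ### The Hecke basis -/

/-- A joint eigenform of all `T_p` is determined by its first Fourier coefficient: the relation for
`T_p` expresses the coefficient at `p m` through those at `m` and `m / p`. -/
lemma eq_zero_of_coeff_one_eq_zero (hk : 9 ≤ k) (hk2 : Even k) {f : CuspForm 𝒮ℒ (k : ℤ)}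
    {χ : Nat.Primes → ℂ} (hf : ∀ p : Nat.Primes, heckeEnd hk hk2 p f = χ p • f)
    (h1 : (qExpansion 1 f).coeff 1 = 0) : f = 0 := by
  refine cuspForm_ext_coeff fun n hn => ?_
  rw [qExpansion_coeff_cuspForm_zero]
  induction n using Nat.strong_induction_on with
  | _ n ih =>
    rcases eq_or_ne n 1 with rfl | hn1
    · exact h1
    have hp := Nat.minFac_prime hn1
    obtain ⟨m, hm⟩ := Nat.minFac_dvd n
    set p := n.minFac
    let p' : Nat.Primes := ⟨p, hp⟩
    have hm0 : 0 < m := by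
      rcases Nat.eq_zero_or_pos m with rfl | h
      · simp at hm; omega
      · exact h
    have hmn : m < n := by
      rw [hm]; exact lt_mul_of_one_lt_left hm0 hp.one_lt
    have h2 := coeff_heckeEnd hk hk2 hp.ne_zero f m
    rw [show heckeEnd hk hk2 p f = χ p' • f from hf p', qExpansion_coeff_smul,
      heckeSum_prime_left _ _ hp, ← hm, ih m hmn hm0] at h2
    split_ifs at h2 with h
    · have h3 : m / p ≤ m := Nat.div_le_self _ _
      rw [ih (m / p) (by omega) (Nat.div_pos (Nat.le_of_dvd hm0 h) hp.pos)] at h2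
      simpa using h2.symm
    · simpa using h2.symm

/-- A joint eigenform of all `T_p` is an eigenform of all `T_n`. -/
lemma exists_eigenvalue (hk : 9 ≤ k) (hk2 : Even k) {f : CuspForm 𝒮ℒ (k : ℤ)}
    {χ : Nat.Primes → ℂ} (hf : ∀ p : Nat.Primes, heckeEnd hk hk2 p f = χ p • f) {n : ℕ}
    (hn : 0 < n) : ∃ c : ℂ, heckeEnd hk hk2 n f = c • f := by
  induction n using Nat.strong_induction_on with
  | _ n ih =>
    rcases eq_or_ne n 1 with rfl | hn1
    · exact ⟨1, by rw [heckeEnd_one, one_smul]⟩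
    have hp := Nat.minFac_prime hn1
    obtain ⟨m, hm⟩ := Nat.minFac_dvd n
    set p := n.minFac
    let p' : Nat.Primes := ⟨p, hp⟩
    have hm0 : 0 < m := by
      rcases Nat.eq_zero_or_pos m with rfl | h
      · simp at hm; omega
      · exact h
    have hmn : m < n := by
      rw [hm]; exact lt_mul_of_one_lt_left hm0 hp.one_lt
    obtain ⟨c, hc⟩ := ih m hmn hm0
    have h2 := heckeEnd_prime_mul hk hk2 hp hm0.ne' f
    rw [hc, map_smul, show heckeEnd hk hk2 p f = χ p' • f from hf p', ← hm] at h2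
    split_ifs at h2 with h
    · have h3 : m / p ≤ m := Nat.div_le_self _ _
      obtain ⟨c', hc'⟩ := ih (m / p) (by omega) (Nat.div_pos (Nat.le_of_dvd hm0 h) hp.pos)
      rw [hc'] at h2
      refine ⟨c * χ p' - (p : ℂ) ^ (k - 1) * c', ?_⟩
      rw [sub_smul, mul_smul, mul_smul, ← h2, add_sub_cancel_right]
    · rw [add_zero] at h2
      exact ⟨c * χ p', by rw [h2, mul_smul]⟩

/-- The eigenvalue of `T_n` is the `n`-th Fourier coefficient. -/
lemma heckeEnd_of_mem_heckeBasis (hk : 9 ≤ k) (hk2 : Even k) {f : CuspForm 𝒮ℒ (k : ℤ)}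
    (hf : f ∈ heckeBasis k) {n : ℕ} (hn : 0 < n) :
    heckeEnd hk hk2 n f = (qExpansion 1 f).coeff n • f := by
  obtain ⟨h1, h2⟩ := hf
  obtain ⟨c, hc⟩ := h2 n hn
  have h3 : heckeEnd hk hk2 n f = c • f := by
    ext z
    rw [heckeEnd_apply, hc z]; rfl
  have h4 := coeff_heckeEnd hk hk2 hn.ne' f 1
  rw [h3, qExpansion_coeff_smul, h1, heckeSum_one_right _ _ hn.ne', mul_one] at h4
  rw [h3, h4]

lemma ne_zero_of_mem_heckeBasis {f : CuspForm 𝒮ℒ (k : ℤ)} (hf : f ∈ heckeBasis k) : f ≠ 0 := by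
  rintro rfl
  have := hf.1
  rw [qExpansion_coeff_cuspForm_zero] at this
  exact zero_ne_one this

/-- The Hecke relations for the Fourier coefficients of a member of the Hecke basis. -/
lemma coeff_mul_coeff (hk : 9 ≤ k) (hk2 : Even k) {f : CuspForm 𝒮ℒ (k : ℤ)}
    (hf : f ∈ heckeBasis k) {n : ℕ} (hn : 0 < n) (l : ℕ) :
    (qExpansion 1 f).coeff n * (qExpansion 1 f).coeff l =
      heckeSum (k - 1) (fun m => (qExpansion 1 f).coeff m) n l := by
  rw [← coeff_heckeEnd hk hk2 hn.ne', heckeEnd_of_mem_heckeBasis hk hk2 hf hn,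
    qExpansion_coeff_smul]

lemma peterssonProd_self_ne_zero (hk : 9 ≤ k) (hk2 : Even k) {f : CuspForm 𝒮ℒ (k : ℤ)}
    (hf : f ∈ heckeBasis k) : peterssonProd f f ≠ 0 := fun h =>
  ne_zero_of_mem_heckeBasis hf (eq_zero_of_peterssonProd_self hk hk2 h)

/-- The Fourier coefficients of a member of the Hecke basis are real, being eigenvalues of
self-adjoint operators. -/
lemma conj_coeff (hk : 9 ≤ k) (hk2 : Even k) {f : CuspForm 𝒮ℒ (k : ℤ)}
    (hf : f ∈ heckeBasis k) (n : ℕ) : conj ((qExpansion 1 f).coeff n) = (qExpansion 1 f).coeff n := by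
  rcases Nat.eq_zero_or_pos n with rfl | hn
  · rw [coeff_zero, map_zero]
  have h := peterssonProd_heckeEnd hk hk2 n f f
  rw [heckeEnd_of_mem_heckeBasis hk hk2 hf hn, peterssonProd_smul_left,
    peterssonProd_smul_right] at h
  exact mul_right_cancel₀ (peterssonProd_self_ne_zero hk hk2 hf) h

lemma peterssonProd_eq_zero_of_ne (hk : 9 ≤ k) (hk2 : Even k) {f g : CuspForm 𝒮ℒ (k : ℤ)}
    (hf : f ∈ heckeBasis k) (hg : g ∈ heckeBasis k) (hfg : f ≠ g) : peterssonProd f g = 0 := by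
  by_contra h0
  refine hfg (cuspForm_ext_coeff fun n hn => ?_)
  have h := peterssonProd_heckeEnd hk hk2 n f g
  rw [heckeEnd_of_mem_heckeBasis hk hk2 hf hn, heckeEnd_of_mem_heckeBasis hk hk2 hg hn,
    peterssonProd_smul_left, peterssonProd_smul_right, conj_coeff hk hk2 hf] at h
  exact mul_right_cancel₀ h0 h

/-- The commuting self-adjoint operators `T_p` are simultaneously diagonalizable, and a nonzero
joint eigenvector can be scaled to a member of the Hecke basis. -/
lemma span_heckeBasis (hk : 9 ≤ k) (hk2 : Even k) : Submodule.span ℂ (heckeBasis k) = ⊤ := by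
  let core := peterssonCore hk hk2
  let _ : NormedAddCommGroup (CuspForm 𝒮ℒ (k : ℤ)) := core.toNormedAddCommGroup
  let _ : InnerProductSpace ℂ (CuspForm 𝒮ℒ (k : ℤ)) := InnerProductSpace.ofCore core.toCore
  have hsymm : ∀ p : Nat.Primes, (heckeEnd hk hk2 p).IsSymmetric := fun p f g =>
    peterssonProd_heckeEnd hk hk2 p f g
  have hcomm : Pairwise (Function.onFun Commute fun p : Nat.Primes => heckeEnd hk hk2 p) :=
    fun p q hpq => heckeEnd_prime_comm hk hk2 p.2 q.2 fun h => hpq (Subtype.ext h)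
  rw [eq_top_iff, ← LinearMap.IsSymmetric.iSup_iInf_eq_top_of_commute hsymm hcomm]
  refine iSup_le fun χ f hf => ?_
  have hf' : ∀ p : Nat.Primes, heckeEnd hk hk2 p f = χ p • f := fun p =>
    Module.End.mem_eigenspace_iff.mp ((Submodule.mem_iInf _).mp hf p)
  by_cases h1 : (qExpansion 1 f).coeff 1 = 0
  · rw [eq_zero_of_coeff_one_eq_zero hk hk2 hf' h1]
    exact Submodule.zero_mem _
  · have h2 : ((qExpansion 1 f).coeff 1)⁻¹ • f ∈ heckeBasis k := by
      refine ⟨?_, fun n hn => ?_⟩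
      · rw [qExpansion_coeff_smul, inv_mul_cancel₀ h1]
      · obtain ⟨c, hc⟩ := exists_eigenvalue hk hk2 hf' hn
        refine ⟨c, fun z => ?_⟩
        rw [← heckeEnd_apply hk hk2, map_smul, hc]
        simp only [smul_apply, smul_eq_mul]
        ring
    have h3 := Submodule.smul_mem _ ((qExpansion 1 f).coeff 1) (Submodule.subset_span h2)
    rwa [smul_smul, mul_inv_cancel₀ h1, one_smul] at h3

lemma finite_heckeBasis (hk : 9 ≤ k) (hk2 : Even k) : (heckeBasis k).Finite := by
  let core := peterssonCore hk hk2
  let _ : NormedAddCommGroup (CuspForm 𝒮ℒ (k : ℤ)) := core.toNormedAddCommGroup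
  let _ : InnerProductSpace ℂ (CuspForm 𝒮ℒ (k : ℤ)) := InnerProductSpace.ofCore core.toCore
  have h : LinearIndependent ℂ (fun f : heckeBasis k => (f : CuspForm 𝒮ℒ (k : ℤ))) :=
    linearIndependent_of_ne_zero_of_inner_eq_zero (fun f => ne_zero_of_mem_heckeBasis f.2)
      fun f g hfg => peterssonProd_eq_zero_of_ne hk hk2 f.2 g.2 fun h => hfg (Subtype.ext h)
  exact h.setFinite

/-- Expansion of a cusp form in the Hecke basis. -/
lemma eq_sum_heckeBasis (hk : 9 ≤ k) (hk2 : Even k) (F : CuspForm 𝒮ℒ (k : ℤ)) :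
    F = ∑ f ∈ (finite_heckeBasis hk hk2).toFinset,
      (peterssonProd f F / peterssonProd f f) • f := by
  classical
  have hF : F ∈ Submodule.span ℂ (heckeBasis k) := by
    rw [span_heckeBasis hk hk2]; trivial
  induction hF using Submodule.span_induction with
  | mem g hg =>
    rw [Finset.sum_eq_single_of_mem g (by simpa using hg), div_self
      (peterssonProd_self_ne_zero hk hk2 hg), one_smul]
    intro f hf hfg
    rw [peterssonProd_eq_zero_of_ne hk hk2 (by simpa using hf) hg hfg, zero_div, zero_smul]
  | zero =>
    symm
    refine Finset.sum_eq_zero fun f _ => ?_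
    have : peterssonProd f (0 : CuspForm 𝒮ℒ (k : ℤ)) = 0 := by
      rw [← zero_smul ℂ (0 : CuspForm 𝒮ℒ (k : ℤ)), peterssonProd_smul_right, zero_mul]
    rw [this, zero_div, zero_smul]
  | add F G _ _ hF hG =>
    conv_lhs => rw [hF, hG]
    rw [← Finset.sum_add_distrib]
    refine Finset.sum_congr rfl fun f _ => ?_
    rw [peterssonProd_add_right, add_div, add_smul]
  | smul c F _ hF =>
    conv_lhs => rw [hF]
    rw [Finset.smul_sum]
    refine Finset.sum_congr rfl fun f _ => ?_
    rw [peterssonProd_smul_right, mul_div_assoc, mul_smul]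

/-- Since its coefficients are real, a member `f` of the Hecke basis satisfies `conj (f w) = f
(-conj w)`. -/
lemma conj_apply_of_mem_heckeBasis (hk : 9 ≤ k) (hk2 : Even k) {f : CuspForm 𝒮ℒ (k : ℤ)}
    (hf : f ∈ heckeBasis k) (w w' : ℍ) (hw : (w' : ℂ) = -conj (w : ℂ)) : conj (f w) = f w' := by
  rw [← (hasSum_coeff f w).tsum_eq, ← (hasSum_coeff f w').tsum_eq, Complex.conj_tsum]
  refine tsum_congr fun n => ?_
  rw [map_mul, conj_coeff hk hk2 hf, ← Complex.exp_conj, hw]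
  congr 2
  simp only [map_mul, map_ofNat, Complex.conj_ofReal, Complex.conj_I, Complex.conj_natCast]
  ring

/-- The spectral expansion of the kernel function. -/
lemma kernel_eq_sum (hk : 9 ≤ k) (hk2 : Even k) (z w : ℍ) :
    kernel k 1 z w = ∑ f ∈ (finite_heckeBasis hk hk2).toFinset,
      2 * reproConst k / peterssonProd f f * (f z * f w) := by
  have h0 : 0 < (-conj (w : ℂ)).im := neg_conj_im_pos w
  set w' : ℍ := ⟨-conj (w : ℂ), h0⟩ with hw'
  have h1 : -conj (w' : ℂ) = w := by simp [hw']
  have h2 := congrArg (fun F : CuspForm 𝒮ℒ (k : ℤ) => F z)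
    (eq_sum_heckeBasis hk hk2 (reproKernel hk w'))
  simp only [reproKernel_apply, h1] at h2
  rw [h2]
  have h3 : ∀ (s : Finset (CuspForm 𝒮ℒ (k : ℤ))) (F : CuspForm 𝒮ℒ (k : ℤ) → CuspForm 𝒮ℒ (k : ℤ)),
      (∑ f ∈ s, F f) z = ∑ f ∈ s, F f z := by
    classical
    intro s F
    induction s using Finset.induction_on with
    | empty => rfl
    | insert a s ha ih => rw [Finset.sum_insert ha, Finset.sum_insert ha, ← ih]; rfl
  rw [h3]
  refine Finset.sum_congr rfl fun f hf => ?_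
  have hf : f ∈ heckeBasis k := by simpa using hf
  rw [← conj_peterssonProd, peterssonProd_reproKernel hk hk2, map_mul, map_mul, map_ofNat,
    conj_reproConst hk2, conj_apply_of_mem_heckeBasis hk hk2 hf w' w h1.symm]
  simp only [smul_apply, smul_eq_mul]
  ring

end

/-! ### The Petersson formula -/

lemma norm_cexp_line (j : ℕ) (x y : ℝ) :
    ‖cexp (2 * π * Complex.I * j * (x + y * Complex.I))‖ = Real.exp (-2 * π * j * y) := by
  rw [norm_cexp_two_pi]; simp

lemma integral_cexp_eq_ite (j n : ℕ) :
    ∫ x in (0 : ℝ)..1, cexp (2 * π * Complex.I * j * x) * cexp (-(2 * π * Complex.I * n * x)) =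
      if j = n then 1 else 0 := by
  simp_rw [← Complex.exp_add]
  split_ifs with h
  · subst h; simp
  · have hc : (2 * π * Complex.I * (j - n) : ℂ) ≠ 0 := by
      refine mul_ne_zero Complex.two_pi_I_ne_zero (sub_ne_zero.mpr ?_)
      exact_mod_cast h
    have h1 : ∀ x : ℝ, cexp (2 * π * Complex.I * j * x + -(2 * π * Complex.I * n * x)) =
        cexp (2 * π * Complex.I * (j - n) * x) := fun x => by congr 1; ring
    simp_rw [h1]
    rw [integral_exp_mul_complex hc]
    have h2 : cexp (2 * π * Complex.I * (j - n) * (1 : ℝ)) = 1 := by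
      rw [Complex.exp_eq_one_iff]
      exact ⟨(j : ℤ) - n, by push_cast; ring⟩
    rw [h2]; simp

/-- Cauchy's estimate for the coefficients of a Fourier series on a horizontal line. -/
lemma norm_coeff_le {b : ℕ → ℂ} {y : ℝ} (hs : Summable fun j => ‖b j‖ * Real.exp (-2 * π * j * y))
    {B : ℝ} (hB : ∀ x : ℝ, 0 ≤ x → x ≤ 1 →
      ‖∑' j, b j * cexp (2 * π * Complex.I * j * (x + y * Complex.I))‖ ≤ B) (n : ℕ) :
    ‖b n‖ ≤ B * Real.exp (2 * π * n * y) := by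
  set F : ℕ → ℝ → ℂ := fun j x => b j * cexp (2 * π * Complex.I * j * (x + y * Complex.I)) *
    cexp (-(2 * π * Complex.I * n * x)) with hF
  have hunit : ∀ x : ℝ, ‖cexp (-(2 * π * Complex.I * n * x))‖ = 1 := fun x => by
    have : (-(2 * π * Complex.I * n * x) : ℂ) = ((-(2 * π * n * x) : ℝ) : ℂ) * Complex.I := by
      push_cast; ring
    rw [this, Complex.norm_exp_ofReal_mul_I]
  have hnorm : ∀ j x, ‖F j x‖ = ‖b j‖ * Real.exp (-2 * π * j * y) := fun j x => by
    rw [hF]; simp only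
    rw [norm_mul, norm_mul, hunit, norm_cexp_line, mul_one]
  have hint : ∀ j, Integrable (F j) (volume.restrict (Set.Ioc (0 : ℝ) 1)) := fun j => by
    have : Continuous (F j) := by rw [hF]; fun_prop
    exact (this.continuousOn.integrableOn_Icc).mono_set Set.Ioc_subset_Icc_self
  have h1 : ∫ x in Set.Ioc (0 : ℝ) 1, ∑' j, F j x = b n * Real.exp (-2 * π * n * y) := by
    rw [← integral_tsum_of_summable_integral_norm hint (by
      simp_rw [hnorm]
      simpa using hs)]
    have h2 : ∀ j, ∫ x in Set.Ioc (0 : ℝ) 1, F j x =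
        if j = n then b n * Real.exp (-2 * π * n * y) else 0 := by
      intro j
      have h3 : ∀ x : ℝ, F j x = b j * Real.exp (-2 * π * j * y) *
          (cexp (2 * π * Complex.I * j * x) * cexp (-(2 * π * Complex.I * n * x))) := by
        intro x
        have : cexp (2 * π * Complex.I * j * (x + y * Complex.I)) =
            Real.exp (-2 * π * j * y) * cexp (2 * π * Complex.I * j * x) := by
          rw [Complex.ofReal_exp, ← Complex.exp_add]
          congr 1
          push_cast
          linear_combination (2 * π * j * y) * Complex.I_mul_I
        rw [hF]; simp only
        rw [this]; ring
      simp_rw [h3]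
      rw [integral_const_mul, ← intervalIntegral.integral_of_le zero_le_one,
        integral_cexp_eq_ite]
      split_ifs with h
      · subst h; ring
      · ring
    simp_rw [h2]
    rw [tsum_ite_eq]
  have h2 : ‖b n * Real.exp (-2 * π * n * y)‖ ≤ B := by
    rw [← h1]
    have := norm_setIntegral_le_of_norm_le_const (μ := volume) (s := Set.Ioc (0 : ℝ) 1) (C := B)
      (f := fun x => ∑' j, F j x) (by simp) (fun x hx => by
        have h3 : ∑' j, F j x = (∑' j, b j * cexp (2 * π * Complex.I * j * (x + y * Complex.I))) *
          cexp (-(2 * π * Complex.I * n * x)) := tsum_mul_right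
        rw [h3, norm_mul, hunit, mul_one]
        exact hB x hx.1.le hx.2)
    simpa using this
  rw [norm_mul, Complex.norm_real, Real.norm_of_nonneg (Real.exp_nonneg _)] at h2
  calc ‖b n‖ = ‖b n‖ * Real.exp (-2 * π * n * y) * Real.exp (2 * π * n * y) := by
        rw [mul_assoc, ← Real.exp_add]
        have : -2 * π * n * y + 2 * π * n * y = 0 := by ring
        rw [this, Real.exp_zero, mul_one]
    _ ≤ _ := by gcongr

/-- The matrices `± (1 b; 0 1)`. -/
def upperUnipotent (q : ℤˣ × ℤ) : FixedDetMatrix (Fin 2) ℤ 1 :=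
  ⟨!![(q.1 : ℤ), q.1 * q.2; 0, q.1], by
    rw [Matrix.det_fin_two_of]
    rcases Int.units_eq_one_or q.1 with h | h <;> simp [h]⟩

/-- The integral matrices of determinant one with vanishing lower left entry. -/
def upperUnipotentEquiv : ℤˣ × ℤ ≃ {M : FixedDetMatrix (Fin 2) ℤ 1 | M.1 1 0 = 0} :=
  Equiv.ofBijective (fun q => ⟨upperUnipotent q, rfl⟩) <| by
    constructor
    · rintro ⟨e, b⟩ ⟨e', b'⟩ h
      have h := congrArg (fun M => M.1.1) h
      have h0 : (e : ℤ) = e' := congrFun (congrFun h 0) 0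
      have h1 : (e * b : ℤ) = e' * b' := congrFun (congrFun h 0) 1
      have he : e = e' := Units.ext h0
      subst he
      rw [(Units.isUnit e).mul_right_inj] at h1
      rw [h1]
    · rintro ⟨⟨M, hM⟩, h⟩
      have h : M 1 0 = 0 := h
      have hdet := hM
      rw [Matrix.det_fin_two, h, mul_zero, sub_zero] at hdet
      have hu : IsUnit (M 0 0) := IsUnit.of_mul_eq_one _ hdet
      obtain ⟨e, he⟩ := hu
      have h11 : M 1 1 = e := by
        rw [← he] at hdet
        rcases Int.units_eq_one_or e with h' | h' <;> simp [h'] at hdet ⊢ <;> omega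
      refine ⟨(e, e * M 0 1), ?_⟩
      apply Subtype.ext
      apply Subtype.ext
      change !![(e : ℤ), e * (e * M 0 1); 0, e] = M
      have h01 : (e : ℤ) * (e * M 0 1) = M 0 1 := by
        rcases Int.units_eq_one_or e with h' | h' <;> simp [h']
      rw [h01]
      conv_rhs => rw [Matrix.eta_fin_two M, h, h11, ← he]

section

variable {k : ℕ}

/-- The matrices `± (1 b; 0 1)` contribute the Lipschitz series to the kernel. It will give the
diagonal term of the Petersson formula. -/
lemma tsum_upperUnipotent (hk : 8 ≤ k) (hk2 : Even k) {z w : ℂ} (hz : 0 < z.im) (hw : 0 < w.im) :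
    ∑' M : {M : FixedDetMatrix (Fin 2) ℤ 1 | M.1 1 0 = 0}, (kernelForm M.1.1 z w ^ k)⁻¹ =
      2 * ((2 * π * Complex.I) ^ k / (k - 1)! *
        ∑' n : ℕ, (n : ℂ) ^ (k - 1) * cexp (2 * π * Complex.I * n * (z + w))) := by
  have hterm : ∀ q : ℤˣ × ℤ, (kernelForm (upperUnipotentEquiv q).1.1 z w ^ k)⁻¹ =
      ((z + w + q.2) ^ k)⁻¹ := by
    rintro ⟨e, b⟩
    change (kernelForm !![(e : ℤ), e * b; 0, e] z w ^ k)⁻¹ = _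
    have : kernelForm !![(e : ℤ), e * b; 0, e] z w = ((e : ℤ) : ℂ) * (z + w + b) := by
      simp [kernelForm]; ring
    rw [this, mul_pow]
    have h1 : (((e : ℤ) : ℂ)) ^ k = 1 := by
      rcases Int.units_eq_one_or e with h | h <;> simp [h, hk2.neg_one_pow]
    rw [h1, one_mul]
  have hs := ((summable_kernel_term one_pos hk hz hw).subtype
    {M : FixedDetMatrix (Fin 2) ℤ 1 | M.1 1 0 = 0})
  have hs' : Summable fun q : ℤˣ × ℤ => ((z + w + q.2) ^ k)⁻¹ :=
    (upperUnipotentEquiv.summable_iff.mpr hs).congr hterm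
  rw [← upperUnipotentEquiv.tsum_eq fun M => (kernelForm M.1.1 z w ^ k)⁻¹]
  simp_rw [hterm]
  rw [hs'.tsum_prod, tsum_fintype]
  simp only
  rw [Finset.sum_const, Finset.card_univ, Fintype.card_units_int,
    lipschitz_formula (by omega) hk2 (by rw [Complex.add_im]; positivity)]
  simp

/-- The kernel minus the contribution of the matrices with vanishing lower left entry: all remaining
terms are bounded by a power of `(Im z Im w)⁻¹`. -/
lemma norm_kernel_sub_le (hk : 8 ≤ k) (hk2 : Even k) {z w : ℂ} {κ : ℝ} (hκ : 0 < κ) (hκ1 : κ ≤ 1)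
    (hz : κ ≤ z.im) (hw : κ ≤ w.im) (hz' : |z.re| ≤ 1) (hw' : |w.re| ≤ 1) :
    ‖kernel k 1 z w - 2 * ((2 * π * Complex.I) ^ k / (k - 1)! *
        ∑' n : ℕ, (n : ℂ) ^ (k - 1) * cexp (2 * π * Complex.I * n * (z + w)))‖ ≤
      ((z.im * w.im) ^ (k - 8))⁻¹ * (5 / κ ^ 2) ^ 8 *
        ∑' M : FixedDetMatrix (Fin 2) ℤ 1, matrixWeight M.1 := by
  have hz0 : 0 < z.im := hκ.trans_le hz
  have hw0 : 0 < w.im := hκ.trans_le hw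
  have hs := summable_kernel_term one_pos hk hz0 hw0
  rw [← tsum_upperUnipotent hk hk2 hz0 hw0, kernel,
    ← hs.tsum_subtype_add_tsum_subtype_compl {M : FixedDetMatrix (Fin 2) ℤ 1 | M.1 1 0 = 0},
    add_sub_cancel_left]
  have hsw := (summable_matrixWeight 1).mul_left (((z.im * w.im) ^ (k - 8))⁻¹ * (5 / κ ^ 2) ^ 8)
  refine (tsum_of_norm_bounded (hsw.subtype _).hasSum fun M => ?_).trans ?_
  · have h := inv_norm_kernelForm_pow_le (det_pos_of_fixedDet one_pos M.1) hκ hκ1 le_rfl hz hw hz' hw'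
      (mul_pos hz0 hw0) (im_mul_im_le_norm_kernelForm (det_pos_of_fixedDet one_pos M.1)
        (fun h => M.2 h) hz0 hw0) hk
    simpa using h
  · rw [← tsum_mul_left]
    exact hsw.tsum_subtype_le _ _ fun M => mul_nonneg (by positivity) (matrixWeight_nonneg _)

/-- The weight `(k-2)! / ((4π)^{k-1} ⟨f, f⟩)` of a form in the Petersson formula. -/
def heckeWeight (f : CuspForm 𝒮ℒ (k : ℤ)) : ℂ :=
  (k - 2)! / ((4 * π) ^ (k - 1) * peterssonProd f f)

/-- The Petersson formula before normalization, on the lines `Im z = y` and `Im w = v`: Cauchy's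
estimate in both variables applied to `norm_kernel_sub_le`, with the spectral expansion inserted for
the kernel. -/
lemma norm_petersson_le (hk : 9 ≤ k) (hk2 : Even k) {κ y v : ℝ} (hκ : 0 < κ) (hκ1 : κ ≤ 1)
    (hy : κ ≤ y) (hv : κ ≤ v) (m n : ℕ) :
    ‖∑ f ∈ (finite_heckeBasis hk hk2).toFinset, 2 * reproConst k / peterssonProd f f *
        ((qExpansion 1 f).coeff m * (qExpansion 1 f).coeff n) -
      (if m = n then 2 * ((2 * π * Complex.I) ^ k / (k - 1)!) * (n : ℂ) ^ (k - 1) else 0)‖ ≤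
    ((y * v) ^ (k - 8))⁻¹ * (5 / κ ^ 2) ^ 8 *
        (∑' M : FixedDetMatrix (Fin 2) ℤ 1, matrixWeight M.1) *
      Real.exp (2 * π * n * v) * Real.exp (2 * π * m * y) := by
  have hy0 : 0 < y := hκ.trans_le hy
  have hv0 : 0 < v := hκ.trans_le hv
  set H := (finite_heckeBasis hk hk2).toFinset
  set α : CuspForm 𝒮ℒ (k : ℤ) → ℂ := fun f => 2 * reproConst k / peterssonProd f f
  set C : ℂ := 2 * ((2 * π * Complex.I) ^ k / (k - 1)!) with hC
  set B := ((y * v) ^ (k - 8))⁻¹ * (5 / κ ^ 2) ^ 8 *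
        (∑' M : FixedDetMatrix (Fin 2) ℤ 1, matrixWeight M.1)
  -- The coefficients in `w`, for fixed `z`.
  set b : ℍ → ℕ → ℂ := fun z j => ∑ f ∈ H, α f * f z * (qExpansion 1 f).coeff j -
    C * (j : ℂ) ^ (k - 1) * cexp (2 * π * Complex.I * j * z) with hb
  have hexp : ∀ (z : ℂ) (hz : 0 < z.im), Summable fun j : ℕ => (j : ℂ) ^ (k - 1) *
      cexp (2 * π * Complex.I * j * z) := fun z hz => by
    refine Summable.of_norm ?_
    simp_rw [norm_mul, norm_pow, Complex.norm_natCast, norm_cexp_two_pi]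
    exact summable_pow_mul_exp _ hz
  have h1 : ∀ z : ℍ, z.im = y → |z.re| ≤ 1 → ‖b z n‖ ≤ B * Real.exp (2 * π * n * v) := by
    intro z hzy hzx
    refine norm_coeff_le ?_ (fun u hu0 hu1 => ?_) n
    · have e1 : Summable fun j : ℕ => ∑ f ∈ H, ‖α f * f z‖ *
          (‖(qExpansion 1 f).coeff j‖ * Real.exp (-2 * π * j * v)) :=
        summable_sum fun f _ => (summable_norm_coeff f hv0).mul_left _
      have e2 := (summable_pow_mul_exp (k - 1) hv0).mul_left ‖C‖
      refine Summable.of_nonneg_of_le (fun j => by positivity) (fun j => ?_) (e1.add e2)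
      have e3 : ‖b z j‖ ≤ ∑ f ∈ H, ‖α f * f z‖ * ‖(qExpansion 1 f).coeff j‖ + ‖C‖ * (j : ℝ) ^ (k - 1) := by
        refine (norm_sub_le _ _).trans (add_le_add ((norm_sum_le _ _).trans
          (Finset.sum_le_sum fun f _ => (norm_mul _ _).le)) ?_)
        rw [norm_mul, norm_mul, norm_pow, Complex.norm_natCast, norm_cexp_two_pi]
        refine mul_le_of_le_one_right (by positivity) (Real.exp_le_one_iff.mpr ?_)
        have : 0 ≤ 2 * π * j * (z : ℂ).im := by rw [UpperHalfPlane.coe_im, hzy]; positivity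
        linarith
      calc _ ≤ (∑ f ∈ H, ‖α f * f z‖ * ‖(qExpansion 1 f).coeff j‖ + ‖C‖ * (j : ℝ) ^ (k - 1)) *
            Real.exp (-2 * π * j * v) := by gcongr
        _ = _ := by
          rw [add_mul, Finset.sum_mul]
          congr 1
          · exact Finset.sum_congr rfl fun f _ => by ring
          · ring
    · set w : ℍ := ofComplex (u + v * Complex.I) with hw
      have hwc : (w : ℂ) = u + v * Complex.I := coe_ofComplex_mk u hv0
      have h2 : ∑' j, b z j * cexp (2 * π * Complex.I * j * (u + v * Complex.I)) =
          kernel k 1 z w - 2 * ((2 * π * Complex.I) ^ k / (k - 1)! *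
        ∑' n : ℕ, (n : ℂ) ^ (k - 1) * cexp (2 * π * Complex.I * n * (z + w))) := by
        rw [kernel_eq_sum hk hk2, ← mul_assoc, ← hC]
        refine HasSum.tsum_eq ?_
        have h3 : HasSum (fun j : ℕ => ∑ f ∈ H, α f * f z * ((qExpansion 1 f).coeff j *
            cexp (2 * π * Complex.I * j * w))) (∑ f ∈ H, α f * (f z * f w)) := by
          simp_rw [← mul_assoc (α _) (_ : ℂ) (_ : ℂ)]
          exact hasSum_sum fun f _ => by
            have := (hasSum_coeff f w).mul_left (α f * f z)
            simpa only [mul_assoc] using this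
        have h4 := ((hexp (z + w) (by
          rw [Complex.add_im]; exact add_pos z.im_pos w.im_pos)).hasSum.mul_left C)
        refine (h3.sub h4).congr_fun fun j => ?_
        rw [hb]; simp only
        rw [sub_mul, Finset.sum_mul, ← hwc]
        congr 1
        · exact Finset.sum_congr rfl fun f _ => by ring
        · rw [mul_add, Complex.exp_add]; ring
      rw [h2]
      have h5 := norm_kernel_sub_le (k := k) (by omega) hk2 hκ hκ1 (z := z) (w := w)
        (by rw [UpperHalfPlane.coe_im, hzy]; exact hy) (by rw [hwc]; simpa using hv)
        (by rw [UpperHalfPlane.coe_re]; exact hzx)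
        (by rw [hwc]; simpa using abs_le.mpr ⟨by linarith, hu1⟩)
      have h6 : (z : ℂ).im * (w : ℂ).im = y * v := by
        rw [hwc, UpperHalfPlane.coe_im, hzy]; simp
      rw [h6] at h5
      exact h5
  -- The coefficients of `b z n` as a function of `z`.
  set b' : ℕ → ℂ := fun j => ∑ f ∈ H, α f * (qExpansion 1 f).coeff n * (qExpansion 1 f).coeff j -
    (if j = n then C * (n : ℂ) ^ (k - 1) else 0) with hb'
  have h2 : ‖b' m‖ ≤ B * Real.exp (2 * π * n * v) * Real.exp (2 * π * m * y) := by
    refine norm_coeff_le ?_ (fun x hx0 hx1 => ?_) m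
    · have e1 : Summable fun j : ℕ => ∑ f ∈ H, ‖α f * (qExpansion 1 f).coeff n‖ *
          (‖(qExpansion 1 f).coeff j‖ * Real.exp (-2 * π * j * y)) :=
        summable_sum fun f _ => (summable_norm_coeff f hy0).mul_left _
      have e2 : Summable fun j : ℕ => if j = n then ‖C * (n : ℂ) ^ (k - 1)‖ *
          Real.exp (-2 * π * n * y) else 0 :=
        (hasSum_ite_eq n _).summable
      refine Summable.of_nonneg_of_le (fun j => by positivity) (fun j => ?_) (e1.add e2)
      have e3 : ‖b' j‖ ≤ ∑ f ∈ H, ‖α f * (qExpansion 1 f).coeff n‖ * ‖(qExpansion 1 f).coeff j‖ +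
          ‖if j = n then C * (n : ℂ) ^ (k - 1) else 0‖ := by
        exact (norm_sub_le _ _).trans (add_le_add ((norm_sum_le _ _).trans
          (Finset.sum_le_sum fun f _ => (norm_mul _ _).le)) le_rfl)
      calc _ ≤ (∑ f ∈ H, ‖α f * (qExpansion 1 f).coeff n‖ * ‖(qExpansion 1 f).coeff j‖ +
            ‖if j = n then C * (n : ℂ) ^ (k - 1) else 0‖) * Real.exp (-2 * π * j * y) := by gcongr
        _ = _ := by
          rw [add_mul, Finset.sum_mul]
          congr 1
          · exact Finset.sum_congr rfl fun f _ => by ring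
          · split_ifs with h
            · rw [h]
            · simp
    · set z : ℍ := ofComplex (x + y * Complex.I) with hz
      have hzc : (z : ℂ) = x + y * Complex.I := coe_ofComplex_mk x hy0
      have h3 : ∑' j, b' j * cexp (2 * π * Complex.I * j * (x + y * Complex.I)) = b z n := by
        refine HasSum.tsum_eq ?_
        have h4 : HasSum (fun j : ℕ => ∑ f ∈ H, α f * (qExpansion 1 f).coeff n *
            ((qExpansion 1 f).coeff j * cexp (2 * π * Complex.I * j * z)))
            (∑ f ∈ H, α f * (qExpansion 1 f).coeff n * f z) :=
          hasSum_sum fun f _ => (hasSum_coeff f z).mul_left _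
        have h5 := hasSum_ite_eq n (C * (n : ℂ) ^ (k - 1) * cexp (2 * π * Complex.I * n * z))
        have h6 : b z n = ∑ f ∈ H, α f * (qExpansion 1 f).coeff n * f z -
            C * (n : ℂ) ^ (k - 1) * cexp (2 * π * Complex.I * n * z) := by
          rw [hb]; simp only
          congr 1
          exact Finset.sum_congr rfl fun f _ => by ring
        rw [h6]
        refine (h4.sub h5).congr_fun fun j => ?_
        rw [hb']; simp only
        rw [sub_mul, Finset.sum_mul, ← hzc]
        congr 1
        · exact Finset.sum_congr rfl fun f _ => by ring
        · split_ifs with h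
          · rw [h]
          · ring
      rw [h3]
      refine h1 z (by rw [← UpperHalfPlane.coe_im, hzc]; simp) ?_
      rw [← UpperHalfPlane.coe_re, hzc]
      simpa using abs_le.mpr ⟨by linarith, hx1⟩
  refine le_trans (le_of_eq ?_) h2
  rw [hb']
  simp only
  congr 2
  exact Finset.sum_congr rfl fun f _ => by ring

lemma coeff_eq_normCoeff_mul (f : CuspForm 𝒮ℒ (k : ℤ)) {n : ℕ} (hn : 0 < n) :
    (qExpansion 1 f).coeff n = normCoeff f n * (((n : ℝ) ^ (((k : ℝ) - 1) / 2) : ℝ) : ℂ) := by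
  have : (((n : ℝ) ^ (((k : ℝ) - 1) / 2) : ℝ) : ℂ) ≠ 0 := by
    have : 0 < (n : ℝ) ^ (((k : ℝ) - 1) / 2) := by positivity
    exact_mod_cast this.ne'
  rw [normCoeff, div_mul_cancel₀ _ this]

lemma rpow_half_mul_rpow_half (hk : 1 ≤ k) (m n : ℕ) :
    (m : ℝ) ^ (((k : ℝ) - 1) / 2) * (n : ℝ) ^ (((k : ℝ) - 1) / 2) = √(m * n) ^ (k - 1) := by
  rw [← Real.mul_rpow (by positivity) (by positivity), Real.sqrt_eq_rpow, ← Real.rpow_natCast,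
    ← Real.rpow_mul (by positivity)]
  congr 1
  push_cast [Nat.cast_sub hk]
  ring

/-- The **Petersson formula** with an explicit error term. The Fourier coefficients at `m` and `n`
are taken on the lines of height `k / (2π m)` and `k / (2π n)`, where the exponentials are of size
`e^k` only and the product of the heights is `(2π √(m n) / k)⁻²`. -/
theorem petersson_formula (hk : 16 ≤ k) (hk2 : Even k) {m n M : ℕ} (hm : 0 < m) (hn : 0 < n)
    (hmM : m ≤ M) (hnM : n ≤ M) :
    ‖∑ f ∈ (finite_heckeBasis (by omega : 9 ≤ k) hk2).toFinset,
        heckeWeight f * (normCoeff f m * normCoeff f n) - (if m = n then 1 else 0)‖ ≤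
      (∑' M : FixedDetMatrix (Fin 2) ℤ 1, matrixWeight M.1) * (245 * M ^ 2) ^ 8 *
        (Real.exp (2 * k) * √(m * n) * (2 * π * √(m * n) / k) ^ (k - 16)) := by
  have hk9 : 9 ≤ k := by omega
  set H := (finite_heckeBasis hk9 hk2).toFinset
  set P := √((m : ℝ) * n) with hP
  set S := ∑' M : FixedDetMatrix (Fin 2) ℤ 1, matrixWeight M.1
  have hP0 : 0 < P := Real.sqrt_pos.mpr (by positivity)
  have hk0 : (0 : ℝ) < k := by exact_mod_cast (by omega : 0 < k)
  have hk1 : (1 : ℝ) ≤ k := by exact_mod_cast (by omega : 1 ≤ k)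
  have hM0 : 0 < M := by omega
  have hM1 : (1 : ℝ) ≤ M := by exact_mod_cast hM0
  set E := ∑ f ∈ H, heckeWeight f * (normCoeff f m * normCoeff f n) - (if m = n then 1 else 0)
    with hE
  have hpi : π < 3.15 := Real.pi_lt_d2
  have hheight : ∀ j : ℕ, 0 < j → j ≤ M → 1 / (7 * (M : ℝ)) ≤ k / (2 * π * j) := by
    intro j hj hjM
    have : (j : ℝ) ≤ M := by exact_mod_cast hjM
    have hj0 : (0 : ℝ) < j := by exact_mod_cast hj
    rw [div_le_div_iff₀ (by positivity) (by positivity)]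
    calc 1 * (2 * π * j) ≤ 7 * M := by nlinarith
      _ ≤ k * (7 * M) := le_mul_of_one_le_left (by positivity) hk1
  -- `7 > 2π`, so that `1 / (7 M)` is a lower bound for both heights.
  have h := norm_petersson_le hk9 hk2 (κ := 1 / (7 * M)) (y := k / (2 * π * m))
    (v := k / (2 * π * n)) (by positivity)
    (by rw [div_le_one (by positivity)]; linarith) (hheight m hm hmM) (hheight n hn hnM) m n
  have hpr : (0 : ℝ) < ‖(2 * π * Complex.I : ℂ) ^ k / (k - 1)!‖ := by
    rw [norm_pos_iff]
    exact div_ne_zero (pow_ne_zero _ Complex.two_pi_I_ne_zero)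
      (by exact_mod_cast (Nat.factorial_pos _).ne')
  have hC : ‖(2 * π * Complex.I : ℂ) ^ k / (k - 1)!‖ = (2 * π) ^ k / (k - 1)! := by
    rw [norm_div, norm_pow, norm_mul, norm_mul, Complex.norm_I, Complex.norm_natCast,
      Complex.norm_real, Real.norm_of_nonneg Real.pi_pos.le]
    norm_num
  have hfac : ∑ f ∈ H, 2 * reproConst k / peterssonProd f f *
        ((qExpansion 1 f).coeff m * (qExpansion 1 f).coeff n) -
      (if m = n then 2 * ((2 * π * Complex.I) ^ k / (k - 1)!) * (n : ℂ) ^ (k - 1) else 0) =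
      2 * ((2 * π * Complex.I) ^ k / (k - 1)!) * ((P ^ (k - 1) : ℝ) : ℂ) * E := by
    rw [hE, mul_sub, Finset.mul_sum]
    congr 1
    · refine Finset.sum_congr rfl fun f _ => ?_
      rw [coeff_eq_normCoeff_mul f hm, coeff_eq_normCoeff_mul f hn, hP,
        ← rpow_half_mul_rpow_half (by omega), reproConst, heckeWeight]
      push_cast
      rw [← div_div]
      ring
    · split_ifs with h
      · subst h
        rw [hP, Real.sqrt_mul_self (by positivity)]
        push_cast; ring
      · ring
  rw [hfac, norm_mul, norm_mul, norm_mul, hC, Complex.norm_real, Real.norm_of_nonneg (by positivity)]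
    at h
  have e1 : Real.exp (2 * π * n * (k / (2 * π * n))) = Real.exp k := by congr 1; field_simp
  have e2 : Real.exp (2 * π * m * (k / (2 * π * m))) = Real.exp k := by congr 1; field_simp
  have e3 : (5 / (1 / (7 * (M : ℝ))) ^ 2) = 245 * M ^ 2 := by field_simp; norm_num
  have e4 : (k / (2 * π * m) * (k / (2 * π * n)) : ℝ) = ((2 * π * P / k) ^ 2)⁻¹ := by
    rw [div_pow, mul_pow, hP, Real.sq_sqrt (by positivity)]; field_simp
  rw [e1, e2, e3, e4, inv_pow, inv_inv, ← pow_mul] at h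
  have h2 : ‖(2 : ℂ)‖ = 2 := by norm_num
  rw [h2] at h
  set t := 2 * π * P / k with ht
  have ht0 : 0 < t := by positivity
  -- The normalizing factor is at least `t ^ k / P`, which leaves `t ^ (2 (k - 8) - k)`.
  have hfacle : t ^ k ≤ (2 * π) ^ k / (k - 1)! * P ^ (k - 1) * P := by
    have h3 : ((k - 1)! : ℝ) ≤ (k : ℝ) ^ k := by
      have : (k - 1)! ≤ k ^ k := (Nat.factorial_le (Nat.sub_le k 1)).trans (Nat.factorial_le_pow k)
      exact_mod_cast this
    have h4 : P ^ (k - 1) * P = P ^ k := by rw [← pow_succ]; congr 1; omega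
    rw [mul_assoc, h4, ht, div_pow, mul_pow (2 * π) P, div_mul_eq_mul_div]
    exact div_le_div_of_nonneg_left (by positivity) (by positivity) h3
  have h5 : t ^ (2 * (k - 8)) = t ^ k * t ^ (k - 16) := by rw [← pow_add]; congr 1; omega
  have h6 : t ^ k * ‖E‖ ≤ t ^ k * (S * (245 * M ^ 2) ^ 8 *
        (Real.exp (2 * k) * P * t ^ (k - 16))) := by
    have hS : 0 ≤ S := tsum_nonneg fun _ => matrixWeight_nonneg _
    have hexp : Real.exp k * Real.exp k = Real.exp (2 * k) := by rw [← Real.exp_add]; congr 1; ring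
    calc t ^ k * ‖E‖ ≤ (2 * π) ^ k / (k - 1)! * P ^ (k - 1) * P * ‖E‖ := by gcongr
      _ = (2 * ((2 * π) ^ k / (k - 1)!) * P ^ (k - 1) * ‖E‖) * (P / 2) := by ring
      _ ≤ (t ^ (2 * (k - 8)) * (245 * M ^ 2) ^ 8 * S * Real.exp k * Real.exp k) * (P / 2) := by gcongr
      _ = t ^ k * (S * (245 * M ^ 2) ^ 8 * (Real.exp (2 * k) * P * t ^ (k - 16))) / 2 := by
        rw [h5, ← hexp]; ring
      _ ≤ _ := half_le_self (by positivity)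
  exact le_of_mul_le_mul_left h6 (by positivity)

end

/-! ### The Epstein zeta function and the unfolding method -/

/-- The term `|c z + d|^{-2s}` of the Epstein zeta function. -/
def latticeTerm (s z : ℂ) (v : Fin 2 → ℤ) : ℂ := ((‖(v 0 : ℂ) * z + v 1‖ : ℝ) : ℂ) ^ (-2 * s)

/-- The Epstein zeta function `∑_{(c, d) ≠ 0} |c z + d|^{-2s}`. The term at `(0, 0)` may be kept in
the sum, since `0 ^ (-2 * s) = 0` for `s ≠ 0`. -/
def epstein (s z : ℂ) : ℂ := ∑' v : Fin 2 → ℤ, latticeTerm s z v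

lemma norm_latticeTerm {s : ℂ} (hs : s.re ≠ 0) (z : ℂ) (v : Fin 2 → ℤ) :
    ‖latticeTerm s z v‖ = ‖(v 0 : ℂ) * z + v 1‖ ^ (-(2 * s.re)) := by
  rw [latticeTerm, Complex.norm_cpow_eq_rpow_re_of_nonneg (norm_nonneg _)]
  · simp
  · simpa using hs

lemma summable_norm_latticeTerm {s : ℂ} (hs : 1 < s.re) (z : ℍ) :
    Summable fun v => ‖latticeTerm s z v‖ := by
  simp_rw [norm_latticeTerm (by linarith : s.re ≠ 0)]
  exact Summable.of_nonneg_of_le (fun _ => by positivity)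
    (fun v => EisensteinSeries.summand_bound z (by linarith) v)
    ((EisensteinSeries.summable_one_div_norm_rpow (by linarith)).mul_left _)

lemma latticeTerm_of_gammaSet (s z : ℂ) {n : ℕ} (v : EisensteinSeries.gammaSet 1 n 0) :
    latticeTerm s z v = (n : ℂ) ^ (-2 * s) * latticeTerm s z (EisensteinSeries.divIntMap n v.1) := by
  have h : (v.1 0 : ℂ) * z + v.1 1 = n * ((EisensteinSeries.divIntMap n v.1 0 : ℂ) * z +
      (EisensteinSeries.divIntMap n v.1 1 : ℤ)) := by
    have h0 := EisensteinSeries.gammaSet_eq_gcd_mul_divIntMap v.2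
    have e0 : (v.1 0 : ℂ) = n * (EisensteinSeries.divIntMap n v.1 0 : ℤ) := by
      have := congrFun h0 0
      rw [Pi.smul_apply, nsmul_eq_mul] at this
      exact_mod_cast this
    have e1 : (v.1 1 : ℂ) = n * (EisensteinSeries.divIntMap n v.1 1 : ℤ) := by
      have := congrFun h0 1
      rw [Pi.smul_apply, nsmul_eq_mul] at this
      exact_mod_cast this
    rw [e0, e1]; ring
  rw [latticeTerm, latticeTerm, h, norm_mul, Complex.norm_natCast, Complex.ofReal_mul,
    Complex.mul_cpow_ofReal_nonneg (by positivity) (norm_nonneg _), Complex.ofReal_natCast]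

lemma zeta_two_mul_eq_tsum {s : ℂ} (hs : 1 < s.re) :
    riemannZeta (2 * s) = ∑' n : ℕ, (n : ℂ) ^ (-2 * s) := by
  have h2s : 1 < (2 * s).re := by simp; linarith
  rw [zeta_eq_tsum_one_div_nat_cpow h2s]
  exact tsum_congr fun n => by rw [one_div, ← Complex.cpow_neg, neg_mul]

lemma tsum_gammaSet_latticeTerm {s : ℂ} (hs : 1 < s.re) (z : ℂ) (n : ℕ) :
    ∑' v : EisensteinSeries.gammaSet 1 n 0, latticeTerm s z v.1 =
      (n : ℂ) ^ (-2 * s) * ∑' v : EisensteinSeries.gammaSet 1 1 0, latticeTerm s z v.1 := by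
  rcases eq_or_ne n 0 with rfl | hn
  · have h0 : (-2 * s : ℂ) ≠ 0 := by
      intro h
      have := congrArg Complex.re h
      simp at this
      rw [this] at hs
      norm_num at hs
    simp only [latticeTerm_of_gammaSet, Nat.cast_zero, Complex.zero_cpow h0, zero_mul, tsum_zero]
  · have : NeZero n := ⟨hn⟩
    rw [← tsum_mul_left, ← (EisensteinSeries.gammaSetDivGcdEquiv n).tsum_eq]
    exact tsum_congr fun v => latticeTerm_of_gammaSet s z v

/-- Sorting the lattice points by their greatest common divisor leaves the sum over coprime pairs
and a factor `ζ(2s)`. -/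
lemma epstein_eq_zeta_mul {s : ℂ} (hs : 1 < s.re) (z : ℍ) : epstein s z =
    riemannZeta (2 * s) * ∑' v : EisensteinSeries.gammaSet 1 1 0, latticeTerm s z v.1 := by
  have hs1 := (summable_norm_latticeTerm hs z).of_norm
  have hsig : Summable fun p : Σ r : ℕ, EisensteinSeries.gammaSet 1 r 0 =>
      latticeTerm s z p.2.1 :=
    (EisensteinSeries.gammaSetDivGcdSigmaEquiv.symm.summable_iff.mpr hs1).congr
      fun _ => rfl
  have h1 : epstein s z = ∑' p : Σ r : ℕ, EisensteinSeries.gammaSet 1 r 0,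
      latticeTerm s z p.2.1 :=
    (EisensteinSeries.gammaSetDivGcdSigmaEquiv.symm.tsum_eq fun v => latticeTerm s z v).symm
  rw [h1, hsig.tsum_sigma, zeta_two_mul_eq_tsum hs, ← tsum_mul_right]
  exact tsum_congr fun n => tsum_gammaSet_latticeTerm hs z n

lemma eq_unipotent_mul {A B : Matrix (Fin 2) (Fin 2) ℤ} (hA : A.det = 1) (hB : B.det = 1)
    (h : A 1 = B 1) : ∃ n : ℤ, A = !![1, n; 0, 1] * B := by
  obtain ⟨a, b, c, d, rfl⟩ : ∃ a b c d, A = !![a, b; c, d] := ⟨_, _, _, _, Matrix.eta_fin_two A⟩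
  obtain ⟨p, q, r, t, rfl⟩ : ∃ a b c d, B = !![a, b; c, d] := ⟨_, _, _, _, Matrix.eta_fin_two B⟩
  have h0 : c = r := congrFun h 0
  have h1 : d = t := congrFun h 1
  subst h0 h1
  rw [Matrix.det_fin_two_of] at hA hB
  refine ⟨b * p - a * q, ?_⟩
  rw [Matrix.mul_fin_two]
  have e0 : 1 * p + (b * p - a * q) * c = a := by linear_combination a * hB - p * hA
  have e1 : 1 * q + (b * p - a * q) * d = b := by linear_combination b * hB - q * hA
  rw [e0, e1]
  simp

lemma SL_eq_T_zpow_mul {γ δ : SL(2, ℤ)} (h : γ.1 1 = δ.1 1) :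
    ∃ n : ℤ, γ = ModularGroup.T ^ n * δ := by
  obtain ⟨n, hn⟩ := eq_unipotent_mul γ.2 δ.2 h
  refine ⟨n, Subtype.ext ?_⟩
  rw [Matrix.SpecialLinearGroup.coe_mul, ModularGroup.coe_T_zpow]
  exact hn

/-- The elements of `SL(2, ℤ)` mapping `z` to the strip `0 ≤ Re z < 1`. -/
def stripSet (z : ℍ) : Set SL(2, ℤ) := {γ | 0 ≤ (γ • z).re ∧ (γ • z).re < 1}

/-- For each coprime pair there is exactly one matrix with this lower row mapping `z` to the
strip. -/
def stripEquiv (z : ℍ) : stripSet z ≃ EisensteinSeries.gammaSet 1 1 0 :=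
  Equiv.ofBijective (fun γ => ⟨γ.1.1 1, (EisensteinSeries.mem_gammaSet_one _).mpr
    (ModularGroup.bottom_row_coprime γ.1)⟩) <| by
    constructor
    · rintro ⟨γ, hγ⟩ ⟨δ, hδ⟩ h
      have h : γ.1 1 = δ.1 1 := congrArg Subtype.val h
      obtain ⟨n, hn⟩ := SL_eq_T_zpow_mul h
      have hre : (γ • z).re = (δ • z).re + n := by
        rw [hn, mul_smul]; exact ModularGroup.re_T_zpow_smul _ n
      have hn0 : n = 0 := by
        have h1 : (n : ℝ) < 1 := by linarith [hγ.2, hδ.1]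
        have h2 : (-1 : ℝ) < n := by linarith [hγ.1, hδ.2]
        have h1 : n < 1 := by exact_mod_cast h1
        have h2 : -1 < n := by exact_mod_cast h2
        omega
      rw [hn0, zpow_zero, one_mul] at hn
      exact Subtype.ext hn
    · rintro ⟨v, hv⟩
      obtain ⟨δ, -, hδ⟩ := ModularGroup.bottom_row_surj ((EisensteinSeries.mem_gammaSet_one v).mp hv)
      have hδ : δ.1 1 = v := hδ
      have hre : ((ModularGroup.T ^ (-⌊(δ • z).re⌋) * δ) • z).re = (δ • z).re - ⌊(δ • z).re⌋ := by
        rw [mul_smul, ModularGroup.re_T_zpow_smul]; push_cast; ring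
      refine ⟨⟨ModularGroup.T ^ (-⌊(δ • z).re⌋) * δ, ?_, ?_⟩, ?_⟩
      · rw [hre]; linarith [Int.floor_le (δ • z).re]
      · rw [hre]; linarith [Int.lt_floor_add_one (δ • z).re]
      · apply Subtype.ext
        change (ModularGroup.T ^ (-⌊(δ • z).re⌋) * δ).1 1 = v
        rw [← hδ]
        exact ModularGroup.T_pow_mul_apply_one _ _

open Classical in
/-- The function `y^s G` cut off to the strip `0 ≤ Re z < 1`. -/
def stripFun (s : ℂ) (G : ℍ → ℂ) (z : ℍ) : ℂ :=
  if 0 ≤ z.re ∧ z.re < 1 then (z.im : ℂ) ^ s * G z else 0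

lemma im_smul_cpow (s : ℂ) (γ : SL(2, ℤ)) (z : ℍ) :
    ((γ • z : ℍ).im : ℂ) ^ s = (z.im : ℂ) ^ s * latticeTerm s z (γ.1 1) := by
  have hd : denom γ z = (γ.1 1 0 : ℂ) * z + γ.1 1 1 := by simp [ModularGroup.denom_apply]
  have hd0 : 0 < ‖denom γ z‖ := norm_pos_iff.mpr (denom_ne_zero γ z)
  rw [ModularGroup.im_smul_eq_div_normSq, Complex.normSq_eq_norm_sq, div_eq_mul_inv,
    Complex.ofReal_mul, Complex.mul_cpow_ofReal_nonneg z.im_pos.le (by positivity), latticeTerm, ← hd]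
  congr 1
  set a := ‖denom γ z‖
  have ha : (a : ℂ) ≠ 0 := by exact_mod_cast hd0.ne'
  have ha2 : (((a ^ 2)⁻¹ : ℝ) : ℂ) ≠ 0 := by exact_mod_cast (by positivity : (a ^ 2)⁻¹ ≠ 0)
  rw [Complex.cpow_def_of_ne_zero ha2, Complex.cpow_def_of_ne_zero ha, ← Complex.ofReal_log hd0.le,
    ← Complex.ofReal_log (by positivity), Real.log_inv, Real.log_pow]
  congr 1
  push_cast
  ring

/-- Exactly one matrix with a given coprime lower row maps `z` into the strip, and its term is `y^s
|c z + d|^{-2s} G z`. -/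
lemma tsum_stripFun_smul (s : ℂ) {G : ℍ → ℂ} (hG : ∀ (γ : SL(2, ℤ)) z, G (γ • z) = G z) (z : ℍ) :
    ∑' γ : SL(2, ℤ), stripFun s G (γ • z) = G z * (z.im : ℂ) ^ s *
      ∑' v : EisensteinSeries.gammaSet 1 1 0, latticeTerm s z v := by
  have hsupp : Function.support (fun γ : SL(2, ℤ) => stripFun s G (γ • z)) ⊆ stripSet z := by
    intro γ hγ
    by_contra h
    refine hγ ?_
    have h : ¬ (0 ≤ (γ • z).re ∧ (γ • z).re < 1) := h
    simp only
    generalize γ • z = w at h ⊢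
    rw [stripFun, if_neg h]
  rw [← tsum_subtype_eq_of_support_subset hsupp, ← (stripEquiv z).tsum_eq, ← tsum_mul_left]
  refine tsum_congr fun γ => ?_
  have h : 0 ≤ (γ.1 • z).re ∧ (γ.1 • z).re < 1 := γ.2
  have h2 : stripFun s G (γ.1 • z) = ((γ.1 • z : ℍ).im : ℂ) ^ s * G (γ.1 • z) := by
    generalize γ.1 • z = w at h ⊢
    rw [stripFun, if_pos h]
  rw [h2, hG, im_smul_cpow]
  change _ = G z * (z.im : ℂ) ^ s * latticeTerm s z (γ.1.1 1)
  ring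

/-- Unfolding of the integral of an invariant function against the Epstein zeta function. -/
lemma integral_mul_epstein {s : ℂ} (hs : 1 < s.re) {G : ℍ → ℂ}
    (hG : ∀ (γ : SL(2, ℤ)) z, G (γ • z) = G z) (hint : Integrable (stripFun s G)) :
    ∫ z in (𝒟 : Set ℍ), G z * (z.im : ℂ) ^ s * epstein s z =
      2 * riemannZeta (2 * s) * ∫ z, stripFun s G z := by
  have h := integral_fd_tsum_smul hint
  simp_rw [tsum_stripFun_smul s hG] at h
  rw [mul_comm 2, mul_assoc, ← h, ← integral_const_mul]
  refine integral_congr_ae (Eventually.of_forall fun z => ?_)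
  simp only [epstein_eq_zeta_mul hs z]
  ring

/-! ### Mellin transforms of the zeroth Fourier coefficient -/

/-- The function `C y^(a-2)` on `(0, 1)`, continued by `C' y^(-2)` on `[1, ∞)`. -/
def cuspMajorant (a C C' y : ℝ) : ℝ :=
  (Set.Ioo (0 : ℝ) 1).indicator (fun y => C * y ^ (a - 2)) y +
    (Set.Ici (1 : ℝ)).indicator (fun y => C' * y ^ (-2 : ℝ)) y

lemma cuspMajorant_of_lt {y : ℝ} (a C C' : ℝ) (hy : 0 < y) (hy1 : y < 1) :
    cuspMajorant a C C' y = C * y ^ (a - 2) := by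
  rw [cuspMajorant, Set.indicator_of_mem (Set.mem_Ioo.mpr ⟨hy, hy1⟩),
    Set.indicator_of_notMem (by simpa using hy1), add_zero]

lemma cuspMajorant_of_le {y : ℝ} (a C C' : ℝ) (hy1 : 1 ≤ y) :
    cuspMajorant a C C' y = C' * y ^ (-2 : ℝ) := by
  rw [cuspMajorant, Set.indicator_of_mem (Set.mem_Ici.mpr hy1),
    Set.indicator_of_notMem (fun h => absurd h.2 (not_lt.mpr hy1)), zero_add]

lemma integrable_cuspMajorant {a : ℝ} (ha : 1 < a) (C C' : ℝ) :
    Integrable (cuspMajorant a C C') := by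
  refine Integrable.add ?_ ?_
  · rw [integrable_indicator_iff measurableSet_Ioo]
    refine Integrable.const_mul ?_ C
    have h := intervalIntegral.intervalIntegrable_rpow' (a := 0) (b := 1) (by linarith : -1 < a - 2)
    rw [intervalIntegrable_iff_integrableOn_Ioo_of_le zero_le_one] at h
    exact h
  · rw [integrable_indicator_iff measurableSet_Ici]
    refine Integrable.const_mul ?_ C'
    have := integrableOn_Ioi_rpow_of_lt (by norm_num : (-2 : ℝ) < -1) (by norm_num : (0 : ℝ) < 1 / 2)
    exact this.mono_set (fun y (hy : 1 ≤ y) => by simp only [Set.mem_Ioi]; linarith)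

lemma norm_im_cpow (s : ℂ) (z : ℍ) : ‖(z.im : ℂ) ^ s‖ = z.im ^ s.re :=
  Complex.norm_cpow_eq_rpow_re_of_pos z.im_pos s

/-- Boundedness of `G` is used near the real axis, rapid decay of `G` towards the cusp. -/
lemma norm_im_cpow_mul_le {G : ℍ → ℂ} {C C' : ℝ} {N : ℕ} (hC : ∀ z, ‖G z‖ ≤ C)
    (hC' : ∀ z : ℍ, 1 / 2 ≤ z.im → ‖G z‖ * z.im ^ N ≤ C') {s : ℂ} (hs : s.re ≤ N) (z : ℍ) :
    ‖(z.im : ℂ) ^ s * G z‖ ≤ z.im ^ 2 * cuspMajorant s.re C C' z.im := by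
  have hy := z.im_pos
  rw [norm_mul, norm_im_cpow]
  rcases lt_or_ge z.im 1 with h1 | h1
  · rw [cuspMajorant_of_lt _ _ _ hy h1, Real.rpow_sub hy, Real.rpow_ofNat]
    calc z.im ^ s.re * ‖G z‖ ≤ z.im ^ s.re * C := by gcongr; exact hC z
      _ = _ := by field_simp
  · rw [cuspMajorant_of_le _ _ _ h1, Real.rpow_neg hy.le, Real.rpow_ofNat]
    calc z.im ^ s.re * ‖G z‖ ≤ z.im ^ (N : ℝ) * ‖G z‖ := by
          gcongr
      _ = ‖G z‖ * z.im ^ N := by rw [Real.rpow_natCast, mul_comm]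
      _ ≤ C' := hC' z (by linarith)
      _ = _ := by field_simp

/-- A function of `y` on the strip `0 ≤ Re z < 1`, weighted to cancel the density `y⁻²` of the
hyperbolic measure, is integrable whenever it is integrable on the line. -/
lemma integrable_strip {ψ : ℝ → ℝ} (hψ : Integrable ψ) :
    Integrable fun z : ℍ => if 0 ≤ z.re ∧ z.re < 1 then ((z.im ^ 2 * ψ z.im : ℝ) : ℂ) else 0 := by
  rw [integrable_iff_coe]
  have h1 : Integrable (fun p : ℝ × ℝ => (Set.Ico (0 : ℝ) 1).indicator
      (fun _ => (1 : ℝ)) p.1 * ψ p.2) (volume.prod volume) := by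
    refine Integrable.mul_prod ?_ hψ
    rw [integrable_indicator_iff measurableSet_Ico]
    exact integrableOn_const (by simp) (by simp)
  have h2 := (Complex.volume_preserving_equiv_real_prod.integrable_comp_emb
    Complex.measurableEquivRealProd.measurableEmbedding).mpr h1
  refine (h2.ofReal (𝕜 := ℂ)).integrableOn.congr_fun (fun z hz => ?_)
    (measurableSet_lt measurable_const Complex.measurable_im)
  have hz : 0 < z.im := hz
  rw [ofComplex_apply_of_im_pos hz]
  simp only [Function.comp_apply, Complex.measurableEquivRealProd_apply]
  change _ = ((z.im ^ 2)⁻¹ : ℝ) • (if 0 ≤ z.re ∧ z.re < 1 then ((z.im ^ 2 * ψ z.im : ℝ) : ℂ) else 0)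
  by_cases h : 0 ≤ z.re ∧ z.re < 1
  · rw [Set.indicator_of_mem (Set.mem_Ico.mpr h), if_pos h, Complex.real_smul, ← ofReal_mul]
    have : z.im ^ 2 ≠ 0 := by positivity
    rw [one_mul, inv_mul_cancel_left₀ this]
    rfl
  · rw [Set.indicator_of_notMem (by simpa using h), if_neg h]; simp

lemma measurable_stripFun (s : ℂ) {G : ℍ → ℂ} (hG : Continuous G) : Measurable (stripFun s G) := by
  have hre : Continuous fun z : ℍ => z.re := UpperHalfPlane.continuous_re
  have him : Continuous fun z : ℍ => z.im := UpperHalfPlane.continuous_im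
  refine Measurable.ite ?_ ?_ measurable_const
  · exact (measurableSet_le measurable_const hre.measurable).inter
      (measurableSet_lt hre.measurable measurable_const)
  · exact ((Complex.measurable_ofReal.comp him.measurable).pow_const s).mul hG.measurable

lemma integrable_stripFun {G : ℍ → ℂ} (hG : Continuous G) {C C' : ℝ} {N : ℕ} (hC : ∀ z, ‖G z‖ ≤ C)
    (hC' : ∀ z : ℍ, 1 / 2 ≤ z.im → ‖G z‖ * z.im ^ N ≤ C') {s : ℂ} (hs1 : 1 < s.re) (hs : s.re ≤ N) :
    Integrable (stripFun s G) := by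
  refine (integrable_strip (integrable_cuspMajorant hs1 C C')).mono
    (measurable_stripFun s hG).aestronglyMeasurable (Eventually.of_forall fun z => ?_)
  rw [stripFun]
  split_ifs with h
  · refine (norm_im_cpow_mul_le hC hC' hs z).trans ?_
    rw [Complex.norm_real]
    exact le_abs_self _
  · simp

section

variable {k : ℕ} (f : CuspForm 𝒮ℒ (k : ℤ))

lemma continuous_petersson : Continuous (petersson k f f) :=
  petersson_continuous k (ModularFormClass.continuous f) (ModularFormClass.continuous f)

lemma petersson_SL_smul (γ : SL(2, ℤ)) (z : ℍ) : petersson k f f (γ • z) = petersson k f f z :=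
  SlashInvariantFormClass.petersson_smul (k := (k : ℤ)) (Γ := 𝒮ℒ) (f := f) (f' := f) ⟨γ, rfl⟩

lemma norm_petersson_self (z : ℍ) : ‖petersson k f f z‖ = ‖f z‖ ^ 2 * z.im ^ k := by
  have := z.im_pos
  rw [petersson_self, Complex.norm_real, Real.norm_of_nonneg (by positivity)]

/-- A cusp form of level one decays exponentially at the cusp. -/
lemma exists_norm_le_exp : ∃ C : ℝ, 0 ≤ C ∧ ∀ z : ℍ, 1 / 2 ≤ z.im →
    ‖f z‖ ≤ C * Real.exp (-2 * π * z.im) := by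
  have hs := summable_norm_coeff f (y := 1 / 2) (by norm_num)
  refine ⟨Real.exp π * ∑' n : ℕ, ‖(qExpansion 1 f).coeff n‖ * Real.exp (-2 * π * n * (1 / 2)),
    by positivity, fun z hz => ?_⟩
  have hz' := summable_norm_coeff f z.im_pos
  have h1 : ‖f z‖ ≤ ∑' n : ℕ, ‖(qExpansion 1 f).coeff n‖ * Real.exp (-2 * π * n * z.im) := by
    rw [← (hasSum_coeff f z).tsum_eq]
    refine tsum_of_norm_bounded hz'.hasSum fun n => ?_
    rw [norm_mul, norm_cexp_two_pi, UpperHalfPlane.coe_im]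
  refine h1.trans ?_
  rw [mul_right_comm, ← tsum_mul_left]
  refine hz'.tsum_le_tsum (fun n => ?_) (hs.mul_left _)
  rcases Nat.eq_zero_or_pos n with rfl | hn
  · simp [coeff_zero]
  · have hn1 : (1 : ℝ) ≤ n := by exact_mod_cast hn
    rw [mul_left_comm, ← Real.exp_add, ← Real.exp_add]
    gcongr
    nlinarith [mul_nonneg (mul_nonneg Real.pi_pos.le (sub_nonneg.mpr hn1)) (sub_nonneg.mpr hz)]

lemma exists_petersson_decay (N : ℕ) : ∃ C : ℝ, ∀ z : ℍ, 1 / 2 ≤ z.im →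
    ‖petersson k f f z‖ * z.im ^ N ≤ C := by
  obtain ⟨C, hC0, hC⟩ := exists_norm_le_exp f
  refine ⟨C ^ 2 * (k + N)!, fun z hz => ?_⟩
  have hy := z.im_pos
  have h1 : z.im ^ (k + N) ≤ (k + N)! * Real.exp z.im := by
    have := Real.pow_div_factorial_le_exp z.im hy.le (k + N)
    rwa [div_le_iff₀' (by positivity)] at this
  rw [norm_petersson_self, mul_assoc, ← pow_add]
  calc ‖f z‖ ^ 2 * z.im ^ (k + N)
      ≤ (C * Real.exp (-2 * π * z.im)) ^ 2 * ((k + N)! * Real.exp z.im) := by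
        gcongr
        exact hC z hz
    _ = C ^ 2 * (k + N)! * Real.exp (-4 * π * z.im + z.im) := by
        rw [Real.exp_add, mul_pow, ← Real.exp_nat_mul]; ring_nf
    _ ≤ C ^ 2 * (k + N)! * 1 := by
        gcongr
        rw [Real.exp_le_one_iff]
        nlinarith [Real.pi_gt_three]
    _ = _ := mul_one _

lemma exists_petersson_bound : ∃ C : ℝ, ∀ z : ℍ, ‖petersson k f f z‖ ≤ C :=
  CuspFormClass.petersson_bounded_left (k : ℤ) 𝒮ℒ f f

lemma integrable_stripFun_petersson {s : ℂ} (hs : 1 < s.re) :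
    Integrable (stripFun s (petersson k f f)) := by
  obtain ⟨C, hC⟩ := exists_petersson_bound f
  obtain ⟨C', hC'⟩ := exists_petersson_decay f ⌈s.re⌉₊
  exact integrable_stripFun (continuous_petersson f) hC hC' hs (Nat.le_ceil _)

/-- Parseval's identity on a horocycle. -/
lemma hasSum_norm_coeff_sq {y : ℝ} (hy : 0 < y) :
    HasSum (fun n : ℕ => ((‖(qExpansion 1 f).coeff n‖ ^ 2 : ℝ) : ℂ) * Real.exp (-(4 * π * n) * y))
      (∫ x in (0 : ℝ)..1, ((‖f (ofComplex (x + y * Complex.I))‖ ^ 2 : ℝ) : ℂ)) := by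
  obtain ⟨B, hB0, hB⟩ := exists_bound_horizontal f hy
  have hc := continuous_comp_ofComplex f hy
  have h := intervalIntegral.hasSum_integral_of_dominated_convergence (a := 0) (b := 1)
    (μ := volume) (F := fun (n : ℕ) (x : ℝ) => conj ((qExpansion 1 f).coeff n *
      cexp (2 * π * Complex.I * n * (x + y * Complex.I))) * f (ofComplex (x + y * Complex.I)))
    (f := fun x : ℝ => ((‖f (ofComplex (x + y * Complex.I))‖ ^ 2 : ℝ) : ℂ))
    (fun n _ => ‖(qExpansion 1 f).coeff n‖ * Real.exp (-2 * π * n * y) * B)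
    (fun n => Continuous.aestronglyMeasurable
      ((Complex.continuous_conj.comp (by fun_prop)).mul hc))
    (fun n => Eventually.of_forall fun x _ => by
      rw [norm_mul, RCLike.norm_conj, norm_mul, norm_cexp_two_pi]
      have him : ((x : ℂ) + y * Complex.I).im = y := by simp
      rw [him]
      exact mul_le_mul_of_nonneg_left (hB x) (by positivity))
    (Eventually.of_forall fun _ _ => (summable_norm_coeff f hy).mul_right B)
    (by simp)
    (Eventually.of_forall fun x _ => by
      have h1 := hasSum_coeff f (ofComplex (x + y * Complex.I))
      rw [coe_ofComplex_mk x hy] at h1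
      have h2 := (Complex.hasSum_conj'.mpr h1).mul_right (f (ofComplex (x + y * Complex.I)))
      rw [mul_comm (conj (f _)), Complex.mul_conj, Complex.normSq_eq_norm_sq] at h2
      exact h2)
  refine h.congr_fun fun n => ?_
  have h3 : ∀ x : ℝ, conj ((qExpansion 1 f).coeff n *
      cexp (2 * π * Complex.I * n * (x + y * Complex.I))) * f (ofComplex (x + y * Complex.I)) =
      conj ((qExpansion 1 f).coeff n) * Real.exp (-(4 * π * n) * y) *
        (f (ofComplex (x + y * Complex.I)) * cexp (-(2 * π * Complex.I * n * (x + y * Complex.I)))) := by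
    intro x
    rw [map_mul, ← Complex.exp_conj, Complex.ofReal_exp]
    have : cexp (conj (2 * π * Complex.I * n * (x + y * Complex.I))) =
        cexp ((-(4 * π * n) * y : ℝ) : ℂ) * cexp (-(2 * π * Complex.I * n * (x + y * Complex.I))) := by
      rw [← Complex.exp_add]
      congr 1
      simp only [map_mul, map_add, Complex.conj_I, Complex.conj_ofReal, map_natCast, map_ofNat]
      push_cast
      ring_nf
      simp only [Complex.I_sq]
      ring
    rw [this]
    ring
  simp_rw [h3]
  rw [intervalIntegral.integral_const_mul, coeff_eq_integral f n hy]
  have h5 := Complex.mul_conj ((qExpansion 1 f).coeff n)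
  rw [Complex.normSq_eq_norm_sq] at h5
  linear_combination (-(Real.exp (-(4 * π * n) * y) : ℂ)) * h5

end

/-! ### The Rankin–Selberg Dirichlet series -/

section

variable {k : ℕ} (f : CuspForm 𝒮ℒ (k : ℤ))

lemma hasSum_norm_coeff_sq_real {y : ℝ} (hy : 0 < y) :
    HasSum (fun n : ℕ => ‖(qExpansion 1 f).coeff n‖ ^ 2 * Real.exp (-(4 * π * n) * y))
      (∫ x in (0 : ℝ)..1, ‖f (ofComplex (x + y * Complex.I))‖ ^ 2) := by
  have h := hasSum_norm_coeff_sq f hy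
  rw [intervalIntegral.integral_ofReal] at h
  exact_mod_cast h

lemma sum_norm_coeff_sq_le {C C' : ℝ} {N : ℕ} (hC : ∀ z, ‖petersson k f f z‖ ≤ C)
    (hC' : ∀ z : ℍ, 1 / 2 ≤ z.im → ‖petersson k f f z‖ * z.im ^ N ≤ C') {σ : ℝ} (hσ : σ ≤ N)
    {y : ℝ} (hy : 0 < y) (u : Finset ℕ) :
    ∑ n ∈ u, ‖(qExpansion 1 f).coeff n‖ ^ 2 * (y ^ (σ + k - 1 - 1) * Real.exp (-(4 * π * n * y))) ≤
      cuspMajorant σ C C' y := by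
  have h1 : ∑ n ∈ u, ‖(qExpansion 1 f).coeff n‖ ^ 2 * Real.exp (-(4 * π * n) * y) ≤
      ∫ x in (0 : ℝ)..1, ‖f (ofComplex (x + y * Complex.I))‖ ^ 2 :=
    sum_le_hasSum u (fun _ _ => by positivity) (hasSum_norm_coeff_sq_real f hy)
  have h2 : ∫ x in (0 : ℝ)..1, ‖f (ofComplex (x + y * Complex.I))‖ ^ 2 ≤
      ∫ x in (0 : ℝ)..1, cuspMajorant σ C C' y * y ^ (2 - σ - k) := by
    refine intervalIntegral.integral_mono zero_le_one ?_ (by simp) fun x => ?_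
    · exact ((continuous_comp_ofComplex f hy).norm.pow 2).intervalIntegrable _ _
    · have h := norm_im_cpow_mul_le hC hC' (s := σ) (by simpa using hσ) (ofComplex (x + y * Complex.I))
      rw [norm_mul, norm_im_cpow, norm_petersson_self, ofComplex_mk_im x hy, Complex.ofReal_re] at h
      simp only
      rw [Real.rpow_sub hy, Real.rpow_sub hy, Real.rpow_ofNat, Real.rpow_natCast]
      have : 0 < y ^ σ := by positivity
      calc _ = (y ^ σ * (‖f (ofComplex (x + y * Complex.I))‖ ^ 2 * y ^ k)) / (y ^ σ * y ^ k) := by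
            field_simp
        _ ≤ (y ^ 2 * cuspMajorant σ C C' y) / (y ^ σ * y ^ k) := by gcongr
        _ = _ := by field_simp
  rw [intervalIntegral.integral_const, sub_zero, one_smul] at h2
  calc _ = y ^ (σ + k - 2) * ∑ n ∈ u, ‖(qExpansion 1 f).coeff n‖ ^ 2 * Real.exp (-(4 * π * n) * y) := by
        rw [Finset.mul_sum]
        refine Finset.sum_congr rfl fun n _ => ?_
        rw [neg_mul, show σ + k - 1 - 1 = σ + k - 2 by ring]
        ring
    _ ≤ y ^ (σ + k - 2) * (cuspMajorant σ C C' y * y ^ (2 - σ - k)) := by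
        gcongr
        exact h1.trans h2
    _ = cuspMajorant σ C C' y * y ^ ((σ + k - 2) + (2 - σ - k)) := by
        rw [Real.rpow_add hy]; ring
    _ = _ := by rw [show (σ + k - 2) + (2 - σ - k) = 0 by ring, Real.rpow_zero, mul_one]

/-- The convergence of the Rankin–Selberg series for `σ > 1`, obtained without any pointwise bound
for the coefficients: by Parseval the partial sums are at most the Mellin integral of `y^(k-2) ∫
|f|² dx`, which converges. -/
lemma summable_norm_coeff_sq_div {σ : ℝ} (hσ : 1 < σ) :
    Summable fun n : ℕ => ‖(qExpansion 1 f).coeff n‖ ^ 2 / (4 * π * n) ^ (σ + k - 1) := by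
  obtain ⟨C, hC⟩ := exists_petersson_bound f
  obtain ⟨C', hC'⟩ := exists_petersson_decay f ⌈σ⌉₊
  have ha : 0 < σ + k - 1 := by have : (0 : ℝ) ≤ k := k.cast_nonneg; linarith
  have hG : 0 < Real.Gamma (σ + k - 1) := Real.Gamma_pos_of_pos ha
  have hI : ∀ n : ℕ, 0 < n → ∫ y in Set.Ioi (0 : ℝ), y ^ (σ + k - 1 - 1) * Real.exp (-(4 * π * n * y)) =
      (1 / (4 * π * n)) ^ (σ + k - 1) * Real.Gamma (σ + k - 1) := fun n hn =>
    Real.integral_rpow_mul_exp_neg_mul_Ioi ha (by positivity)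
  have hint : ∀ n : ℕ, IntegrableOn (fun y : ℝ => ‖(qExpansion 1 f).coeff n‖ ^ 2 *
      (y ^ (σ + k - 1 - 1) * Real.exp (-(4 * π * n * y)))) (Set.Ioi 0) := by
    intro n
    rcases Nat.eq_zero_or_pos n with rfl | hn
    · simp [coeff_zero]
    -- A Bochner integral that does not vanish is that of an integrable function.
    · refine Integrable.const_mul (not_imp_comm.mp integral_undef ?_) _
      rw [hI n hn]
      positivity
  refine summable_of_sum_le (c := (∫ y in Set.Ioi (0 : ℝ), cuspMajorant σ C C' y) /
    Real.Gamma (σ + k - 1)) (fun _ => by positivity) fun u => ?_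
  rw [le_div_iff₀ hG, Finset.sum_mul]
  calc _ = ∑ n ∈ u, ∫ y in Set.Ioi (0 : ℝ), ‖(qExpansion 1 f).coeff n‖ ^ 2 *
          (y ^ (σ + k - 1 - 1) * Real.exp (-(4 * π * n * y))) := by
        refine Finset.sum_congr rfl fun n _ => ?_
        rcases Nat.eq_zero_or_pos n with rfl | hn
        · simp [coeff_zero]
        · rw [integral_const_mul, hI n hn, Real.div_rpow (by positivity) (by positivity), Real.one_rpow]
          ring
    _ = ∫ y in Set.Ioi (0 : ℝ), ∑ n ∈ u, ‖(qExpansion 1 f).coeff n‖ ^ 2 *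
          (y ^ (σ + k - 1 - 1) * Real.exp (-(4 * π * n * y))) :=
        (integral_finsetSum u fun n _ => hint n).symm
    _ ≤ _ := by
        refine setIntegral_mono_on (integrable_finsetSum u fun n _ => hint n)
          (integrable_cuspMajorant hσ C C').integrableOn measurableSet_Ioi fun y hy => ?_
        exact sum_norm_coeff_sq_le f hC hC' (Nat.le_ceil σ) hy u

lemma integral_stripFun_horizontal (s : ℂ) {y : ℝ} (hy : 0 < y) :
    ∫ x : ℝ, stripFun s (petersson k f f) (ofComplex (x + y * Complex.I)) =
      (y : ℂ) ^ s * (y : ℂ) ^ k *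
        ∫ x in (0 : ℝ)..1, ((‖f (ofComplex (x + y * Complex.I))‖ ^ 2 : ℝ) : ℂ) := by
  have h1 : ∀ x : ℝ, stripFun s (petersson k f f) (ofComplex (x + y * Complex.I)) =
      (Set.Ico (0 : ℝ) 1).indicator (fun x : ℝ => (y : ℂ) ^ s * (y : ℂ) ^ k *
        ((‖f (ofComplex (x + y * Complex.I))‖ ^ 2 : ℝ) : ℂ)) x := by
    intro x
    have hre : (ofComplex ((x : ℂ) + y * Complex.I) : ℍ).re = x := by
      rw [← UpperHalfPlane.coe_re, coe_ofComplex_mk x hy]; simp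
    rw [stripFun, hre, ofComplex_mk_im x hy, petersson_self, ofComplex_mk_im x hy]
    by_cases h : 0 ≤ x ∧ x < 1
    · rw [if_pos h, Set.indicator_of_mem (Set.mem_Ico.mpr h)]
      push_cast
      ring
    · rw [if_neg h, Set.indicator_of_notMem (by simpa using h)]
  simp_rw [h1]
  rw [integral_indicator measurableSet_Ico, integral_Ico_eq_integral_Ioc,
    ← intervalIntegral.integral_of_le zero_le_one, intervalIntegral.integral_const_mul]

/-- Parseval on each horocycle, and the Mellin transform of each `exp (-4 π n y)`. -/
lemma integral_stripFun_petersson {s : ℂ} (hs : 1 < s.re) :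
    ∫ z, stripFun s (petersson k f f) z = ∑' n : ℕ, Complex.Gamma (s + k - 1) *
      ((‖(qExpansion 1 f).coeff n‖ ^ 2 : ℝ) : ℂ) / ((4 * π * n : ℝ) : ℂ) ^ (s + k - 1) := by
  have hre : (s + k - 1).re = s.re + k - 1 := by simp
  have hk0 : (0 : ℝ) ≤ k := k.cast_nonneg
  have hmel := hasSum_mellin (a := fun n : ℕ => ((‖(qExpansion 1 f).coeff n‖ ^ 2 : ℝ) : ℂ))
    (p := fun n : ℕ => 4 * π * n) (s := s + k - 1)
    (F := fun y => ∫ x in (0 : ℝ)..1, ((‖f (ofComplex (x + y * Complex.I))‖ ^ 2 : ℝ) : ℂ))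
    (fun n => by
      rcases Nat.eq_zero_or_pos n with rfl | hn
      · left; simp [coeff_zero]
      · right; positivity) (by rw [hre]; linarith)
    (fun t ht => hasSum_norm_coeff_sq f ht)
    ((summable_norm_coeff_sq_div f hs).congr fun n => by
      rw [Complex.norm_real, Real.norm_of_nonneg (by positivity), hre])
  rw [hmel.tsum_eq, integral_eq_iterated (integrable_stripFun_petersson f hs), mellin]
  refine setIntegral_congr_fun measurableSet_Ioi fun y hy => ?_
  have hy : 0 < y := hy
  have hy0 : (y : ℂ) ≠ 0 := by exact_mod_cast hy.ne'
  rw [integral_stripFun_horizontal f s hy, smul_eq_mul, Complex.real_smul,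
    show s + k - 1 - 1 = s + (k : ℂ) - 2 by ring, Complex.cpow_sub _ _ hy0, Complex.cpow_add _ _ hy0,
    Complex.cpow_natCast, Complex.cpow_ofNat]
  push_cast
  field_simp

end

/-! ### Multiplicativity of the normalized coefficients -/

section

variable {k : ℕ}

lemma normCoeff_zero (f : CuspForm 𝒮ℒ (k : ℤ)) : normCoeff f 0 = 0 := by
  rw [normCoeff, coeff_zero, zero_div]

lemma conj_normCoeff (hk : 9 ≤ k) (hk2 : Even k) {f : CuspForm 𝒮ℒ (k : ℤ)}
    (hf : f ∈ heckeBasis k) (n : ℕ) : conj (normCoeff f n) = normCoeff f n := by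
  rw [normCoeff, map_div₀, conj_coeff hk hk2 hf, Complex.conj_ofReal]

/-- The Hecke relations for the normalized coefficients. -/
lemma normCoeff_mul_normCoeff (hk : 9 ≤ k) (hk2 : Even k) {f : CuspForm 𝒮ℒ (k : ℤ)}
    (hf : f ∈ heckeBasis k) {m n : ℕ} (hm : 0 < m) (hn : 0 < n) :
    normCoeff f m * normCoeff f n =
      ∑ d ∈ (Nat.gcd m n).divisors, normCoeff f (m / d * (n / d)) := by
  have h := coeff_mul_coeff hk hk2 hf hm n
  have hfil : ∑ d ∈ (Nat.gcd m n).divisors, normCoeff f (m / d * (n / d)) =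
      ∑ d ∈ m.divisors, if d ∣ n then normCoeff f (m / d * (n / d)) else 0 := by
    rw [← Finset.sum_filter]
    refine Finset.sum_congr ?_ fun _ _ => rfl
    ext d
    simp only [Nat.mem_divisors, Finset.mem_filter, Nat.dvd_gcd_iff]
    have := Nat.gcd_pos_of_pos_left n hm
    constructor
    · rintro ⟨⟨h1, h2⟩, -⟩; exact ⟨⟨h1, hm.ne'⟩, h2⟩
    · rintro ⟨⟨h1, -⟩, h2⟩; exact ⟨⟨h1, h2⟩, this.ne'⟩
  have hpow : ∀ j : ℕ, 0 < j → ((j : ℝ) ^ (((k : ℝ) - 1) / 2)) ≠ 0 := fun j hj => by positivity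
  have hP : (((m : ℝ) ^ (((k : ℝ) - 1) / 2) : ℝ) : ℂ) * (((n : ℝ) ^ (((k : ℝ) - 1) / 2) : ℝ) : ℂ) ≠ 0 :=
    mul_ne_zero (by exact_mod_cast hpow m hm) (by exact_mod_cast hpow n hn)
  refine mul_right_cancel₀ hP ?_
  calc _ = (qExpansion 1 f).coeff m * (qExpansion 1 f).coeff n := by
        rw [coeff_eq_normCoeff_mul f hm, coeff_eq_normCoeff_mul f hn]; ring
    _ = _ := by
        rw [h, heckeSum, hfil, Finset.sum_mul]
        refine Finset.sum_congr rfl fun d hd => ?_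
        split_ifs with hdn
        · obtain ⟨a, rfl⟩ := Nat.dvd_of_mem_divisors hd
          obtain ⟨b, rfl⟩ := hdn
          have hd0 : 0 < d := Nat.pos_of_mul_pos_right hm
          have ha : 0 < a := Nat.pos_of_mul_pos_left hm
          have hb : 0 < b := Nat.pos_of_mul_pos_left hn
          rw [Nat.mul_div_cancel_left _ hd0, Nat.mul_div_cancel_left _ hd0,
            coeff_eq_normCoeff_mul f (Nat.mul_pos ha hb)]
          have hdd : (d : ℝ) ^ (((k : ℝ) - 1) / 2) * (d : ℝ) ^ (((k : ℝ) - 1) / 2) = (d : ℝ) ^ (k - 1) := by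
            rw [rpow_half_mul_rpow_half (by omega), Real.sqrt_mul_self (by positivity)]
          have hreal : (d : ℝ) ^ (k - 1) * (((a * b : ℕ) : ℝ) ^ (((k : ℝ) - 1) / 2)) =
              ((d * a : ℕ) : ℝ) ^ (((k : ℝ) - 1) / 2) * ((d * b : ℕ) : ℝ) ^ (((k : ℝ) - 1) / 2) := by
            push_cast
            rw [Real.mul_rpow (by positivity) (by positivity), Real.mul_rpow (by positivity) (by positivity),
              Real.mul_rpow (by positivity) (by positivity), ← hdd]
            ring
          have hC := congrArg (fun x : ℝ => (x : ℂ)) hreal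
          push_cast only [Complex.ofReal_mul, Complex.ofReal_pow, Complex.ofReal_natCast] at hC
          linear_combination normCoeff f (a * b) * hC
        · simp

/-- The squares of the normalized coefficients as an arithmetic function. -/
def coeffSq (f : CuspForm 𝒮ℒ (k : ℤ)) : ArithmeticFunction ℂ :=
  ⟨fun n => normCoeff f n ^ 2, by rw [normCoeff_zero]; simp⟩

/-- The normalized coefficients at the squares as an arithmetic function. -/
def coeffAtSq (f : CuspForm 𝒮ℒ (k : ℤ)) : ArithmeticFunction ℂ :=
  ⟨fun n => normCoeff f (n ^ 2), by rw [zero_pow two_ne_zero, normCoeff_zero]⟩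

open scoped ArithmeticFunction.zeta ArithmeticFunction.Moebius

/-- The Hecke relation `λ_f(n)² = ∑_{d ∣ n} λ_f((n / d)²)`, as a Dirichlet convolution. -/
lemma coeffSq_eq (hk : 9 ≤ k) (hk2 : Even k) {f : CuspForm 𝒮ℒ (k : ℤ)}
    (hf : f ∈ heckeBasis k) : coeffSq f = (ζ : ArithmeticFunction ℂ) * coeffAtSq f := by
  ext n
  rw [ArithmeticFunction.coe_zeta_mul_apply]
  rcases Nat.eq_zero_or_pos n with rfl | hn
  · simp [coeffSq, normCoeff_zero]
  · rw [← Nat.sum_div_divisors]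
    change normCoeff f n ^ 2 = ∑ d ∈ n.divisors, normCoeff f ((n / d) ^ 2)
    rw [sq, normCoeff_mul_normCoeff hk hk2 hf hn hn, Nat.gcd_self]
    exact Finset.sum_congr rfl fun d _ => by rw [sq]

lemma coeffAtSq_eq (hk : 9 ≤ k) (hk2 : Even k) {f : CuspForm 𝒮ℒ (k : ℤ)}
    (hf : f ∈ heckeBasis k) : coeffAtSq f = (μ : ArithmeticFunction ℂ) * coeffSq f := by
  rw [coeffSq_eq hk hk2 hf, ← mul_assoc, ArithmeticFunction.coe_moebius_mul_coe_zeta, one_mul]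

lemma norm_coeff_sq_div_eq (hk : 9 ≤ k) (hk2 : Even k) {f : CuspForm 𝒮ℒ (k : ℤ)}
    (hf : f ∈ heckeBasis k) (s : ℂ) (n : ℕ) :
    ((‖(qExpansion 1 f).coeff n‖ ^ 2 : ℝ) : ℂ) / ((4 * π * n : ℝ) : ℂ) ^ (s + k - 1) =
      ((4 * π : ℝ) : ℂ) ^ (-(s + k - 1)) * LSeries.term (coeffSq f) s n := by
  rcases Nat.eq_zero_or_pos n with rfl | hn
  · simp [coeff_zero]
  have hn0 : (n : ℂ) ≠ 0 := by exact_mod_cast hn.ne'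
  have h1 : ((‖(qExpansion 1 f).coeff n‖ ^ 2 : ℝ) : ℂ) = normCoeff f n ^ 2 * (n : ℂ) ^ (k - 1) := by
    rw [← Complex.normSq_eq_norm_sq, ← Complex.mul_conj, conj_coeff hk hk2 hf,
      coeff_eq_normCoeff_mul f hn]
    have := congrArg (fun x : ℝ => (x : ℂ)) (rpow_half_mul_rpow_half (k := k) (by omega) n n)
    rw [Real.sqrt_mul_self (by positivity)] at this
    push_cast only [Complex.ofReal_mul, Complex.ofReal_pow, Complex.ofReal_natCast] at this
    linear_combination normCoeff f n ^ 2 * this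
  rw [h1, LSeries.term_of_ne_zero hn.ne', ofReal_mul (4 * π) n,
    Complex.mul_cpow_ofReal_nonneg (by positivity) (by positivity), Complex.ofReal_natCast,
    Complex.cpow_neg, add_sub_assoc, Complex.cpow_add (x := (n : ℂ)) _ _ hn0]
  have hk1 : (k : ℂ) - 1 = ((k - 1 : ℕ) : ℂ) := by push_cast [Nat.cast_sub (by omega : 1 ≤ k)]; ring
  have hn1 : (n : ℂ) ^ s ≠ 0 := by simp [Complex.cpow_eq_zero_iff, hn0]
  rw [hk1, Complex.cpow_natCast]
  change _ = _ * (normCoeff f n ^ 2 / _)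
  have : (n : ℂ) ^ (k - 1) ≠ 0 := pow_ne_zero _ hn0
  field_simp

lemma LSeriesSummable_coeffSq (hk : 9 ≤ k) (hk2 : Even k) {f : CuspForm 𝒮ℒ (k : ℤ)}
    (hf : f ∈ heckeBasis k) {s : ℂ} (hs : 1 < s.re) : LSeriesSummable (coeffSq f) s := by
  have h4 : ((4 * π : ℝ) : ℂ) ^ (-(s + k - 1)) ≠ 0 := by
    rw [Complex.cpow_def_of_ne_zero (by exact_mod_cast (by positivity : (4 * π : ℝ) ≠ 0))]
    exact Complex.exp_ne_zero _
  have h : Summable fun n : ℕ => ((4 * π : ℝ) : ℂ) ^ (-(s + k - 1)) * LSeries.term (coeffSq f) s n := by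
    refine Summable.of_norm ((summable_norm_coeff_sq_div f hs).congr fun n => ?_)
    rw [← norm_coeff_sq_div_eq hk hk2 hf, norm_div, Complex.norm_real, Real.norm_of_nonneg (by positivity)]
    rcases Nat.eq_zero_or_pos n with rfl | hn
    · simp [coeff_zero]
    · rw [Complex.norm_cpow_eq_rpow_re_of_pos (by positivity)]
      simp
  exact (summable_mul_left_iff h4).mp h

lemma LSeriesSummable_coeffAtSq (hk : 9 ≤ k) (hk2 : Even k) {f : CuspForm 𝒮ℒ (k : ℤ)}
    (hf : f ∈ heckeBasis k) {s : ℂ} (hs : 1 < s.re) : LSeriesSummable (coeffAtSq f) s := by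
  have hμ : LSeriesSummable (fun n => (μ : ArithmeticFunction ℂ) n) s :=
    ArithmeticFunction.LSeriesSummable_moebius_iff.mpr hs
  rw [coeffAtSq_eq hk hk2 hf]
  exact ArithmeticFunction.LSeriesSummable_mul hμ (LSeriesSummable_coeffSq hk hk2 hf hs)

/-- The factor relating `∑ λ_f(n)² n^{-s}` to `∑ λ_f(n²) n^{-s}` is `ζ(s)`. -/
lemma LSeries_coeffSq (hk : 9 ≤ k) (hk2 : Even k) {f : CuspForm 𝒮ℒ (k : ℤ)}
    (hf : f ∈ heckeBasis k) {s : ℂ} (hs : 1 < s.re) :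
    LSeries (coeffSq f) s = riemannZeta s * LSeries (fun n => normCoeff f (n ^ 2)) s := by
  have hζ : (fun n => (ζ : ArithmeticFunction ℂ) n) = fun n : ℕ => ((ζ n : ℕ) : ℂ) :=
    funext fun n => ArithmeticFunction.natCoe_apply
  have hζs : LSeriesSummable (fun n => (ζ : ArithmeticFunction ℂ) n) s := by
    rw [hζ]; exact ArithmeticFunction.LSeriesSummable_zeta_iff.mpr hs
  have hg := LSeriesSummable_coeffAtSq hk hk2 hf hs
  rw [coeffSq_eq hk hk2 hf, ArithmeticFunction.LSeries_mul' hζs hg, hζ,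
    ArithmeticFunction.LSeries_zeta_eq_riemannZeta hs]
  rfl

/-- The Rankin–Selberg integral: unfolding against the Epstein zeta function turns it into the
Mellin transform of the zeroth Fourier coefficient of `y^k |f|²`. -/
theorem integral_petersson_mul_epstein (hk : 9 ≤ k) (hk2 : Even k) {f : CuspForm 𝒮ℒ (k : ℤ)}
    (hf : f ∈ heckeBasis k) {s : ℂ} (hs : 1 < s.re) :
    ∫ z in (𝒟 : Set ℍ), petersson k f f z * (z.im : ℂ) ^ s * epstein s z =
      2 * Complex.Gamma (s + k - 1) * ((4 * π : ℝ) : ℂ) ^ (-(s + k - 1)) * riemannZeta s *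
        symSquareSeries f s := by
  rw [integral_mul_epstein hs (petersson_SL_smul f) (integrable_stripFun_petersson f hs),
    integral_stripFun_petersson f hs, symSquareSeries]
  have h := LSeries_coeffSq hk hk2 hf hs
  simp_rw [mul_div_assoc, norm_coeff_sq_div_eq hk hk2 hf, tsum_mul_left]
  rw [← LSeries, h]
  ring

end

/-! ### Holomorphic dependence of integrals on parameters -/

/-- A dominated integral of holomorphic functions is holomorphic. -/
lemma differentiableAt_integral_of_dominated {α : Type*} [MeasurableSpace α] {μ : Measure α}
    {F : ℂ → α → ℂ} {s₀ : ℂ} {r : ℝ} (hr : 0 < r) {bound : α → ℝ}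
    (hmeas : ∀ s ∈ Metric.ball s₀ r, AEStronglyMeasurable (F s) μ)
    (hdiff : ∀ᵐ a ∂μ, DifferentiableOn ℂ (fun s => F s a) (Metric.ball s₀ r))
    (hb : ∀ᵐ a ∂μ, ∀ s ∈ Metric.ball s₀ r, ‖F s a‖ ≤ bound a) (hbi : Integrable bound μ) :
    DifferentiableAt ℂ (fun s => ∫ a, F s a ∂μ) s₀ := by
  have hsub : ∀ x ∈ Metric.ball s₀ (r / 2), Metric.closedBall x (r / 4) ⊆ Metric.ball s₀ r := by
    intro x hx w hw
    have h1 := Metric.mem_ball.mp hx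
    have h2 := Metric.mem_closedBall.mp hw
    have h3 := dist_triangle w x s₀
    exact Metric.mem_ball.mpr (by linarith)
  have hD : ∀ᵐ a ∂μ, ∀ x ∈ Metric.ball s₀ (r / 2),
      HasDerivAt (fun s => F s a) (deriv (fun s => F s a) x) x := by
    filter_upwards [hdiff] with a ha x hx
    have hx' : x ∈ Metric.ball s₀ r := hsub x hx (Metric.mem_closedBall_self (by positivity))
    exact (ha.differentiableAt (Metric.isOpen_ball.mem_nhds hx')).hasDerivAt
  refine (hasDerivAt_integral_of_dominated_loc_of_deriv_le (μ := μ) (F := F)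
    (F' := fun x a => deriv (fun s => F s a) x)
    (s := Metric.ball s₀ (r / 2)) (bound := fun a => bound a / (r / 4))
    (Metric.ball_mem_nhds _ (by positivity)) ?_ ?_ ?_ ?_ (hbi.div_const _) hD).2.differentiableAt
  · filter_upwards [Metric.ball_mem_nhds s₀ hr] with x hx using hmeas x hx
  · refine hbi.mono' (hmeas s₀ (Metric.mem_ball_self hr)) ?_
    filter_upwards [hb] with a ha using ha s₀ (Metric.mem_ball_self hr)
  · -- The derivative is a limit of difference quotients, hence measurable.
    have hlim : Tendsto (fun n : ℕ => s₀ + ((r / (n + 2) : ℝ) : ℂ)) atTop (𝓝[≠] s₀) := by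
      rw [tendsto_nhdsWithin_iff]
      refine ⟨?_, Eventually.of_forall fun n => ?_⟩
      · have h1 : Tendsto (fun n : ℕ => r / ((n : ℝ) + 2)) atTop (𝓝 0) :=
          tendsto_const_nhds.div_atTop (tendsto_natCast_atTop_atTop.atTop_add tendsto_const_nhds)
        have h2 := (Complex.continuous_ofReal.tendsto 0).comp h1
        simpa using h2.const_add s₀
      · have : (r / ((n : ℝ) + 2) : ℝ) ≠ 0 := by positivity
        simpa [-Complex.ofReal_div] using this
    refine aestronglyMeasurable_of_tendsto_ae atTop
      (f := fun (n : ℕ) a => slope (fun s => F s a) s₀ (s₀ + ((r / (n + 2) : ℝ) : ℂ)))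
      (fun n => ?_) ?_
    · simp only [slope_def_field]
      have hmem : s₀ + ((r / (n + 2) : ℝ) : ℂ) ∈ Metric.ball s₀ r := by
        rw [Metric.mem_ball, dist_eq_norm, add_sub_cancel_left, Complex.norm_real,
          Real.norm_of_nonneg (by positivity)]
        exact div_lt_self hr (by have : (0 : ℝ) ≤ n := n.cast_nonneg
                                 linarith)
      simp only [div_eq_mul_inv]
      exact ((hmeas _ hmem).sub (hmeas s₀ (Metric.mem_ball_self hr))).mul_const _
    · filter_upwards [hD] with a ha
      exact ((ha s₀ (Metric.mem_ball_self (by positivity))).tendsto_slope).comp hlim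
  · filter_upwards [hdiff, hb] with a ha hba x hx
    refine Complex.norm_deriv_le_of_forall_mem_sphere_norm_le (by positivity) ?_ ?_
    · refine (ha.mono (hsub x hx)).diffContOnCl_ball (U := Metric.closedBall x (r / 4)) subset_rfl
    · intro w hw
      exact hba w (hsub x hx (Metric.sphere_subset_closedBall hw))

/-! ### Comparison of lattice sums with integrals -/

/-- The term `|c z + d + t|^{-2s}` for `c ≠ 0`. -/
def translateTerm (s : ℂ) (z : ℍ) (t : ℝ) (v : Fin 2 → ℤ) : ℂ :=
  if v 0 = 0 then 0 else (Complex.normSq ((v 0 : ℂ) * z + v 1 + t) : ℂ) ^ (-s)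

lemma latticeTerm_eq_normSq {s : ℂ} (hs : s ≠ 0) (z : ℂ) (v : Fin 2 → ℤ) :
    latticeTerm s z v = (Complex.normSq ((v 0 : ℂ) * z + v 1) : ℂ) ^ (-s) := by
  rw [latticeTerm]
  generalize (v 0 : ℂ) * z + v 1 = w
  rcases eq_or_ne w 0 with rfl | hw
  · simp [Complex.zero_cpow (neg_ne_zero.mpr hs),
      Complex.zero_cpow (neg_ne_zero.mpr (mul_ne_zero two_ne_zero hs))]
  have hw0 : 0 < ‖w‖ := norm_pos_iff.mpr hw
  have h1 : ((‖w‖ : ℝ) : ℂ) ≠ 0 := by exact_mod_cast hw0.ne'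
  have h2 : ((Complex.normSq w : ℝ) : ℂ) ≠ 0 := by exact_mod_cast (Complex.normSq_pos.mpr hw).ne'
  rw [Complex.cpow_def_of_ne_zero h1, Complex.cpow_def_of_ne_zero h2, ← Complex.ofReal_log hw0.le,
    ← Complex.ofReal_log (Complex.normSq_nonneg w), Complex.normSq_eq_norm_sq, Real.log_pow]
  push_cast
  ring_nf

lemma normSq_translate (z : ℍ) (t : ℝ) (v : Fin 2 → ℤ) :
    Complex.normSq ((v 0 : ℂ) * z + v 1 + t) = (v 0 * z.re + v 1 + t) ^ 2 + (v 0 * z.im) ^ 2 := by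
  rw [Complex.normSq_apply]
  simp
  ring

lemma normSq_translate_pos (z : ℍ) (t : ℝ) {v : Fin 2 → ℤ} (hv : v 0 ≠ 0) :
    0 < Complex.normSq ((v 0 : ℂ) * z + v 1 + t) := by
  rw [normSq_translate]
  have h1 : (v 0 : ℝ) * z.im ≠ 0 := mul_ne_zero (by exact_mod_cast hv) z.im_pos.ne'
  positivity

/-- On the fundamental domain the quadratic form `|c z + d + t|²` is comparable to the square of the
norm of `(c, d)`, uniformly up to the cusp. If `|d| ≤ 3 |c|` the imaginary part suffices, and
otherwise `d` dominates the real part. -/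
lemma sq_norm_div_four_le {z : ℍ} (hz : z ∈ (𝒟 : Set ℍ)) {t : ℝ} (ht : t ∈ Set.Icc (0 : ℝ) 1)
    {v : Fin 2 → ℤ} (hv : v 0 ≠ 0) :
    (‖v‖ / 4) ^ 2 ≤ Complex.normSq ((v 0 : ℂ) * z + v 1 + t) := by
  rw [normSq_translate]
  have hy := ModularGroup.three_le_four_mul_im_sq_of_mem_fd hz
  have hx := abs_le.mp hz.2
  set c : ℝ := (v 0 : ℝ)
  set d : ℝ := (v 1 : ℝ)
  have hc : 1 ≤ |c| := by
    have : 1 ≤ |v 0| := Int.one_le_abs hv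
    simp only [c]
    exact_mod_cast this
  have hnorm : ‖v‖ = max |c| |d| := by
    rw [Pi.norm_def, Fin.univ_succ]
    simp [c, d, Int.norm_eq_abs]
  have hcy : c ^ 2 * (3 / 4) ≤ (c * z.im) ^ 2 := by nlinarith [sq_nonneg c]
  have hca : |c| ^ 2 = c ^ 2 := sq_abs c
  have hda : |d| ^ 2 = d ^ 2 := sq_abs d
  rcases le_total |d| (3 * |c|) with h | h
  · have h1 : ‖v‖ ≤ 3 * |c| := by rw [hnorm]; exact max_le (by linarith) h
    have h2 : 0 ≤ ‖v‖ := norm_nonneg v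
    nlinarith [sq_nonneg (c * z.re + d + t)]
  · have h1 : ‖v‖ = |d| := by rw [hnorm]; exact max_eq_right (by linarith)
    have h2 : |c * z.re| ≤ |c| / 2 := by
      rw [abs_mul]
      nlinarith [abs_le.mpr hx, abs_nonneg c]
    have h3 : |d| ≤ |c * z.re + d + t| + |c * z.re| + |t| := by
      calc |d| = |(c * z.re + d + t) - c * z.re - t| := by ring_nf
        _ ≤ |(c * z.re + d + t) - c * z.re| + |t| := abs_sub _ _
        _ ≤ _ := by gcongr; exact abs_sub _ _
    have h4 : |t| ≤ 1 := abs_le.mpr ⟨by linarith [ht.1], ht.2⟩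
    have h5 : |d| / 4 ≤ |c * z.re + d + t| := by linarith
    rw [h1]
    calc (|d| / 4) ^ 2 ≤ |c * z.re + d + t| ^ 2 := by gcongr
      _ = (c * z.re + d + t) ^ 2 := sq_abs _
      _ ≤ _ := by linarith [sq_nonneg (c * z.im)]

lemma one_le_norm {v : Fin 2 → ℤ} (hv : v 0 ≠ 0) : 1 ≤ ‖v‖ := by
  refine le_trans ?_ (norm_le_pi_norm v 0)
  rw [Int.norm_eq_abs]
  exact_mod_cast Int.one_le_abs hv

lemma normSq_rpow_le {z : ℍ} (hz : z ∈ (𝒟 : Set ℍ)) {t : ℝ} (ht : t ∈ Set.Icc (0 : ℝ) 1)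
    {v : Fin 2 → ℤ} (hv : v 0 ≠ 0) {a a₀ R : ℝ} (ha : 0 < a₀) (ha₀ : a₀ ≤ a) (haR : a ≤ R) :
    Complex.normSq ((v 0 : ℂ) * z + v 1 + t) ^ (-a) ≤ 16 ^ R * ‖v‖ ^ (-(2 * a₀)) := by
  have h1 := one_le_norm hv
  have h0 : 0 < ‖v‖ := by linarith
  calc Complex.normSq ((v 0 : ℂ) * z + v 1 + t) ^ (-a) ≤ ((‖v‖ / 4) ^ 2) ^ (-a) :=
        Real.rpow_le_rpow_of_nonpos (by positivity) (sq_norm_div_four_le hz ht hv) (by linarith)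
    _ = 16 ^ a * ‖v‖ ^ (-(2 * a)) := by
        rw [div_pow, Real.div_rpow (by positivity) (by positivity),
          ← Real.rpow_natCast ‖v‖ 2, ← Real.rpow_mul h0.le]
        have h16 : (4 : ℝ) ^ 2 = 16 := by norm_num
        rw [h16, Real.rpow_neg (by norm_num) a, div_inv_eq_mul, mul_comm]
        congr 2
        push_cast
        ring
    _ ≤ _ := by
        gcongr
        norm_num

lemma norm_translateTerm_le {z : ℍ} (hz : z ∈ (𝒟 : Set ℍ)) {t : ℝ} (ht : t ∈ Set.Icc (0 : ℝ) 1)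
    (v : Fin 2 → ℤ) {s : ℂ} {σ R : ℝ} (hσ : 0 < σ) (hs : σ ≤ s.re) (hR : s.re ≤ R) :
    ‖translateTerm s z t v‖ ≤ 16 ^ R * ‖v‖ ^ (-(2 * σ)) := by
  rw [translateTerm]
  split_ifs with hv
  · rw [norm_zero]; positivity
  · rw [Complex.norm_cpow_eq_rpow_re_of_pos (normSq_translate_pos z t hv), Complex.neg_re]
    exact normSq_rpow_le hz ht hv hσ hs hR

/-- By the mean value theorem, translation by `t` gains a factor `‖v‖⁻¹`, which makes the difference
summable for `Re s > 1/2`. -/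
lemma norm_translateTerm_sub_le {z : ℍ} (hz : z ∈ (𝒟 : Set ℍ)) {t : ℝ} (ht : t ∈ Set.Icc (0 : ℝ) 1)
    (v : Fin 2 → ℤ) {s : ℂ} {σ R : ℝ} (hσ : 0 < σ) (hs : σ ≤ s.re) (hR : ‖s‖ ≤ R) :
    ‖translateTerm s z 0 v - translateTerm s z t v‖ ≤
      2 * R * 16 ^ (R + 1 / 2) * ‖v‖ ^ (-(2 * (σ + 1 / 2))) := by
  have hR0 : 0 ≤ R := (norm_nonneg s).trans hR
  by_cases hv : v 0 = 0
  · rw [translateTerm, translateTerm, if_pos hv, if_pos hv, sub_zero, norm_zero]; positivity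
  set x : ℝ := v 0 * z.re + v 1
  set y : ℝ := v 0 * z.im
  have hterm : ∀ u : ℝ, translateTerm s z u v = (((x : ℂ) + u) ^ 2 + (y : ℂ) ^ 2) ^ (-s) := by
    intro u
    rw [translateTerm, if_neg hv, normSq_translate]
    simp only [x, y]
    push_cast
    ring_nf
  have hpos : ∀ u : ℝ, 0 < (x + u) ^ 2 + y ^ 2 := fun u => by
    have := normSq_translate_pos z u hv
    rwa [normSq_translate] at this
  have hderiv : ∀ u : ℝ, HasDerivAt (fun u : ℝ => translateTerm s z u v)
      (-s * (((x + u) ^ 2 + y ^ 2 : ℝ) : ℂ) ^ (-s - 1) * (2 * ((x + u : ℝ) : ℂ))) u := by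
    intro u
    simp_rw [hterm]
    have h1 : HasDerivAt (fun c : ℂ => ((x : ℂ) + c) ^ 2 + (y : ℂ) ^ 2) (2 * ((x : ℂ) + u)) (u : ℂ) := by
      have := (((hasDerivAt_id (u : ℂ)).const_add (x : ℂ)).pow 2).add_const ((y : ℂ) ^ 2)
      simpa using this
    have h2 := h1.cpow_const (c := -s) (by
      left
      have := hpos u
      have e : ((x : ℂ) + u) ^ 2 + (y : ℂ) ^ 2 = (((x + u) ^ 2 + y ^ 2 : ℝ) : ℂ) := by push_cast; ring
      rw [e, Complex.ofReal_re]; exact this)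
    have h3 := h2.comp_ofReal
    push_cast
    exact h3
  have hbound : ∀ u ∈ Set.Icc (0 : ℝ) 1, ‖-s * (((x + u) ^ 2 + y ^ 2 : ℝ) : ℂ) ^ (-s - 1) *
      (2 * ((x + u : ℝ) : ℂ))‖ ≤ 2 * R * 16 ^ (R + 1 / 2) * ‖v‖ ^ (-(2 * (σ + 1 / 2))) := by
    intro u hu
    have hq := hpos u
    have h1 := normSq_rpow_le hz hu hv (a := s.re + 1 / 2) (a₀ := σ + 1 / 2) (R := R + 1 / 2)
      (by linarith) (by linarith) (by linarith [Complex.re_le_norm s])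
    rw [normSq_translate] at h1
    change ((x + u) ^ 2 + y ^ 2) ^ _ ≤ _ at h1
    rw [norm_mul, norm_mul, norm_mul, norm_neg, Complex.norm_cpow_eq_rpow_re_of_pos hq, Complex.norm_real,
      Real.norm_eq_abs, Complex.norm_ofNat]
    have h2 : |x + u| ≤ ((x + u) ^ 2 + y ^ 2) ^ (1 / 2 : ℝ) := by
      rw [← Real.sqrt_eq_rpow]
      exact Real.abs_le_sqrt (by linarith [sq_nonneg y])
    have h3 : ((x + u) ^ 2 + y ^ 2) ^ (-s - 1).re * ((x + u) ^ 2 + y ^ 2) ^ (1 / 2 : ℝ) =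
        ((x + u) ^ 2 + y ^ 2) ^ (-(s.re + 1 / 2)) := by
      rw [← Real.rpow_add hq]
      congr 1
      simp
      ring
    calc ‖s‖ * ((x + u) ^ 2 + y ^ 2) ^ (-s - 1).re * (2 * |x + u|)
        ≤ R * ((x + u) ^ 2 + y ^ 2) ^ (-s - 1).re * (2 * ((x + u) ^ 2 + y ^ 2) ^ (1 / 2 : ℝ)) := by
          gcongr
      _ = 2 * R * ((x + u) ^ 2 + y ^ 2) ^ (-(s.re + 1 / 2)) := by rw [← h3]; ring
      _ ≤ 2 * R * (16 ^ (R + 1 / 2) * ‖v‖ ^ (-(2 * (σ + 1 / 2)))) := by gcongr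
      _ = _ := by ring
  have h := (convex_Icc (0 : ℝ) 1).norm_image_sub_le_of_norm_hasDerivWithin_le
    (fun u _ => (hderiv u).hasDerivWithinAt) hbound ht (Set.left_mem_Icc.mpr zero_le_one)
  refine h.trans ?_
  refine mul_le_of_le_one_right (by positivity) ?_
  rw [zero_sub, norm_neg, Real.norm_of_nonneg ht.1]
  exact ht.2

/-- The function `∑_{c ≠ 0, d} (|c z + d|^{-2s} - |c z + d + t|^{-2s})`, whose terms decay faster
than those of the Epstein zeta function. -/
def diffSum (s : ℂ) (z : ℍ) (t : ℝ) : ℂ :=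
  ∑' v : Fin 2 → ℤ, (translateTerm s z 0 v - translateTerm s z t v)

lemma summable_diffBound {σ : ℝ} (hσ : 1 / 2 < σ) (C : ℝ) :
    Summable fun v : Fin 2 → ℤ => C * ‖v‖ ^ (-(2 * (σ + 1 / 2))) :=
  (EisensteinSeries.summable_one_div_norm_rpow (by linarith)).mul_left C

lemma norm_diffSum_le {z : ℍ} (hz : z ∈ (𝒟 : Set ℍ)) {t : ℝ} (ht : t ∈ Set.Icc (0 : ℝ) 1)
    {s : ℂ} {σ R : ℝ} (hσ : 1 / 2 < σ) (hs : σ ≤ s.re) (hR : ‖s‖ ≤ R) :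
    ‖diffSum s z t‖ ≤ ∑' v : Fin 2 → ℤ, 2 * R * 16 ^ (R + 1 / 2) * ‖v‖ ^ (-(2 * (σ + 1 / 2))) :=
  tsum_of_norm_bounded (summable_diffBound hσ _).hasSum
    fun v => norm_translateTerm_sub_le hz ht v (by linarith) hs hR

lemma differentiable_translateTerm (z : ℍ) (t : ℝ) (v : Fin 2 → ℤ) :
    Differentiable ℂ fun s => translateTerm s z t v := by
  by_cases hv : v 0 = 0
  · simp [translateTerm, hv]
  · simp only [translateTerm, hv, if_false]
    intro s
    refine DifferentiableAt.const_cpow (by fun_prop) (Or.inl ?_)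
    exact_mod_cast (normSq_translate_pos z t hv).ne'

lemma continuous_translateTerm (s : ℂ) (v : Fin 2 → ℤ) :
    Continuous fun p : ℍ × ℝ => translateTerm s p.1 p.2 v := by
  by_cases hv : v 0 = 0
  · simp only [translateTerm, hv, if_true]; exact continuous_const
  · simp only [translateTerm, hv, if_false]
    have h1 : Continuous fun p : ℍ × ℝ => ((p.1 : ℍ) : ℂ) := UpperHalfPlane.continuous_coe.comp continuous_fst
    refine Continuous.cpow ?_ continuous_const fun p => ?_
    · exact Complex.continuous_ofReal.comp (Complex.continuous_normSq.comp (by fun_prop))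
    · left
      rw [Complex.ofReal_re]
      exact normSq_translate_pos _ _ hv

lemma differentiableOn_diffSum {z : ℍ} (hz : z ∈ (𝒟 : Set ℍ)) {t : ℝ} (ht : t ∈ Set.Icc (0 : ℝ) 1)
    {σ R : ℝ} (hσ : 1 / 2 < σ) :
    DifferentiableOn ℂ (fun s => diffSum s z t) {s | σ < s.re ∧ ‖s‖ < R} := by
  refine Complex.differentiableOn_tsum_of_summable_norm (summable_diffBound hσ (2 * R * 16 ^ (R + 1 / 2)))
    (fun v => ((differentiable_translateTerm z 0 v).sub
      (differentiable_translateTerm z t v)).differentiableOn) ?_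
    (fun v s hs => norm_translateTerm_sub_le hz ht v (by linarith) hs.1.le hs.2.le)
  exact (isOpen_lt continuous_const Complex.continuous_re).inter
    (isOpen_lt continuous_norm continuous_const)

lemma continuousOn_diffSum {s : ℂ} (hs : 1 / 2 < s.re) :
    ContinuousOn (fun p : ℍ × ℝ => diffSum s p.1 p.2) ((𝒟 : Set ℍ) ×ˢ Set.Icc (0 : ℝ) 1) := by
  refine continuousOn_tsum (fun v => ?_) (summable_diffBound hs (2 * ‖s‖ * 16 ^ (‖s‖ + 1 / 2)))
    (fun v p hp => norm_translateTerm_sub_le hp.1 hp.2 v (by linarith) le_rfl le_rfl)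
  refine Continuous.continuousOn (Continuous.sub ?_ (continuous_translateTerm s v))
  exact (continuous_translateTerm s v).comp (continuous_fst.prodMk continuous_const)

/-! ### The constant term of the Epstein zeta function -/

/-- The sum over the nonzero integers; the term at `0` vanishes because `0 ^ (-w) = 0`. -/
lemma hasSum_int_cpow {w : ℂ} (hw : 1 < w.re) :
    HasSum (fun c : ℤ => (((|c| : ℤ) : ℝ) : ℂ) ^ (-w)) (2 * riemannZeta w) := by
  have h0 : Summable fun n : ℕ => (n : ℂ) ^ (-w) := by
    refine (Complex.summable_one_div_nat_cpow.mpr hw).congr fun n => ?_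
    rw [one_div, Complex.cpow_neg]
  have h1 : HasSum (fun n : ℕ => (n : ℂ) ^ (-w)) (riemannZeta w) := by
    rw [zeta_eq_tsum_one_div_nat_cpow hw]
    convert! h0.hasSum using 1
    exact tsum_congr fun n => by rw [one_div, Complex.cpow_neg]
  have h2 : HasSum (fun n : ℕ => ((n + 1 : ℕ) : ℂ) ^ (-w)) (riemannZeta w) := by
    have := (hasSum_nat_add_iff' 1).mpr h1
    have hw0 : w ≠ 0 := by rintro rfl; norm_num at hw
    simpa [Complex.zero_cpow (neg_ne_zero.mpr hw0)] using this
  rw [two_mul]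
  refine HasSum.of_nat_of_neg_add_one (h1.congr_fun fun n => ?_) (h2.congr_fun fun n => ?_)
  · rw [Nat.abs_cast]; simp
  · have : |(-((n : ℤ) + 1))| = ((n + 1 : ℕ) : ℤ) := by
      rw [abs_neg, abs_of_nonneg (by positivity)]; push_cast; ring
    rw [this]
    simp

/-- The archimedean factor `∫ (1 + u²)^{-s} du`. -/
def archFactor (s : ℂ) : ℂ := ∫ u : ℝ, ((1 + u ^ 2 : ℝ) : ℂ) ^ (-s)

lemma norm_one_add_sq_cpow (s : ℂ) (u : ℝ) :
    ‖((1 + u ^ 2 : ℝ) : ℂ) ^ (-s)‖ = (1 + u ^ 2) ^ (-s.re) := by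
  rw [Complex.norm_cpow_eq_rpow_re_of_pos (by positivity), Complex.neg_re]

lemma integrable_one_add_sq_rpow {σ : ℝ} (hσ : 1 / 2 < σ) :
    Integrable fun u : ℝ => (1 + u ^ 2) ^ (-σ) := by
  have h := integrable_rpow_neg_one_add_norm_sq (E := ℝ) (μ := volume) (r := 2 * σ)
    (by rw [Module.finrank_self]; push_cast; linarith)
  refine h.congr (Eventually.of_forall fun u => ?_)
  simp only [Real.norm_eq_abs, sq_abs]
  congr 1
  ring

lemma continuous_one_add_sq_cpow (s : ℂ) : Continuous fun u : ℝ => ((1 + u ^ 2 : ℝ) : ℂ) ^ (-s) := by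
  refine Continuous.cpow (by fun_prop) continuous_const fun u => Or.inl ?_
  rw [Complex.ofReal_re]; positivity

lemma integrable_one_add_sq_cpow {s : ℂ} (hs : 1 / 2 < s.re) :
    Integrable fun u : ℝ => ((1 + u ^ 2 : ℝ) : ℂ) ^ (-s) := by
  refine (integrable_one_add_sq_rpow hs).mono' (continuous_one_add_sq_cpow s).aestronglyMeasurable
    (Eventually.of_forall fun u => (norm_one_add_sq_cpow s u).le)

lemma archFactor_one : archFactor 1 = π := by
  have h : ∀ u : ℝ, ((1 + u ^ 2 : ℝ) : ℂ) ^ (-1 : ℂ) = (((1 + u ^ 2)⁻¹ : ℝ) : ℂ) := fun u => by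
    rw [Complex.cpow_neg_one]; push_cast; rfl
  simp_rw [archFactor, h]
  rw [integral_complex_ofReal, integral_univ_inv_one_add_sq]

lemma ball_subset_re_gt {s₀ s : ℂ} {σ : ℝ} (hs : s ∈ Metric.ball s₀ (s₀.re - σ)) : σ < s.re := by
  have h1 := (Complex.abs_re_le_norm (s - s₀)).trans_lt (mem_ball_iff_norm.mp hs)
  rw [Complex.sub_re] at h1
  linarith [(abs_lt.mp h1).1]

lemma differentiableAt_archFactor {s₀ : ℂ} (hs : 1 / 2 < s₀.re) :
    DifferentiableAt ℂ archFactor s₀ := by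
  set σ := (1 / 2 + s₀.re) / 2 with hσ
  have hσ1 : 1 / 2 < σ := by linarith
  refine differentiableAt_integral_of_dominated (r := s₀.re - σ) (by linarith)
    (F := fun s (u : ℝ) => ((1 + u ^ 2 : ℝ) : ℂ) ^ (-s))
    (fun s _ => (continuous_one_add_sq_cpow s).aestronglyMeasurable)
    (Eventually.of_forall fun u => ?_) (Eventually.of_forall fun u s hs => ?_)
    (integrable_one_add_sq_rpow hσ1)
  · intro s _
    refine (DifferentiableAt.const_cpow (by fun_prop) (Or.inl ?_)).differentiableWithinAt
    exact_mod_cast (by positivity : (1 + u ^ 2 : ℝ) ≠ 0)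
  · rw [norm_one_add_sq_cpow]
    exact Real.rpow_le_rpow_of_exponent_le (by nlinarith [sq_nonneg u]) (by
      linarith [ball_subset_re_gt hs])

lemma translate_eq {x y : ℝ} (hy : 0 < y) (s : ℂ) (t : ℝ) :
    (((x + t) ^ 2 + y ^ 2 : ℝ) : ℂ) ^ (-s) =
      (y : ℂ) ^ (-(2 * s)) * ((1 + ((t + x) / y) ^ 2 : ℝ) : ℂ) ^ (-s) := by
  have h1 : (x + t) ^ 2 + y ^ 2 = y ^ 2 * (1 + ((t + x) / y) ^ 2) := by field_simp; ring
  have hy0 : (y : ℂ) ≠ 0 := by exact_mod_cast hy.ne'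
  have hy2 : ((y ^ 2 : ℝ) : ℂ) ≠ 0 := by exact_mod_cast (by positivity : y ^ 2 ≠ 0)
  rw [h1, Complex.ofReal_mul, Complex.mul_cpow_ofReal_nonneg (by positivity) (by positivity)]
  congr 1
  rw [Complex.cpow_def_of_ne_zero hy0, Complex.cpow_def_of_ne_zero hy2, ← Complex.ofReal_log hy.le,
    ← Complex.ofReal_log (by positivity), Real.log_pow]
  push_cast
  ring_nf

lemma integrable_translate {x y : ℝ} (hy : 0 < y) {s : ℂ} (hs : 1 / 2 < s.re) :
    Integrable fun t : ℝ => (((x + t) ^ 2 + y ^ 2 : ℝ) : ℂ) ^ (-s) := by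
  simp_rw [translate_eq hy]
  exact (((integrable_one_add_sq_cpow hs).comp_div hy.ne').comp_add_right x).const_mul _

lemma integral_translate {x y : ℝ} (hy : 0 < y) (s : ℂ) :
    ∫ t : ℝ, (((x + t) ^ 2 + y ^ 2 : ℝ) : ℂ) ^ (-s) = (y : ℂ) ^ (1 - 2 * s) * archFactor s := by
  have hy0 : (y : ℂ) ≠ 0 := by exact_mod_cast hy.ne'
  simp_rw [translate_eq hy]
  rw [integral_const_mul, integral_add_right_eq_self
    (fun t : ℝ => ((1 + (t / y) ^ 2 : ℝ) : ℂ) ^ (-s)) x,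
    Measure.integral_comp_div (fun u : ℝ => ((1 + u ^ 2 : ℝ) : ℂ) ^ (-s)) y, abs_of_pos hy, archFactor,
    Complex.real_smul, sub_eq_add_neg, Complex.cpow_add _ _ hy0, Complex.cpow_one]
  ring

/-- For fixed `c ≠ 0`, the integrals over `t ∈ [0, 1]` of the translates by `d ∈ ℤ` add up to an
integral over the whole line. -/
lemma integral_translateTerm {s : ℂ} (hs : 1 / 2 < s.re) (z : ℍ) (c : ℤ) :
    HasSum (fun d : ℤ => ∫ t in (0 : ℝ)..1, translateTerm s z t ![c, d])
      ((((|c| : ℤ) : ℝ) : ℂ) ^ (-(2 * s - 1)) * ((z.im : ℂ) ^ (1 - 2 * s) * archFactor s)) := by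
  rcases eq_or_ne c 0 with rfl | hc
  · have h0 : -(2 * s - 1) ≠ 0 := by
      intro h
      have := congrArg Complex.re h
      simp at this
      linarith
    rw [neg_sub] at h0
    simp [translateTerm, Complex.zero_cpow h0, hasSum_zero]
  have hc' : (0 : ℝ) < ((|c| : ℤ) : ℝ) := by exact_mod_cast abs_pos.mpr hc
  have hy : 0 < ((|c| : ℤ) : ℝ) * z.im := mul_pos hc' z.im_pos
  have h := (integrable_translate (x := c * z.re) hy hs).hasSum_intervalIntegral_comp_add_int
  rw [integral_translate hy, Complex.ofReal_mul, Complex.mul_cpow_ofReal_nonneg hc'.le z.im_pos.le,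
    mul_assoc] at h
  rw [neg_sub]
  refine h.congr_fun fun d => intervalIntegral.integral_congr fun t _ => ?_
  simp only [translateTerm, Matrix.cons_val_zero, Matrix.cons_val_one, hc, if_false]
  congr 2
  have := normSq_translate z t ![c, d]
  simp only [Matrix.cons_val_zero, Matrix.cons_val_one] at this
  rw [this, mul_pow, mul_pow]
  have h2 : ((|c| : ℤ) : ℝ) ^ 2 = (c : ℝ) ^ 2 := by push_cast; exact sq_abs _
  rw [h2]
  ring

lemma summable_translateBound {σ : ℝ} (hσ : 1 < σ) (C : ℝ) :
    Summable fun v : Fin 2 → ℤ => C * ‖v‖ ^ (-(2 * σ)) :=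
  (EisensteinSeries.summable_one_div_norm_rpow (by linarith)).mul_left C

lemma summable_translateTerm {z : ℍ} (hz : z ∈ (𝒟 : Set ℍ)) {t : ℝ} (ht : t ∈ Set.Icc (0 : ℝ) 1)
    {s : ℂ} (hs : 1 < s.re) : Summable (translateTerm s z t) :=
  Summable.of_norm_bounded (summable_translateBound hs (16 ^ s.re))
    fun v => norm_translateTerm_le hz ht v (by linarith) le_rfl le_rfl

lemma continuous_translateTerm_right (s : ℂ) (z : ℍ) (v : Fin 2 → ℤ) :
    Continuous fun t : ℝ => translateTerm s z t v := by
  by_cases hv : v 0 = 0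
  · simp only [translateTerm, hv, if_true]; exact continuous_const
  · simp only [translateTerm, hv, if_false]
    refine Continuous.cpow ?_ continuous_const fun t => ?_
    · exact Complex.continuous_ofReal.comp (Complex.continuous_normSq.comp (by fun_prop))
    · left
      rw [Complex.ofReal_re]
      exact normSq_translate_pos _ _ hv

lemma hasSum_integral_translateTerm {z : ℍ} (hz : z ∈ (𝒟 : Set ℍ)) {s : ℂ} (hs : 1 < s.re) :
    HasSum (fun v : Fin 2 → ℤ => ∫ t in (0 : ℝ)..1, translateTerm s z t v)
      (∫ t in (0 : ℝ)..1, ∑' v, translateTerm s z t v) := by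
  refine intervalIntegral.hasSum_integral_of_dominated_convergence
    (fun v _ => 16 ^ s.re * ‖v‖ ^ (-(2 * s.re)))
    (fun v => (continuous_translateTerm_right s z v).aestronglyMeasurable)
    (fun v => Eventually.of_forall fun t ht => ?_)
    (Eventually.of_forall fun t _ => summable_translateBound hs _) (by simp)
    (Eventually.of_forall fun t ht => ?_)
  · rw [Set.uIoc_of_le zero_le_one] at ht
    exact norm_translateTerm_le hz (Set.Ioc_subset_Icc_self ht) v (by linarith) le_rfl le_rfl
  · rw [Set.uIoc_of_le zero_le_one] at ht
    exact (summable_translateTerm hz (Set.Ioc_subset_Icc_self ht) hs).hasSum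

lemma integral_tsum_translateTerm {z : ℍ} (hz : z ∈ (𝒟 : Set ℍ)) {s : ℂ} (hs : 1 < s.re) :
    ∫ t in (0 : ℝ)..1, ∑' v, translateTerm s z t v =
      2 * riemannZeta (2 * s - 1) * ((z.im : ℂ) ^ (1 - 2 * s) * archFactor s) := by
  have h1 := hasSum_integral_translateTerm hz hs
  rw [← (finTwoArrowEquiv ℤ).symm.hasSum_iff] at h1
  have h2 := h1.prod_fiberwise fun c => integral_translateTerm (by linarith) z c
  have h3 := (hasSum_int_cpow (w := 2 * s - 1) (by simp; linarith)).mul_right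
    ((z.im : ℂ) ^ (1 - 2 * s) * archFactor s)
  exact h2.unique h3

/-- The terms with `c = 0` contribute `2 ζ(2s)`. -/
lemma epstein_eq_add {z : ℍ} (hz : z ∈ (𝒟 : Set ℍ)) {s : ℂ} (hs : 1 < s.re) :
    epstein s z = 2 * riemannZeta (2 * s) + ∑' v, translateTerm s z 0 v := by
  have hs0 : s ≠ 0 := by rintro rfl; norm_num at hs
  have hinj : Function.Injective fun d : ℤ => (![0, d] : Fin 2 → ℤ) := fun a b h => by
    simpa using congrFun h 1
  have h1 : HasSum (fun v : Fin 2 → ℤ => if v 0 = 0 then (((|v 1| : ℤ) : ℝ) : ℂ) ^ (-(2 * s)) else 0)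
      (2 * riemannZeta (2 * s)) := by
    rw [← hinj.hasSum_iff]
    · refine (hasSum_int_cpow (w := 2 * s) (by simp; linarith)).congr_fun fun d => ?_
      simp
    · intro v hv
      rw [if_neg]
      intro h0
      exact hv ⟨v 1, by ext i; fin_cases i <;> simp [h0]⟩
  have h2 := h1.add (summable_translateTerm hz (Set.left_mem_Icc.mpr zero_le_one) hs).hasSum
  rw [epstein, ← h2.tsum_eq]
  refine tsum_congr fun v => ?_
  by_cases hv : v 0 = 0
  · rw [if_pos hv, translateTerm, if_pos hv, latticeTerm, hv, add_zero]
    simp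
  · rw [if_neg hv, translateTerm, if_neg hv, latticeTerm_eq_normSq hs0, zero_add]
    simp

/-- Averaging over `t ∈ [0, 1]` replaces the sum over `d` by an integral over the line, which gives
the second term; the error is `diffSum`. As `diffSum` converges for `Re s > 1/2`, this continues the
Epstein zeta function across its pole at `s = 1`. -/
lemma epstein_eq {z : ℍ} (hz : z ∈ (𝒟 : Set ℍ)) {s : ℂ} (hs : 1 < s.re) :
    epstein s z = 2 * riemannZeta (2 * s) +
      2 * riemannZeta (2 * s - 1) * ((z.im : ℂ) ^ (1 - 2 * s) * archFactor s) +
      ∫ t in (0 : ℝ)..1, diffSum s z t := by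
  have h0 := summable_translateTerm hz (Set.left_mem_Icc.mpr zero_le_one) hs
  have h1 : ∫ t in (0 : ℝ)..1, diffSum s z t =
      ∫ t in (0 : ℝ)..1, (∑' v, translateTerm s z 0 v - ∑' v, translateTerm s z t v) := by
    refine intervalIntegral.integral_congr fun t ht => ?_
    rw [Set.uIcc_of_le zero_le_one] at ht
    exact h0.tsum_sub (summable_translateTerm hz ht hs)
  have hc : ContinuousOn (fun t : ℝ => ∑' v, translateTerm s z t v) (Set.uIcc 0 1) := by
    rw [Set.uIcc_of_le zero_le_one]
    exact continuousOn_tsum (fun v => (continuous_translateTerm_right s z v).continuousOn)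
      (summable_translateBound hs (16 ^ s.re))
      fun v t ht => norm_translateTerm_le hz ht v (by linarith) le_rfl le_rfl
  rw [h1, intervalIntegral.integral_sub (by simp) hc.intervalIntegrable,
    integral_tsum_translateTerm hz hs, epstein_eq_add hz hs, intervalIntegral.integral_const, sub_zero,
    one_smul]
  ring

/-! ### The value of the symmetric square `L`-function at `1` -/

section

variable {k : ℕ} (f : CuspForm 𝒮ℒ (k : ℤ))

lemma isFiniteMeasure_restrict_fd : IsFiniteMeasure (volume.restrict (𝒟 : Set ℍ)) :=
  ⟨by rw [Measure.restrict_apply_univ]; exact volume_fd_lt_top⟩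

lemma half_le_im_of_mem_fd {z : ℍ} (hz : z ∈ (𝒟 : Set ℍ)) : 1 / 2 ≤ z.im := by
  have := ModularGroup.three_le_four_mul_im_sq_of_mem_fd hz
  nlinarith [z.im_pos]

/-- The decay of `y^k |f|²` towards the cusp beats any power of `y`, uniformly for `s` in a vertical
strip. -/
lemma exists_bound_petersson_mul_cpow (N : ℕ) : ∃ C : ℝ, 0 ≤ C ∧ ∀ z ∈ (𝒟 : Set ℍ), ∀ s : ℂ,
    |s.re| ≤ N → ‖petersson k f f z * (z.im : ℂ) ^ s‖ ≤ C := by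
  obtain ⟨C, hC⟩ := exists_petersson_bound f
  obtain ⟨C', hC'⟩ := exists_petersson_decay f N
  have hC0 : 0 ≤ C := (norm_nonneg _).trans (hC UpperHalfPlane.I)
  refine ⟨C * 2 ^ N + |C'|, by positivity, fun z hz s hs => ?_⟩
  have hy := half_le_im_of_mem_fd hz
  have hs' := abs_le.mp hs
  rw [norm_mul, norm_im_cpow]
  rcases le_total 1 z.im with h1 | h1
  · calc ‖petersson k f f z‖ * z.im ^ s.re ≤ ‖petersson k f f z‖ * z.im ^ (N : ℝ) := by
          gcongr
          exact hs'.2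
      _ ≤ C' := by rw [Real.rpow_natCast]; exact hC' z hy
      _ ≤ C * 2 ^ N + |C'| := by linarith [le_abs_self C', (by positivity : 0 ≤ C * 2 ^ N)]
  · have h2 : z.im ^ s.re ≤ 2 ^ N := by
      calc z.im ^ s.re ≤ z.im ^ (-(N : ℝ)) :=
            Real.rpow_le_rpow_of_exponent_ge z.im_pos h1 (by linarith [hs'.1])
        _ ≤ (1 / 2 : ℝ) ^ (-(N : ℝ)) :=
            Real.rpow_le_rpow_of_nonpos (by norm_num) hy (by simp)
        _ = 2 ^ N := by rw [Real.rpow_neg (by norm_num), Real.rpow_natCast]; simp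
    calc ‖petersson k f f z‖ * z.im ^ s.re ≤ C * 2 ^ N := by gcongr; exact hC z
      _ ≤ _ := by linarith [abs_nonneg C']

lemma measurable_petersson_mul_cpow (s : ℂ) :
    Measurable fun z : ℍ => petersson k f f z * (z.im : ℂ) ^ s :=
  (continuous_petersson f).measurable.mul
    ((Complex.measurable_ofReal.comp UpperHalfPlane.continuous_im.measurable).pow_const s)

lemma continuous_petersson_mul_cpow (s : ℂ) :
    Continuous fun z : ℍ => petersson k f f z * (z.im : ℂ) ^ s := by
  refine (continuous_petersson f).mul (Continuous.cpow
    (Complex.continuous_ofReal.comp UpperHalfPlane.continuous_im) continuous_const fun z => Or.inl ?_)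
  rw [Complex.ofReal_re]
  exact z.im_pos

/-- The integral of `‖f‖² y^{k + s}` over the fundamental domain. -/
def mellinFd (s : ℂ) : ℂ := ∫ z in (𝒟 : Set ℍ), petersson k f f z * (z.im : ℂ) ^ s

lemma mellinFd_zero : mellinFd f 0 = peterssonProd f f := by simp [mellinFd, peterssonProd]

lemma integrableOn_petersson_mul_cpow (s : ℂ) :
    IntegrableOn (fun z : ℍ => petersson k f f z * (z.im : ℂ) ^ s) (𝒟 : Set ℍ) := by
  obtain ⟨C, -, hC⟩ := exists_bound_petersson_mul_cpow f ⌈|s.re|⌉₊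
  refine Measure.integrableOn_of_bounded (M := C) volume_fd_lt_top.ne
    (measurable_petersson_mul_cpow f s).aestronglyMeasurable ?_
  filter_upwards [ae_restrict_mem measurableSet_fd] with z hz using hC z hz s (Nat.le_ceil _)

lemma abs_re_le_ceil {s₀ s : ℂ} {r : ℝ} (hs : s ∈ Metric.ball s₀ r) : |s.re| ≤ ⌈‖s₀‖ + r⌉₊ := by
  have h1 := mem_ball_iff_norm.mp hs
  calc |s.re| ≤ ‖s‖ := Complex.abs_re_le_norm s
    _ = ‖s₀ + (s - s₀)‖ := by ring_nf
    _ ≤ ‖s₀‖ + ‖s - s₀‖ := norm_add_le _ _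
    _ ≤ ‖s₀‖ + r := by linarith
    _ ≤ _ := Nat.le_ceil _

lemma differentiable_im_cpow (z : ℍ) : Differentiable ℂ fun s : ℂ => (z.im : ℂ) ^ s := fun s =>
  DifferentiableAt.const_cpow (by fun_prop) (Or.inl (by exact_mod_cast z.im_pos.ne'))

lemma differentiable_mellinFd : Differentiable ℂ (mellinFd f) := by
  intro s₀
  obtain ⟨C, -, hC⟩ := exists_bound_petersson_mul_cpow f ⌈‖s₀‖ + 1⌉₊
  have := isFiniteMeasure_restrict_fd
  refine differentiableAt_integral_of_dominated one_pos (bound := fun _ => C)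
    (fun s _ => (measurable_petersson_mul_cpow f s).aestronglyMeasurable)
    (Eventually.of_forall fun z => ?_) ?_ (integrable_const C)
  · exact ((differentiable_im_cpow z).const_mul _).differentiableOn
  · filter_upwards [ae_restrict_mem measurableSet_fd] with z hz s hs
    exact hC z hz s (abs_re_le_ceil hs)

/-- The measure on `𝒟 × (0, 1]` for the remainder term of the Epstein zeta function. -/
def fdMeasure : Measure (ℍ × ℝ) :=
  (volume.restrict (𝒟 : Set ℍ)).prod (volume.restrict (Set.Ioc (0 : ℝ) 1))

lemma fdMeasure_eq : fdMeasure = (volume.prod volume).restrict ((𝒟 : Set ℍ) ×ˢ Set.Ioc (0 : ℝ) 1) :=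
  Measure.prod_restrict _ _

lemma isFiniteMeasure_fdMeasure : IsFiniteMeasure fdMeasure := by
  have := isFiniteMeasure_restrict_fd
  rw [fdMeasure]
  infer_instance

/-- The contribution of the remainder term of the Epstein zeta function. -/
def remainderInt (s : ℂ) : ℂ :=
  ∫ p, petersson k f f p.1 * (p.1.im : ℂ) ^ s * diffSum s p.1 p.2 ∂fdMeasure

lemma ae_fdMeasure : ∀ᵐ p ∂fdMeasure, p.1 ∈ (𝒟 : Set ℍ) ∧ p.2 ∈ Set.Icc (0 : ℝ) 1 := by
  rw [fdMeasure_eq]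
  filter_upwards [ae_restrict_mem (measurableSet_fd.prod measurableSet_Ioc)] with p hp
  exact ⟨hp.1, Set.Ioc_subset_Icc_self hp.2⟩

lemma aestronglyMeasurable_remainder {s : ℂ} (hs : 1 / 2 < s.re) :
    AEStronglyMeasurable (fun p : ℍ × ℝ => petersson k f f p.1 * (p.1.im : ℂ) ^ s *
      diffSum s p.1 p.2) fdMeasure := by
  rw [fdMeasure_eq]
  refine ContinuousOn.aestronglyMeasurable ?_ (measurableSet_fd.prod measurableSet_Ioc)
  refine ContinuousOn.mul ?_ ((continuousOn_diffSum hs).mono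
    (Set.prod_mono subset_rfl Set.Ioc_subset_Icc_self))
  exact ((continuous_petersson_mul_cpow f s).comp continuous_fst).continuousOn

lemma exists_bound_remainder {s₀ : ℂ} {σ : ℝ} (hσ : 1 / 2 < σ) : ∃ C : ℝ,
    ∀ p : ℍ × ℝ, p.1 ∈ (𝒟 : Set ℍ) ∧ p.2 ∈ Set.Icc (0 : ℝ) 1 →
      ∀ s : ℂ, σ < s.re → s ∈ Metric.ball s₀ (s₀.re - σ) →
      ‖petersson k f f p.1 * (p.1.im : ℂ) ^ s * diffSum s p.1 p.2‖ ≤ C := by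
  obtain ⟨C, hC0, hC⟩ := exists_bound_petersson_mul_cpow f ⌈‖s₀‖ + (s₀.re - σ)⌉₊
  set R := ‖s₀‖ + (s₀.re - σ)
  refine ⟨C * ∑' v : Fin 2 → ℤ, 2 * R * 16 ^ (R + 1 / 2) * ‖v‖ ^ (-(2 * (σ + 1 / 2))),
    fun p hp s hs hsb => ?_⟩
  rw [norm_mul]
  have hR : ‖s‖ ≤ R := by
    calc ‖s‖ = ‖s₀ + (s - s₀)‖ := by ring_nf
      _ ≤ ‖s₀‖ + ‖s - s₀‖ := norm_add_le _ _
      _ ≤ R := by have := mem_ball_iff_norm.mp hsb; simp only [R]; linarith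
  exact mul_le_mul (hC p.1 hp.1 s (abs_re_le_ceil hsb)) (norm_diffSum_le hp.1 hp.2 hσ hs.le hR)
    (norm_nonneg _) hC0

lemma integrable_remainder {s : ℂ} (hs : 1 / 2 < s.re) :
    Integrable (fun p : ℍ × ℝ => petersson k f f p.1 * (p.1.im : ℂ) ^ s *
      diffSum s p.1 p.2) fdMeasure := by
  have := isFiniteMeasure_fdMeasure
  obtain ⟨C, hC⟩ := exists_bound_remainder f (s₀ := s) (σ := (1 / 2 + s.re) / 2) (by linarith)
  refine Integrable.of_bound (aestronglyMeasurable_remainder f hs) C ?_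
  filter_upwards [ae_fdMeasure] with p hp
  exact hC p hp s (by linarith) (Metric.mem_ball_self (by linarith))

lemma differentiableAt_remainderInt {s₀ : ℂ} (hs : 1 / 2 < s₀.re) :
    DifferentiableAt ℂ (remainderInt f) s₀ := by
  have := isFiniteMeasure_fdMeasure
  set σ := (1 / 2 + s₀.re) / 2 with hσ
  have hσ1 : 1 / 2 < σ := by linarith
  obtain ⟨C, hC⟩ := exists_bound_remainder f (s₀ := s₀) hσ1
  refine differentiableAt_integral_of_dominated (r := s₀.re - σ) (by linarith) (bound := fun _ => C)
    (fun s hs => aestronglyMeasurable_remainder f (hσ1.trans (ball_subset_re_gt hs))) ?_ ?_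
    (integrable_const C)
  · filter_upwards [ae_fdMeasure] with p hp
    refine (((differentiable_im_cpow p.1).const_mul _).differentiableOn).mul
      ((differentiableOn_diffSum (R := ‖s₀‖ + (s₀.re - σ)) hp.1 hp.2 hσ1).mono fun s hs => ?_)
    refine ⟨ball_subset_re_gt hs, ?_⟩
    calc ‖s‖ = ‖s₀ + (s - s₀)‖ := by ring_nf
      _ ≤ ‖s₀‖ + ‖s - s₀‖ := norm_add_le _ _
      _ < _ := by have := mem_ball_iff_norm.mp hs; linarith
  · filter_upwards [ae_fdMeasure] with p hp s hs
    exact hC p hp s (ball_subset_re_gt hs) hs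

lemma integral_petersson_mul_epstein_eq {s : ℂ} (hs : 1 < s.re) :
    ∫ z in (𝒟 : Set ℍ), petersson k f f z * (z.im : ℂ) ^ s * epstein s z =
      2 * riemannZeta (2 * s) * mellinFd f s +
        2 * riemannZeta (2 * s - 1) * archFactor s * mellinFd f (1 - s) + remainderInt f s := by
  have hint := integrable_remainder f (s := s) (by linarith)
  have h3 : remainderInt f s = ∫ z in (𝒟 : Set ℍ), petersson k f f z * (z.im : ℂ) ^ s *
      ∫ t in (0 : ℝ)..1, diffSum s z t := by
    rw [fdMeasure] at hint
    rw [remainderInt, fdMeasure, integral_prod _ hint]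
    refine integral_congr_ae (Eventually.of_forall fun z => ?_)
    simp only
    rw [integral_const_mul, intervalIntegral.integral_of_le zero_le_one]
  have h4 : IntegrableOn (fun z : ℍ => petersson k f f z * (z.im : ℂ) ^ s *
      ∫ t in (0 : ℝ)..1, diffSum s z t) (𝒟 : Set ℍ) := by
    rw [fdMeasure] at hint
    refine hint.integral_prod_left.congr (Eventually.of_forall fun z => ?_)
    simp only
    rw [integral_const_mul, intervalIntegral.integral_of_le zero_le_one]
  rw [h3, mellinFd, mellinFd, ← integral_const_mul, ← integral_const_mul, ← integral_add,
    ← integral_add]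
  · refine setIntegral_congr_fun measurableSet_fd fun z hz => ?_
    rw [epstein_eq hz hs]
    have hy0 : (z.im : ℂ) ≠ 0 := by exact_mod_cast z.im_pos.ne'
    have h5 : (z.im : ℂ) ^ (1 - s) = (z.im : ℂ) ^ s * (z.im : ℂ) ^ (1 - 2 * s) := by
      rw [← Complex.cpow_add _ _ hy0]; ring_nf
    rw [h5]
    ring
  · exact ((integrableOn_petersson_mul_cpow f s).const_mul _).add
      ((integrableOn_petersson_mul_cpow f (1 - s)).const_mul _)
  · exact h4
  · exact (integrableOn_petersson_mul_cpow f s).const_mul _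
  · exact (integrableOn_petersson_mul_cpow f (1 - s)).const_mul _

/-- `(s - 1)` times the Rankin–Selberg integral, continued to `Re s > 1/2`. The factor `s - 1` is
absorbed into the entire function `riemannZeta₁ s = (s - 1) ζ(s)`, so that no pole remains. -/
def rankinNumerator (s : ℂ) : ℂ :=
  2 * (s - 1) * riemannZeta (2 * s) * mellinFd f s +
    riemannZeta₁ (2 * s - 1) * archFactor s * mellinFd f (1 - s) + (s - 1) * remainderInt f s

lemma rankinNumerator_one : rankinNumerator f 1 = π * peterssonProd f f := by
  rw [rankinNumerator, sub_self, mellinFd_zero, archFactor_one]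
  norm_num

lemma differentiableAt_rankinNumerator {s : ℂ} (hs : 1 / 2 < s.re) :
    DifferentiableAt ℂ (rankinNumerator f) s := by
  have h2 : 2 * s ≠ 1 := by
    intro h
    have := congrArg Complex.re h
    simp at this
    linarith
  have hz : DifferentiableAt ℂ (fun s : ℂ => riemannZeta (2 * s)) s :=
    (differentiableAt_riemannZeta h2).comp s (by fun_prop)
  have hz1 : DifferentiableAt ℂ (fun s : ℂ => riemannZeta₁ (2 * s - 1)) s :=
    (differentiable_riemannZeta₁ _).comp s (by fun_prop)
  have hm : DifferentiableAt ℂ (fun s : ℂ => mellinFd f (1 - s)) s :=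
    (differentiable_mellinFd f _).comp s (by fun_prop)
  have ha := differentiableAt_archFactor hs
  have hr := differentiableAt_remainderInt f hs
  have hm' := differentiable_mellinFd f s
  unfold rankinNumerator
  fun_prop

lemma rankinNumerator_eq {s : ℂ} (hs : 1 < s.re) : rankinNumerator f s = (s - 1) *
    ∫ z in (𝒟 : Set ℍ), petersson k f f z * (z.im : ℂ) ^ s * epstein s z := by
  have h1 : s - 1 ≠ 0 := by
    intro h
    have := congrArg Complex.re h
    simp at this
    linarith
  have h2 : 2 * s - 1 ≠ 1 := by
    intro h
    exact h1 (by linear_combination h / 2)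
  rw [integral_petersson_mul_epstein_eq f hs, rankinNumerator, riemannZeta_eq_inv_sub_mul h2]
  have h3 : (2 * s - 1 - 1 : ℂ) = 2 * (s - 1) := by ring
  rw [h3]
  field_simp

/-- The gamma factor in the Rankin–Selberg integral. -/
def rankinFactor (k : ℕ) (s : ℂ) : ℂ :=
  2 * Complex.Gamma (s + k - 1) * ((4 * π : ℝ) : ℂ) ^ (-(s + k - 1))

lemma rankinFactor_ne_zero (hk : 9 ≤ k) {s : ℂ} (hs : 0 < s.re) : rankinFactor k s ≠ 0 := by
  have hk9 : (9 : ℝ) ≤ k := by exact_mod_cast hk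
  refine mul_ne_zero (mul_ne_zero two_ne_zero (Complex.Gamma_ne_zero_of_re_pos ?_)) ?_
  · simp; linarith
  · rw [Complex.cpow_def_of_ne_zero (by exact_mod_cast (by positivity : (4 * π : ℝ) ≠ 0))]
    exact Complex.exp_ne_zero _

lemma differentiableAt_rankinFactor (hk : 9 ≤ k) {s : ℂ} (hs : 0 < s.re) :
    DifferentiableAt ℂ (rankinFactor k) s := by
  have hk9 : (9 : ℝ) ≤ k := by exact_mod_cast hk
  have h1 : DifferentiableAt ℂ (fun s : ℂ => Complex.Gamma (s + k - 1)) s := by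
    refine (Complex.differentiableAt_Gamma _ fun m h => ?_).comp s (by fun_prop)
    have := congrArg Complex.re h
    simp at this
    have hm : (0 : ℝ) ≤ m := m.cast_nonneg
    linarith
  have h2 : DifferentiableAt ℂ (fun s : ℂ => ((4 * π : ℝ) : ℂ) ^ (-(s + k - 1))) s :=
    DifferentiableAt.const_cpow (by fun_prop)
      (Or.inl (by exact_mod_cast (by positivity : (4 * π : ℝ) ≠ 0)))
  unfold rankinFactor
  fun_prop

/-- The domain of the continuation of `L(s, sym² f)`: on a segment from a point of the ball to `2`,
every point outside the half-plane lies in the ball. -/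
lemma starConvex_halfPlane_union_ball (r : ℝ) :
    StarConvex ℝ (2 : ℂ) ({z : ℂ | 1 < z.re} ∪ Metric.ball 1 r) := by
  intro z hz a b ha hb hab
  by_cases h : 1 < (a • (2 : ℂ) + b • z).re
  · exact Or.inl h
  refine Or.inr ?_
  have hre : (a • (2 : ℂ) + b • z).re = 2 * a + b * z.re := by simp; ring
  have him : (a • (2 : ℂ) + b • z).im = b * z.im := by simp
  rw [hre] at h
  rcases hz with hz | hz
  · have hz : 1 < z.re := hz
    exfalso
    rcases ha.eq_or_lt with rfl | ha
    · rw [zero_add] at hab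
      subst hab
      linarith
    · nlinarith
  · rw [mem_ball_iff_norm] at hz ⊢
    refine lt_of_le_of_lt ?_ hz
    rw [← Real.sqrt_sq (norm_nonneg (z - 1)), ← Real.sqrt_sq (norm_nonneg (_ - 1)),
      Complex.sq_norm, Complex.sq_norm, Complex.normSq_apply, Complex.normSq_apply]
    refine Real.sqrt_le_sqrt ?_
    simp only [Complex.sub_re, Complex.sub_im, Complex.one_re, Complex.one_im, sub_zero, hre, him]
    have hb1 : b ≤ 1 := by linarith
    have hx : a ≤ b * (1 - z.re) := by nlinarith
    have h1 : 2 * a + b * z.re - 1 = a - b * (1 - z.re) := by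
      have : a = 1 - b := by linarith
      rw [this]; ring
    have h2 : (a - b * (1 - z.re)) * (a - b * (1 - z.re)) ≤ (b * (1 - z.re)) * (b * (1 - z.re)) := by
      nlinarith
    have h3 : b * b ≤ 1 := by nlinarith
    rw [h1]
    nlinarith [mul_nonneg (sub_nonneg.mpr h3) (mul_self_nonneg (z.re - 1)),
      mul_nonneg (sub_nonneg.mpr h3) (mul_self_nonneg z.im)]

/-- The quotient of the continued Rankin–Selberg integral by its gamma factor and `ζ(s)` continues
`L(s, sym² f)` to the half-plane `Re s > 1` together with a small disc about `1`, on which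
`riemannZeta₁` has no zero. Its value at `1` comes from the residue `π ⟨f, f⟩` of the Rankin–Selberg
integral. -/
lemma isSymSquareValue_one (hk : 9 ≤ k) (hk2 : Even k) {f : CuspForm 𝒮ℒ (k : ℤ)}
    (hf : f ∈ heckeBasis k) :
    IsSymSquareValue f 1 (π * peterssonProd f f / rankinFactor k 1) := by
  obtain ⟨r, hr, hball⟩ := Metric.eventually_nhds_iff_ball.mp riemannZeta₁_ne_zero_of_near_one
  set r' := min r (1 / 2)
  have hr' : 0 < r' := by positivity
  have hre : ∀ s ∈ {z : ℂ | 1 < z.re} ∪ Metric.ball 1 r', 1 / 2 < s.re := by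
    rintro s (hs | hs)
    · have hs : 1 < s.re := hs
      linarith
    · refine ball_subset_re_gt (Metric.ball_subset_ball ?_ hs)
      have := min_le_right r (1 / 2)
      rw [Complex.one_re]
      simp only [r']
      linarith
  have hne : ∀ s : ℂ, 1 < s.re → s - 1 ≠ 0 := fun s hs h => by
    have := congrArg Complex.re h
    simp at this
    linarith
  have hz : ∀ s : ℂ, 1 < s.re → riemannZeta₁ s = (s - 1) * riemannZeta s := fun s hs => by
    rw [riemannZeta_eq_inv_sub_mul (sub_ne_zero.mp (hne s hs)), mul_inv_cancel_left₀ (hne s hs)]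
  have hz0 : ∀ s ∈ {z : ℂ | 1 < z.re} ∪ Metric.ball 1 r', riemannZeta₁ s ≠ 0 := by
    rintro s (hs | hs)
    · rw [hz s hs]
      exact mul_ne_zero (hne s hs) (riemannZeta_ne_zero_of_one_lt_re hs)
    · exact hball s (Metric.ball_subset_ball (min_le_left _ _) hs)
  refine ⟨{z : ℂ | 1 < z.re} ∪ Metric.ball 1 r',
    fun s => rankinNumerator f s / (rankinFactor k s * riemannZeta₁ s),
    (isOpen_lt continuous_const Complex.continuous_re).union Metric.isOpen_ball,
    starConvex_halfPlane_union_ball r', Set.subset_union_left, Or.inr (Metric.mem_ball_self hr'),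
    fun s hs => ?_, fun s hs => ?_, ?_⟩
  · have h1 := hre s hs
    refine (DifferentiableAt.div (differentiableAt_rankinNumerator f h1)
      ((differentiableAt_rankinFactor hk (by linarith)).mul (differentiable_riemannZeta₁ s))
      (mul_ne_zero (rankinFactor_ne_zero hk (by linarith)) (hz0 s hs))).differentiableWithinAt
  · have h1 := rankinFactor_ne_zero hk (s := s) (by linarith)
    have h2 := hne s hs
    have h3 := riemannZeta_ne_zero_of_one_lt_re hs
    simp only
    rw [rankinNumerator_eq f hs, integral_petersson_mul_epstein hk hk2 hf hs, hz s hs, ← rankinFactor]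
    field_simp
  · simp only
    rw [rankinNumerator_one, riemannZeta₁_one, mul_one]

lemma symSquareL_one (hk : 9 ≤ k) (hk2 : Even k) {f : CuspForm 𝒮ℒ (k : ℤ)}
    (hf : f ∈ heckeBasis k) : symSquareL f 1 = π * peterssonProd f f / rankinFactor k 1 := by
  have h : ∃ w, IsSymSquareValue f 1 w := ⟨_, isSymSquareValue_one hk hk2 hf⟩
  rw [symSquareL, dif_pos h]
  exact h.choose_spec.unique (isSymSquareValue_one hk hk2 hf)

/-- The harmonic weights of the Petersson formula in terms of `L(1, sym² f)`. -/
theorem heckeWeight_eq (hk : 9 ≤ k) (hk2 : Even k) {f : CuspForm 𝒮ℒ (k : ℤ)}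
    (hf : f ∈ heckeBasis k) :
    2 * (π : ℂ) ^ 2 / ((k : ℂ) - 1) / symSquareL f 1 = heckeWeight f := by
  have hP := peterssonProd_self_ne_zero hk hk2 hf
  have hpi : (π : ℂ) ≠ 0 := by exact_mod_cast Real.pi_ne_zero
  obtain ⟨j, rfl⟩ : ∃ j, k = j + 2 := ⟨k - 2, by omega⟩
  have e1 : (1 : ℂ) + ((j + 2 : ℕ) : ℂ) - 1 = ((j + 1 : ℕ) : ℂ) + 1 := by push_cast; ring
  have e2 : -(((j + 1 : ℕ) : ℂ) + 1) = -((j + 2 : ℕ) : ℂ) := by push_cast; ring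
  have h4 : (((4 * π : ℝ) : ℂ)) ≠ 0 := by exact_mod_cast (by positivity : (4 * π : ℝ) ≠ 0)
  have hf1 : ((j ! : ℕ) : ℂ) ≠ 0 := by exact_mod_cast (Nat.factorial_pos _).ne'
  have hj : (j : ℂ) + 1 ≠ 0 := by exact_mod_cast Nat.succ_ne_zero j
  have e3 : ((j + 2 : ℕ) : ℂ) - 1 = j + 1 := by push_cast; ring
  rw [symSquareL_one hk hk2 hf, rankinFactor, e1, Complex.Gamma_nat_eq_factorial, e2, Complex.cpow_neg,
    Complex.cpow_natCast, heckeWeight, Nat.factorial_succ, e3]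
  have e4 : j + 2 - 2 = j := by omega
  have e5 : j + 2 - 1 = j + 1 := by omega
  rw [e4, e5]
  push_cast at h4 ⊢
  field_simp
  ring

end

/-! ### The divisor bound -/

/-- The divisor bound for a prime power. -/
lemma add_one_le_const_mul_rpow {δ : ℝ} (hδ : 0 < δ) {p : ℕ} (hp : 2 ≤ p) (e : ℕ) :
    (e : ℝ) + 1 ≤ (1 + 1 / (δ * Real.log 2)) * ((p ^ e : ℕ) : ℝ) ^ δ := by
  have hlog : 0 < Real.log 2 := Real.log_pos one_lt_two
  have hc : 0 < δ * Real.log 2 := by positivity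
  have hp2 : (2 : ℝ) ≤ p := by exact_mod_cast hp
  have h1 : 1 + (δ * Real.log 2) * e ≤ ((p ^ e : ℕ) : ℝ) ^ δ := by
    calc 1 + (δ * Real.log 2) * e ≤ Real.exp ((δ * Real.log 2) * e) := by
          linarith [Real.add_one_le_exp ((δ * Real.log 2) * e)]
      _ = ((2 : ℝ) ^ e) ^ δ := by
          rw [← Real.rpow_natCast, ← Real.rpow_mul (by norm_num), Real.rpow_def_of_pos two_pos]
          congr 1
          ring
      _ ≤ _ := by
          push_cast
          gcongr
  calc (e : ℝ) + 1 ≤ (1 + 1 / (δ * Real.log 2)) * (1 + (δ * Real.log 2) * e) := by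
        have h2 : (1 + 1 / (δ * Real.log 2)) * (1 + (δ * Real.log 2) * e) =
          1 + e + (δ * Real.log 2) * e + 1 / (δ * Real.log 2) := by field_simp; ring
        rw [h2]
        have h3 : 0 ≤ (δ * Real.log 2) * e := by positivity
        have h4 : 0 ≤ 1 / (δ * Real.log 2) := by positivity
        linarith
    _ ≤ _ := by gcongr

/-- The divisor bound `τ(n) ≪ n^δ`. Both sides are multiplicative, and only the primes below
`2^(1/δ)` cost a constant factor. -/
lemma exists_card_divisors_le {δ : ℝ} (hδ : 0 < δ) : ∃ c : ℝ, 1 ≤ c ∧ ∀ n : ℕ, 0 < n →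
    (n.divisors.card : ℝ) ≤ c * (n : ℝ) ^ δ := by
  set D := 1 + 1 / (δ * Real.log 2) with hD
  have hD1 : 1 ≤ D := by
    have hlog : 0 < Real.log 2 := Real.log_pos one_lt_two
    rw [hD]
    linarith [(by positivity : 0 ≤ 1 / (δ * Real.log 2))]
  set Q := ⌈(2 : ℝ) ^ (1 / δ)⌉₊
  refine ⟨D ^ Q, one_le_pow₀ hD1, fun n hn => ?_⟩
  have hpow : (n : ℝ) ^ δ = ∏ p ∈ n.primeFactors, ((p ^ n.factorization p : ℕ) : ℝ) ^ δ := by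
    rw [Real.finsetProd_rpow _ _ fun _ _ => by positivity, ← Nat.cast_prod]
    congr 2
    exact (Nat.prod_factorization_pow_eq_self hn.ne').symm
  have hterm : ∀ p ∈ n.primeFactors, ((n.factorization p + 1 : ℕ) : ℝ) ≤
      (if p < Q then D else 1) * ((p ^ n.factorization p : ℕ) : ℝ) ^ δ := by
    intro p hp
    have hp2 := (Nat.prime_of_mem_primeFactors hp).two_le
    push_cast only [Nat.cast_add, Nat.cast_one]
    split_ifs with h
    · exact add_one_le_const_mul_rpow hδ hp2 _
    · have hpQ : (2 : ℝ) ^ (1 / δ) ≤ p := (Nat.le_ceil _).trans (by exact_mod_cast not_lt.mp h)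
      have h2 : (2 : ℝ) ≤ (p : ℝ) ^ δ := by
        calc (2 : ℝ) = ((2 : ℝ) ^ (1 / δ)) ^ δ := by
              rw [← Real.rpow_mul (by norm_num), one_div_mul_cancel hδ.ne', Real.rpow_one]
          _ ≤ _ := by gcongr
      rw [one_mul, Nat.cast_pow, ← Real.rpow_natCast, ← Real.rpow_mul (by positivity), mul_comm _ δ,
        Real.rpow_mul (by positivity), Real.rpow_natCast]
      calc (n.factorization p : ℝ) + 1 ≤ 2 ^ n.factorization p := by
            exact_mod_cast Nat.succ_le_of_lt Nat.lt_two_pow_self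
        _ ≤ _ := by gcongr
  have hprod : ∏ p ∈ n.primeFactors, (if p < Q then D else 1) ≤ D ^ Q := by
    rw [Finset.prod_ite, Finset.prod_const, Finset.prod_const_one, mul_one]
    refine pow_le_pow_right₀ hD1 ?_
    calc _ ≤ (Finset.range Q).card := Finset.card_le_card fun p hp => by
          simpa using (Finset.mem_filter.mp hp).2
      _ = Q := Finset.card_range Q
  calc (n.divisors.card : ℝ) = ∏ p ∈ n.primeFactors, ((n.factorization p + 1 : ℕ) : ℝ) := by
        rw [Nat.card_divisors hn.ne', Nat.cast_prod]
    _ ≤ ∏ p ∈ n.primeFactors, ((if p < Q then D else 1) * ((p ^ n.factorization p : ℕ) : ℝ) ^ δ) :=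
        Finset.prod_le_prod (fun _ _ => by positivity) hterm
    _ ≤ D ^ Q * (n : ℝ) ^ δ := by
        rw [Finset.prod_mul_distrib, ← hpow]
        gcongr

/-! ### Counting solutions of `m₁ (m₁ + l₁) = m₂ (m₂ + l₂)` -/

lemma eq_of_mul_add_eq {m n l : ℕ} (h : m * (m + l) = n * (n + l)) : m = n := by
  rcases lt_trichotomy m n with h1 | h1 | h1
  · have : m * (m + l) < n * (n + l) := Nat.mul_lt_mul'' h1 (by omega)
    omega
  · exact h1
  · have : n * (n + l) < m * (m + l) := Nat.mul_lt_mul'' h1 (by omega)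
    omega

/-- Completing the square turns the equation into a factorization of `l₁² - l₂² ≠ 0`. -/
lemma card_solutions_le {l₁ l₂ : ℕ} (hl₁ : 0 < l₁) (hl : l₁ ≠ l₂) (N : ℕ) :
    (((Finset.Icc 1 N) ×ˢ (Finset.Icc 1 N)).filter
      fun p : ℕ × ℕ => p.1 * (p.1 + l₁) = p.2 * (p.2 + l₂)).card ≤
      ((l₁ : ℤ) ^ 2 - (l₂ : ℤ) ^ 2).natAbs.divisors.card := by
  have hne : ((l₁ : ℤ) ^ 2 - (l₂ : ℤ) ^ 2) ≠ 0 := by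
    intro h
    have h1 : (l₁ : ℤ) ^ 2 = (l₂ : ℤ) ^ 2 := by linarith
    have h2 : l₁ ^ 2 = l₂ ^ 2 := by exact_mod_cast h1
    exact hl (Nat.pow_left_injective two_ne_zero h2)
  have hfac : ∀ a b : ℕ, a * (a + l₁) = b * (b + l₂) →
      (2 * a + l₁ + 2 * b + l₂ : ℤ) * (2 * a + l₁ - 2 * b - l₂) = (l₁ : ℤ) ^ 2 - (l₂ : ℤ) ^ 2 := by
    intro a b h
    have h : (a : ℤ) * (a + l₁) = b * (b + l₂) := by exact_mod_cast h
    linear_combination 4 * h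
  refine Finset.card_le_card_of_injOn (fun p => 2 * p.1 + l₁ + 2 * p.2 + l₂) ?_ ?_
  · rintro ⟨a, b⟩ hp
    have h := hfac a b (Finset.mem_filter.mp hp).2
    simp only [Finset.mem_coe, Nat.mem_divisors, ne_eq, Int.natAbs_eq_zero]
    refine ⟨?_, hne⟩
    rw [← Int.natCast_dvd]
    exact ⟨_, by push_cast; exact h.symm⟩
  · rintro ⟨a, b⟩ hp ⟨c, d⟩ hq hpq
    have h1 := hfac a b (Finset.mem_filter.mp hp).2
    have h2 := hfac c d (Finset.mem_filter.mp hq).2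
    have hpq : 2 * a + l₁ + 2 * b + l₂ = 2 * c + l₁ + 2 * d + l₂ := hpq
    have hpq' : (2 * a + l₁ + 2 * b + l₂ : ℤ) = 2 * c + l₁ + 2 * d + l₂ := by exact_mod_cast hpq
    rw [hpq', ← h2] at h1
    have h3 := mul_left_cancel₀ (by positivity) h1
    have h4 : a = c := by omega
    have h5 : b = d := by omega
    rw [h4, h5]

/-! ### Comparison of a sum with an integral -/

lemma sum_Icc_one_eq_sum_range {M : Type*} [AddCommMonoid M] (f : ℕ → M) (N : ℕ) :
    ∑ m ∈ Finset.Icc 1 N, f m = ∑ i ∈ Finset.range N, f (i + 1) := by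
  induction N with
  | zero => simp
  | succ N ih => rw [Finset.sum_Icc_succ_top (by omega), ih, Finset.sum_range_succ]

lemma abs_sub_integral_le {g : ℝ → ℝ} (hg : ContDiff ℝ 1 g) (a : ℝ) :
    |g (a + 1) - ∫ u in a..(a + 1), g u| ≤ ∫ u in a..(a + 1), |deriv g u| := by
  have hd : Continuous (deriv g) := hg.continuous_deriv le_rfl
  have hle : a ≤ a + 1 := by linarith
  have h1 : g (a + 1) - ∫ u in a..(a + 1), g u = ∫ u in a..(a + 1), (g (a + 1) - g u) := by
    rw [intervalIntegral.integral_sub (by simp) (hg.continuous.intervalIntegrable _ _)]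
    simp
  have h2 : ∀ u ∈ Set.Icc a (a + 1), |g (a + 1) - g u| ≤ ∫ v in a..(a + 1), |deriv g v| := by
    intro u hu
    rw [← intervalIntegral.integral_deriv_eq_sub (fun x _ => hg.differentiable one_ne_zero x)
      (hd.intervalIntegrable _ _)]
    refine (intervalIntegral.abs_integral_le_integral_abs hu.2).trans ?_
    exact intervalIntegral.integral_mono_interval hu.1 hu.2 le_rfl
      (Eventually.of_forall fun _ => abs_nonneg _) (hd.abs.intervalIntegrable _ _)
  rw [h1]
  refine (intervalIntegral.abs_integral_le_integral_abs hle).trans ?_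
  calc ∫ u in a..(a + 1), |g (a + 1) - g u|
      ≤ ∫ _u in a..(a + 1), ∫ v in a..(a + 1), |deriv g v| :=
        intervalIntegral.integral_mono_on hle
          ((continuous_const.sub hg.continuous).abs.intervalIntegrable _ _) (by simp) h2
    _ = _ := by rw [intervalIntegral.integral_const]; simp

/-- The error of a right Riemann sum with step `1` is at most the total variation. -/
lemma abs_sum_sub_integral_le {g : ℝ → ℝ} (hg : ContDiff ℝ 1 g) (α : ℝ) (N : ℕ) :
    |∑ m ∈ Finset.Icc 1 N, g (m + α) - ∫ u in α..(α + N), g u| ≤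
      ∫ u in α..(α + N), |deriv g u| := by
  have hd : Continuous (deriv g) := hg.continuous_deriv le_rfl
  have hsum : ∀ F : ℝ → ℝ, Continuous F → ∑ i ∈ Finset.range N, ∫ u in (α + i)..(α + i + 1), F u =
      ∫ u in α..(α + N), F u := by
    intro F hF
    have := intervalIntegral.sum_integral_adjacent_intervals (f := F) (μ := volume)
      (a := fun i : ℕ => α + i) (n := N) (fun i _ => hF.intervalIntegrable _ _)
    simp only [Nat.cast_zero, add_zero] at this
    rw [← this]
    refine Finset.sum_congr rfl fun i _ => ?_
    push_cast
    rw [add_assoc]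
  rw [sum_Icc_one_eq_sum_range, ← hsum g hg.continuous, ← hsum _ hd.abs, ← Finset.sum_sub_distrib]
  refine (Finset.abs_sum_le_sum_abs _ _).trans (Finset.sum_le_sum fun i _ => ?_)
  have h := abs_sub_integral_le hg (α + i)
  have e : ((i + 1 : ℕ) : ℝ) + α = α + i + 1 := by push_cast; ring
  rw [e]
  exact h

/-- Riemann sums of a weight supported to the right of `α / Y` and to the left of `(α + N) / Y`. -/
lemma abs_riemann_sum_sub_le {V : ℝ → ℝ} (hV : ContDiff ℝ 1 V) (hVc : HasCompactSupport V)
    {α Y : ℝ} (hα : 0 ≤ α) (hY : 0 < Y) {N : ℕ} (h0 : ∀ y, 0 < y → y ≤ α / Y → V y = 0)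
    (h1 : ∀ y, (α + N) / Y < y → V y = 0) :
    |∑ m ∈ Finset.Icc 1 N, V ((m + α) / Y) - Y * ∫ y in Set.Ioi (0 : ℝ), V y| ≤
      ∫ y in Set.Ioi (0 : ℝ), |deriv V y| := by
  have hd : Continuous (deriv V) := hV.continuous_deriv le_rfl
  have hdint : Integrable (deriv V) := hd.integrable_of_hasCompactSupport hVc.deriv
  have hg : ContDiff ℝ 1 fun u => V (u / Y) := hV.comp (by fun_prop)
  have h := abs_sum_sub_integral_le hg α N
  have hle : α / Y ≤ (α + N) / Y := by gcongr; linarith [N.cast_nonneg (α := ℝ)]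
  have hαY : 0 ≤ α / Y := by positivity
  have e1 : ∫ u in α..(α + N), V (u / Y) = Y * ∫ y in Set.Ioi (0 : ℝ), V y := by
    rw [intervalIntegral.integral_comp_div _ hY.ne', smul_eq_mul,
      intervalIntegral.integral_of_le hle]
    congr 1
    refine (setIntegral_eq_of_subset_of_forall_sdiff_eq_zero measurableSet_Ioi
      (fun y hy => lt_of_le_of_lt hαY hy.1) fun y hy => ?_).symm
    by_cases h2 : y ≤ α / Y
    · exact h0 y hy.1 h2
    · refine h1 y (not_le.mp fun h3 => hy.2 ⟨not_le.mp h2, h3⟩)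
  have e2 : ∀ u, deriv (fun u => V (u / Y)) u = deriv V (u / Y) / Y := by
    intro u
    have := ((hV.differentiable one_ne_zero (u / Y)).hasDerivAt.comp u ((hasDerivAt_id u).div_const Y)).deriv
    simpa [Function.comp_def, div_eq_mul_inv] using this
  have e3 : ∫ u in α..(α + N), |deriv (fun u => V (u / Y)) u| ≤ ∫ y in Set.Ioi (0 : ℝ), |deriv V y| := by
    simp_rw [e2, abs_div, abs_of_pos hY]
    rw [intervalIntegral.integral_div, intervalIntegral.integral_comp_div (fun y => |deriv V y|) hY.ne',
      smul_eq_mul, mul_div_cancel_left₀ _ hY.ne', intervalIntegral.integral_of_le hle]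
    exact setIntegral_mono_set hdint.abs.integrableOn (Eventually.of_forall fun _ => abs_nonneg _)
      (Eventually.of_forall fun y hy => lt_of_le_of_lt hαY hy.1)
  rw [← e1]
  exact h.trans e3

/-! ### Shifted sums through the Hecke relations -/

lemma sum_divisors_gcd {M : Type*} [AddCommMonoid M] {h N : ℕ} (hh : 0 < h) (F : ℕ → ℕ → M)
    (hF : ∀ n d, N < n → F n d = 0) :
    ∑ n ∈ Finset.Icc 1 N, ∑ d ∈ (Nat.gcd n h).divisors, F n d =
      ∑ d ∈ h.divisors, ∑ m ∈ Finset.Icc 1 N, F (d * m) d := by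
  have h1 : ∀ n, ∑ d ∈ (Nat.gcd n h).divisors, F n d =
      ∑ d ∈ h.divisors, if d ∣ n then F n d else 0 := by
    intro n
    rw [← Finset.sum_filter]
    refine Finset.sum_congr ?_ fun _ _ => rfl
    ext d
    simp only [Nat.mem_divisors, Finset.mem_filter, Nat.dvd_gcd_iff]
    have := (Nat.gcd_pos_of_pos_right n hh).ne'
    have hh' := hh.ne'
    tauto
  simp_rw [h1]
  rw [Finset.sum_comm]
  refine Finset.sum_congr rfl fun d hd => ?_
  have hd0 : 0 < d := Nat.pos_of_mem_divisors hd
  rw [← Finset.sum_filter]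
  refine Finset.sum_of_injOn (fun n => n / d) ?_ ?_ ?_ ?_
  · intro a ha b hb hab
    obtain ⟨a, rfl⟩ := (Finset.mem_filter.mp ha).2
    obtain ⟨b, rfl⟩ := (Finset.mem_filter.mp hb).2
    simp only [Nat.mul_div_cancel_left _ hd0] at hab
    rw [hab]
  · intro a ha
    have h2 := Finset.mem_Icc.mp (Finset.mem_filter.mp ha).1
    obtain ⟨a, rfl⟩ := (Finset.mem_filter.mp ha).2
    simp only [Nat.mul_div_cancel_left _ hd0, Finset.coe_Icc, Set.mem_Icc]
    exact ⟨Nat.pos_of_mul_pos_left h2.1, (Nat.le_mul_of_pos_left a hd0).trans h2.2⟩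
  · intro m hm hnot
    refine hF _ _ (not_le.mp fun hle => hnot ⟨d * m, ?_, Nat.mul_div_cancel_left _ hd0⟩)
    simp only [Finset.coe_filter, Finset.mem_Icc, Set.mem_ofPred_eq, dvd_mul_right, and_true]
    exact ⟨Nat.mul_pos hd0 (Finset.mem_Icc.mp hm).1, hle⟩
  · intro a ha
    rw [Nat.mul_div_cancel' (Finset.mem_filter.mp ha).2]

section

variable {k : ℕ}

/-- The weight `W((d m + h/2)/X)`, `d = h/l`, of `λ_f(m (m + l))` in the shifted convolution sum,
at `p = (l, m)`. -/
def shiftWeight (W : ℝ → ℝ) (h : ℕ) (X : ℝ) (p : ℕ × ℕ) : ℝ :=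
  W (h * (((p.2 : ℝ) + (p.1 : ℝ) / 2) / (p.1 * X)))

/-- The range of summation of the pairs `(l, m)`. -/
def shiftIndex (h N : ℕ) : Finset (ℕ × ℕ) := h.divisors ×ˢ Finset.Icc 1 N

lemma shiftedSum_eq_sum (f : CuspForm 𝒮ℒ (k : ℤ)) {W : ℝ → ℝ} {h N : ℕ} {X : ℝ}
    (hsupp : ∀ n : ℕ, N < n → W (((n : ℝ) + (h : ℝ) / 2) / X) = 0) :
    shiftedSum f W h X = ∑ n ∈ Finset.Icc 1 N,
      normCoeff f n * normCoeff f (n + h) * ((W (((n : ℝ) + (h : ℝ) / 2) / X) : ℝ) : ℂ) := by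
  rw [sum_Icc_one_eq_sum_range, shiftedSum]
  refine (tsum_pnat_eq_tsum_succ (f := fun n : ℕ => normCoeff f n * normCoeff f (n + h) *
    ((W (((n : ℝ) + (h : ℝ) / 2) / X) : ℝ) : ℂ))).trans (tsum_eq_sum fun n hn => ?_)
  rw [hsupp (n + 1) (by simpa [Nat.lt_succ_iff] using hn), Complex.ofReal_zero, mul_zero]

/-- The Hecke relation `λ(n) λ(n + h) = ∑ λ(n (n + h) / d²)`, `d ∣ gcd(n, h)`, with `n = d m` and `h
= d l`. -/
lemma shiftedSum_eq (hk : 9 ≤ k) (hk2 : Even k) {f : CuspForm 𝒮ℒ (k : ℤ)} (hf : f ∈ heckeBasis k)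
    {W : ℝ → ℝ} {h N : ℕ} {X : ℝ} (hh : 0 < h)
    (hsupp : ∀ n : ℕ, N < n → W (((n : ℝ) + (h : ℝ) / 2) / X) = 0) :
    shiftedSum f W h X = ∑ p ∈ shiftIndex h N,
      (shiftWeight W h X p : ℂ) * normCoeff f (p.2 * (p.2 + p.1)) := by
  rw [shiftedSum_eq_sum f hsupp, shiftIndex, Finset.sum_product]
  have h1 : ∀ n ∈ Finset.Icc 1 N, normCoeff f n * normCoeff f (n + h) *
      ((W (((n : ℝ) + (h : ℝ) / 2) / X) : ℝ) : ℂ) = ∑ d ∈ (Nat.gcd n h).divisors,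
        normCoeff f (n / d * ((n + h) / d)) * ((W (((n : ℝ) + (h : ℝ) / 2) / X) : ℝ) : ℂ) := by
    intro n hn
    rw [normCoeff_mul_normCoeff hk hk2 hf (Finset.mem_Icc.mp hn).1 (by omega), Finset.sum_mul,
      Nat.gcd_self_add_right]
  rw [Finset.sum_congr rfl h1, sum_divisors_gcd hh _ fun n d hn => by
    rw [hsupp n hn, Complex.ofReal_zero, mul_zero], ← Nat.sum_div_divisors]
  refine Finset.sum_congr rfl fun l hl => Finset.sum_congr rfl fun m _ => ?_
  obtain ⟨d, rfl⟩ := Nat.dvd_of_mem_divisors hl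
  have hl0 : 0 < l := Nat.pos_of_mul_pos_right hh
  have hd0 : 0 < d := Nat.pos_of_mul_pos_left hh
  have e1 : l * d / l = d := Nat.mul_div_cancel_left _ hl0
  have e2 : (d * m + l * d) / d = m + l := by
    rw [show d * m + l * d = d * (m + l) by ring, Nat.mul_div_cancel_left _ hd0]
  rw [e1, e2, Nat.mul_div_cancel_left _ hd0, mul_comm, shiftWeight]
  congr 3
  have hl' : (l : ℝ) ≠ 0 := by exact_mod_cast hl0.ne'
  push_cast
  field_simp

lemma conj_shiftedSum (hk : 9 ≤ k) (hk2 : Even k) {f : CuspForm 𝒮ℒ (k : ℤ)} (hf : f ∈ heckeBasis k)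
    (W : ℝ → ℝ) (h : ℕ) (X : ℝ) : conj (shiftedSum f W h X) = shiftedSum f W h X := by
  rw [shiftedSum, Complex.conj_tsum]
  exact tsum_congr fun n => by
    rw [map_mul, map_mul, conj_normCoeff hk hk2 hf, conj_normCoeff hk hk2 hf, Complex.conj_ofReal]

lemma variance_eq (hk : 9 ≤ k) (hk2 : Even k) (W₁ W₂ : ℝ → ℝ) (h₁ h₂ : ℕ) (X : ℝ) :
    variance k W₁ W₂ h₁ h₂ X = ∑ f ∈ (finite_heckeBasis hk hk2).toFinset,
      heckeWeight f * (shiftedSum f W₁ h₁ X * shiftedSum f W₂ h₂ X) := by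
  rw [variance, finsum_mem_eq_finite_toFinset_sum _ (finite_heckeBasis hk hk2), Finset.mul_sum]
  refine Finset.sum_congr rfl fun f hf => ?_
  have hf : f ∈ heckeBasis k := by simpa using hf
  rw [conj_shiftedSum hk hk2 hf, ← heckeWeight_eq hk hk2 hf]
  ring

end

/-- An approximate orthogonality relation for the `λ_f(q)` applied to a product of linear forms. -/
lemma norm_bilinear_sub_le {ι κ κ' : Type*} (H : Finset ι) (w : ι → ℂ) (c : ι → ℕ → ℂ)
    (P : Finset κ) (P' : Finset κ') (u : κ → ℝ) (u' : κ' → ℝ) (q : κ → ℕ) (q' : κ' → ℕ)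
    {S S' E : ℝ} (hS : ∀ p ∈ P, |u p| ≤ S) (hS' : ∀ p ∈ P', |u' p| ≤ S') (hE : 0 ≤ E)
    (h : ∀ p ∈ P, ∀ p' ∈ P', u p ≠ 0 → u' p' ≠ 0 →
      ‖∑ f ∈ H, w f * (c f (q p) * c f (q' p')) - (if q p = q' p' then 1 else 0)‖ ≤ E) :
    ‖∑ f ∈ H, w f * ((∑ p ∈ P, (u p : ℂ) * c f (q p)) * ∑ p ∈ P', (u' p : ℂ) * c f (q' p)) -
      ((∑ p ∈ P, ∑ p' ∈ P', if q p = q' p' then u p * u' p' else 0 : ℝ) : ℂ)‖ ≤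
      P.card * P'.card * (S * S') * E := by
  have h1 : ∑ f ∈ H, w f * ((∑ p ∈ P, (u p : ℂ) * c f (q p)) * ∑ p ∈ P', (u' p : ℂ) * c f (q' p)) =
      ∑ p ∈ P, ∑ p' ∈ P', (u p : ℂ) * u' p' * ∑ f ∈ H, w f * (c f (q p) * c f (q' p')) := by
    simp_rw [Finset.sum_mul_sum, Finset.mul_sum]
    rw [Finset.sum_comm]
    refine Finset.sum_congr rfl fun p _ => ?_
    rw [Finset.sum_comm]
    refine Finset.sum_congr rfl fun p' _ => Finset.sum_congr rfl fun f _ => ?_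
    ring
  have h2 : ((∑ p ∈ P, ∑ p' ∈ P', if q p = q' p' then u p * u' p' else 0 : ℝ) : ℂ) =
      ∑ p ∈ P, ∑ p' ∈ P', (u p : ℂ) * u' p' * (if q p = q' p' then 1 else 0) := by
    push_cast
    refine Finset.sum_congr rfl fun p _ => Finset.sum_congr rfl fun p' _ => ?_
    split_ifs <;> simp
  rw [h1, h2, ← Finset.sum_sub_distrib]
  simp_rw [← Finset.sum_sub_distrib, ← mul_sub]
  calc _ ≤ ∑ p ∈ P, ∑ p' ∈ P', S * S' * E := by
        refine norm_sum_le_of_le _ fun p hp => norm_sum_le_of_le _ fun p' hp' => ?_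
        have hS0 : 0 ≤ S := (abs_nonneg _).trans (hS p hp)
        have hS0' : 0 ≤ S' := (abs_nonneg _).trans (hS' p' hp')
        rw [norm_mul, norm_mul, Complex.norm_real, Complex.norm_real, Real.norm_eq_abs, Real.norm_eq_abs]
        by_cases hu : u p = 0
        · rw [hu, abs_zero, zero_mul, zero_mul]; positivity
        by_cases hu' : u' p' = 0
        · rw [hu', abs_zero, mul_zero, zero_mul]; positivity
        have := h p hp p' hp' hu hu'
        have h3 := hS p hp
        have h4 := hS' p' hp'
        gcongr
    _ = _ := by simp only [Finset.sum_const, nsmul_eq_mul]; ring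

/-! ### The diagonal contribution -/

lemma sum_divisors_ite_eq {M : Type*} [AddCommMonoid M] {h₁ h₂ : ℕ} (hh₁ : 0 < h₁)
    (hh₂ : 0 < h₂) (F : ℕ → M) :
    ∑ l₁ ∈ h₁.divisors, ∑ l₂ ∈ h₂.divisors, (if l₁ = l₂ then F l₁ else 0) =
      ∑ l ∈ (Nat.gcd h₁ h₂).divisors, F l := by
  simp_rw [Finset.sum_ite_eq]
  rw [← Finset.sum_filter]
  refine Finset.sum_congr ?_ fun _ _ => rfl
  ext l
  have := (Nat.gcd_pos_of_pos_left h₂ hh₁).ne'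
  simp only [Nat.mem_divisors, Finset.mem_filter, Nat.dvd_gcd_iff]
  have h1 := hh₁.ne'
  have h2 := hh₂.ne'
  tauto

lemma abs_offDiagonal_le {u u' : ℕ × ℕ → ℝ} {S S' : ℝ} {l₁ l₂ N : ℕ} (hl₁ : 0 < l₁) (hl : l₁ ≠ l₂)
    (hS : ∀ m ∈ Finset.Icc 1 N, |u (l₁, m)| ≤ S) (hS' : ∀ m ∈ Finset.Icc 1 N, |u' (l₂, m)| ≤ S')
    (hS0 : 0 ≤ S) (hS0' : 0 ≤ S') :
    |∑ m ∈ Finset.Icc 1 N, ∑ m' ∈ Finset.Icc 1 N,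
      if m * (m + l₁) = m' * (m' + l₂) then u (l₁, m) * u' (l₂, m') else 0| ≤
      ((l₁ : ℤ) ^ 2 - (l₂ : ℤ) ^ 2).natAbs.divisors.card * (S * S') := by
  rw [← Finset.sum_product', ← Finset.sum_filter]
  refine (Finset.abs_sum_le_sum_abs _ _).trans ?_
  calc _ ≤ ∑ p ∈ ((Finset.Icc 1 N) ×ˢ (Finset.Icc 1 N)).filter
        (fun p : ℕ × ℕ => p.1 * (p.1 + l₁) = p.2 * (p.2 + l₂)), S * S' := by
        refine Finset.sum_le_sum fun p hp => ?_
        have hp' := Finset.mem_product.mp (Finset.mem_filter.mp hp).1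
        rw [abs_mul]
        exact mul_le_mul (hS _ hp'.1) (hS' _ hp'.2) (abs_nonneg _) hS0
    _ ≤ _ := by
        rw [Finset.sum_const, nsmul_eq_mul]
        gcongr
        exact card_solutions_le hl₁ hl N

lemma diagonal_eq (u u' : ℕ × ℕ → ℝ) (h₁ h₂ N : ℕ) :
    ∑ p ∈ shiftIndex h₁ N, ∑ p' ∈ shiftIndex h₂ N,
      (if p.2 * (p.2 + p.1) = p'.2 * (p'.2 + p'.1) then u p * u' p' else 0) =
    ∑ l₁ ∈ h₁.divisors, ∑ l₂ ∈ h₂.divisors, ∑ m ∈ Finset.Icc 1 N, ∑ m' ∈ Finset.Icc 1 N,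
      if m * (m + l₁) = m' * (m' + l₂) then u (l₁, m) * u' (l₂, m') else 0 := by
  simp_rw [shiftIndex, Finset.sum_product]
  exact Finset.sum_congr rfl fun l₁ _ => Finset.sum_comm

lemma sum_solutions_self (u u' : ℕ × ℕ → ℝ) (l N : ℕ) :
    (∑ m ∈ Finset.Icc 1 N, ∑ m' ∈ Finset.Icc 1 N,
      if m * (m + l) = m' * (m' + l) then u (l, m) * u' (l, m') else 0) =
    ∑ m ∈ Finset.Icc 1 N, u (l, m) * u' (l, m) := by
  refine Finset.sum_congr rfl fun m hm => ?_
  rw [Finset.sum_eq_single m]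
  · rw [if_pos rfl]
  · intro m' _ hne
    exact if_neg fun h => hne (eq_of_mul_add_eq h).symm
  · exact fun h => absurd hm h

/-- Evaluation of the diagonal: the terms with `l₁ = l₂` are Riemann sums, and the divisor bound
controls the number of the others. -/
lemma abs_diagonal_sub_le {W₁ W₂ : ℝ → ℝ} (hW₁ : ContDiff ℝ 1 W₁) (hW₂ : ContDiff ℝ 1 W₂)
    (hc₁ : HasCompactSupport W₁) {a A X : ℝ} {h₁ h₂ N : ℕ} (hh₁ : 0 < h₁) (hh₂ : 0 < h₂) (hX : 0 < X)
    (hlow : ∀ y, y < a → W₁ y = 0) (hhigh : ∀ y, A < y → W₁ y = 0) (hN : A * X ≤ N)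
    (ha : (h₁ : ℝ) < 2 * a * X) {S S' T : ℝ}
    (hS : ∀ p ∈ shiftIndex h₁ N, |shiftWeight W₁ h₁ X p| ≤ S)
    (hS' : ∀ p ∈ shiftIndex h₂ N, |shiftWeight W₂ h₂ X p| ≤ S') (hS0 : 0 ≤ S) (hS0' : 0 ≤ S')
    (hT : ∀ l₁ ∈ h₁.divisors, ∀ l₂ ∈ h₂.divisors, l₁ ≠ l₂ →
      (((l₁ : ℤ) ^ 2 - (l₂ : ℤ) ^ 2).natAbs.divisors.card : ℝ) ≤ T) (hT0 : 0 ≤ T) :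
    |∑ p ∈ shiftIndex h₁ N, ∑ p' ∈ shiftIndex h₂ N,
      (if p.2 * (p.2 + p.1) = p'.2 * (p'.2 + p'.1) then
        shiftWeight W₁ h₁ X p * shiftWeight W₂ h₂ X p' else 0) - mainTerm W₁ W₂ h₁ h₂ * X| ≤
      (Nat.gcd h₁ h₂).divisors.card * (∫ y in Set.Ioi (0 : ℝ), |deriv (fun y => W₁ (h₁ * y) * W₂ (h₂ * y)) y|) +
        h₁.divisors.card * h₂.divisors.card * (T * (S * S')) := by
  set V : ℝ → ℝ := fun y => W₁ (h₁ * y) * W₂ (h₂ * y) with hVdef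
  have hh₁' : (0 : ℝ) < h₁ := by exact_mod_cast hh₁
  have hV : ContDiff ℝ 1 V := (hW₁.comp (by fun_prop)).mul (hW₂.comp (by fun_prop))
  have hVc : HasCompactSupport V := (hc₁.comp_smul hh₁'.ne').mul_right
  set F : ℕ → ℕ → ℝ := fun l₁ l₂ => ∑ m ∈ Finset.Icc 1 N, ∑ m' ∈ Finset.Icc 1 N,
      if m * (m + l₁) = m' * (m' + l₂) then
        shiftWeight W₁ h₁ X (l₁, m) * shiftWeight W₂ h₂ X (l₂, m') else 0 with hF
  have hsplit : ∑ l₁ ∈ h₁.divisors, ∑ l₂ ∈ h₂.divisors, F l₁ l₂ =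
      ∑ l ∈ (Nat.gcd h₁ h₂).divisors, F l l +
        ∑ l₁ ∈ h₁.divisors, ∑ l₂ ∈ h₂.divisors, (if l₁ = l₂ then 0 else F l₁ l₂) := by
    rw [← sum_divisors_ite_eq hh₁ hh₂ fun l => F l l, ← Finset.sum_add_distrib]
    refine Finset.sum_congr rfl fun l₁ _ => ?_
    rw [← Finset.sum_add_distrib]
    refine Finset.sum_congr rfl fun l₂ _ => ?_
    split_ifs with h
    · rw [h, add_zero]
    · rw [zero_add]
  have hdiag : ∀ l ∈ (Nat.gcd h₁ h₂).divisors, |F l l - l * X * ∫ y in Set.Ioi (0 : ℝ), V y| ≤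
      ∫ y in Set.Ioi (0 : ℝ), |deriv V y| := by
    intro l hl
    have hl0 : 0 < l := Nat.pos_of_mem_divisors hl
    have hl0' : (0 : ℝ) < l := by exact_mod_cast hl0
    have hlh : (l : ℝ) ≤ h₁ := by
      exact_mod_cast Nat.le_of_dvd hh₁ ((Nat.dvd_of_mem_divisors hl).trans (Nat.gcd_dvd_left _ _))
    have h := abs_riemann_sum_sub_le hV hVc (α := (l : ℝ) / 2) (Y := l * X) (N := N) (by positivity)
      (by positivity) (fun y hy hle => ?_) (fun y hy => ?_)
    · simp only [hF]
      rw [sum_solutions_self]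
      exact h
    · -- The support of `W₁` and `h₁ < 2 a X` exclude `y ≤ 1 / (2 X)`.
      have h1 : W₁ (h₁ * y) = 0 := by
        refine hlow _ ?_
        rw [le_div_iff₀ (by positivity)] at hle
        have h2 : y * X ≤ 1 / 2 := by
          by_contra! hcon
          nlinarith
        have h3 : h₁ * y * (2 * X) < a * (2 * X) := by nlinarith
        exact lt_of_mul_lt_mul_right h3 (by positivity)
      simp only [hVdef, h1, zero_mul]
    · have h1 : W₁ (h₁ * y) = 0 := by
        refine hhigh _ ?_
        rw [div_lt_iff₀ (by positivity)] at hy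
        have hN0 : (0 : ℝ) ≤ N := N.cast_nonneg
        have hy0 : 0 < y := by
          by_contra! hcon
          have : y * (l * X) ≤ 0 := mul_nonpos_of_nonpos_of_nonneg hcon (by positivity)
          linarith
        have h2 : y * (l * X) ≤ y * (h₁ * X) := by gcongr
        have h3 : A * X < (h₁ * y) * X := by linarith
        exact lt_of_mul_lt_mul_right h3 hX.le
      simp only [hVdef, h1, zero_mul]
  have hoff : ∀ l₁ ∈ h₁.divisors, ∀ l₂ ∈ h₂.divisors, |if l₁ = l₂ then 0 else F l₁ l₂| ≤ T * (S * S') := by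
    intro l₁ hl₁ l₂ hl₂
    split_ifs with h
    · rw [abs_zero]; positivity
    · refine (abs_offDiagonal_le (Nat.pos_of_mem_divisors hl₁) h
        (fun m hm => hS _ (Finset.mem_product.mpr ⟨hl₁, hm⟩))
        (fun m hm => hS' _ (Finset.mem_product.mpr ⟨hl₂, hm⟩)) hS0 hS0').trans ?_
      have := hT l₁ hl₁ l₂ hl₂ h
      gcongr
  have hmain : mainTerm W₁ W₂ h₁ h₂ * X =
      ∑ l ∈ (Nat.gcd h₁ h₂).divisors, (l : ℝ) * X * ∫ y in Set.Ioi (0 : ℝ), V y := by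
    rw [mainTerm, ← Finset.sum_mul, ← Finset.sum_mul]
    push_cast
    ring
  rw [diagonal_eq, hmain]
  change |∑ l₁ ∈ h₁.divisors, ∑ l₂ ∈ h₂.divisors, F l₁ l₂ - _| ≤ _
  rw [hsplit, add_sub_right_comm, ← Finset.sum_sub_distrib]
  refine (abs_add_le _ _).trans (add_le_add ?_ ?_)
  · refine (Finset.abs_sum_le_sum_abs _ _).trans ((Finset.sum_le_sum hdiag).trans_eq ?_)
    rw [Finset.sum_const, nsmul_eq_mul]
  · refine (Finset.abs_sum_le_sum_abs _ _).trans ((Finset.sum_le_sum fun l₁ hl₁ =>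
      (Finset.abs_sum_le_sum_abs _ _).trans (Finset.sum_le_sum (hoff l₁ hl₁))).trans_eq ?_)
    simp only [Finset.sum_const, nsmul_eq_mul]
    ring

/-! ### Norms of the weights -/

section

variable {W : ℝ → ℝ} {a A : ℝ}

lemma eq_zero_of_lt (hs : tsupport W ⊆ Set.Icc a A) {y : ℝ} (hy : y < a) : W y = 0 :=
  image_eq_zero_of_notMem_tsupport fun h => absurd (hs h).1 (not_le.mpr hy)

lemma eq_zero_of_gt (hs : tsupport W ⊆ Set.Icc a A) {y : ℝ} (hy : A < y) : W y = 0 :=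
  image_eq_zero_of_notMem_tsupport fun h => absurd (hs h).2 (not_le.mpr hy)

lemma hasCompactSupport_of_tsupport_subset (hs : tsupport W ⊆ Set.Icc a A) : HasCompactSupport W :=
  isCompact_Icc.of_isClosed_subset (isClosed_tsupport W) hs

lemma eq_zero_of_endpoints_lt (hs : tsupport W ⊆ Set.Icc a A) (h : A < a) : W = 0 := by
  rw [Set.Icc_eq_empty (not_le.mpr h), Set.subset_empty_iff, tsupport_eq_empty_iff] at hs
  exact hs

lemma abs_le_supNorm (hW : Continuous W) (hs : tsupport W ⊆ Set.Icc a A) {y : ℝ} (hy : 0 < y) :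
    |W y| ≤ supNorm W := by
  obtain ⟨C, hC⟩ := hW.bounded_above_of_compact_support (hasCompactSupport_of_tsupport_subset hs)
  exact le_ciSup (f := fun y : Set.Ioi (0 : ℝ) => |W y|)
    ⟨C, by rintro _ ⟨y, rfl⟩; exact hC y⟩ ⟨y, hy⟩

lemma supNorm_nonneg (W : ℝ → ℝ) : 0 ≤ supNorm W := Real.iSup_nonneg fun _ => abs_nonneg _

lemma integral_abs_iteratedDeriv_le (V : ℝ → ℝ) {i : ℕ} (hi : i ≤ 2) :
    ∫ y in Set.Ioi (0 : ℝ), |iteratedDeriv i V y| ≤ sobolevNormOne 2 V :=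
  Finset.single_le_sum (f := fun i => ∫ y in Set.Ioi (0 : ℝ), |iteratedDeriv i V y|)
    (fun _ _ => integral_nonneg fun _ => abs_nonneg _) (Finset.mem_range.mpr (by omega))

lemma integral_abs_deriv_le_sobolevNormOne (V : ℝ → ℝ) :
    ∫ y in Set.Ioi (0 : ℝ), |deriv V y| ≤ sobolevNormOne 2 V := by
  have := integral_abs_iteratedDeriv_le V (i := 1) (by omega)
  rwa [iteratedDeriv_one] at this

lemma abs_integral_le_sobolevNormOne (V : ℝ → ℝ) :
    |∫ y in Set.Ioi (0 : ℝ), V y| ≤ sobolevNormOne 2 V := by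
  have := integral_abs_iteratedDeriv_le V (i := 0) (by omega)
  rw [iteratedDeriv_zero] at this
  exact (abs_integral_le_integral_abs).trans this

lemma sobolevNormOne_nonneg (V : ℝ → ℝ) : 0 ≤ sobolevNormOne 2 V :=
  (abs_nonneg _).trans (abs_integral_le_sobolevNormOne V)

end

/-! ### The estimate for a fixed weight -/

/-- Below weight twelve there are no nonzero cusp forms of level one. -/
lemma finite_heckeBasis_of_even {k : ℕ} (hk2 : Even k) : (heckeBasis k).Finite := by
  rcases lt_or_ge k 9 with h | h
  · have hrank : Module.rank ℂ (CuspForm 𝒮ℒ (k : ℤ)) = 0 :=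
      CuspForm.rank_eq_zero_of_weight_lt_twelve (by omega)
    have hzero := rank_zero_iff_forall_zero.mp hrank
    exact Set.Subsingleton.finite fun f _ g _ => by rw [hzero f, hzero g]
  · exact finite_heckeBasis h hk2

lemma variance_sub_eq_zero {k h₁ h₂ : ℕ} {X : ℝ} {W₁ W₂ : ℝ → ℝ} (h : W₁ = 0 ∨ W₂ = 0) :
    variance k W₁ W₂ h₁ h₂ X - ((mainTerm W₁ W₂ h₁ h₂ * X : ℝ) : ℂ) = 0 := by
  rcases h with rfl | rfl <;> simp [variance, mainTerm, shiftedSum]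

section

variable {k : ℕ}

lemma norm_shiftedSum_le (f : CuspForm 𝒮ℒ (k : ℤ)) {W : ℝ → ℝ} (hW : Continuous W) {a A X : ℝ}
    (hs : tsupport W ⊆ Set.Icc a A) (hX : 0 < X) {h N : ℕ} (hN : A * X ≤ N) (hh : h ≤ 2 * N) :
    ‖shiftedSum f W h X‖ ≤
      (∑ n ∈ Finset.Icc 1 N, ∑ j ∈ Finset.range (2 * N + 1), ‖normCoeff f n * normCoeff f (n + j)‖) *
        supNorm W := by
  rw [shiftedSum_eq_sum f (N := N) fun n hn => ?_, Finset.sum_mul]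
  · refine norm_sum_le_of_le _ fun n hn => ?_
    have hn1 : (1 : ℝ) ≤ n := by exact_mod_cast (Finset.mem_Icc.mp hn).1
    rw [norm_mul, Complex.norm_real, Real.norm_eq_abs]
    have h1 : |W (((n : ℝ) + (h : ℝ) / 2) / X)| ≤ supNorm W := abs_le_supNorm hW hs (by positivity)
    have h2 : ‖normCoeff f n * normCoeff f (n + h)‖ ≤
        ∑ j ∈ Finset.range (2 * N + 1), ‖normCoeff f n * normCoeff f (n + j)‖ :=
      Finset.single_le_sum (f := fun j => ‖normCoeff f n * normCoeff f (n + j)‖)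
        (fun _ _ => norm_nonneg _) (Finset.mem_range.mpr (by omega))
    exact mul_le_mul h2 h1 (abs_nonneg _) ((norm_nonneg _).trans h2)
  · refine eq_zero_of_gt hs ?_
    rw [lt_div_iff₀ hX]
    have : (N : ℝ) < n := by exact_mod_cast hn
    linarith [(by positivity : (0 : ℝ) ≤ (h : ℝ) / 2)]

/-- For a fixed weight and a bounded range both terms are bounded trivially: finitely many forms and
finitely many of their coefficients are involved. -/
lemma exists_bound_fixed_weight (hfin : (heckeBasis k).Finite) (N : ℕ) : ∃ K : ℝ, 0 ≤ K ∧
    ∀ (W₁ W₂ : ℝ → ℝ) (a₁ A₁ a₂ A₂ X : ℝ) (h₁ h₂ : ℕ), Continuous W₁ → Continuous W₂ →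
      tsupport W₁ ⊆ Set.Icc a₁ A₁ → tsupport W₂ ⊆ Set.Icc a₂ A₂ → 0 < X → X ≤ N →
      A₁ * X ≤ N → A₂ * X ≤ N → 0 < h₁ → h₁ ≤ 2 * N → h₂ ≤ 2 * N →
      ‖variance k W₁ W₂ h₁ h₂ X - ((mainTerm W₁ W₂ h₁ h₂ * X : ℝ) : ℂ)‖ ≤
        K * (sobolevNormOne 2 (fun y => W₁ (h₁ * y) * W₂ (h₂ * y)) + supNorm W₁ * supNorm W₂) := by
  set c : CuspForm 𝒮ℒ (k : ℤ) → ℝ := fun f => ∑ n ∈ Finset.Icc 1 N,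
    ∑ j ∈ Finset.range (2 * N + 1), ‖normCoeff f n * normCoeff f (n + j)‖
  have hc : ∀ f, 0 ≤ c f := fun f => by positivity
  set K₁ := ‖(2 * (Real.pi : ℂ) ^ 2 / ((k : ℂ) - 1))‖ *
    ∑ f ∈ hfin.toFinset, c f * c f / ‖symSquareL f 1‖ with hK₁
  have hK₁0 : 0 ≤ K₁ := mul_nonneg (norm_nonneg _)
    (Finset.sum_nonneg fun f _ => div_nonneg (mul_nonneg (hc f) (hc f)) (norm_nonneg _))
  refine ⟨K₁ + (2 * N) ^ 2 * N, by positivity, ?_⟩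
  intro W₁ W₂ a₁ A₁ a₂ A₂ X h₁ h₂ hW₁ hW₂ hs₁ hs₂ hX hXN hA₁ hA₂ hh₁ hhN₁ hhN₂
  have hS₁ := supNorm_nonneg W₁
  have hS₂ := supNorm_nonneg W₂
  have hV := sobolevNormOne_nonneg fun y => W₁ (h₁ * y) * W₂ (h₂ * y)
  have h1 : ‖variance k W₁ W₂ h₁ h₂ X‖ ≤ K₁ * (supNorm W₁ * supNorm W₂) := by
    rw [variance, finsum_mem_eq_finite_toFinset_sum _ hfin, norm_mul, hK₁, mul_assoc, Finset.sum_mul]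
    gcongr
    refine norm_sum_le_of_le _ fun f _ => ?_
    rw [norm_div, norm_mul, RCLike.norm_conj]
    have e1 := norm_shiftedSum_le f hW₁ hs₁ hX hA₁ hhN₁
    have e2 := norm_shiftedSum_le f hW₂ hs₂ hX hA₂ hhN₂
    calc ‖shiftedSum f W₁ h₁ X‖ * ‖shiftedSum f W₂ h₂ X‖ / ‖symSquareL f 1‖
        ≤ (c f * supNorm W₁) * (c f * supNorm W₂) / ‖symSquareL f 1‖ := by
          have := hc f
          gcongr
      _ = _ := by ring
  have h2 : ‖((mainTerm W₁ W₂ h₁ h₂ * X : ℝ) : ℂ)‖ ≤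
      (2 * N) ^ 2 * N * sobolevNormOne 2 (fun y => W₁ (h₁ * y) * W₂ (h₂ * y)) := by
    rw [Complex.norm_real, Real.norm_eq_abs, mainTerm, abs_mul, abs_mul, abs_of_pos hX, Nat.abs_cast]
    have hg : Nat.gcd h₁ h₂ ≤ 2 * N := (Nat.gcd_le_left _ hh₁).trans hhN₁
    have hsum : ∑ d ∈ (Nat.gcd h₁ h₂).divisors, d ≤ (2 * N) ^ 2 := by
      calc _ ≤ ∑ _d ∈ (Nat.gcd h₁ h₂).divisors, 2 * N :=
            Finset.sum_le_sum fun d hd => (Nat.divisor_le hd).trans hg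
        _ = (Nat.gcd h₁ h₂).divisors.card * (2 * N) := by rw [Finset.sum_const, smul_eq_mul]
        _ ≤ (2 * N) * (2 * N) := Nat.mul_le_mul_right _ ((Nat.card_divisors_le_self _).trans hg)
        _ = _ := (sq _).symm
    have hsum' : ((∑ d ∈ (Nat.gcd h₁ h₂).divisors, d : ℕ) : ℝ) ≤ (2 * N) ^ 2 := by exact_mod_cast hsum
    have hint := abs_integral_le_sobolevNormOne fun y => W₁ (h₁ * y) * W₂ (h₂ * y)
    calc _ ≤ (2 * N : ℝ) ^ 2 * sobolevNormOne 2 (fun y => W₁ (h₁ * y) * W₂ (h₂ * y)) * N := by gcongr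
      _ = _ := by ring
  refine (norm_sub_le _ _).trans ((add_le_add h1 h2).trans ?_)
  have e1 : 0 ≤ K₁ * sobolevNormOne 2 (fun y => W₁ (h₁ * y) * W₂ (h₂ * y)) := by positivity
  have e2 : 0 ≤ (2 * (N : ℝ)) ^ 2 * N * (supNorm W₁ * supNorm W₂) := by positivity
  linarith

end

/-! ### The estimate for large weights -/

/-- The error term of the Petersson formula decays superexponentially in the relevant range: as soon
as `D k^{-2ε} ≤ e^{-3}`, the last factor compensates both `k^j ≤ j! e^k` and `e^{2k}`. -/
lemma exists_superexponential_bound {ε D : ℝ} (hε : 0 < ε) (hD : 0 < D) (j : ℕ) : ∃ K : ℝ, 0 ≤ K ∧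
    ∀ k : ℕ, (k : ℝ) ^ j * Real.exp (2 * k) * (D * (k : ℝ) ^ (-(2 * ε))) ^ (k - 16) ≤ K := by
  have hlim : Tendsto (fun k : ℕ => D * (k : ℝ) ^ (-(2 * ε))) atTop (𝓝 0) := by
    have := ((tendsto_rpow_neg_atTop (y := 2 * ε) (by positivity)).comp
      tendsto_natCast_atTop_atTop).const_mul D
    simpa using this
  obtain ⟨k₁, hk₁⟩ := eventually_atTop.mp
    (hlim.eventually_le_const (Real.exp_pos (-3)))
  set F : ℕ → ℝ := fun k => (k : ℝ) ^ j * Real.exp (2 * k) * (D * (k : ℝ) ^ (-(2 * ε))) ^ (k - 16)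
  have hF : ∀ k, 0 ≤ F k := fun k => by positivity
  refine ⟨Real.exp 48 * j ! + ∑ k ∈ Finset.range (max k₁ 16), F k,
    add_nonneg (by positivity) (Finset.sum_nonneg fun k _ => hF k), fun k => ?_⟩
  rcases lt_or_ge k (max k₁ 16) with h | h
  · have := Finset.single_le_sum (f := F) (fun k _ => hF k) (Finset.mem_range.mpr h)
    have h2 : 0 ≤ Real.exp 48 * j ! := by positivity
    change F k ≤ _
    linarith
  · have hk16 : 16 ≤ k := (le_max_right _ _).trans h
    have h1 := hk₁ k ((le_max_left _ _).trans h)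
    have h2 : (k : ℝ) ^ j ≤ j ! * Real.exp k := by
      have := Real.pow_div_factorial_le_exp (k : ℝ) k.cast_nonneg j
      rwa [div_le_iff₀' (by positivity)] at this
    have h3 : 0 ≤ ∑ k ∈ Finset.range (max k₁ 16), F k := Finset.sum_nonneg fun k _ => hF k
    calc F k ≤ (j ! * Real.exp k) * Real.exp (2 * k) * Real.exp (-3) ^ (k - 16) := by
          simp only [F]
          gcongr
      _ = Real.exp 48 * j ! := by
          rw [← Real.exp_nat_mul, Nat.cast_sub hk16, mul_assoc, mul_assoc, ← Real.exp_add,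
            ← Real.exp_add, mul_comm]
          congr 2
          push_cast
          ring
      _ ≤ _ := by linarith

section

variable {k : ℕ}

/-- The indices that occur are at most `B²`, because `m (m + l) ≤ (m + l/2)²` and the support of the
weight gives `m + l/2 ≤ A l X / h ≤ B`. -/
lemma mul_add_le_sq_of_shiftWeight_ne_zero {W : ℝ → ℝ} {a A X B : ℝ} (hs : tsupport W ⊆ Set.Icc a A)
    (hX : 0 < X) (hAX : 0 ≤ A * X) (hB : A * X ≤ B) {h N : ℕ} {p : ℕ × ℕ} (hp : p ∈ shiftIndex h N)
    (hw : shiftWeight W h X p ≠ 0) : ((p.2 * (p.2 + p.1) : ℕ) : ℝ) ≤ B ^ 2 := by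
  obtain ⟨hl, hm⟩ := Finset.mem_product.mp hp
  have hl0 : 0 < p.1 := Nat.pos_of_mem_divisors hl
  have hh0 : h ≠ 0 := (Nat.mem_divisors.mp hl).2
  have hlh : (p.1 : ℝ) ≤ h := by exact_mod_cast Nat.divisor_le hl
  have hl0' : (0 : ℝ) < p.1 := by exact_mod_cast hl0
  have hh0' : (0 : ℝ) < h := by exact_mod_cast Nat.pos_of_ne_zero hh0
  have h1 : h * (((p.2 : ℝ) + (p.1 : ℝ) / 2) / (p.1 * X)) ≤ A :=
    not_lt.mp fun hlt => hw (eq_zero_of_gt hs hlt)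
  rw [mul_div_assoc', div_le_iff₀ (by positivity)] at h1
  have h2 : h * ((p.2 : ℝ) + (p.1 : ℝ) / 2) ≤ h * B := by
    calc _ ≤ A * X * p.1 := by linarith
      _ ≤ A * X * h := by gcongr
      _ ≤ B * h := by gcongr
      _ = h * B := mul_comm _ _
  have h3 := le_of_mul_le_mul_left h2 hh0'
  calc ((p.2 * (p.2 + p.1) : ℕ) : ℝ) ≤ ((p.2 : ℝ) + (p.1 : ℝ) / 2) ^ 2 := by
        push_cast; nlinarith [sq_nonneg (p.1 : ℝ)]
    _ ≤ B ^ 2 := by gcongr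

lemma card_shiftIndex_le {h : ℕ} {B : ℝ} (hB : 0 ≤ B) (hh : (h : ℝ) ≤ 2 * B) :
    ((shiftIndex h ⌈B⌉₊).card : ℝ) ≤ 2 * B * (B + 1) := by
  rw [shiftIndex, Finset.card_product, Nat.card_Icc, Nat.add_sub_cancel, Nat.cast_mul]
  have h1 : (h.divisors.card : ℝ) ≤ h := by exact_mod_cast Nat.card_divisors_le_self h
  have h2 := (Nat.ceil_lt_add_one hB).le
  exact mul_le_mul (h1.trans hh) h2 (by positivity) (by positivity)

/-- The sum of the dominating weights of the matrices of determinant one, the absolute constant in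
`petersson_formula`. -/
def peterssonConst : ℝ := ∑' M : FixedDetMatrix (Fin 2) ℤ 1, matrixWeight M.1

lemma peterssonConst_nonneg : 0 ≤ peterssonConst := tsum_nonneg fun _ => matrixWeight_nonneg _

lemma petersson_formula_of_le (hk : 16 ≤ k) (hk2 : Even k) {m n : ℕ} (hm : 0 < m) (hn : 0 < n)
    {B : ℝ} (hmB : (m : ℝ) ≤ B ^ 2) (hnB : (n : ℝ) ≤ B ^ 2) :
    ‖∑ f ∈ (finite_heckeBasis (by omega : 9 ≤ k) hk2).toFinset,
        heckeWeight f * (normCoeff f m * normCoeff f n) - (if m = n then 1 else 0)‖ ≤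
      peterssonConst * (245 * (B ^ 2) ^ 2) ^ 8 *
        (Real.exp (2 * k) * B ^ 2 * (2 * π * B ^ 2 / k) ^ (k - 16)) := by
  have hP := peterssonConst_nonneg
  refine (petersson_formula hk hk2 hm hn (M := ⌊B ^ 2⌋₊) (Nat.le_floor hmB)
    (Nat.le_floor hnB)).trans ?_
  rw [← peterssonConst]
  have h1 : (⌊B ^ 2⌋₊ : ℝ) ≤ B ^ 2 := Nat.floor_le (by positivity)
  have h2 : √((m : ℝ) * n) ≤ B ^ 2 := by
    rw [Real.sqrt_le_left (by positivity)]
    calc (m : ℝ) * n ≤ B ^ 2 * B ^ 2 := by gcongr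
      _ = _ := by ring
  gcongr

/-- Up to the error of the Petersson formula, the average over the forms keeps only the pairs with
`m₁ (m₁ + l₁) = m₂ (m₂ + l₂)`. -/
lemma norm_variance_sub_diagonal_le (hk : 16 ≤ k) (hk2 : Even k) {W₁ W₂ : ℝ → ℝ}
    (hW₁ : Continuous W₁) (hW₂ : Continuous W₂) {a₁ A₁ a₂ A₂ X B : ℝ}
    (hs₁ : tsupport W₁ ⊆ Set.Icc a₁ A₁) (hs₂ : tsupport W₂ ⊆ Set.Icc a₂ A₂) (hX : 0 < X)
    (hA₁ : 0 ≤ A₁) (hA₂ : 0 ≤ A₂) (hB₁ : A₁ * X ≤ B) (hB₂ : A₂ * X ≤ B) {h₁ h₂ : ℕ} (hh₁ : 0 < h₁)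
    (hh₂ : 0 < h₂) (hh₁B : (h₁ : ℝ) ≤ 2 * B) (hh₂B : (h₂ : ℝ) ≤ 2 * B) :
    ‖variance k W₁ W₂ h₁ h₂ X - ((∑ p ∈ shiftIndex h₁ ⌈B⌉₊, ∑ p' ∈ shiftIndex h₂ ⌈B⌉₊,
      (if p.2 * (p.2 + p.1) = p'.2 * (p'.2 + p'.1) then
        shiftWeight W₁ h₁ X p * shiftWeight W₂ h₂ X p' else 0) : ℝ) : ℂ)‖ ≤
      (2 * B * (B + 1)) ^ 2 * (supNorm W₁ * supNorm W₂) *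
        (peterssonConst * (245 * (B ^ 2) ^ 2) ^ 8 *
        (Real.exp (2 * k) * B ^ 2 * (2 * π * B ^ 2 / k) ^ (k - 16))) := by
  have hk9 : 9 ≤ k := by omega
  have hAX₁ : 0 ≤ A₁ * X := by positivity
  have hAX₂ : 0 ≤ A₂ * X := by positivity
  have hB : 0 ≤ B := hAX₁.trans hB₁
  have hP := peterssonConst_nonneg
  have hsupp : ∀ (W : ℝ → ℝ) (a A : ℝ) (h : ℕ), tsupport W ⊆ Set.Icc a A → A * X ≤ B →
      ∀ n : ℕ, ⌈B⌉₊ < n → W (((n : ℝ) + (h : ℝ) / 2) / X) = 0 := by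
    intro W a A h hs hAB n hn
    refine eq_zero_of_gt hs ?_
    rw [lt_div_iff₀ hX]
    have h1 : B < n := Nat.lt_of_ceil_lt hn
    linarith [(by positivity : (0 : ℝ) ≤ (h : ℝ) / 2)]
  have hw : ∀ (W : ℝ → ℝ) (a A : ℝ) (h : ℕ), Continuous W → tsupport W ⊆ Set.Icc a A →
      ∀ p ∈ shiftIndex h ⌈B⌉₊, |shiftWeight W h X p| ≤ supNorm W := by
    intro W a A h hWc hs p hp
    obtain ⟨hl, hm⟩ := Finset.mem_product.mp hp
    have hl0 : (0 : ℝ) < p.1 := by exact_mod_cast Nat.pos_of_mem_divisors hl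
    have hh0 : (0 : ℝ) < h := by exact_mod_cast Nat.pos_of_ne_zero (Nat.mem_divisors.mp hl).2
    exact abs_le_supNorm hWc hs (by positivity)
  have hpos : ∀ (h : ℕ), ∀ p ∈ shiftIndex h ⌈B⌉₊, 0 < p.2 * (p.2 + p.1) := by
    intro h p hp
    have := (Finset.mem_Icc.mp (Finset.mem_product.mp hp).2).1
    positivity
  have hbil := norm_bilinear_sub_le (finite_heckeBasis hk9 hk2).toFinset heckeWeight
    (fun f n => normCoeff f n) (shiftIndex h₁ ⌈B⌉₊) (shiftIndex h₂ ⌈B⌉₊) (shiftWeight W₁ h₁ X)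
    (shiftWeight W₂ h₂ X) (fun p => p.2 * (p.2 + p.1)) (fun p => p.2 * (p.2 + p.1))
    (hw W₁ a₁ A₁ h₁ hW₁ hs₁) (hw W₂ a₂ A₂ h₂ hW₂ hs₂)
    (E := peterssonConst * (245 * (B ^ 2) ^ 2) ^ 8 *
        (Real.exp (2 * k) * B ^ 2 * (2 * π * B ^ 2 / k) ^ (k - 16))) (by positivity)
    fun p hp p' hp' hu hu' => petersson_formula_of_le hk hk2 (hpos h₁ p hp) (hpos h₂ p' hp')
      (mul_add_le_sq_of_shiftWeight_ne_zero hs₁ hX hAX₁ hB₁ hp hu)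
      (mul_add_le_sq_of_shiftWeight_ne_zero hs₂ hX hAX₂ hB₂ hp' hu')
  have hvar : variance k W₁ W₂ h₁ h₂ X = ∑ f ∈ (finite_heckeBasis hk9 hk2).toFinset, heckeWeight f *
      ((∑ p ∈ shiftIndex h₁ ⌈B⌉₊, (shiftWeight W₁ h₁ X p : ℂ) * normCoeff f (p.2 * (p.2 + p.1))) *
        ∑ p ∈ shiftIndex h₂ ⌈B⌉₊, (shiftWeight W₂ h₂ X p : ℂ) * normCoeff f (p.2 * (p.2 + p.1))) := by
    rw [variance_eq hk9 hk2]
    refine Finset.sum_congr rfl fun f hf => ?_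
    have hf : f ∈ heckeBasis k := by simpa using hf
    rw [shiftedSum_eq hk9 hk2 hf hh₁ (hsupp W₁ a₁ A₁ h₁ hs₁ hB₁),
      shiftedSum_eq hk9 hk2 hf hh₂ (hsupp W₂ a₂ A₂ h₂ hs₂ hB₂)]
  rw [hvar]
  refine hbil.trans ?_
  have hS₁ := supNorm_nonneg W₁
  have hS₂ := supNorm_nonneg W₂
  have hc₁ := card_shiftIndex_le hB hh₁B
  have hc₂ := card_shiftIndex_le hB hh₂B
  rw [sq (2 * B * (B + 1))]
  gcongr

end

/-! ### Uniformity in the weight -/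

/-- For `B = C k^(1/2-ε)` the base `2 π B² / k` is `2 π C² k^{-2ε}`. The other factors are bounded
using `B ≤ C k`: four powers of `k` from the number of terms, `32 + 2` from the Petersson formula.
-/
lemma exists_off_diagonal_bound {ε C : ℝ} (hε : 0 < ε) (hC : 0 < C) : ∃ K : ℝ, 0 ≤ K ∧
    ∀ (k : ℕ) (B : ℝ), 16 ≤ k → B = C * (k : ℝ) ^ (1 / 2 - ε) →
      (2 * B * (B + 1)) ^ 2 * (peterssonConst * (245 * (B ^ 2) ^ 2) ^ 8 *
        (Real.exp (2 * k) * B ^ 2 * (2 * π * B ^ 2 / k) ^ (k - 16))) ≤ K := by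
  obtain ⟨K, hK0, hK⟩ := exists_superexponential_bound (D := 2 * π * C ^ 2) hε (by positivity) 38
  have hP := peterssonConst_nonneg
  refine ⟨(2 * C * (C + 1)) ^ 2 * (peterssonConst * (245 * (C ^ 2) ^ 2) ^ 8 * C ^ 2) * K,
    by positivity, fun k B hk hBk => ?_⟩
  have hk1 : (1 : ℝ) ≤ k := by exact_mod_cast (by omega : 1 ≤ k)
  have hk0 : (0 : ℝ) < k := by linarith
  have hB0 : 0 ≤ B := by rw [hBk]; positivity
  have hBle : B ≤ C * k := by
    rw [hBk]
    gcongr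
    calc (k : ℝ) ^ (1 / 2 - ε) ≤ (k : ℝ) ^ (1 : ℝ) :=
          Real.rpow_le_rpow_of_exponent_le hk1 (by linarith)
      _ = k := Real.rpow_one _
  have hB1 : B + 1 ≤ (C + 1) * k := by linarith
  have hsq : 2 * π * B ^ 2 / k = 2 * π * C ^ 2 * (k : ℝ) ^ (-(2 * ε)) := by
    have h1 : ((k : ℝ) ^ (1 / 2 - ε)) ^ 2 = (k : ℝ) ^ (-(2 * ε)) * k := by
      rw [← Real.rpow_natCast, ← Real.rpow_mul hk0.le, ← Real.rpow_add_one hk0.ne']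
      congr 1
      push_cast
      ring
    rw [hBk, mul_pow, h1]
    field_simp
  rw [hsq]
  set r := (2 * π * C ^ 2 * (k : ℝ) ^ (-(2 * ε))) ^ (k - 16) with hr
  have hr0 : 0 ≤ r := by positivity
  calc (2 * B * (B + 1)) ^ 2 * (peterssonConst * (245 * (B ^ 2) ^ 2) ^ 8 *
        (Real.exp (2 * k) * B ^ 2 * r))
      ≤ (2 * (C * k) * ((C + 1) * k)) ^ 2 * (peterssonConst * (245 * ((C * k) ^ 2) ^ 2) ^ 8 *
        (Real.exp (2 * k) * (C * k) ^ 2 * r)) := by gcongr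
    _ = (2 * C * (C + 1)) ^ 2 * (peterssonConst * (245 * (C ^ 2) ^ 2) ^ 8 * C ^ 2) *
        ((k : ℝ) ^ 38 * Real.exp (2 * k) * r) := by ring
    _ ≤ _ := by
        gcongr
        exact hK k

/-- The divisor bound is used with exponent `δ/4`: once for the divisors of each of `h₁` and `h₂`,
and at double cost for those of `l₁² - l₂²`, which is at most `H²`. -/
lemma exists_diagonal_bound {δ : ℝ} (hδ : 0 < δ) : ∃ K : ℝ, 0 ≤ K ∧
    ∀ (W₁ W₂ : ℝ → ℝ) (a₁ A₁ a₂ A₂ X : ℝ) (h₁ h₂ N : ℕ), ContDiff ℝ 1 W₁ → ContDiff ℝ 1 W₂ →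
      tsupport W₁ ⊆ Set.Icc a₁ A₁ → tsupport W₂ ⊆ Set.Icc a₂ A₂ → 0 < X → 0 < h₁ → 0 < h₂ →
      A₁ * X ≤ N → (h₁ : ℝ) < 2 * a₁ * X →
      |∑ p ∈ shiftIndex h₁ N, ∑ p' ∈ shiftIndex h₂ N,
        (if p.2 * (p.2 + p.1) = p'.2 * (p'.2 + p'.1) then
          shiftWeight W₁ h₁ X p * shiftWeight W₂ h₂ X p' else 0) - mainTerm W₁ W₂ h₁ h₂ * X| ≤
        K * (max (h₁ : ℝ) (h₂ : ℝ)) ^ δ *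
          (sobolevNormOne 2 (fun y => W₁ (h₁ * y) * W₂ (h₂ * y)) + supNorm W₁ * supNorm W₂) := by
  obtain ⟨c, hc1, hc⟩ := exists_card_divisors_le (δ := δ / 4) (by positivity)
  refine ⟨c ^ 3, by positivity, fun W₁ W₂ a₁ A₁ a₂ A₂ X h₁ h₂ N hW₁ hW₂ hs₁ hs₂ hX hh₁ hh₂ hN ha => ?_⟩
  set H := max (h₁ : ℝ) (h₂ : ℝ) with hH
  have hh₁H : (h₁ : ℝ) ≤ H := le_max_left _ _
  have hh₂H : (h₂ : ℝ) ≤ H := le_max_right _ _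
  have hH1 : 1 ≤ H := le_trans (by exact_mod_cast hh₁) hh₁H
  have hH0 : 0 < H := by linarith
  set t := H ^ (δ / 4) with ht
  have ht1 : 1 ≤ t := Real.one_le_rpow hH1 (by positivity)
  have ht4 : H ^ δ = t ^ 4 := by
    rw [ht, ← Real.rpow_natCast, ← Real.rpow_mul hH0.le]
    congr 1
    push_cast
    ring
  have hdiv : ∀ n : ℕ, 0 < n → (n : ℝ) ≤ H → (n.divisors.card : ℝ) ≤ c * t := fun n hn hnH =>
    (hc n hn).trans (by rw [ht]; gcongr)
  have hw : ∀ (W : ℝ → ℝ) (a A : ℝ) (h : ℕ), Continuous W → tsupport W ⊆ Set.Icc a A →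
      ∀ p ∈ shiftIndex h N, |shiftWeight W h X p| ≤ supNorm W := by
    intro W a A h hWc hs p hp
    obtain ⟨hl, hm⟩ := Finset.mem_product.mp hp
    have hl0 : (0 : ℝ) < p.1 := by exact_mod_cast Nat.pos_of_mem_divisors hl
    have hh0 : (0 : ℝ) < h := by exact_mod_cast Nat.pos_of_ne_zero (Nat.mem_divisors.mp hl).2
    exact abs_le_supNorm hWc hs (by positivity)
  have hT : ∀ l₁ ∈ h₁.divisors, ∀ l₂ ∈ h₂.divisors, l₁ ≠ l₂ →
      (((l₁ : ℤ) ^ 2 - (l₂ : ℤ) ^ 2).natAbs.divisors.card : ℝ) ≤ c * t ^ 2 := by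
    intro l₁ hl₁ l₂ hl₂ hne
    have hl₁H : (l₁ : ℝ) ≤ H :=
      le_trans (by exact_mod_cast Nat.divisor_le hl₁) hh₁H
    have hl₂H : (l₂ : ℝ) ≤ H :=
      le_trans (by exact_mod_cast Nat.divisor_le hl₂) hh₂H
    have hpos : 0 < ((l₁ : ℤ) ^ 2 - (l₂ : ℤ) ^ 2).natAbs := by
      refine Int.natAbs_pos.mpr (sub_ne_zero.mpr fun h => hne ?_)
      exact_mod_cast (sq_eq_sq₀ (Int.natCast_nonneg l₁) (Int.natCast_nonneg l₂)).mp h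
    have hle : ((((l₁ : ℤ) ^ 2 - (l₂ : ℤ) ^ 2).natAbs : ℕ) : ℝ) ≤ H ^ 2 := by
      rw [Nat.cast_natAbs]
      push_cast
      have h1 : (l₁ : ℝ) ^ 2 ≤ H ^ 2 := by gcongr
      have h2 : (l₂ : ℝ) ^ 2 ≤ H ^ 2 := by gcongr
      exact abs_sub_le_of_nonneg_of_le (by positivity) h1 (by positivity) h2
    refine (hc _ hpos).trans ?_
    calc c * ((((l₁ : ℤ) ^ 2 - (l₂ : ℤ) ^ 2).natAbs : ℕ) : ℝ) ^ (δ / 4)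
        ≤ c * (H ^ 2) ^ (δ / 4) := by gcongr
      _ = c * t ^ 2 := by
        rw [ht, ← Real.rpow_natCast, ← Real.rpow_natCast, ← Real.rpow_mul hH0.le,
          ← Real.rpow_mul hH0.le, mul_comm (δ / 4)]
  refine (abs_diagonal_sub_le hW₁ hW₂ (hasCompactSupport_of_tsupport_subset hs₁) hh₁ hh₂ hX
    (fun y => eq_zero_of_lt hs₁) (fun y => eq_zero_of_gt hs₁) hN ha
    (hw W₁ a₁ A₁ h₁ hW₁.continuous hs₁) (hw W₂ a₂ A₂ h₂ hW₂.continuous hs₂) (supNorm_nonneg _)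
    (supNorm_nonneg _) hT (by positivity)).trans ?_
  have hg : ((Nat.gcd h₁ h₂).divisors.card : ℝ) ≤ c * t :=
    hdiv _ (Nat.gcd_pos_of_pos_left _ hh₁)
      (le_trans (by exact_mod_cast Nat.gcd_le_left _ hh₁) hh₁H)
  have hd₁ := hdiv h₁ hh₁ hh₁H
  have hd₂ := hdiv h₂ hh₂ hh₂H
  have hI := integral_abs_deriv_le_sobolevNormOne (fun y => W₁ (h₁ * y) * W₂ (h₂ * y))
  have hV := sobolevNormOne_nonneg (fun y => W₁ (h₁ * y) * W₂ (h₂ * y))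
  have hS₁ := supNorm_nonneg W₁
  have hS₂ := supNorm_nonneg W₂
  have hct : c * t ≤ c ^ 3 * t ^ 4 := by
    gcongr
    · exact le_self_pow₀ hc1 (by norm_num)
    · exact le_self_pow₀ ht1 (by norm_num)
  rw [ht4, mul_add]
  refine add_le_add ?_ ?_
  · exact mul_le_mul (hg.trans hct) hI (by positivity) (by positivity)
  · calc (h₁.divisors.card : ℝ) * h₂.divisors.card * (c * t ^ 2 * (supNorm W₁ * supNorm W₂))
        ≤ (c * t) * (c * t) * (c * t ^ 2 * (supNorm W₁ * supNorm W₂)) := by gcongr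
      _ = _ := by ring

/-- The bound of the theorem for all weights `k ≥ 16`, with one constant. -/
lemma exists_bound_large_weight {ε δ C : ℝ} (hε : 0 < ε) (hδ : 0 < δ) (hC : 0 < C) :
    ∃ K : ℝ, 0 ≤ K ∧ ∀ (W₁ W₂ : ℝ → ℝ) (a₁ A₁ a₂ A₂ X B : ℝ) (h₁ h₂ k : ℕ), 16 ≤ k → Even k →
      B = C * (k : ℝ) ^ (1 / 2 - ε) → ContDiff ℝ 1 W₁ → ContDiff ℝ 1 W₂ →
      tsupport W₁ ⊆ Set.Icc a₁ A₁ → tsupport W₂ ⊆ Set.Icc a₂ A₂ → 0 < X → 0 ≤ A₁ → 0 ≤ A₂ →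
      A₁ * X ≤ B → A₂ * X ≤ B → 0 < h₁ → 0 < h₂ → (h₁ : ℝ) < 2 * a₁ * X → (h₁ : ℝ) ≤ 2 * B →
      (h₂ : ℝ) ≤ 2 * B →
      ‖variance k W₁ W₂ h₁ h₂ X - ((mainTerm W₁ W₂ h₁ h₂ * X : ℝ) : ℂ)‖ ≤
        K * (max (h₁ : ℝ) (h₂ : ℝ)) ^ δ *
          (sobolevNormOne 2 (fun y => W₁ (h₁ * y) * W₂ (h₂ * y)) + supNorm W₁ * supNorm W₂) := by
  obtain ⟨K, hK0, hK⟩ := exists_off_diagonal_bound hε hC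
  obtain ⟨K', hK0', hK'⟩ := exists_diagonal_bound hδ
  refine ⟨K + K', by positivity, ?_⟩
  intro W₁ W₂ a₁ A₁ a₂ A₂ X B h₁ h₂ k hk hk2 hB hW₁ hW₂ hs₁ hs₂ hX hA₁ hA₂ hB₁ hB₂ hh₁ hh₂ ha hh₁B hh₂B
  have hdiag := hK' W₁ W₂ a₁ A₁ a₂ A₂ X h₁ h₂ ⌈B⌉₊ hW₁ hW₂ hs₁ hs₂ hX hh₁ hh₂
    (hB₁.trans (Nat.le_ceil B)) ha
  have hoff := norm_variance_sub_diagonal_le hk hk2 hW₁.continuous hW₂.continuous hs₁ hs₂ hX hA₁ hA₂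
    hB₁ hB₂ hh₁ hh₂ hh₁B hh₂B
  have hV := sobolevNormOne_nonneg (fun y => W₁ (h₁ * y) * W₂ (h₂ * y))
  have hS : 0 ≤ supNorm W₁ * supNorm W₂ := mul_nonneg (supNorm_nonneg W₁) (supNorm_nonneg W₂)
  have hH1 : 1 ≤ (max (h₁ : ℝ) (h₂ : ℝ)) ^ δ :=
    Real.one_le_rpow (le_trans (by exact_mod_cast hh₁) (le_max_left _ _)) hδ.le
  rw [← Real.norm_eq_abs, ← Complex.norm_real, Complex.ofReal_sub] at hdiag
  refine (norm_sub_le_norm_sub_add_norm_sub _ _ _).trans ((add_le_add hoff hdiag).trans ?_)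
  rw [add_mul K, add_mul]
  gcongr ?_ + _
  calc _ = (2 * B * (B + 1)) ^ 2 * (peterssonConst * (245 * (B ^ 2) ^ 2) ^ 8 *
        (Real.exp (2 * k) * B ^ 2 * (2 * π * B ^ 2 / k) ^ (k - 16))) *
          (supNorm W₁ * supNorm W₂) := by ring
    _ ≤ K * (supNorm W₁ * supNorm W₂) := mul_le_mul_of_nonneg_right (hK k B hk hB) hS
    _ = K * 1 * (supNorm W₁ * supNorm W₂) := by ring
    _ ≤ _ := by
        gcongr
        linarith

end ShiftedConvolution

end

theorem theorem3p1 (ε δ C : ℝ) (hε : 0 < ε) (hδ : 0 < δ) (hC : 0 < C) :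
    ∃ K : ℝ, 0 < K ∧
      ∀ (W₁ W₂ : ℝ → ℝ) (a₁ A₁ a₂ A₂ X : ℝ) (h₁ h₂ k : ℕ),
        ContDiff ℝ ∞ W₁ → ContDiff ℝ ∞ W₂ →
        0 < a₁ → 1 ≤ A₁ → tsupport W₁ ⊆ Set.Icc a₁ A₁ →
        0 < a₂ → 1 ≤ A₂ → tsupport W₂ ⊆ Set.Icc a₂ A₂ →
        0 < h₁ → 0 < h₂ → 0 < k → Even k → 0 < X →
        A₁ * A₂ * X ≤ C * (k : ℝ) ^ (1 / 2 - ε) →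
        (h₁ : ℝ) < 2 * a₁ * X → (h₂ : ℝ) < 2 * a₂ * X →
        (ShiftedConvolution.heckeBasis k).Finite ∧
        ‖ShiftedConvolution.variance k W₁ W₂ h₁ h₂ X
            - ((ShiftedConvolution.mainTerm W₁ W₂ h₁ h₂ * X : ℝ) : ℂ)‖
          ≤ K * (max (h₁ : ℝ) (h₂ : ℝ)) ^ δ *
            (ShiftedConvolution.sobolevNormOne 2 (fun y => W₁ (h₁ * y) * W₂ (h₂ * y))
              + ShiftedConvolution.supNorm W₁ * ShiftedConvolution.supNorm W₂) := by
  obtain ⟨K, hK0, hK⟩ := ShiftedConvolution.exists_bound_large_weight hε hδ hC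
  -- For `k < 16` the sums range over a bounded number of forms and of integers.
  have hsmall : ∀ k : ℕ, ∃ K : ℝ, 0 ≤ K ∧ (Even k → ∀ (W₁ W₂ : ℝ → ℝ) (a₁ A₁ a₂ A₂ X : ℝ)
      (h₁ h₂ : ℕ), Continuous W₁ → Continuous W₂ → tsupport W₁ ⊆ Set.Icc a₁ A₁ →
      tsupport W₂ ⊆ Set.Icc a₂ A₂ → 0 < X → X ≤ ⌈C * (k : ℝ) ^ (1 / 2 - ε)⌉₊ →
      A₁ * X ≤ ⌈C * (k : ℝ) ^ (1 / 2 - ε)⌉₊ → A₂ * X ≤ ⌈C * (k : ℝ) ^ (1 / 2 - ε)⌉₊ → 0 < h₁ →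
      h₁ ≤ 2 * ⌈C * (k : ℝ) ^ (1 / 2 - ε)⌉₊ → h₂ ≤ 2 * ⌈C * (k : ℝ) ^ (1 / 2 - ε)⌉₊ →
      ‖ShiftedConvolution.variance k W₁ W₂ h₁ h₂ X
          - ((ShiftedConvolution.mainTerm W₁ W₂ h₁ h₂ * X : ℝ) : ℂ)‖ ≤
        K * (ShiftedConvolution.sobolevNormOne 2 (fun y => W₁ (h₁ * y) * W₂ (h₂ * y))
          + ShiftedConvolution.supNorm W₁ * ShiftedConvolution.supNorm W₂)) := by
    intro k
    by_cases hk2 : Even k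
    · obtain ⟨K, hK0, hK⟩ := ShiftedConvolution.exists_bound_fixed_weight
        (ShiftedConvolution.finite_heckeBasis_of_even hk2) ⌈C * (k : ℝ) ^ (1 / 2 - ε)⌉₊
      exact ⟨K, hK0, fun _ => hK⟩
    · exact ⟨0, le_rfl, fun h => absurd h hk2⟩
  choose L hL0 hL using hsmall
  refine ⟨K + ∑ k ∈ Finset.range 16, L k + 1,
    by linarith [Finset.sum_nonneg fun k (_ : k ∈ Finset.range 16) => hL0 k], ?_⟩
  intro W₁ W₂ a₁ A₁ a₂ A₂ X h₁ h₂ k hW₁ hW₂ ha₁ hA₁ hs₁ ha₂ hA₂ hs₂ hh₁ hh₂ hk hk2 hX hAX hhX₁ hhX₂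
  refine ⟨ShiftedConvolution.finite_heckeBasis_of_even hk2, ?_⟩
  have hsum := Finset.sum_nonneg fun k (_ : k ∈ Finset.range 16) => hL0 k
  have hQ : 0 ≤ ShiftedConvolution.sobolevNormOne 2 (fun y => W₁ (h₁ * y) * W₂ (h₂ * y))
      + ShiftedConvolution.supNorm W₁ * ShiftedConvolution.supNorm W₂ :=
    add_nonneg (ShiftedConvolution.sobolevNormOne_nonneg _)
      (mul_nonneg (ShiftedConvolution.supNorm_nonneg _) (ShiftedConvolution.supNorm_nonneg _))
  have hH1 : 1 ≤ (max (h₁ : ℝ) (h₂ : ℝ)) ^ δ :=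
    Real.one_le_rpow (le_trans (by exact_mod_cast hh₁) (le_max_left _ _)) hδ.le
  -- If one of the intervals is empty, the corresponding weight vanishes identically.
  by_cases hne : A₁ < a₁ ∨ A₂ < a₂
  · rw [ShiftedConvolution.variance_sub_eq_zero
      (hne.imp (ShiftedConvolution.eq_zero_of_endpoints_lt hs₁)
        (ShiftedConvolution.eq_zero_of_endpoints_lt hs₂)), norm_zero]
    positivity
  obtain ⟨hle₁, hle₂⟩ : a₁ ≤ A₁ ∧ a₂ ≤ A₂ := by simpa using hne
  set B := C * (k : ℝ) ^ (1 / 2 - ε) with hB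
  have hB₁ : A₁ * X ≤ B := le_trans (by nlinarith [mul_pos (by linarith : 0 < A₁) hX]) hAX
  have hB₂ : A₂ * X ≤ B := le_trans (by nlinarith [mul_pos (by linarith : 0 < A₂) hX]) hAX
  have hhB₁ : (h₁ : ℝ) ≤ 2 * B := by nlinarith
  have hhB₂ : (h₂ : ℝ) ≤ 2 * B := by nlinarith
  rcases le_or_gt 16 k with hk16 | hk16
  · refine (hK W₁ W₂ a₁ A₁ a₂ A₂ X B h₁ h₂ k hk16 hk2 hB (hW₁.of_le (by simp)) (hW₂.of_le (by simp))
      hs₁ hs₂ hX (by linarith) (by linarith) hB₁ hB₂ hh₁ hh₂ hhX₁ hhB₁ hhB₂).trans ?_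
    gcongr
    linarith
  · have hceil : B ≤ ⌈B⌉₊ := Nat.le_ceil B
    have hXB : X ≤ B := le_trans (by nlinarith) hB₁
    have hLk : L k ≤ K + ∑ k ∈ Finset.range 16, L k + 1 := by
      have := Finset.single_le_sum (f := L) (fun k _ => hL0 k) (Finset.mem_range.mpr hk16)
      linarith
    refine (hL k hk2 W₁ W₂ a₁ A₁ a₂ A₂ X h₁ h₂ hW₁.continuous hW₂.continuous hs₁ hs₂ hX
      (hXB.trans hceil) (hB₁.trans hceil) (hB₂.trans hceil) hh₁
      (by exact_mod_cast hhB₁.trans (by linarith : 2 * B ≤ 2 * (⌈B⌉₊ : ℝ)))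
      (by exact_mod_cast hhB₂.trans (by linarith : 2 * B ≤ 2 * (⌈B⌉₊ : ℝ)))).trans ?_
    gcongr
    calc L k = L k * 1 := (mul_one _).symm
      _ ≤ _ := by gcongr
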